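/- Let $\Phi\subset\mathfrak h^*$ be a finite, reduced, crystallographic root system spanning $\mathfrak h^*$ ($\mathfrak h$ a finite-dimensional complex vector space, the complexification of the Euclidean space of $\Phi$), with positive roots $\Phi^+$, coroots $\alpha^\vee\in\mathfrak h$ and coweight lattice $P^\vee=\{\lambda\in\mathfrak h:\alpha(\lambda)\in\mathbb Z\ \ \forall\alpha\in\Phi\}$. **Lie algebras.** Let $\mathfrak t_{ell,\Phi}$ be the complex Lie algebra generated by elements $t_\alpha$ ($\alpha\in\Phi$, $t_{-\alpha}=t_\alpha$) and by the images of two linear maps $x,y:\mathfrak h\to\mathfrak t_{ell,\Phi}$, with the relations $[t_\alpha,\sum_{\beta\in\Psi\cap\Phi^+}t_\beta]=0$ for every root subsystem $\Psi$ (that is, $\langle\Psi\rangle_{\mathbb Z}\cap\Phi=\Psi$) and $\alpha\in\Psi$; $[x(u),x(v)]=0=[y(u),y(v)]$; $[y(u),x(v)]=\sum_{\gamma\in\Phi^+}\gamma(u)\gamma(v)t_\gamma$; and $[t_\alpha,x(u)]=0=[t_\alpha,y(u)]$ if $\alpha(u)=0$. Let $\mathfrak d$ be the Lie algebra with generators $\Delta_0,d,X,\delta_{2m}$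 ($m\ge1$) and relations $[d,X]=2X$, $[d,\Delta_0]=-2\Delta_0$, $[X,\Delta_0]=d$, $[\delta_{2m},X]=0$, $[d,\delta_{2m}]=2m\,\delta_{2m}$, $(\operatorname{ad}\Delta_0)^{2m+1}(\delta_{2m})=0$. Write $x_u=x(u)$. There is a (necessarily unique) Lie algebra morphism $\mathfrak d\to\operatorname{Der}(\mathfrak t_{ell,\Phi})$, $\xi\mapsto\tilde\xi$, with $\tilde d$: $x(u)\mapsto x(u)$, $y(u)\mapsto -y(u)$, $t_\alpha\mapsto0$; $\tilde X$: $x(u)\mapsto0$, $y(u)\mapsto x(u)$, $t_\alpha\mapsto0$; $\tilde\Delta_0$: $x(u)\mapsto y(u)$, $y(u)\mapsto0$, $t_\alpha\mapsto0$; and $$\tilde\delta_{2m}:\quad x(u)\mapsto0,\qquad t_\alpha\mapsto\big[t_\alpha,(\operatorname{ad}\tfrac{x_{\alpha^\vee}}2)^{2m}(t_\alpha)\big],\qquad y(u)\mapsto\tfrac12\sum_{\alpha\in\Phi^+}\alpha(u)\sum_{p+q=2m-1}\big[(\operatorname{ad}\tfrac{x_{\alpha^\vee}}2)^p(t_\alpha),(-\operatorname{ad}\tfrac{x_{\alpha^\vee}}2)^q(t_\alpha)\big].$$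 Form $\mathfrak t_{ell,\Phi}\rtimes\mathfrak d$, with the $\mathbb Z^2$-grading $\deg x(u)=(1,0)$, $\deg y(u)=(0,1)$, $\deg t_\alpha=(1,1)$, $\deg\Delta_0=(-1,1)$, $\deg d=(0,0)$, $\deg X=(1,-1)$, $\deg\delta_{2m}=(2m+1,1)$, and let $\widehat{\mathfrak t_{ell,\Phi}\rtimes\mathfrak d}$ be its completion with respect to the total degree. **Functions.** With $u=e^{2\pi iz}$ and $q=e^{2\pi i\tau}$ let $$\theta(z|\tau)=u^{1/2}\prod_{s>0}(1-q^su)\prod_{s\ge0}(1-q^su^{-1})\,\frac1{2\pi i}\prod_{s>0}(1-q^s)^{-2},$$ where $u^{1/2}=e^{\pi iz}$. For $z\notin\mathbb Z+\mathbb Z\tau$ let $k(z,x|\tau)=\frac{\theta(z+x|\tau)}{\theta(z|\tau)\theta(x|\tau)}-\frac1x$ and $g(z,x|\tau)=\partial_xk(z,x|\tau)$, regarded as power series in $x$. Let $E_{2n+2}(\tau)$ be the Eisenstein series of weight $2n+2$ with constant term $1$, and $a_{2n}=-\frac{(2n+1)B_{2n+2}(2\pi i)^{2n+2}}{(2n+2)!}$.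 **Moduli space.** The elliptic moduli space $\mathcal M_{1,n}$ ($n=\dim\mathfrak h$) is the quotient of $$Y=\{(z,\tau)\in\mathfrak h\times\mathbb C:\operatorname{Im}\tau>0,\ \alpha(z)\notin\mathbb Z+\mathbb Z\tau\ \ \forall\alpha\in\Phi\}$$ by $(P^\vee\oplus P^\vee)\rtimes SL_2(\mathbb Z)$, acting by $(z,\tau)\mapsto(z+\mathbf n+\tau\mathbf m,\tau)$ and $(z,\tau)\mapsto(\frac z{c\tau+d},\frac{a\tau+b}{c\tau+d})$. Let $\mathfrak d_+\subset\mathfrak d$ be the kernel of the projection $\mathfrak d\to\mathfrak{sl}_2$ that kills the $\delta_{2m}$, and let $G_n=\exp(\widehat{\mathfrak t_{ell,\Phi}\rtimes\mathfrak d_+})\rtimes SL_2(\mathbb C)$. Let $P_n$ be the principal $G_n$-bundle on $\mathcal M_{1,n}$ whose sections are the $G_n$-valued functions $f$ on open invariant subsets of $Y$ with, for $\lambda\in P^\vee$, $$f(z+\lambda|\tau)=f(z|\tau),\quad f(z+\tau\lambda|\tau)=e^{-2\pi ix(\lambda)}f(z|\tau),\quad f(z|\tau+1)=f(z|\tau),\quad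 f(\tfrac z\tau|-\tfrac1\tau)=\tau^d\exp\!\big(\tfrac{2\pi i}\tau(x(z)+X)\big)f(z|\tau),$$ where $\tau^d=\operatorname{diag}(\tau,\tau^{-1})$ and $\exp(vX)=\begin{pmatrix}1&v\\0&1\end{pmatrix}$. **Theorem.** Let $\{u_i\}$, $\{u^i\}$ be dual bases of $\mathfrak h^*$ and $\mathfrak h$, and for $(z,\tau)\in Y$ put $$\Delta=-\frac1{2\pi i}\Delta_0-\frac1{2\pi i}\sum_{n\ge1}a_{2n}E_{2n+2}(\tau)\,\delta_{2n}+\frac1{2\pi i}\sum_{\beta\in\Phi^+}g\big(\beta(z),\operatorname{ad}\tfrac{x_{\beta^\vee}}2\big|\tau\big)(t_\beta).$$ Then the $\widehat{\mathfrak t_{ell,\Phi}\rtimes\mathfrak d}$-valued connection $$\nabla_{KZB}=\nabla_{KZB,\tau}-\Delta\,d\tau=d-\Delta\,d\tau-\sum_{\alpha\in\Phi^+}k\big(\alpha,\operatorname{ad}\tfrac{x_{\alpha^\vee}}2\big|\tau\big)(t_\alpha)\,d\alpha+\sum_iy(u^i)\,du_i$$ is a holomorphic connection on the bundle $P_n$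 over $\mathcal M_{1,n}$, and it is flat. -/

import Mathlib

set_option linter.unusedSectionVars false

noncomputable section

namespace EllipticKZB

/-- The quotient map by a Lie ideal, as a homomorphism of Lie algebras. -/
def quotHom {L : Type*} [LieRing L] [LieAlgebra ℂ L] (I : LieIdeal ℂ L) : L →ₗ⁅ℂ⁆ (L ⧸ I) where
  toLinearMap := (LieSubmodule.Quotient.mk' I : L →ₗ[ℂ] (L ⧸ I))
  map_lie' := rfl

theorem quotHom_eq_zero {L : Type*} [LieRing L] [LieAlgebra ℂ L] {I : LieIdeal ℂ L} {a : L}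
    (h : a ∈ I) : quotHom I a = 0 :=
  (LieSubmodule.Quotient.mk_eq_zero (N := I)).2 h

/-! ### The Lie algebra attached to a root system

The root system `Φ` is given, after complexification, by a root pairing `P` between
`M = 𝔥*` and `𝔥` over `ℂ`: roots `P.root i` in `M`, coroots `P.coroot i` in `𝔥`,
`P.root' i` is the root as a linear form on `𝔥`. Positive roots are those of a base `b`. -/

section Holonomy

variable {ι 𝔥 M : Type*} [Fintype ι] [AddCommGroup 𝔥] [Module ℂ 𝔥] [AddCommGroup M] [Module ℂ M]
variable {P : RootPairing ι ℂ M 𝔥}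

/-- Indices of the positive roots. -/
def posRoots (b : P.Base) : Finset ι :=
  open Classical in
  Finset.univ.filter fun i => P.root i ∈ AddSubmonoid.closure (P.root '' (b.support : Set ι))

/-- A root subsystem: a set of roots `Ψ` with `⟨Ψ⟩_ℤ ∩ Φ = Ψ`. -/
def IsSubsystem (P : RootPairing ι ℂ M 𝔥) (Ψ : Set ι) : Prop :=
  ∀ i, P.root i ∈ AddSubgroup.closure (P.root '' Ψ) → i ∈ Ψ

/-- The positive roots of a root subsystem. -/
def posRootsOf (b : P.Base) (Ψ : Set ι) : Finset ι :=
  open Classical in (posRoots b).filter fun i => i ∈ Ψ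

/-- Generators `x(u)`, `y(u)` (`u ∈ 𝔥`) and `t_α` (`α ∈ Φ`). -/
inductive Gen (ι 𝔥 : Type*)
  | x (u : 𝔥)
  | y (u : 𝔥)
  | t (i : ι)

/-- The generator `x(u)` of the free Lie algebra. -/
abbrev fx (ι : Type*) {𝔥 : Type*} (u : 𝔥) : FreeLieAlgebra ℂ (Gen ι 𝔥) :=
  FreeLieAlgebra.of ℂ (.x u)

/-- The generator `y(u)` of the free Lie algebra. -/
abbrev fy (ι : Type*) {𝔥 : Type*} (u : 𝔥) : FreeLieAlgebra ℂ (Gen ι 𝔥) :=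
  FreeLieAlgebra.of ℂ (.y u)

/-- The generator `t_α` of the free Lie algebra. -/
abbrev ft {ι : Type*} (𝔥 : Type*) (i : ι) : FreeLieAlgebra ℂ (Gen ι 𝔥) :=
  FreeLieAlgebra.of ℂ (.t i)

/-- The relators of `𝔱_{ell,Φ}`: an element `r` of this set stands for the relation `r = 0`. -/
inductive Relator (b : P.Base) : FreeLieAlgebra ℂ (Gen ι 𝔥) → Prop
  | x_add (u v : 𝔥) : Relator b (fx ι (u + v) - fx ι u - fx ι v)
  | x_smul (c : ℂ) (u : 𝔥) : Relator b (fx ι (c • u) - c • fx ι u)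
  | y_add (u v : 𝔥) : Relator b (fy ι (u + v) - fy ι u - fy ι v)
  | y_smul (c : ℂ) (u : 𝔥) : Relator b (fy ι (c • u) - c • fy ι u)
  | t_neg (i j : ι) (h : P.root j = -P.root i) : Relator b (ft 𝔥 i - ft 𝔥 j)
  | tt (Ψ : Set ι) (hΨ : IsSubsystem P Ψ) (i : ι) (hi : i ∈ Ψ) :
      Relator b ⁅ft 𝔥 i, ∑ j ∈ posRootsOf b Ψ, ft 𝔥 j⁆
  | xx (u v : 𝔥) : Relator b ⁅fx ι u, fx ι v⁆
  | yy (u v : 𝔥) : Relator b ⁅fy ι u, fy ι v⁆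
  | yx (u v : 𝔥) : Relator b (⁅fy ι u, fx ι v⁆ -
      ∑ i ∈ posRoots b, (P.root' i v * P.root' i u) • ft 𝔥 i)
  | tx (i : ι) (u : 𝔥) (h : P.root' i u = 0) : Relator b ⁅ft 𝔥 i, fx ι u⁆
  | ty (i : ι) (u : 𝔥) (h : P.root' i u = 0) : Relator b ⁅ft 𝔥 i, fy ι u⁆

/-- The ideal generated by the relators. -/
def relIdeal (b : P.Base) : LieIdeal ℂ (FreeLieAlgebra ℂ (Gen ι 𝔥)) :=
  LieSubmodule.lieSpan ℂ _ {r | Relator b r}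

/-- The Lie algebra `𝔱_{ell,Φ}`. -/
def Ell (b : P.Base) : Type _ := FreeLieAlgebra ℂ (Gen ι 𝔥) ⧸ relIdeal b

instance (b : P.Base) : LieRing (Ell b) :=
  inferInstanceAs (LieRing (FreeLieAlgebra ℂ (Gen ι 𝔥) ⧸ relIdeal b))

instance (b : P.Base) : LieAlgebra ℂ (Ell b) :=
  inferInstanceAs (LieAlgebra ℂ (FreeLieAlgebra ℂ (Gen ι 𝔥) ⧸ relIdeal b))

/-- The quotient map from the free Lie algebra. -/
def Ell.mk (b : P.Base) : FreeLieAlgebra ℂ (Gen ι 𝔥) →ₗ⁅ℂ⁆ Ell b :=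
  quotHom (relIdeal b)

theorem Ell.mk_relator (b : P.Base) {r : FreeLieAlgebra ℂ (Gen ι 𝔥)} (hr : Relator b r) :
    Ell.mk b r = 0 :=
  quotHom_eq_zero (LieSubmodule.subset_lieSpan hr)

/-- The linear map `x : 𝔥 → 𝔱_{ell,Φ}`. -/
def Ell.x (b : P.Base) : 𝔥 →ₗ[ℂ] Ell b where
  toFun u := Ell.mk b (fx ι u)
  map_add' u v := by
    have h := Ell.mk_relator b (Relator.x_add u v)
    rw [map_sub, map_sub, sub_sub, sub_eq_zero] at h
    exact h
  map_smul' c u := by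
    have h := Ell.mk_relator b (Relator.x_smul c u)
    rw [map_sub, map_smul, sub_eq_zero] at h
    exact h

/-- The linear map `y : 𝔥 → 𝔱_{ell,Φ}`. -/
def Ell.y (b : P.Base) : 𝔥 →ₗ[ℂ] Ell b where
  toFun u := Ell.mk b (fy ι u)
  map_add' u v := by
    have h := Ell.mk_relator b (Relator.y_add u v)
    rw [map_sub, map_sub, sub_sub, sub_eq_zero] at h
    exact h
  map_smul' c u := by
    have h := Ell.mk_relator b (Relator.y_smul c u)
    rw [map_sub, map_smul, sub_eq_zero] at h
    exact h

/-- The generator `t_α`. -/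
def Ell.t (b : P.Base) (i : ι) : Ell b := Ell.mk b (ft 𝔥 i)

end Holonomy

/-! ### The Lie algebra `𝔡` -/

/-- Generators `Δ₀`, `d`, `X` and `δ_{2m}` (`m ≥ 1`) of `𝔡`. -/
inductive DGen
  | Δ₀
  | d
  | X
  | δ (m : ℕ+)

/-- Shorthand for the generators inside the free Lie algebra. -/
abbrev dfr (g : DGen) : FreeLieAlgebra ℂ DGen := FreeLieAlgebra.of ℂ g

/-- The relators of `𝔡`. -/
inductive DRelator : FreeLieAlgebra ℂ DGen → Prop
  | d_X : DRelator (⁅dfr .d, dfr .X⁆ - (2 : ℂ) • dfr .X)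
  | d_Δ₀ : DRelator (⁅dfr .d, dfr .Δ₀⁆ + (2 : ℂ) • dfr .Δ₀)
  | X_Δ₀ : DRelator (⁅dfr .X, dfr .Δ₀⁆ - dfr .d)
  | δ_X (m : ℕ+) : DRelator ⁅dfr (.δ m), dfr .X⁆
  | d_δ (m : ℕ+) : DRelator (⁅dfr .d, dfr (.δ m)⁆ - (2 * m : ℂ) • dfr (.δ m))
  | Δ₀_δ (m : ℕ+) : DRelator (((LieAlgebra.ad ℂ (FreeLieAlgebra ℂ DGen) (dfr .Δ₀)) ^
      (2 * (m : ℕ) + 1)) (dfr (.δ m)))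

/-- The ideal generated by the relators of `𝔡`. -/
def dRelIdeal : LieIdeal ℂ (FreeLieAlgebra ℂ DGen) := LieSubmodule.lieSpan ℂ _ {r | DRelator r}

/-- The Lie algebra `𝔡`. -/
def Der : Type := FreeLieAlgebra ℂ DGen ⧸ dRelIdeal

instance : LieRing Der := inferInstanceAs (LieRing (FreeLieAlgebra ℂ DGen ⧸ dRelIdeal))

instance : LieAlgebra ℂ Der := inferInstanceAs (LieAlgebra ℂ (FreeLieAlgebra ℂ DGen ⧸ dRelIdeal))

/-- The generators of `𝔡`. -/
def Der.gen (g : DGen) : Der := quotHom dRelIdeal (dfr g)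

/-! ### The action of `𝔡` on `𝔱_{ell,Φ}` by derivations, the semidirect product -/

section Semidirect

variable {ι 𝔥 M : Type*} [Fintype ι] [AddCommGroup 𝔥] [Module ℂ 𝔥] [AddCommGroup M] [Module ℂ M]
variable {P : RootPairing ι ℂ M 𝔥}

/-- `(ad (c x(α^∨)/2))^p (t_α)` in `𝔱_{ell,Φ}`; used with `c = 1` and `c = -1`. -/
def adPow (b : P.Base) (c : ℂ) (i : ι) (p : ℕ) : Ell b :=
  ((LieAlgebra.ad ℂ (Ell b) ((c / 2) • Ell.x b (P.coroot i))) ^ p) (Ell.t b i)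

/-- `ρ : 𝔡 → Der(𝔱_{ell,Φ})` is given by the prescribed formulas on generators. -/
structure IsAction (b : P.Base) (ρ : Der →ₗ⁅ℂ⁆ LieDerivation ℂ (Ell b) (Ell b)) : Prop where
  d_x (u : 𝔥) : ρ (Der.gen .d) (Ell.x b u) = Ell.x b u
  d_y (u : 𝔥) : ρ (Der.gen .d) (Ell.y b u) = -Ell.y b u
  d_t (i : ι) : ρ (Der.gen .d) (Ell.t b i) = 0
  X_x (u : 𝔥) : ρ (Der.gen .X) (Ell.x b u) = 0
  X_y (u : 𝔥) : ρ (Der.gen .X) (Ell.y b u) = Ell.x b u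
  X_t (i : ι) : ρ (Der.gen .X) (Ell.t b i) = 0
  Δ₀_x (u : 𝔥) : ρ (Der.gen .Δ₀) (Ell.x b u) = Ell.y b u
  Δ₀_y (u : 𝔥) : ρ (Der.gen .Δ₀) (Ell.y b u) = 0
  Δ₀_t (i : ι) : ρ (Der.gen .Δ₀) (Ell.t b i) = 0
  δ_x (m : ℕ+) (u : 𝔥) : ρ (Der.gen (.δ m)) (Ell.x b u) = 0
  δ_t (m : ℕ+) (i : ι) :
    ρ (Der.gen (.δ m)) (Ell.t b i) = ⁅Ell.t b i, adPow b 1 i (2 * (m : ℕ))⁆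
  δ_y (m : ℕ+) (u : 𝔥) :
    ρ (Der.gen (.δ m)) (Ell.y b u) = (1 / 2 : ℂ) • ∑ i ∈ posRoots b, P.root' i u •
      ∑ pq ∈ Finset.HasAntidiagonal.antidiagonal (2 * (m : ℕ) - 1), ⁅adPow b 1 i pq.1, adPow b (-1) i pq.2⁆

variable {b : P.Base} (ρ : Der →ₗ⁅ℂ⁆ LieDerivation ℂ (Ell b) (Ell b))

/-- The semidirect product `𝔱_{ell,Φ} ⋊ 𝔡`. -/
abbrev Semi : Type _ := LieAlgebra.SemiDirectSum (Ell b) Der ρ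

/-- The element `x(u)` of the semidirect product. -/
def Semi.x (u : 𝔥) : Semi ρ := LieAlgebra.SemiDirectSum.inl ρ (Ell.x b u)

/-- The element `y(u)` of the semidirect product. -/
def Semi.y (u : 𝔥) : Semi ρ := LieAlgebra.SemiDirectSum.inl ρ (Ell.y b u)

/-- The element `t_α` of the semidirect product. -/
def Semi.t (i : ι) : Semi ρ := LieAlgebra.SemiDirectSum.inl ρ (Ell.t b i)

/-- The generators of `𝔡` in the semidirect product. -/
def Semi.gen (g : DGen) : Semi ρ := LieAlgebra.SemiDirectSum.inr ρ (Der.gen g)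

/-- Lie monomials in the generators, with their `ℤ²`-degree:
`deg x(u) = (1,0)`, `deg y(u) = (0,1)`, `deg t_α = (1,1)`, `deg Δ₀ = (-1,1)`, `deg d = (0,0)`,
`deg X = (1,-1)`, `deg δ_{2m} = (2m+1,1)`. The homogeneous components are their spans. -/
inductive HasDegree : ℤ × ℤ → Semi ρ → Prop
  | x (u : 𝔥) : HasDegree (1, 0) (Semi.x ρ u)
  | y (u : 𝔥) : HasDegree (0, 1) (Semi.y ρ u)
  | t (i : ι) : HasDegree (1, 1) (Semi.t ρ i)
  | Δ₀ : HasDegree (-1, 1) (Semi.gen ρ .Δ₀)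
  | d : HasDegree (0, 0) (Semi.gen ρ .d)
  | X : HasDegree (1, -1) (Semi.gen ρ .X)
  | δ (m : ℕ+) : HasDegree (2 * (m : ℤ) + 1, 1) (Semi.gen ρ (.δ m))
  | lie {p q : ℤ × ℤ} {a c : Semi ρ} :
      HasDegree p a → HasDegree q c → HasDegree (p + q) ⁅a, c⁆

/-- The ideal spanned by the components of total degree `≥ N`. -/
def filt (N : ℕ) : LieIdeal ℂ (Semi ρ) :=
  LieSubmodule.lieSpan ℂ _ {a | ∃ p : ℤ × ℤ, (N : ℤ) ≤ p.1 + p.2 ∧ HasDegree ρ p a}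

/-- The truncation `Semi ρ → Semi ρ / (total degree ≥ N)`. -/
def trunc (N : ℕ) : Semi ρ →ₗ⁅ℂ⁆ (Semi ρ ⧸ filt ρ N) := quotHom (filt ρ N)

theorem trunc_eq_zero {N : ℕ} {a : Semi ρ} (h : a ∈ filt ρ N) : trunc ρ N a = 0 :=
  quotHom_eq_zero h

theorem filt_anti {m n : ℕ} (h : m ≤ n) : filt ρ n ≤ filt ρ m := by
  apply LieSubmodule.lieSpan_mono
  rintro a ⟨p, hp, ha⟩
  exact ⟨p, le_trans (by exact_mod_cast h) hp, ha⟩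

/-- The completion of `𝔱_{ell,Φ} ⋊ 𝔡` with respect to the grading: the inverse limit of the
truncations, i.e. families of classes such that any finitely many of them come from a common
element. -/
def complSubmodule : Submodule ℂ (∀ N, Semi ρ ⧸ filt ρ N) where
  carrier := {f | ∀ n, ∃ a, ∀ m ≤ n, f m = trunc ρ m a}
  zero_mem' n := ⟨0, fun m _ => (map_zero (trunc ρ m)).symm⟩
  add_mem' {f g} hf hg n := by
    obtain ⟨a, ha⟩ := hf n
    obtain ⟨c, hc⟩ := hg n
    exact ⟨a + c, fun m hm => by rw [Pi.add_apply, ha m hm, hc m hm, map_add]⟩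
  smul_mem' r f hf n := by
    obtain ⟨a, ha⟩ := hf n
    exact ⟨r • a, fun m hm => by rw [Pi.smul_apply, ha m hm, map_smul]⟩

/-- The completion as a Lie algebra, with componentwise operations. -/
def Compl : Type _ := complSubmodule ρ

instance : AddCommGroup (Compl ρ) := inferInstanceAs (AddCommGroup (complSubmodule ρ))

instance : Module ℂ (Compl ρ) := inferInstanceAs (Module ℂ (complSubmodule ρ))

/-- The component of an element of the completion in the `N`-th truncation. -/
def Compl.proj (N : ℕ) : Compl ρ →ₗ[ℂ] (Semi ρ ⧸ filt ρ N) :=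
  (LinearMap.proj N).comp (complSubmodule ρ).subtype

@[ext]
theorem Compl.ext {f g : Compl ρ} (h : ∀ N, Compl.proj ρ N f = Compl.proj ρ N g) : f = g :=
  Subtype.ext (funext h)

instance : Bracket (Compl ρ) (Compl ρ) where
  bracket f g := ⟨fun N => ⁅Compl.proj ρ N f, Compl.proj ρ N g⁆, fun n => by
    obtain ⟨a, ha⟩ := f.2 n
    obtain ⟨c, hc⟩ := g.2 n
    refine ⟨⁅a, c⁆, fun m hm => ?_⟩
    have h1 : Compl.proj ρ m f = trunc ρ m a := ha m hm
    have h2 : Compl.proj ρ m g = trunc ρ m c := hc m hm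
    change ⁅Compl.proj ρ m f, Compl.proj ρ m g⁆ = _
    rw [h1, h2, LieHom.map_lie]⟩

theorem Compl.proj_lie (N : ℕ) (f g : Compl ρ) :
    Compl.proj ρ N ⁅f, g⁆ = ⁅Compl.proj ρ N f, Compl.proj ρ N g⁆ := rfl

instance : LieRing (Compl ρ) where
  add_lie f g h := by ext N; simp [Compl.proj_lie]
  lie_add f g h := by ext N; simp [Compl.proj_lie]
  lie_self f := by ext N; simp [Compl.proj_lie]
  leibniz_lie f g h := by ext N; simp [Compl.proj_lie]

instance : LieAlgebra ℂ (Compl ρ) where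
  lie_smul c f g := by ext N; simp [Compl.proj_lie]

/-- The canonical map from `𝔱_{ell,Φ} ⋊ 𝔡` to its completion. -/
def Compl.of : Semi ρ →ₗ[ℂ] Compl ρ where
  toFun a := ⟨fun N => trunc ρ N a, fun _ => ⟨a, fun _ _ => rfl⟩⟩
  map_add' a c := by
    apply Subtype.ext
    funext N
    exact map_add (trunc ρ N) a c
  map_smul' r a := by
    apply Subtype.ext
    funext N
    exact map_smul (trunc ρ N) r a

/-- The sum in the completion of a series whose `j`-th term has total degree `≥ j`. -/
def Compl.series (s : ℕ → Semi ρ) (hs : ∀ j, s j ∈ filt ρ j) : Compl ρ :=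
  ⟨fun N => trunc ρ N (∑ j ∈ Finset.range N, s j), fun n =>
    ⟨∑ j ∈ Finset.range n, s j, fun m hm => by
      rw [← sub_eq_zero, ← map_sub]
      apply trunc_eq_zero
      rw [← neg_mem_iff, neg_sub, ← Finset.sum_Ico_eq_sub _ hm]
      refine sum_mem fun j hj => ?_
      exact filt_anti ρ (Finset.mem_Ico.1 hj).1 (hs j)⟩⟩

theorem hasDegree_adPow (u : 𝔥) (i : ι) (j : ℕ) :
    HasDegree ρ ((j : ℤ) + 1, 1)
      (((LieAlgebra.ad ℂ (Semi ρ) (Semi.x ρ u)) ^ j) (Semi.t ρ i)) := by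
  induction j with
  | zero => simpa using HasDegree.t (ρ := ρ) i
  | succ j ih =>
    rw [pow_succ', Module.End.mul_apply, LieAlgebra.ad_apply]
    have h := HasDegree.lie (HasDegree.x (ρ := ρ) u) ih
    have e : ((1, 0) : ℤ × ℤ) + ((j : ℤ) + 1, 1) = (((j + 1 : ℕ) : ℤ) + 1, 1) := by
      ext <;> simp; ring
    rwa [e] at h

/-- For a power series `ψ`, the element `ψ(ad x(α^∨)/2)(t_α)` of the completion. -/
def psAd (ψ : PowerSeries ℂ) (i : ι) : Compl ρ :=
  Compl.series ρ (fun j => PowerSeries.coeff j ψ •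
      ((LieAlgebra.ad ℂ (Semi ρ) (Semi.x ρ ((1 / 2 : ℂ) • P.coroot i))) ^ j) (Semi.t ρ i))
    fun j => by
      refine SMulMemClass.smul_mem _ (LieSubmodule.subset_lieSpan ⟨_, ?_, hasDegree_adPow ρ _ i j⟩)
      dsimp only
      omega

/-- The element `∑_{n ≥ 1} c_n δ_{2n}` of the completion. -/
def deltaSeries (c : ℕ+ → ℂ) : Compl ρ :=
  Compl.series ρ (fun j => c j.succPNat • Semi.gen ρ (.δ j.succPNat)) fun j => by
    refine SMulMemClass.smul_mem _ (LieSubmodule.subset_lieSpan ⟨_, ?_, HasDegree.δ j.succPNat⟩)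
    simp only [Nat.succPNat_coe]
    push_cast
    omega

end Semidirect

/-! ### Theta functions and the coefficient functions -/

/-- The constant `2πi`. -/
def twoPiI : ℂ := 2 * Real.pi * Complex.I

/-- The theta function
`θ(z|τ) = u^{1/2} ∏_{s>0} (1 - q^s u) ∏_{s≥0} (1 - q^s u⁻¹) (2πi)⁻¹ ∏_{s>0} (1 - q^s)⁻²`,
`u = e^{2πiz}`, `q = e^{2πiτ}`; it is odd in `z`, vanishes exactly on `ℤ + ℤτ`, and has
derivative `1` at `z = 0`. -/
def theta (z τ : ℂ) : ℂ :=
  Complex.exp (twoPiI * z / 2) *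
    (∏' s : ℕ, (1 - Complex.exp (twoPiI * τ) ^ (s + 1) * Complex.exp (twoPiI * z))) *
    (∏' s : ℕ, (1 - Complex.exp (twoPiI * τ) ^ s * Complex.exp (-(twoPiI * z)))) *
    twoPiI⁻¹ * ((∏' s : ℕ, (1 - Complex.exp (twoPiI * τ) ^ (s + 1))) ^ 2)⁻¹

/-- The Taylor series of `x ↦ θ(z + x|τ)` at `x = 0`. -/
def thetaTaylor (z τ : ℂ) : PowerSeries ℂ :=
  PowerSeries.mk fun n => iteratedDeriv n (fun w => theta w τ) z / (n.factorial : ℂ)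

/-- The power series `θ(x|τ)/x`, which has constant term `1`. -/
def thetaDivX (τ : ℂ) : PowerSeries ℂ :=
  PowerSeries.mk fun n => PowerSeries.coeff (n + 1) (thetaTaylor 0 τ)

/-- `k(z,x|τ) = θ(z+x|τ) / (θ(z|τ) θ(x|τ)) - 1/x` as a power series in `x`, for `z ∉ ℤ + ℤτ`:
it is `(θ(z|τ)⁻¹ θ(z+x|τ) (θ(x|τ)/x)⁻¹ - 1) / x`, and subtracting `1` and dividing by `x` amounts
to dropping the constant term `1` and shifting the coefficients. -/
def kSeries (z τ : ℂ) : PowerSeries ℂ :=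
  PowerSeries.mk fun n => PowerSeries.coeff (n + 1)
    (PowerSeries.C (theta z τ)⁻¹ * thetaTaylor z τ * (thetaDivX τ)⁻¹)

/-- `g(z,x|τ) = ∂k/∂x (z,x|τ)` as a power series in `x`. -/
def gSeries (z τ : ℂ) : PowerSeries ℂ := PowerSeries.derivative ℂ (kSeries z τ)

/-- `a_{2n} = -(2n+1) B_{2n+2} (2πi)^{2n+2} / (2n+2)!`. -/
def aCoeff (n : ℕ+) : ℂ :=
  -((2 * (n : ℂ) + 1) * (bernoulli (2 * (n : ℕ) + 2) : ℂ) *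
    twoPiI ^ (2 * (n : ℕ) + 2)) / ((2 * (n : ℕ) + 2).factorial : ℂ)

/-- The Eisenstein series `E_{2n+2}(τ) = 1 + ⋯` of weight `2n+2`, normalised to have constant
term `1`. -/
def eisenstein (n : ℕ+) (τ : ℂ) : ℂ :=
  ModularForm.E (k := 2 * (n : ℕ) + 2) (by have := n.pos; omega) (UpperHalfPlane.ofComplex τ)

/-! ### The connection -/

section Connection

variable {ι 𝔥 M : Type*} [Fintype ι] [NormedAddCommGroup 𝔥] [NormedSpace ℂ 𝔥]
  [AddCommGroup M] [Module ℂ M]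
variable {P : RootPairing ι ℂ M 𝔥}

/-- The complement in `𝔥 × ℍ` of the hypersurfaces `{(z,τ) | α(z) ∈ ℤ + ℤτ}`. The elliptic moduli
space `M_{1,n}` is its quotient by `(P^∨ ⊕ P^∨) ⋊ SL₂(ℤ)`, where `(n,m)` acts by
`(z,τ) ↦ (z + n + τm, τ)` and a matrix by `(z,τ) ↦ (z/(cτ+d), (aτ+b)/(cτ+d))`. -/
def regularSet (P : RootPairing ι ℂ M 𝔥) : Set (𝔥 × ℂ) :=
  {p | 0 < p.2.im ∧ ∀ (i : ι) (m n : ℤ), P.root' i p.1 ≠ m + n * p.2}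

/-- The coweight lattice `P^∨`. -/
def IsCoweight (P : RootPairing ι ℂ M 𝔥) (l : 𝔥) : Prop := ∀ i, ∃ m : ℤ, P.root' i l = m

variable {b : P.Base} (ρ : Der →ₗ⁅ℂ⁆ LieDerivation ℂ (Ell b) (Ell b))

/-- `Δ(z,τ) = -(2πi)⁻¹ Δ₀ - (2πi)⁻¹ ∑_{n ≥ 1} a_{2n} E_{2n+2}(τ) δ_{2n}
  + (2πi)⁻¹ ∑_{β > 0} g(β(z), ad x(β^∨)/2 | τ)(t_β)`. -/
def bigDelta (p : 𝔥 × ℂ) : Compl ρ :=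
  -(twoPiI⁻¹ • Compl.of ρ (Semi.gen ρ .Δ₀)) -
    twoPiI⁻¹ • deltaSeries ρ (fun n => aCoeff n * eisenstein n p.2) +
    twoPiI⁻¹ • ∑ i ∈ posRoots b, psAd ρ (gSeries (P.root' i p.1) p.2) i

/-- The connection form `A = Δ dτ + ∑_{α > 0} k(α, ad x(α^∨)/2 | τ)(t_α) dα - ∑ᵢ y(uⁱ) duᵢ`, so
that `∇_KZB = d - A`. At a point `p` it is a linear map on tangent vectors `(v,s) ∈ 𝔥 × ℂ`; for
any pair of dual bases `∑ᵢ y(uⁱ) duᵢ` is the form `(v,s) ↦ y(v)`. -/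
def kzbForm (p : 𝔥 × ℂ) : 𝔥 × ℂ →ₗ[ℂ] Compl ρ :=
  (LinearMap.snd ℂ 𝔥 ℂ).smulRight (bigDelta ρ p) +
    ∑ i ∈ posRoots b, ((P.root' i).comp (LinearMap.fst ℂ 𝔥 ℂ)).smulRight
      (psAd ρ (kSeries (P.root' i p.1) p.2) i) -
    (Compl.of ρ).comp (((LieAlgebra.SemiDirectSum.inl ρ : Ell b →ₗ[ℂ] Semi ρ).comp (Ell.y b)).comp
      (LinearMap.fst ℂ 𝔥 ℂ))

/-- `F'` is the complex derivative at `p` of the function `F` valued in the completion: it is so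
for every coordinate (linear functional) of every truncation. The truncations attached to a
root system are finite-dimensional. -/
def HasDerivative (F : 𝔥 × ℂ → Compl ρ) (F' : 𝔥 × ℂ →ₗ[ℂ] Compl ρ) (p : 𝔥 × ℂ) : Prop :=
  ∀ (N : ℕ) (f : Module.Dual ℂ (Semi ρ ⧸ filt ρ N)), ∃ L : 𝔥 × ℂ →L[ℂ] ℂ,
    (∀ v, L v = f (Compl.proj ρ N (F' v))) ∧ HasFDerivAt (fun q => f (Compl.proj ρ N (F q))) L p

/-- The connection `d - A` is holomorphic and flat on `U`: `A` is differentiable there and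
`dA(u,v) - [A(u),A(v)] = 0`, where `dA(u,v) = ∂_u A(v) - ∂_v A(u)`. Here `D v u` is `∂_u A(v)`. -/
def IsFlatOn (A : 𝔥 × ℂ → 𝔥 × ℂ →ₗ[ℂ] Compl ρ) (U : Set (𝔥 × ℂ)) : Prop :=
  ∀ p ∈ U, ∃ D : 𝔥 × ℂ → 𝔥 × ℂ →ₗ[ℂ] Compl ρ,
    (∀ v, HasDerivative ρ (fun q => A q v) (D v) p) ∧
      ∀ u v, D v u - D u v - ⁅A p u, A p v⁆ = 0

/-- `c = exp(ad w)(a)` in the completion; in each truncation the exponential series is a finite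
sum. -/
def IsExpAd (w a c : Compl ρ) : Prop :=
  ∀ N, ∃ n₀ : ℕ, (∀ n ≥ n₀, Compl.proj ρ N (((LieAlgebra.ad ℂ (Compl ρ) w) ^ n) a) = 0) ∧
    Compl.proj ρ N c = ∑ n ∈ Finset.range n₀,
      (n.factorial : ℂ)⁻¹ • Compl.proj ρ N (((LieAlgebra.ad ℂ (Compl ρ) w) ^ n) a)

/-- `c = Ad(r^d)(a)`, where `r^d = diag(r, r⁻¹) ∈ SL₂(ℂ)`: in each truncation, `Ad(r^d)` is
multiplication by `r^j` on the eigenspace of `ad d` with eigenvalue `j ∈ ℤ`. -/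
def IsTorusAd (r : ℂ) (a c : Compl ρ) : Prop :=
  ∀ N, ∃ f : ℤ →₀ (Semi ρ ⧸ filt ρ N),
    (∀ j, ⁅trunc ρ N (Semi.gen ρ .d), f j⁆ = (j : ℂ) • f j) ∧
      Compl.proj ρ N a = (f.sum fun _ e => e) ∧ Compl.proj ρ N c = (f.sum fun j e => r ^ j • e)

/-- `d - A` is a connection on the principal bundle `P_n` over the moduli space `M_{1,n}`.

With structure group `G_n = exp((𝔱_{ell,Φ} ⋊ 𝔡₊)^) ⋊ SL₂(ℂ)`, the sections of `P_n` are the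
`G_n`-valued functions `f` on the inverse image of an open subset of `M_{1,n}` such that, for
`l ∈ P^∨`,
`f(z+l|τ) = f(z|τ)`, `f(z+τl|τ) = e^{-2πi x(l)} f(z|τ)`, `f(z|τ+1) = f(z|τ)`,
`f(z/τ|-1/τ) = τ^d exp(w) f(z|τ)`, where `w = (2πi/τ)(x(z) + X)`.

So for each of these transformations `γ` of the covering, with `f(γp) = c(p) f(p)`, the condition
on `A` is `(γ^*A)_p = Ad(c(p)) A_p + (dc c⁻¹)_p`. In the last case `w` commutes with `dw`, so that
`dc c⁻¹ = (dτ/τ) d + Ad(τ^d)(dw)`, with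
`dw(v,s) = (2πi/τ) x(v) - (2πi s/τ²) (x(z) + X)`. -/
structure IsModuliConnection (A : 𝔥 × ℂ → 𝔥 × ℂ →ₗ[ℂ] Compl ρ) : Prop where
  transl (l : 𝔥) (hl : IsCoweight P l) (z : 𝔥) (τ : ℂ) (h : (z, τ) ∈ regularSet P)
    (v : 𝔥) (s : ℂ) : A (z + l, τ) (v, s) = A (z, τ) (v, s)
  transl_tau (l : 𝔥) (hl : IsCoweight P l) (z : 𝔥) (τ : ℂ) (h : (z, τ) ∈ regularSet P)
    (v : 𝔥) (s : ℂ) :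
    IsExpAd ρ (Compl.of ρ (-twoPiI • Semi.x ρ l))
      (A (z, τ) (v, s)) (A (z + τ • l, τ) (v + s • l, s))
  tau_add_one (z : 𝔥) (τ : ℂ) (h : (z, τ) ∈ regularSet P) (v : 𝔥) (s : ℂ) :
    A (z, τ + 1) (v, s) = A (z, τ) (v, s)
  inversion (z : 𝔥) (τ : ℂ) (h : (z, τ) ∈ regularSet P) (v : 𝔥) (s : ℂ) :
    ∃ B : Compl ρ,
      IsExpAd ρ (Compl.of ρ ((twoPiI / τ) • (Semi.x ρ z + Semi.gen ρ .X)))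
        (A (z, τ) (v, s)) B ∧
      IsTorusAd ρ τ
        (B + Compl.of ρ ((twoPiI / τ) • Semi.x ρ v -
          (twoPiI * s / τ ^ 2) • (Semi.x ρ z + Semi.gen ρ .X)))
        (A (τ⁻¹ • z, -τ⁻¹) (τ⁻¹ • v - (s / τ ^ 2) • z, s / τ ^ 2) -
          Compl.of ρ ((s / τ) • Semi.gen ρ .d))

end Connection

end EllipticKZB

end

set_option linter.unusedSectionVars false

noncomputable section

namespace EllipticKZB

/-! ### Positive roots and classes of roots -/

section Roots

variable {ι 𝔥 M : Type*} [Fintype ι] [AddCommGroup 𝔥] [Module ℂ 𝔥] [AddCommGroup M] [Module ℂ M]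
variable {P : RootPairing ι ℂ M 𝔥}

/-- The index of the negative of a root. -/
def negIdx (P : RootPairing ι ℂ M 𝔥) (i : ι) : ι := P.reflectionPerm i i

@[simp]
theorem root_negIdx (i : ι) : P.root (negIdx P i) = -P.root i := by
  simp [negIdx, RootPairing.root_reflectionPerm]

@[simp]
theorem coroot_negIdx (i : ι) : P.coroot (negIdx P i) = -P.coroot i := by
  simp [negIdx, RootPairing.coroot_reflectionPerm]

theorem root'_eq (i : ι) (u : 𝔥) : P.root' i u = P.toLinearMap (P.root i) u := rfl

@[simp]
theorem root'_negIdx (i : ι) : P.root' (negIdx P i) = -P.root' i := by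
  ext u
  simp [root'_eq]

theorem root'_coroot_self (i : ι) : P.root' i (P.coroot i) = 2 :=
  P.root_coroot_two i

theorem root_injective : Function.Injective P.root := P.root.injective

@[simp]
theorem negIdx_negIdx (i : ι) : negIdx P (negIdx P i) = i :=
  root_injective (P := P) (by simp)

theorem negIdx_ne (i : ι) : negIdx P i ≠ i := by
  intro h
  have h1 := root_negIdx (P := P) i
  rw [h] at h1
  have h2 : (2 : ℂ) • P.root i = 0 := by
    rw [two_smul]
    nth_rewrite 1 [h1]
    simp
  exact P.ne_zero i ((smul_eq_zero.1 h2).resolve_left two_ne_zero)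

/-- A coweight taking the value `1` on the simple roots. -/
theorem exists_heightVec [P.IsRootSystem] (b : P.Base) :
    ∃ l : 𝔥, ∀ i ∈ b.support, P.root' i l = 1 := by
  obtain ⟨l, hl⟩ := (LinearMap.IsPerfPair.bijective_right P.toLinearMap).2
    (b.toWeightBasis.constr ℂ (fun _ => (1 : ℂ)))
  refine ⟨l, fun i hi => ?_⟩
  have h := congrArg (fun f => f (P.root i)) hl
  have h2 : b.toWeightBasis.constr ℂ (fun _ => (1 : ℂ)) (P.root i) = 1 := by
    rw [← b.toWeightBasis_apply ⟨i, hi⟩, Module.Basis.constr_basis]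
  rw [h2] at h
  exact h

/-- The vector `ρ^∨`. -/
def heightVec [P.IsRootSystem] (b : P.Base) : 𝔥 := (exists_heightVec b).choose

theorem heightVec_closure [P.IsRootSystem] (b : P.Base) {m : M}
    (hm : m ∈ AddSubmonoid.closure (P.root '' (b.support : Set ι))) :
    ∃ n : ℕ, P.toLinearMap m (heightVec b) = n ∧ (n = 0 → m = 0) := by
  induction hm using AddSubmonoid.closure_induction with
  | mem x hx =>
    obtain ⟨i, hi, rfl⟩ := hx
    exact ⟨1, by rw [Nat.cast_one]; exact (exists_heightVec b).choose_spec i hi, by simp⟩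
  | zero => exact ⟨0, by simp⟩
  | add x y _ _ hx hy =>
    obtain ⟨n, hn, hn'⟩ := hx
    obtain ⟨k, hk, hk'⟩ := hy
    refine ⟨n + k, by simp [hn, hk], fun h => ?_⟩
    rw [hn' (by omega), hk' (by omega), add_zero]

theorem mem_posRoots {b : P.Base} {i : ι} :
    i ∈ posRoots b ↔ P.root i ∈ AddSubmonoid.closure (P.root '' (b.support : Set ι)) := by
  simp [posRoots]

theorem root'_heightVec [P.IsRootSystem] (b : P.Base) (i : ι) :
    ∃ n : ℤ, n ≠ 0 ∧ P.root' i (heightVec b) = n ∧ (i ∈ posRoots b ↔ 0 < n) := by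
  have key : ∀ j, j ∈ posRoots b → ∃ n : ℕ, n ≠ 0 ∧ P.root' j (heightVec b) = n := by
    intro j hj
    obtain ⟨n, hn, hn'⟩ := heightVec_closure b (mem_posRoots.1 hj)
    exact ⟨n, fun h => P.ne_zero j (hn' h), hn⟩
  by_cases hi : i ∈ posRoots b
  · obtain ⟨n, hn, h⟩ := key i hi
    exact ⟨n, by exact_mod_cast hn, by simpa using h,
      by simp [hi, Nat.pos_of_ne_zero hn]⟩
  · have hi' : negIdx P i ∈ posRoots b := by
      rw [mem_posRoots, root_negIdx]
      exact (b.root_mem_or_neg_mem i).resolve_left (fun h => hi (mem_posRoots.2 h))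
    obtain ⟨n, hn, h⟩ := key _ hi'
    refine ⟨-n, by simpa using hn, ?_, ?_⟩
    · rw [root'_negIdx] at h
      simp only [LinearMap.neg_apply] at h
      push_cast
      rw [← h, neg_neg]
    · simp [hi]

theorem negIdx_mem_posRoots [P.IsRootSystem] (b : P.Base) (i : ι) :
    negIdx P i ∈ posRoots b ↔ i ∉ posRoots b := by
  obtain ⟨n, hn, h, hp⟩ := root'_heightVec b i
  obtain ⟨k, hk, h', hp'⟩ := root'_heightVec b (negIdx P i)
  rw [hp, hp']
  rw [root'_negIdx, LinearMap.neg_apply, h] at h'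
  have : k = -n := by exact_mod_cast h'.symm
  omega

/-- The sum over all roots of an even function is twice the sum over the positive roots. -/
theorem two_nsmul_sum_posRoots [P.IsRootSystem] (b : P.Base) {V : Type*} [AddCommGroup V]
    (f : ι → V) (hf : ∀ i, f (negIdx P i) = f i) :
    ∑ i, f i = 2 • ∑ i ∈ posRoots b, f i := by
  classical
  rw [← Finset.sum_filter_add_sum_filter_not Finset.univ (fun i => i ∈ posRoots b), two_nsmul]
  congr 1
  · exact Finset.sum_congr (by ext; simp) fun _ _ => rfl
  · refine Finset.sum_nbij' (negIdx P) (negIdx P) ?_ ?_ ?_ ?_ ?_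
    · intro i hi
      exact (negIdx_mem_posRoots b i).2 (by simpa using hi)
    · intro i hi
      simpa [negIdx_mem_posRoots b] using hi
    · simp
    · simp
    · simp [hf]

theorem sum_posRoots [P.IsRootSystem] (b : P.Base) {V : Type*} [AddCommGroup V] [Module ℂ V]
    (f : ι → V) (hf : ∀ i, f (negIdx P i) = f i) :
    ∑ i ∈ posRoots b, f i = (1 / 2 : ℂ) • ∑ i, f i := by
  rw [two_nsmul_sum_posRoots b f hf, ← Nat.cast_smul_eq_nsmul ℂ, smul_smul]
  norm_num

theorem eq_or_eq_negIdx [P.IsReduced] {i j : ι}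
    (h : ¬ LinearIndependent ℂ ![P.root i, P.root j]) : j = i ∨ j = negIdx P i := by
  rcases RootPairing.IsReduced.eq_or_eq_neg (P := P) i j h with h | h
  · exact Or.inl (root_injective (P := P) h.symm)
  · exact Or.inr (root_injective (P := P) (by simp [h]))

end Roots

/-! ### Elementary identities in `𝔱_{ell,Φ}` -/

section EllBasic

variable {ι 𝔥 M : Type*} [Fintype ι] [AddCommGroup 𝔥] [Module ℂ 𝔥] [AddCommGroup M] [Module ℂ M]
variable {P : RootPairing ι ℂ M 𝔥} {b : P.Base}

theorem Ell.mk_eq {r s : FreeLieAlgebra ℂ (Gen ι 𝔥)} (h : Relator b (r - s)) :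
    Ell.mk b r = Ell.mk b s := by
  have := Ell.mk_relator b h
  rwa [map_sub, sub_eq_zero] at this

theorem Ell.t_negIdx (i : ι) : Ell.t b (negIdx P i) = Ell.t b i :=
  (Ell.mk_eq (Relator.t_neg i (negIdx P i) (by simp))).symm

theorem Ell.lie_x_x (u v : 𝔥) : ⁅Ell.x b u, Ell.x b v⁆ = 0 := by
  have := Ell.mk_relator b (Relator.xx u v)
  rwa [LieHom.map_lie] at this

theorem Ell.lie_y_y (u v : 𝔥) : ⁅Ell.y b u, Ell.y b v⁆ = 0 := by
  have := Ell.mk_relator b (Relator.yy u v)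
  rwa [LieHom.map_lie] at this

theorem Ell.lie_t_x_of_eq_zero (i : ι) (u : 𝔥) (h : P.root' i u = 0) :
    ⁅Ell.t b i, Ell.x b u⁆ = 0 := by
  have := Ell.mk_relator b (Relator.tx i u h)
  rwa [LieHom.map_lie] at this

theorem Ell.lie_t_y_of_eq_zero (i : ι) (u : 𝔥) (h : P.root' i u = 0) :
    ⁅Ell.t b i, Ell.y b u⁆ = 0 := by
  have := Ell.mk_relator b (Relator.ty i u h)
  rwa [LieHom.map_lie] at this

theorem Ell.lie_y_x_pos (u v : 𝔥) : ⁅Ell.y b u, Ell.x b v⁆ =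
    ∑ i ∈ posRoots b, (P.root' i v * P.root' i u) • Ell.t b i := by
  have := Ell.mk_eq (Relator.yx (b := b) u v)
  rw [LieHom.map_lie, map_sum] at this
  refine this.trans (Finset.sum_congr rfl fun i _ => ?_)
  rw [map_smul]
  rfl

theorem Ell.lie_y_x [P.IsRootSystem] (u v : 𝔥) : ⁅Ell.y b u, Ell.x b v⁆ =
    (1 / 2 : ℂ) • ∑ i, (P.root' i v * P.root' i u) • Ell.t b i := by
  rw [Ell.lie_y_x_pos, sum_posRoots]
  intro i
  simp [Ell.t_negIdx]

/-- The element `(ad x(α^∨)/2)^p (t_α)`. -/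
abbrev Ell.tx (b : P.Base) (i : ι) (p : ℕ) : Ell b := adPow b 1 i p

theorem adPow_zero (c : ℂ) (i : ι) : adPow b c i 0 = Ell.t b i := by
  simp [adPow]

theorem adPow_succ (c : ℂ) (i : ι) (p : ℕ) :
    adPow b c i (p + 1) = (c / 2) • ⁅Ell.x b (P.coroot i), adPow b c i p⁆ := by
  simp only [adPow, pow_succ', Module.End.mul_apply, LieAlgebra.ad_apply, smul_lie]

theorem Ell.tx_zero (i : ι) : Ell.tx b i 0 = Ell.t b i := adPow_zero 1 i

theorem Ell.tx_succ (i : ι) (p : ℕ) :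
    Ell.tx b i (p + 1) = (1 / 2 : ℂ) • ⁅Ell.x b (P.coroot i), Ell.tx b i p⁆ :=
  adPow_succ 1 i p

theorem Ell.lie_x_adPow_of_eq_zero (c : ℂ) (i : ι) (p : ℕ) (u : 𝔥) (h : P.root' i u = 0) :
    ⁅Ell.x b u, adPow b c i p⁆ = 0 := by
  induction p with
  | zero => rw [adPow_zero, ← lie_skew, Ell.lie_t_x_of_eq_zero i u h, neg_zero]
  | succ p ih =>
    rw [adPow_succ, lie_smul, leibniz_lie, Ell.lie_x_x, ih]
    simp

theorem Ell.lie_x_tx (i : ι) (p : ℕ) (u : 𝔥) :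
    ⁅Ell.x b u, Ell.tx b i p⁆ = P.root' i u • Ell.tx b i (p + 1) := by
  have h0 : P.root' i (u - (P.root' i u / 2) • P.coroot i) = 0 := by
    rw [map_sub, map_smul, root'_coroot_self]
    simp
  have h1 := Ell.lie_x_adPow_of_eq_zero (b := b) 1 i p _ h0
  rw [map_sub, map_smul, sub_lie, sub_eq_zero] at h1
  rw [Ell.tx, h1, Ell.tx, adPow_succ, smul_lie, smul_smul]
  congr 1
  ring

theorem adPow_eq (c : ℂ) (i : ι) (p : ℕ) : adPow b c i p = c ^ p • Ell.tx b i p := by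
  induction p with
  | zero => simp [adPow_zero]
  | succ p ih =>
    rw [adPow_succ, ih, lie_smul, Ell.tx_succ, smul_smul, smul_smul]
    congr 1
    ring

theorem Ell.tx_negIdx (i : ι) (p : ℕ) :
    Ell.tx b (negIdx P i) p = (-1 : ℂ) ^ p • Ell.tx b i p := by
  induction p with
  | zero => simp [adPow_zero, Ell.t_negIdx]
  | succ p ih =>
    rw [Ell.tx_succ, ih, coroot_negIdx, map_neg, lie_smul, Ell.tx_succ,
      neg_lie, smul_neg, smul_neg, smul_smul, smul_smul, ← neg_smul]
    congr 1
    ring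

/-- The class of a root modulo integral multiples of another one. -/
theorem Ell.sum_lie_t_class [P.IsRootSystem] [P.IsReduced] (i k₀ : ι)
    (h : LinearIndependent ℂ ![P.root i, P.root k₀]) :
    open Classical in
    ∑ k ∈ Finset.univ.filter (fun k => ∃ c : ℤ, P.root k = P.root k₀ + c • P.root i),
      ⁅Ell.t b i, Ell.t b k⁆ = 0 := by
  classical
  set Ψ : ι → Finset ι := fun k => Finset.univ.filter
    (fun j => P.root j ∈ AddSubgroup.closure {P.root i, P.root k}) with hΨ
  have pair : ∀ {k : ι}, LinearIndependent ℂ ![P.root i, P.root k] → ∀ {m n m' n' : ℤ},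
      m • P.root i + n • P.root k = m' • P.root i + n' • P.root k → m = m' ∧ n = n' := by
    intro k hk m n m' n' e
    rw [LinearIndependent.pair_iff] at hk
    have := hk (m - m') (n - n') (by
      simp only [sub_smul, Int.cast_smul_eq_zsmul]
      rw [sub_add_sub_comm, e, sub_self])
    constructor
    · exact_mod_cast sub_eq_zero.1 this.1
    · exact_mod_cast sub_eq_zero.1 this.2
  induction hcard : (Ψ k₀).card using Nat.strong_induction_on generalizing k₀ with
  | _ N IH =>
  have hmem : ∀ j ∈ Ψ k₀, ∃ n m : ℤ, m • P.root i + n • P.root k₀ = P.root j := by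
    intro j hj
    obtain ⟨m, n, e⟩ := AddSubgroup.mem_closure_pair.1 (Finset.mem_filter.1 hj).2
    exact ⟨n, m, e⟩
  choose! n m hnm using hmem
  have hmem' : ∀ j (p q : ℤ), p • P.root i + q • P.root k₀ = P.root j →
      j ∈ Ψ k₀ ∧ n j = q ∧ m j = p := by
    intro j p q e
    have hj : j ∈ Ψ k₀ :=
      Finset.mem_filter.2 ⟨Finset.mem_univ _, AddSubgroup.mem_closure_pair.2 ⟨p, q, e⟩⟩
    have := pair h ((hnm j hj).trans e.symm)
    exact ⟨hj, this.2, this.1⟩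
  set f : ι → Ell b := fun k => ⁅Ell.t b i, Ell.t b k⁆ with hf
  have hfneg : ∀ k, f (negIdx P k) = f k := fun k => by simp [hf, Ell.t_negIdx]
  -- the relation of the subsystem spanned by the two roots
  have htot : ∑ k ∈ Ψ k₀, f k = 0 := by
    have hsub : IsSubsystem P (Ψ k₀ : Set ι) := by
      intro j hj
      have : AddSubgroup.closure (P.root '' (Ψ k₀ : Set ι)) ≤
          AddSubgroup.closure {P.root i, P.root k₀} := by
        rw [AddSubgroup.closure_le]
        rintro _ ⟨j, hj, rfl⟩
        exact (Finset.mem_filter.1 hj).2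
      exact Finset.mem_coe.2 (Finset.mem_filter.2 ⟨Finset.mem_univ _, this hj⟩)
    have hi : i ∈ (Ψ k₀ : Set ι) := Finset.mem_coe.2 (Finset.mem_filter.2
      ⟨Finset.mem_univ _, AddSubgroup.subset_closure (by simp)⟩)
    have h1 := Ell.mk_relator b (Relator.tt _ hsub i hi)
    rw [LieHom.map_lie, map_sum] at h1
    have h2 : ∑ k ∈ posRootsOf b (Ψ k₀ : Set ι), f k = 0 := by
      rw [hf, ← lie_sum]
      exact h1
    have h3 := two_nsmul_sum_posRoots b (fun k => if k ∈ Ψ k₀ then f k else 0) (by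
      intro k
      have : negIdx P k ∈ Ψ k₀ ↔ k ∈ Ψ k₀ := by simp [hΨ]
      simp only [this, hfneg])
    rw [← Finset.sum_filter, ← Finset.sum_filter] at h3
    have e1 : Finset.univ.filter (fun k => k ∈ Ψ k₀) = Ψ k₀ := by ext; simp
    have e2 : (posRoots b).filter (fun k => k ∈ Ψ k₀) = posRootsOf b (Ψ k₀ : Set ι) := by
      ext; simp [posRootsOf]
    rw [e1, e2, h2, smul_zero] at h3
    exact h3
  have hrest : ∑ k ∈ (Ψ k₀).filter (fun k => ¬ (n k = 1 ∨ n k = -1)), f k = 0 := by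
    rw [← Finset.sum_fiberwise_of_maps_to
      (t := ((Ψ k₀).filter (fun k => ¬ (n k = 1 ∨ n k = -1))).image n) (g := n)
      (fun k hk => Finset.mem_image_of_mem n hk)]
    refine Finset.sum_eq_zero fun q hq => ?_
    obtain ⟨g, hg, rfl⟩ := Finset.mem_image.1 hq
    obtain ⟨hgΨ, hg1⟩ := Finset.mem_filter.1 hg
    by_cases hq0 : n g = 0
    · refine Finset.sum_eq_zero fun k hk => ?_
      obtain ⟨hk, hkn⟩ := Finset.mem_filter.1 hk
      have hk1 := hnm k (Finset.mem_filter.1 hk).1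
      have : ¬ LinearIndependent ℂ ![P.root i, P.root k] := by
        rw [LinearIndependent.pair_iff]
        intro hh
        have := hh (m k) (-1) (by
          rw [← hk1, hkn, hq0, Int.cast_smul_eq_zsmul]
          simp)
        simp at this
      rcases eq_or_eq_negIdx this with e | e
      · simp [hf, e]
      · simp [hf, e, Ell.t_negIdx]
    · have hgind : LinearIndependent ℂ ![P.root i, P.root g] := by
        rw [LinearIndependent.pair_iff] at h ⊢
        intro s t hst
        rw [← hnm g hgΨ, smul_add, ← Int.cast_smul_eq_zsmul ℂ, ← Int.cast_smul_eq_zsmul ℂ,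
          smul_smul, smul_smul, ← add_assoc, ← add_smul] at hst
        obtain ⟨h1, h2⟩ := h _ _ hst
        have ht : t = 0 := by
          rcases mul_eq_zero.1 h2 with h2 | h2
          · exact h2
          · exact absurd (by exact_mod_cast h2) hq0
        rw [ht] at h1
        exact ⟨by simpa using h1, ht⟩
      have hlt : (Ψ g).card < N := by
        rw [← hcard]
        refine Finset.card_lt_card (Finset.ssubset_iff_subset_ne.2 ⟨?_, ?_⟩)
        · intro j hj
          refine Finset.mem_filter.2 ⟨Finset.mem_univ _, ?_⟩
          have : AddSubgroup.closure {P.root i, P.root g} ≤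
              AddSubgroup.closure {P.root i, P.root k₀} := by
            rw [AddSubgroup.closure_le]
            rintro x (rfl | rfl)
            · exact AddSubgroup.subset_closure (by simp)
            · exact (Finset.mem_filter.1 hgΨ).2
          exact this (Finset.mem_filter.1 hj).2
        · intro e
          have hk₀ : k₀ ∈ Ψ g := by
            rw [e]
            exact Finset.mem_filter.2 ⟨Finset.mem_univ _, AddSubgroup.subset_closure (by simp)⟩
          obtain ⟨p, q, e'⟩ := AddSubgroup.mem_closure_pair.1 (Finset.mem_filter.1 hk₀).2
          rw [← hnm g hgΨ] at e'
          have := (pair h (m := p + q * m g) (n := q * n g) (m' := 0) (n' := 1) (by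
            rw [zero_smul, zero_add, one_smul]
            refine Eq.trans ?_ e'
            rw [smul_add, smul_smul, smul_smul, add_smul]
            abel)).2
          exact hg1 (Int.eq_one_or_neg_one_of_mul_eq_one' this |>.elim (fun h => Or.inl h.2)
            (fun h => Or.inr h.2))
      have := IH _ hlt g hgind rfl
      refine Eq.trans (Finset.sum_congr ?_ fun _ _ => rfl) this
      ext k
      simp only [Finset.mem_filter, Finset.mem_univ, true_and]
      constructor
      · rintro ⟨⟨hk, -⟩, hkn⟩
        refine ⟨m k - m g, ?_⟩
        rw [← hnm k hk, ← hnm g hgΨ, hkn, sub_smul]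
        abel
      · rintro ⟨c, hc⟩
        obtain ⟨h1, h2, -⟩ := hmem' k (m g + c) (n g) (by
          rw [hc, ← hnm g hgΨ, add_smul]
          abel)
        exact ⟨⟨h1, by rw [h2]; exact hg1⟩, h2⟩
  have hpm : ∑ k ∈ (Ψ k₀).filter (fun k => n k = 1 ∨ n k = -1), f k = 0 := by
    have := Finset.sum_filter_add_sum_filter_not (Ψ k₀) (fun k => n k = 1 ∨ n k = -1) f
    rwa [hrest, add_zero, htot] at this
  have hneg1 : ∑ k ∈ (Ψ k₀).filter (fun k => n k = -1), f k =
      ∑ k ∈ (Ψ k₀).filter (fun k => n k = 1), f k := by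
    have hn : ∀ k ∈ Ψ k₀, negIdx P k ∈ Ψ k₀ ∧ n (negIdx P k) = - n k := by
      intro k hk
      obtain ⟨h1, h2, -⟩ := hmem' (negIdx P k) (- m k) (- n k) (by
        rw [root_negIdx, ← hnm k hk, neg_smul, neg_smul]
        abel)
      exact ⟨h1, h2⟩
    refine Finset.sum_nbij' (negIdx P) (negIdx P) ?_ ?_ (by simp) (by simp)
      (fun k _ => (hfneg k).symm)
    · intro k hk
      obtain ⟨hk, hk1⟩ := Finset.mem_filter.1 hk
      exact Finset.mem_filter.2 ⟨(hn k hk).1, by rw [(hn k hk).2, hk1, neg_neg]⟩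
    · intro k hk
      obtain ⟨hk, hk1⟩ := Finset.mem_filter.1 hk
      exact Finset.mem_filter.2 ⟨(hn k hk).1, by rw [(hn k hk).2, hk1]⟩
  rw [Finset.filter_or, Finset.sum_union (Finset.disjoint_filter.2 (by
    intro k _ h1 h2
    omega)), hneg1, ← two_smul ℂ, smul_eq_zero] at hpm
  refine Eq.trans (Finset.sum_congr ?_ fun _ _ => rfl) (hpm.resolve_left two_ne_zero)
  ext k
  simp only [Finset.mem_filter, Finset.mem_univ, true_and]
  constructor
  · rintro ⟨c, hc⟩
    obtain ⟨h1, h2, -⟩ := hmem' k c 1 (by rw [hc, one_smul, add_comm])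
    exact ⟨h1, h2⟩
  · rintro ⟨hk, hkn⟩
    exact ⟨m k, by rw [← hnm k hk, hkn, one_smul, add_comm]⟩

theorem Ell.lie_t_t_of_dependent [P.IsReduced] {i k : ι}
    (h : ¬ LinearIndependent ℂ ![P.root i, P.root k]) : ⁅Ell.t b i, Ell.t b k⁆ = 0 := by
  rcases eq_or_eq_negIdx h with e | e
  · simp [e]
  · simp [e, Ell.t_negIdx]

/-- Linear functionals on the span of two independent roots are given by vectors. -/
theorem exists_root'_pair (i k : ι) (h : LinearIndependent ℂ ![P.root i, P.root k]) (a c : ℂ) :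
    ∃ w : 𝔥, P.root' i w = a ∧ P.root' k w = c := by
  rw [linearIndependent_iff_injective_fintypeLinearCombination] at h
  obtain ⟨g, hg⟩ := LinearMap.exists_leftInverse_of_injective _ (LinearMap.ker_eq_bot.2 h)
  obtain ⟨w, hw⟩ := (LinearMap.IsPerfPair.bijective_right P.toLinearMap).2
    ((Fintype.linearCombination ℂ ![a, c]).comp g)
  have key : ∀ v : Fin 2 → ℂ, P.toLinearMap (Fintype.linearCombination ℂ ![P.root i, P.root k] v) w
      = Fintype.linearCombination ℂ ![a, c] v := by
    intro v
    have h1 := congrArg (fun f => f (Fintype.linearCombination ℂ ![P.root i, P.root k] v)) hw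
    have h2 := congrArg (fun f => f v) hg
    simp only [LinearMap.comp_apply, LinearMap.id_apply, LinearMap.flip_apply] at h1 h2
    rw [h1, h2]
  refine ⟨w, ?_, ?_⟩
  · simpa [Fintype.linearCombination_apply] using key ![1, 0]
  · simpa [Fintype.linearCombination_apply] using key ![0, 1]

/-- `∑_k F_k [t_i, t_k] = 0` when `F` is constant on classes of roots modulo `ℤ α_i`. -/
theorem Ell.sum_apply_lie_t [P.IsRootSystem] [P.IsReduced] {V : Type*} [AddCommGroup V]
    [Module ℂ V] (i : ι) (F : ι → Ell b →ₗ[ℂ] V)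
    (hF : ∀ k k' (c : ℤ), LinearIndependent ℂ ![P.root i, P.root k] →
      P.root k' = P.root k + c • P.root i → F k' = F k) :
    ∑ k, F k ⁅Ell.t b i, Ell.t b k⁆ = 0 := by
  classical
  let S : Setoid ι :=
    { r := fun k k' => ∃ c : ℤ, P.root k' = P.root k + c • P.root i
      iseqv :=
        { refl := fun k => ⟨0, by simp⟩
          symm := fun {k k'} ⟨c, hc⟩ => ⟨-c, by rw [hc]; simp⟩
          trans := fun {k k' k''} ⟨c, hc⟩ ⟨d, hd⟩ =>
            ⟨c + d, by rw [hd, hc, add_smul, add_assoc]⟩ } }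
  rw [← Finset.sum_fiberwise Finset.univ (fun k => (Quotient.mk S k))]
  refine Finset.sum_eq_zero fun q _ => ?_
  obtain ⟨k₀, rfl⟩ := Quotient.exists_rep q
  have hfib : Finset.univ.filter (fun k => Quotient.mk S k = Quotient.mk S k₀) =
      Finset.univ.filter (fun k => ∃ c : ℤ, P.root k = P.root k₀ + c • P.root i) := by
    ext k
    simp only [Finset.mem_filter, Finset.mem_univ, true_and]
    rw [eq_comm, Quotient.eq]
    rfl
  rw [hfib]
  by_cases h : LinearIndependent ℂ ![P.root i, P.root k₀]
  · have h1 : ∀ k ∈ Finset.univ.filter (fun k => ∃ c : ℤ, P.root k = P.root k₀ + c • P.root i),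
        F k ⁅Ell.t b i, Ell.t b k⁆ = F k₀ ⁅Ell.t b i, Ell.t b k⁆ := by
      intro k hk
      obtain ⟨c, hc⟩ := (Finset.mem_filter.1 hk).2
      rw [hF k₀ k c h hc]
    rw [Finset.sum_congr rfl h1, ← map_sum, Ell.sum_lie_t_class i k₀ h, map_zero]
  · refine Finset.sum_eq_zero fun k hk => ?_
    obtain ⟨c, hc⟩ := (Finset.mem_filter.1 hk).2
    rw [Ell.lie_t_t_of_dependent, map_zero]
    refine fun hk => h ?_
    rw [LinearIndependent.pair_iff] at hk ⊢
    intro s t hst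
    obtain ⟨h1, h2⟩ := hk (s - t * c) t (by
      rw [hc, ← hst, ← Int.cast_smul_eq_zsmul ℂ, smul_add, sub_smul, smul_smul]
      abel)
    rw [h2] at h1
    exact ⟨by simpa using h1, h2⟩

end EllBasic

end EllipticKZB

end

noncomputable section

namespace EllipticKZB

/-! ### Tangent vectors of Lie algebras -/

/-- The Lie algebra `L ⊗ ℂ[ε]`, `ε² = 0`. -/
def Tang (L : Type*) : Type _ := L × L

namespace Tang

variable {L : Type*} [LieRing L] [LieAlgebra ℂ L]

instance : AddCommGroup (Tang L) := inferInstanceAs (AddCommGroup (L × L))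
instance : Module ℂ (Tang L) := inferInstanceAs (Module ℂ (L × L))

instance : Bracket (Tang L) (Tang L) := ⟨fun a c => (⁅a.1, c.1⁆, ⁅a.2, c.1⁆ + ⁅a.1, c.2⁆)⟩

theorem lie_def (a c : Tang L) : ⁅a, c⁆ = (⁅a.1, c.1⁆, ⁅a.2, c.1⁆ + ⁅a.1, c.2⁆) := rfl

theorem ext' {a c : Tang L} (h₁ : a.1 = c.1) (h₂ : a.2 = c.2) : a = c := Prod.ext h₁ h₂

instance : LieRing (Tang L) where
  add_lie a c e := by
    refine ext' (add_lie a.1 c.1 e.1) ?_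
    change ⁅a.2 + c.2, e.1⁆ + ⁅a.1 + c.1, e.2⁆ = (⁅a.2, e.1⁆ + ⁅a.1, e.2⁆) + (⁅c.2, e.1⁆ + ⁅c.1, e.2⁆)
    rw [add_lie, add_lie]
    abel
  lie_add a c e := by
    refine ext' (lie_add a.1 c.1 e.1) ?_
    change ⁅a.2, c.1 + e.1⁆ + ⁅a.1, c.2 + e.2⁆ = (⁅a.2, c.1⁆ + ⁅a.1, c.2⁆) + (⁅a.2, e.1⁆ + ⁅a.1, e.2⁆)
    rw [lie_add, lie_add]
    abel
  lie_self a := by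
    refine ext' (lie_self a.1) ?_
    change ⁅a.2, a.1⁆ + ⁅a.1, a.2⁆ = (0 : L)
    rw [← lie_skew a.2 a.1, neg_add_cancel]
  leibniz_lie a c e := by
    refine ext' (leibniz_lie a.1 c.1 e.1) ?_
    change ⁅a.2, ⁅c.1, e.1⁆⁆ + ⁅a.1, ⁅c.2, e.1⁆ + ⁅c.1, e.2⁆⁆ =
      (⁅⁅a.2, c.1⁆ + ⁅a.1, c.2⁆, e.1⁆ + ⁅⁅a.1, c.1⁆, e.2⁆) +
      (⁅c.2, ⁅a.1, e.1⁆⁆ + ⁅c.1, ⁅a.2, e.1⁆ + ⁅a.1, e.2⁆⁆)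
    rw [leibniz_lie a.2, lie_add, leibniz_lie a.1 c.2, leibniz_lie a.1 c.1 e.2, add_lie, lie_add]
    abel

instance : LieAlgebra ℂ (Tang L) where
  lie_smul c a e := by
    refine ext' (lie_smul c a.1 e.1) ?_
    change ⁅a.2, c • e.1⁆ + ⁅a.1, c • e.2⁆ = c • (⁅a.2, e.1⁆ + ⁅a.1, e.2⁆)
    rw [lie_smul, lie_smul, smul_add]

/-- The projection to the base point. -/
def fst : Tang L →ₗ⁅ℂ⁆ L where
  toLinearMap := LinearMap.fst ℂ L L
  map_lie' := rfl

/-- The tangent vector `a + ε c`. -/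
def mk (a c : L) : Tang L := (a, c)

/-- The projection to the tangent vector. -/
def snd : Tang L →ₗ[ℂ] L := LinearMap.snd ℂ L L

end Tang

section Derivations

variable {ι 𝔥 M : Type*} [Fintype ι] [AddCommGroup 𝔥] [Module ℂ 𝔥] [AddCommGroup M] [Module ℂ M]
variable {P : RootPairing ι ℂ M 𝔥} (b : P.Base)

theorem Ell.mk_surjective : Function.Surjective (Ell.mk b) :=
  LieSubmodule.Quotient.surjective_mk' (relIdeal b)

/-- The homomorphism to `Tang (Ell b)` with prescribed tangent vectors on generators. -/
def tangLift (D : Gen ι 𝔥 → Ell b) : FreeLieAlgebra ℂ (Gen ι 𝔥) →ₗ⁅ℂ⁆ Tang (Ell b) :=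
  FreeLieAlgebra.lift ℂ fun g => Tang.mk (Ell.mk b (FreeLieAlgebra.of ℂ g)) (D g)

/-- The derivation of the free Lie algebra with values in `𝔱_{ell,Φ}` which is prescribed on
generators. -/
def preDer (D : Gen ι 𝔥 → Ell b) : FreeLieAlgebra ℂ (Gen ι 𝔥) →ₗ[ℂ] Ell b :=
  Tang.snd.comp (tangLift b D : FreeLieAlgebra ℂ (Gen ι 𝔥) →ₗ[ℂ] Tang (Ell b))

variable {b}

theorem tangLift_fst (D : Gen ι 𝔥 → Ell b) (r : FreeLieAlgebra ℂ (Gen ι 𝔥)) :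
    (tangLift b D r).1 = Ell.mk b r := by
  have : Tang.fst.comp (tangLift b D) = Ell.mk b :=
    FreeLieAlgebra.hom_ext fun g => by
      rw [LieHom.comp_apply, tangLift, FreeLieAlgebra.lift_of_apply]
      rfl
  exact congrArg (fun f => f r) this

theorem preDer_of (D : Gen ι 𝔥 → Ell b) (g : Gen ι 𝔥) :
    preDer b D (FreeLieAlgebra.of ℂ g) = D g := by
  have : tangLift b D (FreeLieAlgebra.of ℂ g) = Tang.mk (Ell.mk b (FreeLieAlgebra.of ℂ g)) (D g) :=
    FreeLieAlgebra.lift_of_apply _ _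
  exact congrArg Prod.snd this

theorem preDer_lie (D : Gen ι 𝔥 → Ell b) (r s : FreeLieAlgebra ℂ (Gen ι 𝔥)) :
    preDer b D ⁅r, s⁆ = ⁅preDer b D r, Ell.mk b s⁆ + ⁅Ell.mk b r, preDer b D s⁆ := by
  have := congrArg Prod.snd (LieHom.map_lie (tangLift b D) r s)
  rw [Tang.lie_def, tangLift_fst, tangLift_fst] at this
  exact this

theorem preDer_relIdeal (D : Gen ι 𝔥 → Ell b) (h : ∀ r, Relator b r → preDer b D r = 0)
    {r : FreeLieAlgebra ℂ (Gen ι 𝔥)} (hr : r ∈ relIdeal b) : preDer b D r = 0 := by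
  have hle : relIdeal b ≤ (tangLift b D).ker := by
    refine LieSubmodule.lieSpan_le.2 fun r hr => ?_
    rw [SetLike.mem_coe, LieHom.mem_ker]
    refine Tang.ext' ?_ (h r hr)
    exact (tangLift_fst D r).trans (Ell.mk_relator b hr)
  exact congrArg Tang.snd ((LieHom.mem_ker).1 (hle hr))

/-- A derivation of the free Lie algebra killing the relators descends to `𝔱_{ell,Φ}`. -/
def derOf (D : Gen ι 𝔥 → Ell b) (h : ∀ r, Relator b r → preDer b D r = 0) :
    LieDerivation ℂ (Ell b) (Ell b) where
  toLinearMap := (relIdeal b).toSubmodule.liftQ (preDer b D) fun _ hr =>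
    LinearMap.mem_ker.2 (preDer_relIdeal D h hr)
  leibniz' a c := by
    obtain ⟨r, rfl⟩ := Ell.mk_surjective b a
    obtain ⟨s, rfl⟩ := Ell.mk_surjective b c
    rw [← LieHom.map_lie]
    refine (preDer_lie D r s).trans ?_
    rw [← lie_skew, neg_add_eq_sub]
    rfl

theorem Ell.lieSpan_generators :
    LieSubalgebra.lieSpan ℂ (Ell b)
      (Set.range (Ell.x b) ∪ Set.range (Ell.y b) ∪ Set.range (Ell.t b)) = ⊤ := by
  rw [eq_top_iff]
  set K := LieSubalgebra.lieSpan ℂ (Ell b)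
    (Set.range (Ell.x b) ∪ Set.range (Ell.y b) ∪ Set.range (Ell.t b)) with hK
  have hg : ∀ g : Gen ι 𝔥, Ell.mk b (FreeLieAlgebra.of ℂ g) ∈ K := by
    intro g
    refine LieSubalgebra.subset_lieSpan ?_
    cases g with
    | x u => exact Or.inl (Or.inl ⟨u, rfl⟩)
    | y u => exact Or.inl (Or.inr ⟨u, rfl⟩)
    | t i => exact Or.inr ⟨i, rfl⟩
  have : K.incl.comp (FreeLieAlgebra.lift ℂ fun g => (⟨_, hg g⟩ : K)) = Ell.mk b :=
    FreeLieAlgebra.hom_ext fun g => by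
      rw [LieHom.comp_apply, FreeLieAlgebra.lift_of_apply]
      rfl
  intro a _
  obtain ⟨r, rfl⟩ := Ell.mk_surjective b a
  rw [← this]
  exact Subtype.property _

theorem Ell.induction {p : Ell b → Prop} (a : Ell b) (x : ∀ u, p (Ell.x b u))
    (y : ∀ u, p (Ell.y b u)) (t : ∀ i, p (Ell.t b i)) (zero : p 0)
    (add : ∀ a c, p a → p c → p (a + c)) (smul : ∀ (r : ℂ) a, p a → p (r • a))
    (lie : ∀ a c, p a → p c → p ⁅a, c⁆) : p a := by
  have ha : a ∈ LieSubalgebra.lieSpan ℂ (Ell b)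
      (Set.range (Ell.x b) ∪ Set.range (Ell.y b) ∪ Set.range (Ell.t b)) := by
    rw [Ell.lieSpan_generators]
    trivial
  induction ha using LieSubalgebra.lieSpan_induction with
  | mem a h =>
    rcases h with (⟨u, rfl⟩ | ⟨u, rfl⟩) | ⟨i, rfl⟩
    · exact x u
    · exact y u
    · exact t i
  | zero => exact zero
  | add a c _ _ h1 h2 => exact add a c h1 h2
  | smul r a _ h => exact smul r a h
  | lie a c _ _ h1 h2 => exact lie a c h1 h2

theorem Ell.der_ext {D₁ D₂ : LieDerivation ℂ (Ell b) (Ell b)}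
    (x : ∀ u, D₁ (Ell.x b u) = D₂ (Ell.x b u)) (y : ∀ u, D₁ (Ell.y b u) = D₂ (Ell.y b u))
    (t : ∀ i, D₁ (Ell.t b i) = D₂ (Ell.t b i)) : D₁ = D₂ := by
  refine LieDerivation.ext_of_lieSpan_eq_top _ Ell.lieSpan_generators ?_
  rintro a ((⟨u, rfl⟩ | ⟨u, rfl⟩) | ⟨i, rfl⟩)
  · exact x u
  · exact y u
  · exact t i

/-- Values on generators, linear in `𝔥`. -/
def genData (X Y : 𝔥 →ₗ[ℂ] Ell b) (T : ι → Ell b) : Gen ι 𝔥 → Ell b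
  | .x u => X u
  | .y u => Y u
  | .t i => T i

section

variable (X Y : 𝔥 →ₗ[ℂ] Ell b) (T : ι → Ell b)

theorem preDer_fx (u : 𝔥) : preDer b (genData X Y T) (fx ι u) = X u := preDer_of _ _

theorem preDer_fy (u : 𝔥) : preDer b (genData X Y T) (fy ι u) = Y u := preDer_of _ _

theorem preDer_ft (i : ι) : preDer b (genData X Y T) (ft 𝔥 i) = T i := preDer_of _ _

theorem preDer_relator (t_neg : ∀ i, T (negIdx P i) = T i)
    (tt : ∀ Ψ : Set ι, IsSubsystem P Ψ → ∀ i ∈ Ψ,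
      ⁅T i, ∑ j ∈ posRootsOf b Ψ, Ell.t b j⁆ + ⁅Ell.t b i, ∑ j ∈ posRootsOf b Ψ, T j⁆ = 0)
    (xx : ∀ u v, ⁅X u, Ell.x b v⁆ + ⁅Ell.x b u, X v⁆ = 0)
    (yy : ∀ u v, ⁅Y u, Ell.y b v⁆ + ⁅Ell.y b u, Y v⁆ = 0)
    (yx : ∀ u v, ⁅Y u, Ell.x b v⁆ + ⁅Ell.y b u, X v⁆ =
      ∑ i ∈ posRoots b, (P.root' i v * P.root' i u) • T i)
    (tx : ∀ i u, P.root' i u = 0 → ⁅T i, Ell.x b u⁆ + ⁅Ell.t b i, X u⁆ = 0)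
    (ty : ∀ i u, P.root' i u = 0 → ⁅T i, Ell.y b u⁆ + ⁅Ell.t b i, Y u⁆ = 0)
    (r : FreeLieAlgebra ℂ (Gen ι 𝔥)) (hr : Relator b r) : preDer b (genData X Y T) r = 0 := by
  cases hr with
  | x_add u v => simp [preDer_fx]
  | x_smul c u => simp [preDer_fx]
  | y_add u v => simp [preDer_fy]
  | y_smul c u => simp [preDer_fy]
  | t_neg i j h =>
    have : j = negIdx P i := root_injective (P := P) (by simp [h])
    simp [preDer_ft, this, t_neg]
  | tt Ψ hΨ i hi =>
    rw [preDer_lie, map_sum, map_sum, preDer_ft]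
    simp only [preDer_ft]
    exact tt Ψ hΨ i hi
  | xx u v =>
    rw [preDer_lie, preDer_fx, preDer_fx]
    exact xx u v
  | yy u v =>
    rw [preDer_lie, preDer_fy, preDer_fy]
    exact yy u v
  | yx u v =>
    rw [map_sub, preDer_lie, preDer_fx, preDer_fy, map_sum, sub_eq_zero]
    simp only [map_smul, preDer_ft]
    exact yx u v
  | tx i u h =>
    rw [preDer_lie, preDer_fx, preDer_ft]
    exact tx i u h
  | ty i u h =>
    rw [preDer_lie, preDer_fy, preDer_ft]
    exact ty i u h

end

/-! ### The action of `𝔰𝔩₂` -/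

variable (b)

theorem genData_d_relator (r : FreeLieAlgebra ℂ (Gen ι 𝔥)) (hr : Relator b r) :
    preDer b (genData (Ell.x b) (-Ell.y b) 0) r = 0 := by
  refine preDer_relator _ _ _ ?_ ?_ ?_ ?_ ?_ ?_ ?_ r hr
  · simp
  · simp
  · simp [Ell.lie_x_x]
  · simp [Ell.lie_y_y]
  · intro u v
    rw [LinearMap.neg_apply, neg_lie, neg_add_cancel]
    simp
  · intro i u h
    simp [Ell.lie_t_x_of_eq_zero i u h]
  · intro i u h
    simp [Ell.lie_t_y_of_eq_zero i u h]

theorem genData_X_relator (r : FreeLieAlgebra ℂ (Gen ι 𝔥)) (hr : Relator b r) :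
    preDer b (genData 0 (Ell.x b) 0) r = 0 := by
  refine preDer_relator _ _ _ ?_ ?_ ?_ ?_ ?_ ?_ ?_ r hr
  · simp
  · simp
  · simp
  · intro u v
    rw [← lie_skew, Ell.lie_y_x_pos, Ell.lie_y_x_pos, neg_add_eq_zero]
    exact Finset.sum_congr rfl fun i _ => by rw [mul_comm]
  · intro u v
    simp [Ell.lie_x_x]
  · simp
  · intro i u h
    simp [Ell.lie_t_x_of_eq_zero i u h]

theorem genData_Δ₀_relator (r : FreeLieAlgebra ℂ (Gen ι 𝔥)) (hr : Relator b r) :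
    preDer b (genData (Ell.y b) 0 0) r = 0 := by
  refine preDer_relator _ _ _ ?_ ?_ ?_ ?_ ?_ ?_ ?_ r hr
  · simp
  · simp
  · intro u v
    rw [← lie_skew (Ell.x b u), Ell.lie_y_x_pos, Ell.lie_y_x_pos, ← sub_eq_add_neg, sub_eq_zero]
    exact Finset.sum_congr rfl fun i _ => by rw [mul_comm]
  · simp
  · simp [Ell.lie_y_y]
  · intro i u h
    simp [Ell.lie_t_y_of_eq_zero i u h]
  · simp

/-- The derivation `d̃`. -/
def derD : LieDerivation ℂ (Ell b) (Ell b) := derOf _ (genData_d_relator b)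

/-- The derivation `X̃`. -/
def derX : LieDerivation ℂ (Ell b) (Ell b) := derOf _ (genData_X_relator b)

/-- The derivation `Δ̃₀`. -/
def derΔ : LieDerivation ℂ (Ell b) (Ell b) := derOf _ (genData_Δ₀_relator b)

variable {b}

@[simp] theorem derD_x (u : 𝔥) : derD b (Ell.x b u) = Ell.x b u := preDer_fx _ _ _ u
@[simp] theorem derD_y (u : 𝔥) : derD b (Ell.y b u) = -Ell.y b u := preDer_fy _ _ _ u
@[simp] theorem derD_t (i : ι) : derD b (Ell.t b i) = 0 := preDer_ft _ _ _ i
@[simp] theorem derX_x (u : 𝔥) : derX b (Ell.x b u) = 0 := preDer_fx _ _ _ u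
@[simp] theorem derX_y (u : 𝔥) : derX b (Ell.y b u) = Ell.x b u := preDer_fy _ _ _ u
@[simp] theorem derX_t (i : ι) : derX b (Ell.t b i) = 0 := preDer_ft _ _ _ i
@[simp] theorem derΔ_x (u : 𝔥) : derΔ b (Ell.x b u) = Ell.y b u := preDer_fx _ _ _ u
@[simp] theorem derΔ_y (u : 𝔥) : derΔ b (Ell.y b u) = 0 := preDer_fy _ _ _ u
@[simp] theorem derΔ_t (i : ι) : derΔ b (Ell.t b i) = 0 := preDer_ft _ _ _ i

theorem derD_tx (i : ι) (p : ℕ) : derD b (Ell.tx b i p) = (p : ℂ) • Ell.tx b i p := by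
  induction p with
  | zero => simp [adPow_zero]
  | succ p ih =>
    rw [Ell.tx_succ, map_smul, LieDerivation.apply_lie_eq_add, ih, derD_x, lie_smul, smul_comm]
    push_cast
    rw [add_smul, one_smul, add_comm]

theorem derX_tx (i : ι) (p : ℕ) : derX b (Ell.tx b i p) = 0 := by
  induction p with
  | zero => simp [adPow_zero]
  | succ p ih =>
    rw [Ell.tx_succ, map_smul, LieDerivation.apply_lie_eq_add, ih, derX_x]
    simp

theorem lie_derD_derX : ⁅derD b, derX b⁆ = (2 : ℂ) • derX b :=
  Ell.der_ext (by intro u; simp) (by intro u; simp [two_smul]) (by intro i; simp)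

theorem lie_derD_derΔ : ⁅derD b, derΔ b⁆ = -((2 : ℂ) • derΔ b) :=
  Ell.der_ext (by intro u; simp [two_smul]; abel) (by intro u; simp) (by intro i; simp)

theorem lie_derX_derΔ : ⁅derX b, derΔ b⁆ = derD b :=
  Ell.der_ext (by intro u; simp) (by intro u; simp) (by intro i; simp)

theorem derΔ_locally_nilpotent (a : Ell b) : ∃ n, (derΔ b)^[n] a = 0 := by
  have mono : ∀ {a : Ell b} {n k : ℕ}, n ≤ k → (derΔ b)^[n] a = 0 → (derΔ b)^[k] a = 0 := by
    intro a n k hnk h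
    obtain ⟨j, rfl⟩ := Nat.exists_eq_add_of_le hnk
    rw [add_comm, Function.iterate_add_apply, h]
    exact iterate_map_zero _ _
  refine Ell.induction (p := fun a => ∃ n, (derΔ b)^[n] a = 0) a (fun u => ⟨2, by simp⟩)
    (fun u => ⟨1, by simp⟩) (fun i => ⟨1, by simp⟩) ⟨0, rfl⟩ ?_ ?_ ?_
  · rintro a c ⟨n, hn⟩ ⟨k, hk⟩
    refine ⟨n + k, ?_⟩
    rw [iterate_map_add, mono (Nat.le_add_right _ _) hn, mono (Nat.le_add_left _ _) hk, add_zero]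
  · rintro r a ⟨n, hn⟩
    refine ⟨n, ?_⟩
    have := Module.End.pow_apply (derΔ b : Ell b →ₗ[ℂ] Ell b) n
    exact (this (r • a)).symm.trans (by rw [map_smul, this]; exact (congrArg (r • ·) hn).trans (smul_zero r))
  · rintro a c ⟨n, hn⟩ ⟨k, hk⟩
    refine ⟨n + k, ?_⟩
    rw [LieDerivation.iterate_apply_lie]
    refine Finset.sum_eq_zero fun ij hij => ?_
    rw [Finset.HasAntidiagonal.mem_antidiagonal] at hij
    rcases le_or_gt n ij.1 with h | h
    · rw [mono h hn, zero_lie, smul_zero]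
    · rw [mono (show k ≤ ij.2 by omega) hk, lie_zero, smul_zero]

/-- The action of the raising operator on the strings of lowering operators. -/
theorem sl2_raise {V : Type*} [AddCommGroup V] [Module ℂ V] {E F H : V → V}
    (hF : ∀ (c : ℂ) v, F (c • v) = c • F v)
    (hEF : ∀ v, E (F v) = F (E v) + H v) (hHF : ∀ v, H (F v) = F (H v) - (2 : ℂ) • F v)
    {v : V} {μ : ℂ} (hv : E v = 0) (hμ : H v = μ • v) (j : ℕ) :
    E (F^[j + 1] v) = (((j : ℂ) + 1) * (μ - j)) • F^[j] v := by
  have hH : ∀ j : ℕ, H (F^[j] v) = (μ - 2 * j) • F^[j] v := by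
    intro j
    induction j with
    | zero => simp [hμ]
    | succ j ih =>
      rw [Function.iterate_succ_apply', hHF, ih, hF, ← sub_smul]
      congr 1
      push_cast
      ring
  have F0 : F 0 = 0 := by simpa using hF 0 0
  induction j with
  | zero =>
    rw [zero_add, Function.iterate_one, hEF, hv, hμ, F0]
    simp
  | succ j ih =>
    rw [Function.iterate_succ_apply', hEF, ih, hH, hF, ← Function.iterate_succ_apply' F, ← add_smul]
    congr 1
    push_cast
    ring

theorem sl2_lowest_eq_zero {a : Ell b} {μ : ℂ} (hX : derX b a = 0) (hd : derD b a = μ • a)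
    (hμ : ∀ j : ℕ, μ ≠ j) : a = 0 := by
  have key := fun j => sl2_raise (E := derX b) (F := derΔ b) (H := derD b)
    (by simp)
    (fun v => by
      have := LieDerivation.congr_fun (lie_derX_derΔ (b := b)) v
      rw [LieDerivation.lie_apply, sub_eq_iff_eq_add'] at this
      exact this)
    (fun v => by
      have := LieDerivation.congr_fun (lie_derD_derΔ (b := b)) v
      rw [LieDerivation.lie_apply, sub_eq_iff_eq_add'] at this
      rw [this]
      simp [sub_eq_add_neg]) hX hd j
  obtain ⟨n, hn⟩ := derΔ_locally_nilpotent a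
  induction n with
  | zero => exact hn
  | succ n ih =>
    apply ih
    have h := key n
    rw [hn, map_zero, eq_comm, smul_eq_zero] at h
    refine h.resolve_left (mul_ne_zero (by exact_mod_cast n.succ_ne_zero) (sub_ne_zero.2 (hμ n)))

theorem ad_derΔ_pow_eq_zero {δ : LieDerivation ℂ (Ell b) (Ell b)} {m : ℕ}
    (hX : ⁅δ, derX b⁆ = 0) (hd : ⁅derD b, δ⁆ = (m : ℂ) • δ) :
    ((LieAlgebra.ad ℂ (LieDerivation ℂ (Ell b) (Ell b)) (derΔ b)) ^ (m + 1)) δ = 0 := by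
  set η := ((LieAlgebra.ad ℂ (LieDerivation ℂ (Ell b) (Ell b)) (derΔ b)) ^ (m + 1)) δ with hη
  have hη' : η = (fun v : LieDerivation ℂ (Ell b) (Ell b) => ⁅derΔ b, v⁆)^[m + 1] δ := by
    rw [hη, Module.End.pow_apply]
    rfl
  have hdF : ∀ v : LieDerivation ℂ (Ell b) (Ell b), ⁅derD b, ⁅derΔ b, v⁆⁆ = ⁅derΔ b, ⁅derD b, v⁆⁆ - (2 : ℂ) • ⁅derΔ b, v⁆ := by
    intro v
    rw [leibniz_lie, lie_derD_derΔ, neg_lie, smul_lie]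
    abel
  have hXη : ⁅derX b, η⁆ = 0 := by
    have := sl2_raise (E := fun v : LieDerivation ℂ (Ell b) (Ell b) => ⁅derX b, v⁆) (F := fun v : LieDerivation ℂ (Ell b) (Ell b) => ⁅derΔ b, v⁆)
      (H := fun v : LieDerivation ℂ (Ell b) (Ell b) => ⁅derD b, v⁆) (by simp)
      (fun v => by
        rw [leibniz_lie, lie_derX_derΔ, add_comm]) hdF (v := δ)
      (by rw [← lie_skew, hX, neg_zero]) hd m
    rw [← hη'] at this
    simpa using this
  have hdη : ⁅derD b, η⁆ = ((m : ℂ) - 2 * (m + 1)) • η := by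
    have : ∀ j : ℕ, ⁅derD b, (fun v : LieDerivation ℂ (Ell b) (Ell b) => ⁅derΔ b, v⁆)^[j] δ⁆ =
        ((m : ℂ) - 2 * j) • (fun v : LieDerivation ℂ (Ell b) (Ell b) => ⁅derΔ b, v⁆)^[j] δ := by
      intro j
      induction j with
      | zero => simp [hd]
      | succ j ih =>
        rw [Function.iterate_succ_apply', hdF, ih, lie_smul, ← sub_smul]
        congr 1
        push_cast
        ring
    rw [hη', this]
    push_cast
    rfl
  have hXη' : ∀ a, derX b (η a) = η (derX b a) := by
    intro a
    have := LieDerivation.congr_fun hXη a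
    rwa [LieDerivation.lie_apply, LieDerivation.zero_apply, sub_eq_zero] at this
  have hdη' : ∀ a, derD b (η a) = η (derD b a) + ((m : ℂ) - 2 * (m + 1)) • η a := by
    intro a
    have := LieDerivation.congr_fun hdη a
    rwa [LieDerivation.lie_apply, LieDerivation.smul_apply, sub_eq_iff_eq_add'] at this
  have hne : ∀ (k : ℤ), k ≤ 1 → ∀ j : ℕ, (k : ℂ) + ((m : ℂ) - 2 * (m + 1)) ≠ j := by
    intro k hk j h
    have : k + ((m : ℤ) - 2 * (m + 1)) = j := by exact_mod_cast h
    omega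
  have hx : ∀ u, η (Ell.x b u) = 0 := by
    intro u
    refine sl2_lowest_eq_zero (μ := ((1 : ℤ) : ℂ) + ((m : ℂ) - 2 * (m + 1))) ?_ ?_ (hne 1 le_rfl)
    · simp [hXη']
    · rw [hdη', derD_x, add_smul]
      simp
  refine Ell.der_ext hx (fun u => ?_) (fun i => ?_)
  · refine sl2_lowest_eq_zero (μ := ((-1 : ℤ) : ℂ) + ((m : ℂ) - 2 * (m + 1))) ?_ ?_
      (hne (-1) (by norm_num))
    · simp [hXη', hx]
    · rw [hdη', derD_y, add_smul]
      simp
  · refine sl2_lowest_eq_zero (μ := ((0 : ℤ) : ℂ) + ((m : ℂ) - 2 * (m + 1))) ?_ ?_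
      (hne 0 (by norm_num))
    · simp [hXη']
    · rw [hdη', derD_t, add_smul]
      simp

/-! ### The derivations `δ̃_{2m}` -/

variable (b)

/-- The value of `δ̃_{2m}` on `t_α`. -/
def deltaT (m : ℕ) (i : ι) : Ell b := ⁅Ell.t b i, Ell.tx b i (2 * m)⁆

/-- The contribution of the root `α` to the value of `δ̃_{2m}` on `y`. -/
def deltaYTerm (m : ℕ) (i : ι) : Ell b :=
  ∑ pq ∈ Finset.HasAntidiagonal.antidiagonal (2 * m - 1), ⁅adPow b 1 i pq.1, adPow b (-1) i pq.2⁆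

/-- The value of `δ̃_{2m}` on `y(u)`. -/
def deltaY (m : ℕ) : 𝔥 →ₗ[ℂ] Ell b :=
  (1 / 2 : ℂ) • ∑ i ∈ posRoots b, (P.root' i).smulRight (deltaYTerm b m i)

variable {b}

theorem deltaYTerm_eq (m : ℕ) (i : ι) : deltaYTerm b m i =
    ∑ pq ∈ Finset.HasAntidiagonal.antidiagonal (2 * m - 1),
      (-1 : ℂ) ^ pq.2 • ⁅Ell.tx b i pq.1, Ell.tx b i pq.2⁆ :=
  Finset.sum_congr rfl fun pq _ => by rw [adPow_eq (-1), lie_smul]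

theorem deltaYTerm_negIdx {m : ℕ} (hm : 0 < m) (i : ι) :
    deltaYTerm b m (negIdx P i) = -deltaYTerm b m i := by
  rw [deltaYTerm_eq, deltaYTerm_eq, ← Finset.sum_neg_distrib]
  refine Finset.sum_congr rfl fun pq hpq => ?_
  rw [Finset.HasAntidiagonal.mem_antidiagonal] at hpq
  have hodd : Odd (2 * m - 1) := ⟨m - 1, by omega⟩
  rw [Ell.tx_negIdx, Ell.tx_negIdx, smul_lie, lie_smul, smul_smul (_ ^ pq.1), ← pow_add, hpq,
    hodd.neg_one_pow, neg_smul, one_smul, smul_neg]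

theorem deltaY_apply (m : ℕ) (u : 𝔥) : deltaY b m u =
    (1 / 2 : ℂ) • ∑ i ∈ posRoots b, P.root' i u • deltaYTerm b m i := by
  simp [deltaY]

theorem deltaT_negIdx (m : ℕ) (i : ι) : deltaT b m (negIdx P i) = deltaT b m i := by
  rw [deltaT, Ell.tx_negIdx, Ell.t_negIdx, deltaT]
  simp

theorem Ell.lie_x_deltaYTerm {m : ℕ} (hm : 0 < m) (i : ι) (v : 𝔥) :
    ⁅deltaYTerm b m i, Ell.x b v⁆ = (2 * P.root' i v) • deltaT b m i := by
  have tel : ∀ (N : ℕ) (A : ℕ → ℕ → Ell b),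
      ∑ pq ∈ Finset.HasAntidiagonal.antidiagonal N,
        (-1 : ℂ) ^ pq.2 • (A (pq.1 + 1) pq.2 + A pq.1 (pq.2 + 1)) =
      A (N + 1) 0 - (-1 : ℂ) ^ (N + 1) • A 0 (N + 1) := by
    intro N A
    have h1 := Finset.Nat.sum_antidiagonal_succ (n := N) (f := fun pq => (-1 : ℂ) ^ pq.2 • A pq.1 pq.2)
    have h2 := Finset.Nat.sum_antidiagonal_succ' (n := N) (f := fun pq => (-1 : ℂ) ^ pq.2 • A pq.1 pq.2)
    rw [h1] at h2
    simp only [pow_zero, one_smul, pow_succ, mul_neg, mul_one, neg_smul, Finset.sum_neg_distrib]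
      at h2
    simp only [smul_add, Finset.sum_add_distrib, pow_succ, mul_neg, mul_one, neg_smul]
    rw [← sub_eq_zero] at h2 ⊢
    rw [← h2]
    abel
  have h := tel (2 * m - 1) fun p q => ⁅Ell.tx b i p, Ell.tx b i q⁆
  rw [deltaYTerm_eq, ← lie_skew, lie_sum]
  have e : ∀ pq : ℕ × ℕ, ⁅Ell.x b v, (-1 : ℂ) ^ pq.2 • ⁅Ell.tx b i pq.1, Ell.tx b i pq.2⁆⁆ =
      P.root' i v • ((-1 : ℂ) ^ pq.2 • (⁅Ell.tx b i (pq.1 + 1), Ell.tx b i pq.2⁆ +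
        ⁅Ell.tx b i pq.1, Ell.tx b i (pq.2 + 1)⁆)) := by
    intro pq
    rw [lie_smul, leibniz_lie, Ell.lie_x_tx, Ell.lie_x_tx, smul_lie, lie_smul, ← smul_add, smul_comm]
  simp only [e]
  rw [← Finset.smul_sum, h, show 2 * m - 1 + 1 = 2 * m by omega, (even_two_mul m).neg_one_pow, one_smul,
    ← lie_skew (Ell.tx b i (2 * m)), Ell.tx_zero, deltaT]
  module

variable [P.IsRootSystem] [P.IsReduced]

/-- `[t_β, ∑_γ (ad x_γ)^n t_γ] = 2 [t_β, (ad x_β)^n t_β]` for `n` even. -/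
theorem Ell.sum_lie_t_tx (i : ι) {n : ℕ} (hn : Even n) :
    ∑ k, ⁅Ell.t b i, Ell.tx b k n⁆ = (2 : ℂ) • ⁅Ell.t b i, Ell.tx b i n⁆ := by
  classical
  set w : ι → 𝔥 := fun k => Classical.epsilon fun w => P.root' i w = 0 ∧ P.root' k w = 1 with hw
  have hwspec : ∀ k, LinearIndependent ℂ ![P.root i, P.root k] →
      P.root' i (w k) = 0 ∧ P.root' k (w k) = 1 :=
    fun k hk => Classical.epsilon_spec (exists_root'_pair i k hk 0 1)
  have h0 := Ell.sum_apply_lie_t (b := b) i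
    (fun k => (LieAlgebra.ad ℂ (Ell b) (Ell.x b (w k))) ^ n) (by
      intro k k' c _ e
      have : w k' = w k := by
        simp only [hw]
        congr 1
        funext u
        have : P.root' k' u = P.root' k u + c * P.root' i u := by
          rw [root'_eq, e, map_add, map_zsmul, LinearMap.add_apply, LinearMap.smul_apply]
          simp [root'_eq]
        rw [this]
        by_cases h : P.root' i u = 0 <;> simp [h]
      rw [this])
  have key : ∀ k, ⁅Ell.t b i, Ell.tx b k n⁆ =
      ((LieAlgebra.ad ℂ (Ell b) (Ell.x b (w k))) ^ n) ⁅Ell.t b i, Ell.t b k⁆ +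
      ((if k = i then ⁅Ell.t b i, Ell.tx b i n⁆ else 0) +
      (if k = negIdx P i then ⁅Ell.t b i, Ell.tx b i n⁆ else 0)) := by
    intro k
    by_cases hk : LinearIndependent ℂ ![P.root i, P.root k]
    · obtain ⟨h1, h2⟩ := hwspec k hk
      rw [if_neg, if_neg, add_zero, add_zero]
      · clear h0 hn
        induction n with
        | zero => simp [adPow_zero]
        | succ n ih =>
          rw [pow_succ', Module.End.mul_apply, ← ih, LieAlgebra.ad_apply, leibniz_lie,
            Ell.lie_x_tx, h2, one_smul, ← lie_skew (Ell.x b (w k)) (Ell.t b i),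
            Ell.lie_t_x_of_eq_zero i _ h1]
          simp
      · rintro rfl
        rw [LinearIndependent.pair_iff] at hk
        simpa using hk 1 1 (by simp)
      · rintro rfl
        rw [LinearIndependent.pair_iff] at hk
        simpa using hk 1 (-1) (by simp)
    · rw [Ell.lie_t_t_of_dependent hk, map_zero, zero_add]
      rcases eq_or_eq_negIdx hk with e | e
      · subst e
        rw [if_pos rfl, if_neg (negIdx_ne k).symm, add_zero]
      · subst e
        rw [if_pos rfl, if_neg (negIdx_ne i), zero_add, Ell.tx_negIdx, hn.neg_one_pow, one_smul]
  rw [Finset.sum_congr rfl fun k _ => key k, Finset.sum_add_distrib, h0, Finset.sum_add_distrib, Finset.sum_ite_eq' Finset.univ i,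
    Finset.sum_ite_eq' Finset.univ (negIdx P i), if_pos (Finset.mem_univ _),
    if_pos (Finset.mem_univ _), zero_add, two_smul]

theorem preDer_delta_relator {m : ℕ} (hm : 0 < m)
    (yy : ∀ u v, ⁅deltaY b m u, Ell.y b v⁆ + ⁅Ell.y b u, deltaY b m v⁆ = 0)
    (ty : ∀ i u, P.root' i u = 0 → ⁅deltaT b m i, Ell.y b u⁆ + ⁅Ell.t b i, deltaY b m u⁆ = 0)
    (r : FreeLieAlgebra ℂ (Gen ι 𝔥)) (hr : Relator b r) :
    preDer b (genData 0 (deltaY b m) (deltaT b m)) r = 0 := by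
  refine preDer_relator _ _ _ (deltaT_negIdx m) ?_ ?_ yy ?_ ?_ ty r hr
  · intro Ψ hΨ i hi
    have hT : ∀ i, deltaT b m i = -⁅(1 / 2 : ℂ) • ∑ k, Ell.tx b k (2 * m), Ell.t b i⁆ := by
      intro i
      rw [lie_skew, lie_smul, lie_sum, Ell.sum_lie_t_tx i (even_two_mul m), smul_smul]
      norm_num
      rfl
    have h1 := Ell.mk_relator b (Relator.tt Ψ hΨ i hi)
    rw [LieHom.map_lie, map_sum] at h1
    have h2 : ⁅Ell.t b i, ∑ j ∈ posRootsOf b Ψ, Ell.t b j⁆ = 0 := h1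
    simp only [hT]
    rw [Finset.sum_neg_distrib, ← lie_sum, neg_lie, lie_neg, ← neg_add, ← leibniz_lie, h2, lie_zero,
      neg_zero]
  · simp
  · intro u v
    rw [deltaY_apply, smul_lie, sum_lie]
    simp only [LinearMap.zero_apply, lie_zero, add_zero, smul_lie, Ell.lie_x_deltaYTerm hm,
      Finset.smul_sum, smul_smul]
    refine Finset.sum_congr rfl fun i _ => ?_
    congr 1
    ring
  · intro i u h
    rw [LinearMap.zero_apply, lie_zero, add_zero, ← lie_skew, deltaT, leibniz_lie, Ell.lie_x_tx, h,
      ← lie_skew (Ell.x b u) (Ell.t b i), Ell.lie_t_x_of_eq_zero i u h]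
    simp

/-! ### The action of `𝔡` -/

/-- The derivations `d̃`, `X̃`, `Δ̃₀` and `δ̃_{2m}` define an action of `𝔡`. -/
theorem exists_isAction
    (yy : ∀ m : ℕ, 0 < m → ∀ u v, ⁅deltaY b m u, Ell.y b v⁆ + ⁅Ell.y b u, deltaY b m v⁆ = 0)
    (ty : ∀ m : ℕ, 0 < m → ∀ i u, P.root' i u = 0 →
      ⁅deltaT b m i, Ell.y b u⁆ + ⁅Ell.t b i, deltaY b m u⁆ = 0) :
    ∃ ρ : Der →ₗ⁅ℂ⁆ LieDerivation ℂ (Ell b) (Ell b), IsAction b ρ := by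
  set δ : ℕ+ → LieDerivation ℂ (Ell b) (Ell b) := fun m =>
    derOf _ (preDer_delta_relator m.pos (yy m m.pos) (ty m m.pos)) with hδ
  have δx : ∀ m u, δ m (Ell.x b u) = 0 := fun m u => preDer_fx _ _ _ u
  have δy : ∀ m u, δ m (Ell.y b u) = deltaY b m u := fun m u => preDer_fy _ _ _ u
  have δt : ∀ m i, δ m (Ell.t b i) = deltaT b m i := fun m i => preDer_ft _ _ _ i
  have δX : ∀ m, ⁅δ m, derX b⁆ = 0 := by
    intro m
    refine Ell.der_ext ?_ ?_ ?_
    · intro u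
      simp [δx]
    · intro u
      simp only [LieDerivation.lie_apply, derX_y, δx, δy, deltaY_apply, deltaYTerm_eq, map_smul,
        map_sum, LieDerivation.apply_lie_eq_add, derX_tx]
      simp
    · intro i
      simp only [LieDerivation.lie_apply, derX_t, δt, deltaT, LieDerivation.apply_lie_eq_add,
        derX_tx]
      simp
  have dδ : ∀ m : ℕ+, ⁅derD b, δ m⁆ = ((2 * (m : ℕ) : ℕ) : ℂ) • δ m := by
    intro m
    refine Ell.der_ext ?_ ?_ ?_
    · intro u
      simp [δx]
    · intro u
      have : derD b (deltaY b m u) = ((2 * (m : ℕ) : ℕ) - 1 : ℂ) • deltaY b m u := by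
        rw [deltaY_apply, map_smul, smul_comm _ (1 / 2 : ℂ), map_sum]
        congr 1
        rw [Finset.smul_sum]
        apply Finset.sum_congr rfl
        intro i _
        rw [map_smul, smul_comm _ (P.root' i u), deltaYTerm_eq, map_sum]
        congr 1
        rw [Finset.smul_sum]
        apply Finset.sum_congr rfl
        intro pq hpq
        rw [map_smul, smul_comm _ ((-1 : ℂ) ^ pq.2), LieDerivation.apply_lie_eq_add, derD_tx, derD_tx, lie_smul,
          smul_lie, ← add_smul]
        congr 2
        rw [Finset.HasAntidiagonal.mem_antidiagonal] at hpq
        have h2 : 2 * (m : ℕ) = pq.1 + pq.2 + 1 := by have := m.pos; omega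
        rw [h2]
        push_cast
        ring
      simp only [LieDerivation.lie_apply, derD_y, map_neg, δy, this, LieDerivation.smul_apply]
      rw [sub_smul, one_smul]
      abel
    · intro i
      simp only [LieDerivation.lie_apply, derD_t, δt, deltaT, LieDerivation.apply_lie_eq_add,
        derD_tx, LieDerivation.smul_apply]
      simp
  set D : DGen → LieDerivation ℂ (Ell b) (Ell b) := fun g => match g with
    | .Δ₀ => derΔ b
    | .d => derD b
    | .X => derX b
    | .δ m => δ m with hD
  set φ := FreeLieAlgebra.lift ℂ D with hφ
  have φof : ∀ g, φ (dfr g) = D g := fun g => FreeLieAlgebra.lift_of_apply _ _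
  have hker : dRelIdeal ≤ φ.ker := by
    refine LieSubmodule.lieSpan_le.2 fun r hr => ?_
    rw [SetLike.mem_coe, LieHom.mem_ker]
    cases hr with
    | d_X =>
      rw [map_sub, LieHom.map_lie, map_smul, φof, φof, sub_eq_zero]
      exact lie_derD_derX
    | d_Δ₀ =>
      rw [map_add, LieHom.map_lie, map_smul, φof, φof, add_eq_zero_iff_eq_neg]
      exact lie_derD_derΔ
    | X_Δ₀ =>
      rw [map_sub, LieHom.map_lie, φof, φof, φof, sub_eq_zero]
      exact lie_derX_derΔ
    | δ_X m =>
      rw [LieHom.map_lie, φof, φof]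
      exact δX m
    | d_δ m =>
      rw [map_sub, LieHom.map_lie, map_smul, φof, φof, sub_eq_zero]
      have := dδ m
      push_cast at this
      exact this
    | Δ₀_δ m =>
      have : ∀ (n : ℕ) a, φ (((LieAlgebra.ad ℂ (FreeLieAlgebra ℂ DGen) (dfr .Δ₀)) ^ n) a) =
          ((LieAlgebra.ad ℂ _ (derΔ b)) ^ n) (φ a) := by
        intro n a
        induction n with
        | zero => simp
        | succ n ih =>
          rw [pow_succ', pow_succ', Module.End.mul_apply, Module.End.mul_apply, ← ih,
            LieAlgebra.ad_apply, LieAlgebra.ad_apply, LieHom.map_lie, φof]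
      rw [this, φof]
      exact ad_derΔ_pow_eq_zero (δX m) (dδ m)
  let ρ : Der →ₗ⁅ℂ⁆ LieDerivation ℂ (Ell b) (Ell b) :=
    { toLinearMap := dRelIdeal.toSubmodule.liftQ (φ : FreeLieAlgebra ℂ DGen →ₗ[ℂ] _)
        fun _ hr => LinearMap.mem_ker.2 (LieHom.mem_ker.1 (hker hr))
      map_lie' := by
        intro a c
        obtain ⟨r, rfl⟩ := LieSubmodule.Quotient.surjective_mk' dRelIdeal a
        obtain ⟨s, rfl⟩ := LieSubmodule.Quotient.surjective_mk' dRelIdeal c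
        exact LieHom.map_lie φ r s }
  have hρ : ∀ g, ρ (Der.gen g) = D g := φof
  refine ⟨ρ, ?_, ?_, ?_, ?_, ?_, ?_, ?_, ?_, ?_, ?_, ?_, ?_⟩
  · intro u; rw [hρ]; exact derD_x u
  · intro u; rw [hρ]; exact derD_y u
  · intro i; rw [hρ]; exact derD_t i
  · intro u; rw [hρ]; exact derX_x u
  · intro u; rw [hρ]; exact derX_y u
  · intro i; rw [hρ]; exact derX_t i
  · intro u; rw [hρ]; exact derΔ_x u
  · intro u; rw [hρ]; exact derΔ_y u
  · intro i; rw [hρ]; exact derΔ_t i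
  · intro m u; rw [hρ]; exact δx m u
  · intro m i; rw [hρ]; exact δt m i
  · intro m u; rw [hρ]; exact (δy m u).trans (deltaY_apply m u)

end Derivations

end EllipticKZB

end

noncomputable section

namespace EllipticKZB

open Filter Topology PowerSeries

/-! ### Elliptic functions -/

/-- The lattice `ℤ + ℤτ`. -/
def lat (τ : ℂ) : AddSubgroup ℂ where
  carrier := {z | ∃ m n : ℤ, z = m + n * τ}
  add_mem' := by
    rintro _ _ ⟨m, n, rfl⟩ ⟨m', n', rfl⟩
    exact ⟨m + m', n + n', by push_cast; ring⟩
  zero_mem' := ⟨0, 0, by simp⟩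
  neg_mem' := by
    rintro _ ⟨m, n, rfl⟩
    exact ⟨-m, -n, by push_cast; ring⟩

theorem mem_lat {τ z : ℂ} : z ∈ lat τ ↔ ∃ m n : ℤ, z = m + n * τ := Iff.rfl

theorem one_mem_lat (τ : ℂ) : (1 : ℂ) ∈ lat τ := ⟨1, 0, by simp⟩

theorem self_mem_lat (τ : ℂ) : τ ∈ lat τ := ⟨0, 1, by simp⟩

theorem eq_zero_of_mem_lat {τ z : ℂ} (hτ : 0 < τ.im) (hz : z ∈ lat τ) (h : ‖z‖ < min τ.im 1) :
    z = 0 := by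
  obtain ⟨m, n, rfl⟩ := hz
  have h1 := (Complex.abs_im_le_norm _).trans_lt (h.trans_le (min_le_left _ _))
  have h2 := (Complex.abs_re_le_norm _).trans_lt (h.trans_le (min_le_right _ _))
  have hn : n = 0 := by
    simp only [Complex.add_im, Complex.intCast_im, zero_add, Complex.mul_im, Complex.intCast_re,
      zero_mul, add_zero, abs_mul, abs_of_pos hτ] at h1
    have : |(n : ℝ)| < 1 := by
      by_contra hh
      nlinarith
    exact Int.abs_lt_one_iff.1 (by exact_mod_cast this)
  subst hn
  simp only [Int.cast_zero, zero_mul, add_zero, Complex.intCast_re] at h2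
  have : m = 0 := Int.abs_lt_one_iff.1 (by exact_mod_cast h2)
  simp [this]

theorem eventually_notMem_lat {τ : ℂ} (hτ : 0 < τ.im) (w : ℂ) : ∀ᶠ z in 𝓝[≠] w, z ∉ lat τ := by
  have hδ : 0 < min τ.im 1 := lt_min hτ one_pos
  have hball : ∀ᶠ z in 𝓝[≠] w, z ∈ Metric.ball w (min τ.im 1 / 2) :=
    nhdsWithin_le_nhds (Metric.ball_mem_nhds _ (by positivity))
  by_cases h : ∃ z₁ ∈ lat τ, z₁ ∈ Metric.ball w (min τ.im 1 / 2)
  · obtain ⟨z₁, hz₁, hb⟩ := h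
    have hne : ∀ᶠ z in 𝓝[≠] w, z ≠ z₁ := by
      rcases eq_or_ne w z₁ with rfl | hw
      · exact self_mem_nhdsWithin
      · exact nhdsWithin_le_nhds (isOpen_ne.mem_nhds hw)
    filter_upwards [hball, hne] with z hz hz1 hzl
    refine hz1 (sub_eq_zero.1 (eq_zero_of_mem_lat hτ (sub_mem hzl hz₁) ?_))
    rw [← dist_eq_norm]
    have := dist_triangle_right z z₁ w
    rw [Metric.mem_ball] at hz hb
    linarith
  · push Not at h
    filter_upwards [hball] with z hz hzl using h z hzl hz

theorem isOpen_compl_lat {τ : ℂ} (hτ : 0 < τ.im) : IsOpen ((lat τ : Set ℂ)ᶜ) := by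
  rw [isOpen_iff_mem_nhds]
  intro w hw
  have := eventually_notMem_lat hτ w
  rw [eventually_nhdsWithin_iff] at this
  filter_upwards [this] with z hz
  rcases eq_or_ne z w with rfl | h
  · exact hw
  · exact hz h

theorem apply_eq_of_doubly_periodic {τ : ℂ} (hτ : 0 < τ.im) {f : ℂ → ℂ} (hf : Differentiable ℂ f)
    (h₁ : ∀ s, f (s + 1) = f s) (h₂ : ∀ s, f (s + τ) = f s) (s t : ℂ) : f s = f t := by
  refine hf.apply_eq_apply_of_bounded ?_ s t
  have hK : IsCompact ((fun p : ℝ × ℝ => (p.1 : ℂ) + p.2 * τ) '' (Set.Icc 0 1 ×ˢ Set.Icc 0 1)) :=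
    (isCompact_Icc.prod isCompact_Icc).image (by fun_prop)
  refine (hK.image hf.continuous).isBounded.subset ?_
  rintro _ ⟨s, rfl⟩
  set β : ℝ := s.im / τ.im with hβ
  set α : ℝ := s.re - β * τ.re with hα
  have hs : s = α + β * τ := by
    apply Complex.ext
    · simp [hα]
    · simp [hβ, hτ.ne']
  refine ⟨(Int.fract α : ℝ) + (Int.fract β : ℝ) * τ, ⟨(Int.fract α, Int.fract β),
    ⟨⟨Int.fract_nonneg _, (Int.fract_lt_one _).le⟩, Int.fract_nonneg _, (Int.fract_lt_one _).le⟩,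
    rfl⟩, ?_⟩
  have p₁ : Function.Periodic f (⌊α⌋ * 1) := Function.Periodic.int_mul h₁ _
  have p₂ : Function.Periodic f (⌊β⌋ * τ) := Function.Periodic.int_mul h₂ _
  rw [← p₁, ← p₂]
  congr 1
  refine Eq.trans ?_ hs.symm
  rw [← Int.self_sub_floor, ← Int.self_sub_floor]
  push_cast
  ring

theorem eq_zero_of_quasi_periodic {τ : ℂ} (hτ : 0 < τ.im) {f : ℂ → ℂ} (hf : Differentiable ℂ f)
    {c : ℂ} (h₁ : ∀ s, f (s + 1) = f s) (h₂ : ∀ s, f (s + τ) = f s + c) : c = 0 := by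
  have hd : Differentiable ℂ (deriv f) := fun s =>
    ((hf.differentiableOn (s := Set.univ)).deriv isOpen_univ).differentiableAt univ_mem
  have h1 : ∀ s, deriv f (s + 1) = deriv f s := by
    intro s
    rw [← deriv_comp_add_const]
    simp only [h₁]
  have h2 : ∀ s, deriv f (s + τ) = deriv f s := by
    intro s
    rw [← deriv_comp_add_const]
    simp only [h₂]
    rw [deriv_add_const]
  have hc := apply_eq_of_doubly_periodic hτ hd h1 h2
  set d := deriv f 0
  have hg : ∀ s t, f s - d * s = f t - d * t := by
    intro s t
    refine is_const_of_deriv_eq_zero (f := fun s => f s - d * s) ?_ ?_ s t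
    · fun_prop
    · intro s
      have := ((hf s).hasDerivAt.sub ((hasDerivAt_id s).const_mul d)).deriv
      simp only [id, mul_one] at this
      rw [hc s 0, sub_self] at this
      exact this
  have hd0 : d = 0 := by
    have := hg (0 + 1) 0
    rw [h₁] at this
    simpa using this
  have := hg (0 + τ) 0
  rw [h₂, hd0] at this
  simpa using this

theorem exists_entire_of_removable {f : ℂ → ℂ}
    (hd : ∀ c, ∀ᶠ s in 𝓝[≠] c, DifferentiableAt ℂ f s)
    (hr : ∀ c, Tendsto (fun s => (s - c) * f s) (𝓝[≠] c) (𝓝 0)) :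
    ∃ g : ℂ → ℂ, Differentiable ℂ g ∧ (∀ c, ∀ᶠ s in 𝓝[≠] c, g s = f s) ∧
      ∀ c, ContinuousAt f c → g c = f c := by
  have hlim : ∀ c, ContinuousAt f c → limUnder (𝓝[≠] c) f = f c :=
    fun c hc => (hc.tendsto.mono_left nhdsWithin_le_nhds).limUnder_eq
  have hev : ∀ c, ∀ᶠ s in 𝓝[≠] c, limUnder (𝓝[≠] s) f = f s := fun c => by
    filter_upwards [hd c] with s hs using hlim s hs.continuousAt
  refine ⟨fun s => limUnder (𝓝[≠] s) f, fun c => ?_, hev, hlim⟩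
  obtain ⟨U, hU, hcU, hUd⟩ := mem_nhdsWithin.1 (hd c)
  have hD : DifferentiableOn ℂ f (U \ {c}) := fun s hs =>
    (hUd ⟨hs.1, hs.2⟩ : DifferentiableAt ℂ f s).differentiableWithinAt
  have hO : (fun z => f z - f c) =o[𝓝[≠] c] fun z => (z - c)⁻¹ := by
    rw [Asymptotics.isLittleO_iff_tendsto' (by
      filter_upwards [self_mem_nhdsWithin] with z hz h
      exact absurd (sub_eq_zero.1 (inv_eq_zero.1 h)) hz)]
    have h1 : Tendsto (fun z => (z - c) * f z - (z - c) * f c) (𝓝[≠] c) (𝓝 (0 - 0 * f c)) := by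
      refine (hr c).sub (Tendsto.mul_const _ ?_)
      have : Tendsto (fun z : ℂ => z - c) (𝓝 c) (𝓝 (c - c)) := by
        exact (continuous_id.sub continuous_const).tendsto c
      rw [sub_self] at this
      exact this.mono_left nhdsWithin_le_nhds
    simp only [zero_mul, sub_zero] at h1
    refine h1.congr fun z => ?_
    rw [div_inv_eq_mul]
    ring
  have := Complex.differentiableOn_update_limUnder_of_isLittleO (hU.mem_nhds hcU) hD hO
  refine (this.differentiableAt (hU.mem_nhds hcU)).congr_of_eventuallyEq ?_
  filter_upwards [hU.mem_nhds hcU] with s hs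
  rcases eq_or_ne s c with rfl | h
  · rw [Function.update_self]
  · rw [Function.update_of_ne h]
    exact hlim s (hUd ⟨hs, h⟩ : DifferentiableAt ℂ f s).continuousAt

theorem eq_of_eventuallyEq_punctured {f g : ℂ → ℂ} {c : ℂ} (hf : ContinuousAt f c)
    (hg : ContinuousAt g c) (h : ∀ᶠ s in 𝓝[≠] c, f s = g s) : f c = g c :=
  tendsto_nhds_unique_of_eventuallyEq (hf.tendsto.mono_left nhdsWithin_le_nhds)
    (hg.tendsto.mono_left nhdsWithin_le_nhds) h

theorem eventually_punctured_add {p : ℂ → Prop} (h : ∀ c, ∀ᶠ s in 𝓝[≠] c, p s) (c w : ℂ) :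
    ∀ᶠ s in 𝓝[≠] c, p (s + w) := by
  have h1 := h (c + w)
  rw [eventually_nhdsWithin_iff] at h1 ⊢
  have h2 : Tendsto (fun s : ℂ => s + w) (𝓝 c) (𝓝 (c + w)) :=
    (continuous_id.add continuous_const).tendsto c
  filter_upwards [h2.eventually h1] with s hs hsc
  exact hs (by simpa using hsc)

/-- A power series whose coefficients are elliptic up to a factor `exp(μX)`, `μ ≠ 0`, and have
removable singularities, vanishes. -/
theorem coeff_eq_zero_of_quasi_periodic {τ : ℂ} (hτ : 0 < τ.im) {f : ℂ → ℂ⟦X⟧} {μ : ℂ} (hμ : μ ≠ 0)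
    (hd : ∀ n c, ∀ᶠ s in 𝓝[≠] c, DifferentiableAt ℂ (fun s => coeff n (f s)) s)
    (hr : ∀ n c, Tendsto (fun s => (s - c) * coeff n (f s)) (𝓝[≠] c) (𝓝 0))
    (h₁ : ∀ c, ∀ᶠ s in 𝓝[≠] c, f (s + 1) = f s)
    (h₂ : ∀ c, ∀ᶠ s in 𝓝[≠] c, f (s + τ) = rescale μ (exp ℂ) * f s) (n : ℕ) (c : ℂ)
    (hc : ContinuousAt (fun s => coeff n (f s)) c) : coeff n (f c) = 0 := by
  choose g hg hgf hgc using fun n => exists_entire_of_removable (hd n) (hr n)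
  have g1 : ∀ n s, g n (s + 1) = g n s := fun n s => by
    refine eq_of_eventuallyEq_punctured (f := fun s => g n (s + 1))
      (((hg n).continuous.comp (continuous_id.add continuous_const)).continuousAt)
      (hg n).continuous.continuousAt ?_
    filter_upwards [eventually_punctured_add (hgf n) s 1, hgf n s, h₁ s] with t a1 a2 a3
    rw [a1, a2, a3]
  have g2 : ∀ n s, g n (s + τ) = ∑ p ∈ Finset.HasAntidiagonal.antidiagonal n,
      coeff p.1 (rescale μ (exp ℂ)) * g p.2 s := fun n s => by
    refine eq_of_eventuallyEq_punctured (f := fun s => g n (s + τ))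
      (g := fun s => ∑ p ∈ Finset.HasAntidiagonal.antidiagonal n,
        coeff p.1 (rescale μ (exp ℂ)) * g p.2 s)
      (((hg n).continuous.comp (continuous_id.add continuous_const)).continuousAt)
      (continuous_finsetSum _ fun p _ => continuous_const.mul (hg p.2).continuous).continuousAt ?_
    have hall : ∀ᶠ t in 𝓝[≠] s, ∀ p ∈ Finset.HasAntidiagonal.antidiagonal n,
        g p.2 t = coeff p.2 (f t) := by
      rw [Filter.eventually_all_finset]
      exact fun p _ => hgf p.2 s
    filter_upwards [eventually_punctured_add (hgf n) s τ, h₂ s, hall] with t a1 a2 a3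
    rw [a1, a2, coeff_mul]
    exact Finset.sum_congr rfl fun p hp => by rw [a3 p hp]
  have key : ∀ n s, g n s = 0 := by
    intro n
    induction n using Nat.strong_induction_on with
    | _ n IH =>
      have hper : ∀ s, g n (s + τ) = g n s := by
        intro s
        rw [g2, Finset.sum_eq_single (0, n)]
        · simp [coeff_rescale, coeff_exp]
        · intro p hp hne
          have hp' := Finset.HasAntidiagonal.mem_antidiagonal.1 hp
          have : p.2 < n := by
            rcases p with ⟨a, e⟩
            simp only [ne_eq, Prod.mk.injEq, not_and] at hne hp' ⊢
            omega
          rw [IH _ this, mul_zero]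
        · simp
      have hconst := apply_eq_of_doubly_periodic hτ (hg n) (g1 n) hper
      have hz : μ * g n 0 = 0 := by
        refine eq_zero_of_quasi_periodic hτ (hg (n + 1)) (g1 (n + 1)) (fun s => ?_)
        rw [g2, Finset.Nat.antidiagonal_succ, Finset.sum_cons, Finset.sum_map,
          Finset.sum_eq_single (0, n)]
        · simp [coeff_rescale, coeff_exp, hconst s 0]
        · intro p hp hne
          have hp' := Finset.HasAntidiagonal.mem_antidiagonal.1 hp
          have : p.2 < n := by
            rcases p with ⟨a, e⟩
            simp only [ne_eq, Prod.mk.injEq, not_and] at hne hp' ⊢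
            omega
          simp [IH _ this]
        · simp
      intro s
      rw [hconst s 0]
      exact (mul_eq_zero.1 hz).resolve_left hμ
  rw [← hgc n c hc, key]

end EllipticKZB

end

noncomputable section

namespace EllipticKZB

open Filter Topology PowerSeries
open scoped PowerSeries.WithPiTopology

/-! ### Kronecker functions -/

/-- The power series `exp(cX)`. -/
def expS (c : ℂ) : ℂ⟦X⟧ := rescale c (exp ℂ)

theorem expS_zero : expS 0 = 1 := by
  rw [expS, rescale_zero_apply, constantCoeff_exp, map_one]

theorem expS_add (a c : ℂ) : expS (a + c) = expS a * expS c := by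
  rw [expS, expS, expS, exp_mul_exp_eq_exp_add]

theorem rescale_expS (a c : ℂ) : rescale a (expS c) = expS (c * a) := by
  rw [expS, rescale_rescale, expS]

theorem expS_ne_zero (c : ℂ) : expS c ≠ 0 := by
  intro h
  have := expS_add c (-c)
  rw [add_neg_cancel, expS_zero, h, zero_mul] at this
  exact one_ne_zero this

theorem tendsto_rescale {α : Type*} {l : Filter α} {f : α → ℂ⟦X⟧} {g : ℂ⟦X⟧} (a : ℂ)
    (h : Tendsto f l (𝓝 g)) : Tendsto (fun s => rescale a (f s)) l (𝓝 (rescale a g)) := by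
  rw [WithPiTopology.tendsto_iff_coeff_tendsto] at h ⊢
  intro d
  simp only [coeff_rescale]
  exact (h d).const_mul _

theorem tendsto_of_coeff {α : Type*} {l : Filter α} {f : α → ℂ⟦X⟧} {g : ℂ⟦X⟧}
    (h : ∀ n, Tendsto (fun s => coeff n (f s)) l (𝓝 (coeff n g))) : Tendsto f l (𝓝 g) :=
  (WithPiTopology.tendsto_iff_coeff_tendsto ℂ f l g).2 h

theorem tendsto_coeff {α : Type*} {l : Filter α} {f : α → ℂ⟦X⟧} {g : ℂ⟦X⟧}
    (h : Tendsto f l (𝓝 g)) (n : ℕ) : Tendsto (fun s => coeff n (f s)) l (𝓝 (coeff n g)) :=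
  (WithPiTopology.tendsto_iff_coeff_tendsto ℂ f l g).1 h n

/-- All coefficients are complex differentiable. -/
def CoeffDiffAt (f : ℂ → ℂ⟦X⟧) (s : ℂ) : Prop := ∀ n, DifferentiableAt ℂ (fun s => coeff n (f s)) s

namespace CoeffDiffAt

variable {f g : ℂ → ℂ⟦X⟧} {s : ℂ}

theorem const (a : ℂ⟦X⟧) : CoeffDiffAt (fun _ => a) s := fun _ => differentiableAt_const _

theorem sub (hf : CoeffDiffAt f s) (hg : CoeffDiffAt g s) : CoeffDiffAt (fun s => f s - g s) s :=
  fun n => by simpa using (hf n).fun_sub (hg n)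

theorem sum {ι : Type*} {u : Finset ι} {F : ι → ℂ → ℂ⟦X⟧} (h : ∀ i ∈ u, CoeffDiffAt (F i) s) :
    CoeffDiffAt (fun s => ∑ i ∈ u, F i s) s := fun n => by
  simp only [map_sum]
  exact DifferentiableAt.fun_sum fun i hi => h i hi n

theorem mul (hf : CoeffDiffAt f s) (hg : CoeffDiffAt g s) : CoeffDiffAt (fun s => f s * g s) s :=
  fun n => by
    simp only [coeff_mul]
    exact DifferentiableAt.fun_sum fun p _ => (hf p.1).fun_mul (hg p.2)

theorem rescale (a : ℂ) (hf : CoeffDiffAt f s) : CoeffDiffAt (fun s => rescale a (f s)) s :=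
  fun n => by
    simp only [coeff_rescale]
    exact (hf n).const_mul _

theorem derivative (hf : CoeffDiffAt f s) :
    CoeffDiffAt (fun s => PowerSeries.derivative ℂ (f s)) s :=
  fun n => by
    simp only [coeff_derivative]
    exact (hf (n + 1)).mul_const _

theorem comp_affine {a n : ℂ} (hf : CoeffDiffAt f (a + n * s)) :
    CoeffDiffAt (fun s => f (a + n * s)) s := fun k =>
  DifferentiableAt.comp (g := fun w => coeff k (f w)) s (hf k)
    (by fun_prop : DifferentiableAt ℂ (fun s => a + n * s) s)

theorem tendsto (hf : CoeffDiffAt f s) : Tendsto f (𝓝 s) (𝓝 (f s)) :=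
  tendsto_of_coeff fun n => (hf n).continuousAt.tendsto

end CoeffDiffAt

theorem twoPiI_ne_zero : twoPiI ≠ 0 := Complex.two_pi_I_ne_zero

/-- The properties characterising `x ↦ x F(z, x)`, where `F` is the Kronecker function; `Γ` is the
value at `z = 0` of `x² ∂_x F`. -/
structure IsKron (τ : ℂ) (Γ : ℂ⟦X⟧) (κ : ℂ → ℂ⟦X⟧) : Prop where
  im_pos : 0 < τ.im
  hol {z : ℂ} (hz : z ∉ lat τ) : CoeffDiffAt κ z
  const {z : ℂ} (hz : z ∉ lat τ) : constantCoeff (κ z) = 1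
  per {z : ℂ} (hz : z ∉ lat τ) : κ (z + 1) = κ z
  perτ {z : ℂ} (hz : z ∉ lat τ) : κ (z + τ) = expS (-twoPiI) * κ z
  res : Tendsto (fun z => C z * κ z) (𝓝[≠] 0) (𝓝 X)
  fay : Tendsto (fun z => X * derivative ℂ (κ z) - κ z) (𝓝[≠] 0) (𝓝 Γ)

theorem add_mem_lat_iff {τ z w : ℂ} (hw : w ∈ lat τ) : z + w ∈ lat τ ↔ z ∈ lat τ :=
  add_mem_cancel_right hw

section QuasiPeriodic

variable {τ μ : ℂ} {f : ℂ → ℂ⟦X⟧} (h₁ : ∀ z ∉ lat τ, f (z + 1) = f z)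
include h₁

theorem add_int_of_periodic {z : ℂ} (hz : z ∉ lat τ) (m : ℤ) : f (z + m) = f z := by
  induction m using Int.induction_on with
  | zero => simp
  | succ m ih =>
    have : z + (m : ℤ) ∉ lat τ := by rwa [add_mem_lat_iff ⟨m, 0, by simp⟩]
    rw [← ih, ← h₁ _ this]
    push_cast
    rw [add_assoc]
  | pred m ih =>
    have : z + ((-m - 1 : ℤ) : ℂ) ∉ lat τ := by rwa [add_mem_lat_iff ⟨-m - 1, 0, by simp⟩]
    rw [← ih, ← h₁ _ this]
    push_cast
    congr 1
    ring

theorem add_lat_of_quasiPeriodic (h₂ : ∀ z ∉ lat τ, f (z + τ) = expS μ * f z) {z : ℂ}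
    (hz : z ∉ lat τ) (m n : ℤ) : f (z + (m + n * τ)) = expS (μ * n) * f z := by
  have key : ∀ n : ℤ, f (z + n * τ) = expS (μ * n) * f z := by
    intro n
    induction n using Int.induction_on with
    | zero => simp [expS_zero]
    | succ n ih =>
      have : z + (n : ℤ) * τ ∉ lat τ := by rwa [add_mem_lat_iff ⟨0, n, by simp⟩]
      have h1 := h₂ _ this
      rw [ih, ← mul_assoc, ← expS_add] at h1
      push_cast at h1 ⊢
      convert h1 using 2 <;> ring_nf
    | pred n ih =>
      have : z + ((-n - 1 : ℤ) : ℂ) * τ ∉ lat τ := by rwa [add_mem_lat_iff ⟨0, -n - 1, by simp⟩]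
      have h1 := h₂ _ this
      have e : z + ((-n - 1 : ℤ) : ℂ) * τ + τ = z + ((-n : ℤ) : ℂ) * τ := by push_cast; ring
      rw [e, ih] at h1
      refine mul_left_cancel₀ (expS_ne_zero μ) ?_
      rw [← h1, ← mul_assoc, ← expS_add]
      congr 2
      push_cast
      ring
  have : z + n * τ ∉ lat τ := by rwa [add_mem_lat_iff ⟨0, n, by simp⟩]
  have h2 := add_int_of_periodic h₁ this m
  rw [key] at h2
  rw [← h2]
  congr 1
  ring

/-- A quasi-periodic function with nontrivial multiplier and without poles vanishes. -/
theorem eq_zero_of_quasiPeriodic (hτ : 0 < τ.im) (hμ : μ ≠ 0)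
    (h₂ : ∀ z ∉ lat τ, f (z + τ) = expS μ * f z) (hd : ∀ z ∉ lat τ, CoeffDiffAt f z)
    (res : Tendsto (fun z => C z * f z) (𝓝[≠] 0) (𝓝 0)) {z : ℂ} (hz : z ∉ lat τ) : f z = 0 := by
  ext d
  rw [map_zero]
  refine coeff_eq_zero_of_quasi_periodic hτ hμ ?_ ?_ ?_ ?_ d z (hd z hz d).continuousAt
  · intro d s
    filter_upwards [eventually_notMem_lat hτ s] with w hw using hd w hw d
  · intro d s
    by_cases hs : s ∈ lat τ
    · obtain ⟨m, n, e⟩ := mem_lat.1 hs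
      have h0 : Tendsto (fun w => w - s) (𝓝[≠] s) (𝓝[≠] 0) := by
        refine tendsto_nhdsWithin_iff.2 ⟨?_, ?_⟩
        · have : Tendsto (fun w : ℂ => w - s) (𝓝 s) (𝓝 (s - s)) :=
            (continuous_id.sub continuous_const).tendsto s
          rw [sub_self] at this
          exact this.mono_left nhdsWithin_le_nhds
        · filter_upwards [self_mem_nhdsWithin] with w hw using sub_ne_zero.2 hw
      have h1 := tendsto_coeff ((res.comp h0).const_mul (expS (μ * n))) d
      rw [mul_zero, map_zero] at h1
      refine h1.congr' ?_
      filter_upwards [h0.eventually (eventually_notMem_lat hτ 0)] with w hw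
      have h2 := add_lat_of_quasiPeriodic h₁ h₂ hw m n
      rw [← e, sub_add_cancel] at h2
      rw [h2, Function.comp_apply, mul_left_comm, coeff_C_mul]
    · have h1 : Tendsto (fun w : ℂ => w - s) (𝓝 s) (𝓝 (s - s)) :=
        (continuous_id.sub continuous_const).tendsto s
      have h2 := h1.mul (hd s hs d).continuousAt.tendsto
      rw [sub_self, zero_mul] at h2
      exact h2.mono_left nhdsWithin_le_nhds
  · intro s
    filter_upwards [eventually_notMem_lat hτ s] with w hw using h₁ w hw
  · intro s
    filter_upwards [eventually_notMem_lat hτ s] with w hw using h₂ w hw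

end QuasiPeriodic

namespace IsKron

variable {τ : ℂ} {Γ : ℂ⟦X⟧} {κ : ℂ → ℂ⟦X⟧} (h : IsKron τ Γ κ)
include h

theorem per_int {z : ℂ} (hz : z ∉ lat τ) (m : ℤ) : κ (z + m) = κ z :=
  add_int_of_periodic (fun _ => h.per) hz m

theorem per_lat {z : ℂ} (hz : z ∉ lat τ) (m n : ℤ) :
    κ (z + (m + n * τ)) = expS (-twoPiI * n) * κ z :=
  add_lat_of_quasiPeriodic (fun _ => h.per) (fun _ => h.perτ) hz m n

/-- The residues of `κ` at the lattice points. -/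
theorem tendsto_mul {a n c : ℂ} (hn : n ≠ 0) (m q : ℤ) (hc : a + n * c = m + q * τ) :
    Tendsto (fun s => C (s - c) * κ (a + n * s)) (𝓝[≠] c)
      (𝓝 (C n⁻¹ * (expS (-twoPiI * q) * X))) := by
  have h1 : Tendsto (fun s => n * (s - c)) (𝓝[≠] c) (𝓝[≠] 0) := by
    refine tendsto_nhdsWithin_iff.2 ⟨?_, ?_⟩
    · have : Tendsto (fun s : ℂ => n * (s - c)) (𝓝 c) (𝓝 (n * (c - c))) :=
        (continuous_const.mul (continuous_id.sub continuous_const)).tendsto c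
      rw [sub_self, mul_zero] at this
      exact this.mono_left nhdsWithin_le_nhds
    · filter_upwards [self_mem_nhdsWithin] with s hs
      exact mul_ne_zero hn (sub_ne_zero.2 hs)
  have h2 := ((h.res.comp h1).const_mul (expS (-twoPiI * q))).const_mul (C n⁻¹)
  refine h2.congr' ?_
  have h3 : ∀ᶠ s in 𝓝[≠] c, n * (s - c) ∉ lat τ := h1.eventually (eventually_notMem_lat h.im_pos 0)
  filter_upwards [h3] with s hs
  have e : a + n * s = n * (s - c) + (m + q * τ) := by rw [← hc]; ring
  rw [e, h.per_lat hs]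
  simp only [Function.comp_apply, map_mul]
  have : C n⁻¹ * C n = (1 : ℂ⟦X⟧) := by rw [← map_mul, inv_mul_cancel₀ hn, map_one]
  linear_combination (expS (-twoPiI * q) * C (s - c) * κ (n * (s - c))) * this

theorem eventually_affine {a n : ℂ} (hn : n ≠ 0) (c : ℂ) :
    ∀ᶠ s in 𝓝[≠] c, a + n * s ∉ lat τ := by
  have h1 : Tendsto (fun s => a + n * s) (𝓝[≠] c) (𝓝[≠] (a + n * c)) := by
    refine tendsto_nhdsWithin_iff.2 ⟨?_, ?_⟩
    · have : Tendsto (fun s : ℂ => a + n * s) (𝓝 c) (𝓝 (a + n * c)) :=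
        (continuous_const.add (continuous_const.mul continuous_id)).tendsto c
      exact this.mono_left nhdsWithin_le_nhds
    · filter_upwards [self_mem_nhdsWithin] with s hs e
      exact hs (mul_left_cancel₀ hn (add_left_cancel e))
  exact h1.eventually (eventually_notMem_lat h.im_pos _)

/-- A sum of products of Kronecker functions along a line vanishes if its residues cancel. -/
theorem sum_eq_zero {ι : Type*} [Fintype ι] {c ξ : ι → ι → ℂ} {a : ι → ℂ} {n : ι → ℤ}
    (hn : ∀ i, n i ≠ 0) (hc : ∀ i k, c i k = c k i) {μ : ℂ} (hμ : μ ≠ 0)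
    (hμc : ∀ i k, c i k ≠ 0 → n i * ξ i k + n k * ξ k i = μ)
    (hgen : ∀ s i k, c i k ≠ 0 → a i + n i * s ∈ lat τ → a k + n k * s ∉ lat τ)
    (hres : ∀ s i (m q : ℤ), a i + n i * s = m + q * τ →
      ∑ k, C (c i k * ξ i k) * expS (-twoPiI * q * ξ i k) * rescale (ξ k i) (κ (a k + n k * s)) = 0)
    (h0 : ∀ i, a i ∉ lat τ) :
    ∑ i, ∑ k, C (c i k) * rescale (ξ i k) (κ (a i)) * rescale (ξ k i) (κ (a k)) = 0 := by
  set T : ι → ι → ℂ → ℂ⟦X⟧ := fun i k s =>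
    C (c i k) * rescale (ξ i k) (κ (a i + n i * s)) * rescale (ξ k i) (κ (a k + n k * s)) with hT
  have hn' : ∀ i, (n i : ℂ) ≠ 0 := fun i => by exact_mod_cast hn i
  have hreg : ∀ i k s, a i + n i * s ∉ lat τ → a k + n k * s ∉ lat τ → CoeffDiffAt (T i k) s := by
    intro i k s hi hk
    exact ((CoeffDiffAt.const _).mul ((h.hol hi).comp_affine.rescale _)).mul
      ((h.hol hk).comp_affine.rescale _)
  have hev : ∀ s₀, ∀ᶠ s in 𝓝[≠] s₀, ∀ i, a i + n i * s ∉ lat τ := fun s₀ => by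
    rw [Filter.eventually_all]
    exact fun i => h.eventually_affine (hn' i) s₀
  have key : ∀ s, (∀ i, a i + n i * s ∉ lat τ) → ∑ i, ∑ k, T i k s = 0 := by
    intro s₁ hs₁
    ext d
    rw [map_zero]
    refine coeff_eq_zero_of_quasi_periodic h.im_pos (μ := -twoPiI * μ)
      (f := fun s => ∑ i, ∑ k, T i k s) (mul_ne_zero (neg_ne_zero.2 twoPiI_ne_zero) hμ)
      ?_ ?_ ?_ ?_ d s₁ ?_
    · intro d s₀
      filter_upwards [hev s₀] with s hs
      exact CoeffDiffAt.sum (fun i _ => CoeffDiffAt.sum fun k _ => hreg i k s (hs i) (hs k)) d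
    · intro d s₀
      classical
      set G : ι → ι → ℂ⟦X⟧ := fun i k =>
        if hi : a i + n i * s₀ ∈ lat τ then C ((n i : ℂ)⁻¹) * X *
          (C (c i k * ξ i k) * expS (-twoPiI * (mem_lat.1 hi).choose_spec.choose * ξ i k) *
            rescale (ξ k i) (κ (a k + n k * s₀))) else 0 with hG
      have hGsum : ∀ i, ∑ k, G i k = 0 := by
        intro i
        by_cases hi : a i + n i * s₀ ∈ lat τ
        · simp only [hG, dif_pos hi]
          rw [← Finset.mul_sum, hres s₀ i _ _ (mem_lat.1 hi).choose_spec.choose_spec, mul_zero]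
        · simp only [hG, dif_neg hi, Finset.sum_const_zero]
      have hsing : ∀ i k, c i k ≠ 0 → a i + n i * s₀ ∈ lat τ →
          Tendsto (fun s => C (s - s₀) * T i k s) (𝓝[≠] s₀) (𝓝 (G i k)) := by
        intro i k hik hi
        have h1 := h.tendsto_mul (hn' i) _ _ (mem_lat.1 hi).choose_spec.choose_spec
        have h2 := (((h.hol (hgen s₀ i k hik hi)).comp_affine.rescale (ξ k i)).tendsto).mono_left
          (nhdsWithin_le_nhds (s := {s₀}ᶜ))
        have h3 := ((tendsto_rescale (ξ i k) h1).const_mul (C (c i k))).mul h2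
        have e : G i k = C (c i k) * rescale (ξ i k) (C (n i : ℂ)⁻¹ *
            (expS (-twoPiI * (mem_lat.1 hi).choose_spec.choose) * X)) *
              rescale (ξ k i) (κ (a k + n k * s₀)) := by
          simp only [hG, dif_pos hi, map_mul, rescale_expS, rescale_X]
          have : ∀ w : ℂ, rescale (ξ i k) (C w) = C w := fun w => by
            ext j
            rw [coeff_rescale, coeff_C]
            split_ifs with hj <;> simp [hj]
          rw [this]
          ring
        rw [e]
        refine h3.congr fun s => ?_
        simp only [hT, map_mul]
        have : ∀ w : ℂ, rescale (ξ i k) (C w) = C w := fun w => by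
          ext j
          rw [coeff_rescale, coeff_C]
          split_ifs with hj <;> simp [hj]
        rw [this]
        ring
      have hlim : ∀ i k, Tendsto (fun s => C (s - s₀) * T i k s) (𝓝[≠] s₀)
          (𝓝 (G i k + G k i)) := by
        intro i k
        by_cases hik : c i k = 0
        · have hki : c k i = 0 := by rw [← hc, hik]
          have e1 : G i k = 0 := by simp [hG, hik]
          have e2 : G k i = 0 := by simp [hG, hki]
          rw [e1, e2, add_zero]
          refine tendsto_const_nhds.congr fun s => ?_
          simp [hT, hik]
        have hki : c k i ≠ 0 := by rwa [← hc]
        by_cases hi : a i + n i * s₀ ∈ lat τ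
        · have e2 : G k i = 0 := by
            simp only [hG, dif_neg (hgen s₀ i k hik hi)]
          rw [e2, add_zero]
          exact hsing i k hik hi
        · have e1 : G i k = 0 := by simp only [hG, dif_neg hi]
          rw [e1, zero_add]
          by_cases hk : a k + n k * s₀ ∈ lat τ
          · refine (hsing k i hki hk).congr fun s => ?_
            simp only [hT]
            rw [hc k i]
            ring
          · have e2 : G k i = 0 := by simp only [hG, dif_neg hk]
            rw [e2]
            have h1 : Tendsto (fun s : ℂ => (C (s - s₀) : ℂ⟦X⟧)) (𝓝 s₀) (𝓝 (C (s₀ - s₀))) :=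
              (WithPiTopology.continuous_C.comp
                (continuous_id.sub continuous_const)).tendsto s₀
            have h2 := h1.mul (hreg i k s₀ hi hk).tendsto
            rw [sub_self, map_zero, zero_mul] at h2
            exact h2.mono_left nhdsWithin_le_nhds
      have hsum : Tendsto (fun s => ∑ i, ∑ k, C (s - s₀) * T i k s) (𝓝[≠] s₀)
          (𝓝 (∑ i, ∑ k, (G i k + G k i))) :=
        tendsto_finsetSum _ fun i _ => tendsto_finsetSum _ fun k _ => hlim i k
      have e : ∑ i, ∑ k, (G i k + G k i) = 0 := by
        simp only [Finset.sum_add_distrib, hGsum, zero_add]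
        rw [Finset.sum_comm]
        simp only [hGsum, Finset.sum_const_zero]
      rw [e] at hsum
      have := tendsto_coeff hsum d
      rw [map_zero] at this
      refine this.congr fun s => ?_
      simp only [← Finset.mul_sum, coeff_C_mul]
    · intro s₀
      filter_upwards [hev s₀] with s hs
      refine Finset.sum_congr rfl fun i _ => Finset.sum_congr rfl fun k _ => ?_
      have : ∀ i, κ (a i + n i * (s + 1)) = κ (a i + n i * s) := by
        intro i
        rw [← h.per_int (hs i) (n i)]
        congr 1
        ring
      simp only [hT, this]
    · intro s₀
      filter_upwards [hev s₀] with s hs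
      rw [Finset.mul_sum]
      refine Finset.sum_congr rfl fun i _ => ?_
      rw [Finset.mul_sum]
      refine Finset.sum_congr rfl fun k _ => ?_
      by_cases hik : c i k = 0
      · simp [hT, hik]
      have : ∀ i, κ (a i + n i * (s + τ)) = expS (-twoPiI * n i) * κ (a i + n i * s) := by
        intro i
        rw [← h.per_lat (hs i) 0 (n i)]
        congr 1
        push_cast
        ring
      simp only [hT, this, map_mul, rescale_expS]
      have e : rescale (-twoPiI * μ) (exp ℂ) =
          expS (-twoPiI * n i * ξ i k) * expS (-twoPiI * n k * ξ k i) := by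
        rw [← expS_add, expS, ← hμc i k hik]
        congr 2
        ring
      rw [e]
      ring
    · exact (CoeffDiffAt.sum (fun i _ => CoeffDiffAt.sum fun k _ =>
        hreg i k s₁ (hs₁ i) (hs₁ k)) d).continuousAt
  have := key 0 (by simpa using h0)
  simpa [hT] using this

end IsKron

end EllipticKZB

end

noncomputable section

namespace EllipticKZB

open Filter Topology PowerSeries
open scoped PowerSeries.WithPiTopology

/-! ### Identities between Kronecker functions for planar configurations -/

theorem sub_mul_sum_antidiagonal (T Y : ℂ) (n : ℕ) :
    (T - Y) * ∑ p ∈ Finset.HasAntidiagonal.antidiagonal n, T ^ p.1 * Y ^ p.2 =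
      T ^ (n + 1) - Y ^ (n + 1) := by
  induction n with
  | zero => simp
  | succ n ih =>
    rw [Finset.Nat.sum_antidiagonal_succ', mul_add]
    simp only [pow_succ Y, ← mul_assoc]
    rw [← Finset.sum_mul, ← mul_assoc, ih]
    ring

theorem sub_sq_mul_sum_antidiagonal (T Y : ℂ) (n : ℕ) :
    (T - Y) ^ 2 * ∑ p ∈ Finset.HasAntidiagonal.antidiagonal n, (p.1 + 1 : ℂ) * (T ^ p.1 * Y ^ p.2) =
      (n + 2) * T ^ (n + 1) * (T - Y) - (T ^ (n + 2) - Y ^ (n + 2)) := by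
  induction n with
  | zero => simp; ring
  | succ n ih =>
    rw [Finset.Nat.sum_antidiagonal_succ', mul_add]
    simp only [pow_succ Y, ← mul_assoc] at ih ⊢
    rw [← Finset.sum_mul, ← mul_assoc, ih]
    push_cast
    ring

/-- A finite family of vectors of a plane, with a vector `l` on which they take nonzero integral
values. -/
structure Planar (ι : Type*) where
  x : ι → ℂ
  y : ι → ℂ
  l₁ : ℂ
  l₂ : ℂ
  n : ι → ℤ
  n_ne i : n i ≠ 0
  n_eq i : (n i : ℂ) = x i * l₁ + y i * l₂

namespace Planar

variable {ι : Type*} (D : Planar ι)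

/-- The determinant of two vectors of the family. -/
def det (i k : ι) : ℂ := D.x i * D.y k - D.x k * D.y i

/-- The first coordinate of `(p₁, p₂)` with respect to the basis dual to the vectors `i`, `k`. -/
def ξ (p₁ p₂ : ℂ) (i k : ι) : ℂ := (D.y k * p₁ - D.x k * p₂) / D.det i k

theorem det_swap (i k : ι) : D.det k i = -D.det i k := by
  unfold det; ring

/-- Points `p` in general position. -/
def Gen (p₁ p₂ : ℂ) : Prop :=
  D.l₁ * p₁ + D.l₂ * p₂ ≠ 0 ∧ ∀ i k, D.det i k ≠ 0 → D.ξ p₁ p₂ i k ≠ 0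

/-- `k'` is congruent to `k` modulo integral multiples of `i`. -/
def Cls (i k k' : ι) : Prop := ∃ c : ℤ, D.x k' = D.x k + c * D.x i ∧ D.y k' = D.y k + c * D.y i

/-- Antisymmetric weights with vanishing sums over classes. -/
structure IsWeight [Fintype ι] (e : ι → ι → ℂ) : Prop where
  anti i k : e k i = -e i k
  zero {i k} : D.det i k = 0 → e i k = 0
  cls (i : ι) (ψ : ι → ℂ) (hψ : ∀ k k', D.det i k ≠ 0 → D.Cls i k k' → ψ k' = ψ k) :
    ∑ k, ψ k * e i k = 0

variable {D}

theorem det_of_cls {i k k' : ι} (h : D.Cls i k k') : D.det i k' = D.det i k := by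
  obtain ⟨c, h1, h2⟩ := h
  rw [det, det, h1, h2]
  ring

theorem ξ_of_cls {p₁ p₂ : ℂ} {i k k' : ι} (h : D.Cls i k k') : D.ξ p₁ p₂ k' i = D.ξ p₁ p₂ k i := by
  rw [ξ, ξ, D.det_swap i k', det_of_cls h, D.det_swap i k]

theorem mul_ξ_add {p₁ p₂ : ℂ} {i k : ι} (h : D.det i k ≠ 0) (a₁ a₂ : ℂ) :
    (D.x i * a₁ + D.y i * a₂) * D.ξ p₁ p₂ i k + (D.x k * a₁ + D.y k * a₂) * D.ξ p₁ p₂ k i =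
      a₁ * p₁ + a₂ * p₂ := by
  rw [ξ, ξ, D.det_swap i k, div_neg, mul_neg, mul_div_assoc', mul_div_assoc', ← sub_eq_add_neg,
    ← sub_div, div_eq_iff h, det]
  ring

section Weight

variable [Fintype ι] {e : ι → ι → ℂ} (he : D.IsWeight e)
include he

theorem IsWeight.cls' (k : ι) (ψ : ι → ℂ)
    (hψ : ∀ i i', D.det i k ≠ 0 → D.Cls k i i' → ψ i' = ψ i) : ∑ i, ψ i * e i k = 0 := by
  have := he.cls k ψ fun i i' hi => hψ i i' (by rwa [D.det_swap, neg_ne_zero])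
  simp only [he.anti k, mul_neg, Finset.sum_neg_distrib, this, neg_zero]

variable {τ : ℂ} {Γ : ℂ⟦X⟧} {κ : ℂ → ℂ⟦X⟧} (h : IsKron τ Γ κ) {p₁ p₂ : ℂ} (hp : D.Gen p₁ p₂)
include h hp

theorem kron_sum_of_generic {z₁ z₂ : ℂ} (hz : ∀ i, D.x i * z₁ + D.y i * z₂ ∉ lat τ)
    (hgen : ∀ i k, D.det i k ≠ 0 → D.det i k * (D.l₂ * z₁ - D.l₁ * z₂) ∉ lat τ) :
    ∑ i, ∑ k, C (D.det i k * e i k / (D.ξ p₁ p₂ i k * D.ξ p₁ p₂ k i)) *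
      rescale (D.ξ p₁ p₂ i k) (κ (D.x i * z₁ + D.y i * z₂)) *
      rescale (D.ξ p₁ p₂ k i) (κ (D.x k * z₁ + D.y k * z₂)) = 0 := by
  have hdet : ∀ {i k}, D.det i k * e i k / (D.ξ p₁ p₂ i k * D.ξ p₁ p₂ k i) ≠ 0 → D.det i k ≠ 0 := by
    intro i k hc hd
    simp [hd] at hc
  have hboth : ∀ s i k, D.det i k ≠ 0 → D.x i * z₁ + D.y i * z₂ + D.n i * s ∈ lat τ →
      D.x k * z₁ + D.y k * z₂ + D.n k * s ∉ lat τ := by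
    intro s i k hd hi hk
    refine hgen i k hd ?_
    have h1 := sub_mem (zsmul_mem hi (D.n k)) (zsmul_mem hk (D.n i))
    rw [zsmul_eq_mul, zsmul_eq_mul] at h1
    convert h1 using 1
    rw [D.n_eq, D.n_eq, det]
    ring
  refine h.sum_eq_zero (n := D.n) (μ := D.l₁ * p₁ + D.l₂ * p₂) D.n_ne ?_ hp.1 ?_ ?_ ?_ hz
  · intro i k
    rw [D.det_swap, he.anti]
    ring
  · intro i k hc
    rw [D.n_eq, D.n_eq, mul_ξ_add (hdet hc)]
  · intro s i k hc
    exact hboth s i k (hdet hc)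
  · intro s i m q hs
    ext d
    rw [map_zero, map_sum]
    have := he.cls i (fun k => coeff d (C (D.det i k / D.ξ p₁ p₂ k i) *
      expS (-twoPiI * q * D.ξ p₁ p₂ i k) *
      rescale (D.ξ p₁ p₂ k i) (κ (D.x k * z₁ + D.y k * z₂ + D.n k * s)))) (by
        intro k k' hd hkk
        have hξ := ξ_of_cls (p₁ := p₁) (p₂ := p₂) hkk
        have hdd := det_of_cls hkk
        have hk := hboth s i k hd ⟨m, q, hs⟩
        obtain ⟨c, hx, hy⟩ := hkk
        have hξ' : D.ξ p₁ p₂ i k' = D.ξ p₁ p₂ i k - c * D.ξ p₁ p₂ k i := by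
          rw [ξ, ξ, ξ, hdd, D.det_swap i k, hx, hy]
          field_simp
          ring
        have hn : (D.n k' : ℂ) = D.n k + c * D.n i := by
          rw [D.n_eq, D.n_eq, D.n_eq, hx, hy]
          ring
        have harg : D.x k' * z₁ + D.y k' * z₂ + D.n k' * s =
            D.x k * z₁ + D.y k * z₂ + D.n k * s + (((c * m : ℤ) : ℂ) + ((c * q : ℤ) : ℂ) * τ) := by
          push_cast
          rw [hn, hx, hy]
          linear_combination c * hs
        congr 1
        rw [harg, h.per_lat hk, hξ, hdd, hξ', map_mul, rescale_expS, mul_assoc (C _),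
          mul_assoc (C _), ← mul_assoc (expS _) (expS _), ← expS_add]
        congr 4
        push_cast
        ring)
    refine Eq.trans (Finset.sum_congr rfl fun k _ => ?_) this
    by_cases hd : D.det i k = 0
    · simp [he.zero hd]
    · rw [mul_assoc, coeff_C_mul, mul_assoc (C _), coeff_C_mul]
      have := hp.2 i k hd
      field_simp

/-- The Fay identity, summed over a planar configuration. -/
theorem kron_sum {z₁ z₂ : ℂ} (hz : ∀ i, D.x i * z₁ + D.y i * z₂ ∉ lat τ) :
    ∑ i, ∑ k, C (D.det i k * e i k / (D.ξ p₁ p₂ i k * D.ξ p₁ p₂ k i)) *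
      rescale (D.ξ p₁ p₂ i k) (κ (D.x i * z₁ + D.y i * z₂)) *
      rescale (D.ξ p₁ p₂ k i) (κ (D.x k * z₁ + D.y k * z₂)) = 0 := by
  obtain ⟨v₁, v₂, hv⟩ : ∃ v₁ v₂ : ℂ, D.l₂ * v₁ - D.l₁ * v₂ = 1 := by
    by_cases h2 : D.l₂ = 0
    · have h1 : D.l₁ ≠ 0 := by
        intro h1
        exact hp.1 (by simp [h1, h2])
      exact ⟨0, -1 / D.l₁, by field_simp; ring⟩
    · exact ⟨1 / D.l₂, 0, by field_simp; ring⟩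
  set F : ℂ → ℂ⟦X⟧ := fun t => ∑ i, ∑ k,
    C (D.det i k * e i k / (D.ξ p₁ p₂ i k * D.ξ p₁ p₂ k i)) *
      rescale (D.ξ p₁ p₂ i k) (κ (D.x i * z₁ + D.y i * z₂ + (D.x i * v₁ + D.y i * v₂) * t)) *
      rescale (D.ξ p₁ p₂ k i) (κ (D.x k * z₁ + D.y k * z₂ + (D.x k * v₁ + D.y k * v₂) * t)) with hF
  have hreg : ∀ i, ∀ t, D.x i * z₁ + D.y i * z₂ + (D.x i * v₁ + D.y i * v₂) * t ∉ lat τ →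
      CoeffDiffAt (fun t => κ (D.x i * z₁ + D.y i * z₂ + (D.x i * v₁ + D.y i * v₂) * t)) t :=
    fun i t ht => (h.hol ht).comp_affine
  have hev0 : ∀ᶠ t in 𝓝 (0 : ℂ), ∀ i,
      D.x i * z₁ + D.y i * z₂ + (D.x i * v₁ + D.y i * v₂) * t ∉ lat τ := by
    rw [Filter.eventually_all]
    intro i
    have hc : ContinuousAt (fun t : ℂ => D.x i * z₁ + D.y i * z₂ + (D.x i * v₁ + D.y i * v₂) * t)
      0 := by fun_prop
    exact hc.eventually ((isOpen_compl_lat h.im_pos).mem_nhds (by simpa using hz i))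
  have hev1 : ∀ᶠ t in 𝓝[≠] (0 : ℂ), ∀ i k, D.det i k ≠ 0 →
      D.det i k * (D.l₂ * z₁ - D.l₁ * z₂) + D.det i k * t ∉ lat τ := by
    rw [Filter.eventually_all]
    intro i
    rw [Filter.eventually_all]
    intro k
    by_cases hd : D.det i k = 0
    · simp [hd]
    · filter_upwards [h.eventually_affine hd 0] with t ht _ using ht
  have hcont : Tendsto F (𝓝[≠] 0) (𝓝 (F 0)) := by
    refine (CoeffDiffAt.tendsto (CoeffDiffAt.sum fun i _ => CoeffDiffAt.sum fun k _ => ?_)).mono_left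
      nhdsWithin_le_nhds
    have h0 := hev0.self_of_nhds
    exact ((CoeffDiffAt.const _).mul ((hreg i 0 (h0 i)).rescale _)).mul
      ((hreg k 0 (h0 k)).rescale _)
  have hzero : ∀ᶠ t in 𝓝[≠] (0 : ℂ), F t = 0 := by
    filter_upwards [hev1, nhdsWithin_le_nhds hev0] with t ht ht0
    have e : ∀ i, D.x i * z₁ + D.y i * z₂ + (D.x i * v₁ + D.y i * v₂) * t =
        D.x i * (z₁ + v₁ * t) + D.y i * (z₂ + v₂ * t) := fun i => by ring
    simp only [hF, e]
    refine kron_sum_of_generic he h hp (fun i => e i ▸ ht0 i) fun i k hd => ?_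
    have := ht i k hd
    have e2 : D.det i k * (D.l₂ * (z₁ + v₁ * t) - D.l₁ * (z₂ + v₂ * t)) =
        D.det i k * (D.l₂ * z₁ - D.l₁ * z₂) + D.det i k * t := by
      linear_combination D.det i k * t * hv
    rwa [e2]
  have := tendsto_nhds_unique hcont (tendsto_const_nhds.congr' (hzero.mono fun t ht => ht.symm))
  simpa [hF] using this

theorem kron_sum_coeff {z₁ z₂ : ℂ} (hz : ∀ i, D.x i * z₁ + D.y i * z₂ ∉ lat τ) (m : ℕ) :
    ∑ i, ∑ k, D.det i k * e i k * ∑ a ∈ Finset.HasAntidiagonal.antidiagonal m,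
      coeff a.1 (κ (D.x i * z₁ + D.y i * z₂)) * coeff a.2 (κ (D.x k * z₁ + D.y k * z₂)) *
        (D.ξ p₁ p₂ i k ^ (a.1 - 1 : ℤ) * D.ξ p₁ p₂ k i ^ (a.2 - 1 : ℤ)) = 0 := by
  have h1 := congrArg (coeff m) (kron_sum he h hp hz)
  rw [map_zero, map_sum] at h1
  rw [← h1]
  refine Finset.sum_congr rfl fun i _ => ?_
  rw [map_sum]
  refine Finset.sum_congr rfl fun k _ => ?_
  by_cases hd : D.det i k = 0
  · simp [hd]
  have hx := hp.2 i k hd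
  have hy := hp.2 k i (by rwa [D.det_swap, neg_ne_zero])
  rw [mul_assoc (C _), coeff_C_mul, coeff_mul, div_mul_eq_mul_div, mul_div_assoc, Finset.sum_div]
  congr 1
  refine Finset.sum_congr rfl fun a _ => ?_
  rw [coeff_rescale, coeff_rescale, zpow_sub_one₀ hx, zpow_sub_one₀ hy, zpow_natCast, zpow_natCast]
  field_simp

/-- The scalar identity behind the flatness in the directions of `𝔥`. -/
theorem zz_identity {z₁ z₂ : ℂ} (hz : ∀ i, D.x i * z₁ + D.y i * z₂ ∉ lat τ) (c₁ c₂ : ι → ℂ)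
    (hc : ∀ k, D.x k * c₁ k + D.y k * c₂ k = 1) (m : ℕ) :
    ∑ i, ∑ k, D.det i k * e i k * ((∑ a ∈ Finset.HasAntidiagonal.antidiagonal m,
      coeff (a.1 + 1) (κ (D.x i * z₁ + D.y i * z₂)) * coeff (a.2 + 1) (κ (D.x k * z₁ + D.y k * z₂)) *
        (D.ξ p₁ p₂ i k ^ a.1 * D.ξ p₁ p₂ k i ^ a.2)) -
      2 * coeff (m + 2) (κ (D.x k * z₁ + D.y k * z₂)) * ((D.x i * c₁ k + D.y i * c₂ k) *
        ∑ a ∈ Finset.HasAntidiagonal.antidiagonal m,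
          (p₁ * c₁ k + p₂ * c₂ k) ^ a.1 * D.ξ p₁ p₂ k i ^ a.2)) = 0 := by
  set K : ι → ℕ → ℂ := fun i j => coeff j (κ (D.x i * z₁ + D.y i * z₂)) with hK
  have hK0 : ∀ i, K i 0 = 1 := fun i => by
    rw [hK]
    simp only [coeff_zero_eq_constantCoeff]
    exact h.const (hz i)
  set X : ι → ι → ℂ := D.ξ p₁ p₂ with hX
  set T : ι → ℂ := fun k => p₁ * c₁ k + p₂ * c₂ k with hT
  have hcoeff := kron_sum_coeff he h hp hz (m + 2)
  have hcls : ∑ k, ∑ i, (D.det i k * K k (m + 2) * T k ^ (m + 1) / X i k) * e i k = 0 := by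
    refine Finset.sum_eq_zero fun k _ => he.cls' k _ fun i i' _ hii => ?_
    rw [D.det_swap k i', det_of_cls hii, hX, ξ_of_cls hii, ← D.det_swap k i]
  rw [Finset.sum_comm] at hcls
  have hswap : ∑ i, ∑ k, D.det i k * e i k * (K i (m + 2) * X i k ^ (m + 1) / X k i) =
      ∑ i, ∑ k, D.det i k * e i k * (K k (m + 2) * X k i ^ (m + 1) / X i k) := by
    rw [Finset.sum_comm]
    refine Finset.sum_congr rfl fun i _ => Finset.sum_congr rfl fun k _ => ?_
    rw [D.det_swap, he.anti]
    ring
  have hterm : ∀ i k, D.det i k * e i k * ((∑ a ∈ Finset.HasAntidiagonal.antidiagonal m,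
      K i (a.1 + 1) * K k (a.2 + 1) * (X i k ^ a.1 * X k i ^ a.2)) -
      2 * K k (m + 2) * ((D.x i * c₁ k + D.y i * c₂ k) *
        ∑ a ∈ Finset.HasAntidiagonal.antidiagonal m, T k ^ a.1 * X k i ^ a.2)) =
      D.det i k * e i k * (∑ a ∈ Finset.HasAntidiagonal.antidiagonal (m + 2),
        K i a.1 * K k a.2 * (X i k ^ (a.1 - 1 : ℤ) * X k i ^ (a.2 - 1 : ℤ))) -
      2 * ((D.det i k * K k (m + 2) * T k ^ (m + 1) / X i k) * e i k) +
      (D.det i k * e i k * (K k (m + 2) * X k i ^ (m + 1) / X i k) -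
        D.det i k * e i k * (K i (m + 2) * X i k ^ (m + 1) / X k i)) := by
    intro i k
    by_cases hd : D.det i k = 0
    · simp [hd]
    have hx : X i k ≠ 0 := hp.2 i k hd
    have hy : X k i ≠ 0 := hp.2 k i (by rwa [D.det_swap, neg_ne_zero])
    rw [Finset.Nat.sum_antidiagonal_succ, Finset.Nat.sum_antidiagonal_succ']
    simp only [hK0]
    have e1 : ∀ a : ℕ × ℕ, K i (a.1 + 1) * K k (a.2 + 1) *
        (X i k ^ (((a.1 + 1 : ℕ) : ℤ) - 1) * X k i ^ (((a.2 + 1 : ℕ) : ℤ) - 1)) =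
        K i (a.1 + 1) * K k (a.2 + 1) * (X i k ^ a.1 * X k i ^ a.2) := by
      intro a
      simp
    simp only [e1]
    have hTX : (D.x i * c₁ k + D.y i * c₂ k) * X i k = T k - X k i := by
      have := mul_ξ_add (p₁ := p₁) (p₂ := p₂) hd (c₁ k) (c₂ k)
      rw [hc, one_mul] at this
      rw [eq_sub_iff_add_eq, hT, hX, this]
      ring
    have hgeo := sub_mul_sum_antidiagonal (T k) (X k i) m
    rw [← hTX] at hgeo
    have hgeo' : (D.x i * c₁ k + D.y i * c₂ k) *
        ∑ a ∈ Finset.HasAntidiagonal.antidiagonal m, T k ^ a.1 * X k i ^ a.2 =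
        (T k ^ (m + 1) - X k i ^ (m + 1)) / X i k := by
      rw [eq_div_iff hx, ← hgeo]
      ring
    rw [hgeo']
    have z1 : X i k ^ (((0 : ℕ) : ℤ) - 1) = (X i k)⁻¹ := by simp
    have z2 : X k i ^ (((0 : ℕ) : ℤ) - 1) = (X k i)⁻¹ := by simp
    have z3 : X k i ^ (((m + 2 : ℕ) : ℤ) - 1) = X k i ^ (m + 1) := by
      rw [← zpow_natCast]; congr 1; push_cast; ring
    have z4 : X i k ^ (((m + 1 + 1 : ℕ) : ℤ) - 1) = X i k ^ (m + 1) := by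
      rw [← zpow_natCast]; congr 1; push_cast; ring
    rw [z1, z2, z3, z4]
    ring
  refine Eq.trans (Finset.sum_congr rfl fun i _ => Finset.sum_congr rfl fun k _ => hterm i k) ?_
  simp only [Finset.sum_add_distrib, Finset.sum_sub_distrib, ← Finset.mul_sum]
  rw [hswap, sub_self, add_zero, hcls, mul_zero, sub_zero]
  exact hcoeff

theorem kron_sum_deriv {z₁ z₂ : ℂ} (hz : ∀ i, D.x i * z₁ + D.y i * z₂ ∉ lat τ) (u₁ u₂ : ℂ)
    (m : ℕ) :
    ∑ i, ∑ k, e i k * ((D.x i * u₁ + D.y i * u₂) * ∑ a ∈ Finset.HasAntidiagonal.antidiagonal m,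
      coeff a.1 (κ (D.x i * z₁ + D.y i * z₂)) * coeff a.2 (κ (D.x k * z₁ + D.y k * z₂)) *
        (D.ξ p₁ p₂ i k ^ (a.1 - 1 : ℤ) * ((a.2 - 1 : ℂ) * D.ξ p₁ p₂ k i ^ (a.2 - 1 - 1 : ℤ)))) =
      0 := by
  set K : ι → ℕ → ℂ := fun i j => coeff j (κ (D.x i * z₁ + D.y i * z₂)) with hK
  set X : ι → ι → ℂ := D.ξ p₁ p₂ with hX
  set U : ι → ℂ := fun i => D.x i * u₁ + D.y i * u₂ with hU
  set X' : ι → ι → ℂ := fun i k => -U k / D.det i k with hX'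
  have hline : ∀ (t : ℂ) i k, D.ξ (p₁ + t * -u₂) (p₂ + t * u₁) i k = X i k + t * X' i k := by
    intro t i k
    rw [hX, hX', hU, ξ, ξ]
    ring
  set f : ℂ → ℂ := fun t => ∑ i, ∑ k, D.det i k * e i k *
    ∑ a ∈ Finset.HasAntidiagonal.antidiagonal m, K i a.1 * K k a.2 *
      ((X i k + t * X' i k) ^ (a.1 - 1 : ℤ) * (X k i + t * X' k i) ^ (a.2 - 1 : ℤ)) with hf
  have hgen : ∀ᶠ t in 𝓝 (0 : ℂ), D.Gen (p₁ + t * -u₂) (p₂ + t * u₁) := by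
    refine Filter.Eventually.and ?_ ?_
    · have hc : ContinuousAt (fun t : ℂ => D.l₁ * (p₁ + t * -u₂) + D.l₂ * (p₂ + t * u₁)) 0 := by
        fun_prop
      exact hc.eventually_ne (by simpa using hp.1)
    · rw [Filter.eventually_all]
      intro i
      rw [Filter.eventually_all]
      intro k
      by_cases hd : D.det i k = 0
      · simp [hd]
      · have hc : ContinuousAt (fun t : ℂ => X i k + t * X' i k) 0 := by fun_prop
        have := hc.eventually_ne (y := 0) (by simpa using hp.2 i k hd)
        filter_upwards [this] with t ht _
        rwa [hline]
  have hzero : f =ᶠ[𝓝 0] fun _ => 0 := by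
    filter_upwards [hgen] with t ht
    have := kron_sum_coeff he h ht hz m
    simp only [hline] at this
    exact this
  have hd0 : HasDerivAt f 0 0 := (hasDerivAt_const 0 (0 : ℂ)).congr_of_eventuallyEq hzero
  have hd1 : HasDerivAt f (∑ i, ∑ k, D.det i k * e i k *
      ∑ a ∈ Finset.HasAntidiagonal.antidiagonal m, K i a.1 * K k a.2 *
        ((a.1 - 1 : ℂ) * X i k ^ (a.1 - 1 - 1 : ℤ) * X' i k * X k i ^ (a.2 - 1 : ℤ) +
          X i k ^ (a.1 - 1 : ℤ) * ((a.2 - 1 : ℂ) * X k i ^ (a.2 - 1 - 1 : ℤ) * X' k i))) 0 := by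
    refine HasDerivAt.fun_sum fun i _ => HasDerivAt.fun_sum fun k _ => ?_
    by_cases hd : D.det i k = 0
    · simp only [hd, zero_mul]
      exact hasDerivAt_const _ _
    refine HasDerivAt.const_mul _ (HasDerivAt.fun_sum fun a _ => HasDerivAt.const_mul _ ?_)
    have hx : X i k ≠ 0 := hp.2 i k hd
    have hy : X k i ≠ 0 := hp.2 k i (by rwa [D.det_swap, neg_ne_zero])
    have hlin : ∀ i k, HasDerivAt (fun t : ℂ => X i k + t * X' i k) (X' i k) 0 := by
      intro i k
      simpa using ((hasDerivAt_id (0 : ℂ)).mul_const (X' i k)).const_add (X i k)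
    have hz' : ∀ i k (j : ℤ), X i k ≠ 0 → HasDerivAt (fun t : ℂ => (X i k + t * X' i k) ^ j)
        (j * X i k ^ (j - 1) * X' i k) 0 := by
      intro i k j hj
      have := (hasDerivAt_zpow j (X i k + 0 * X' i k) (Or.inl (by simpa using hj))).comp 0 (hlin i k)
      rw [zero_mul, add_zero] at this
      exact this
    have := (hz' i k (a.1 - 1) hx).fun_mul (hz' k i (a.2 - 1) hy)
    simpa using this
  have hs := hd1.unique hd0
  set A : ι → ι → ℂ := fun i k => e i k * (U i * ∑ a ∈ Finset.HasAntidiagonal.antidiagonal m,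
      K i a.1 * K k a.2 *
        (X i k ^ (a.1 - 1 : ℤ) * ((a.2 - 1 : ℂ) * X k i ^ (a.2 - 1 - 1 : ℤ)))) with hA
  have hAs : ∀ i k, D.det i k * e i k * ∑ a ∈ Finset.HasAntidiagonal.antidiagonal m,
      K i a.1 * K k a.2 *
        ((a.1 - 1 : ℂ) * X i k ^ (a.1 - 1 - 1 : ℤ) * X' i k * X k i ^ (a.2 - 1 : ℤ) +
          X i k ^ (a.1 - 1 : ℤ) * ((a.2 - 1 : ℂ) * X k i ^ (a.2 - 1 - 1 : ℤ) * X' k i)) =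
      A k i + A i k := by
    intro i k
    by_cases hd : D.det i k = 0
    · have h1 := he.zero hd
      have h2 : e k i = 0 := by rw [he.anti, h1, neg_zero]
      simp [hA, h1, h2]
    have h1 : D.det i k * X' i k = -U k := by
      simp only [hX']
      field_simp
    have h2 : D.det i k * X' k i = U i := by
      simp only [hX']
      rw [D.det_swap i k]
      field_simp
    simp only [hA, mul_add, Finset.sum_add_distrib]
    congr 1
    · rw [he.anti i k, ← Finset.Nat.sum_antidiagonal_swap, ← mul_assoc, Finset.mul_sum,
        Finset.mul_sum]
      refine Finset.sum_congr rfl fun a _ => ?_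
      simp only [Prod.fst_swap, Prod.snd_swap]
      linear_combination (e i k * K i a.2 * K k a.1 * (a.2 - 1) * X i k ^ (a.2 - 1 - 1 : ℤ) *
        X k i ^ (a.1 - 1 : ℤ)) * h1
    · rw [← mul_assoc, Finset.mul_sum, Finset.mul_sum]
      refine Finset.sum_congr rfl fun a _ => ?_
      linear_combination (e i k * K i a.1 * K k a.2 * X i k ^ (a.1 - 1 : ℤ) * (a.2 - 1) *
        X k i ^ (a.2 - 1 - 1 : ℤ)) * h2
  simp only [hAs, Finset.sum_add_distrib] at hs
  rw [Finset.sum_comm, ← two_mul] at hs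
  exact (mul_eq_zero.1 hs).resolve_left two_ne_zero

/-- The scalar identity behind the flatness in the direction of `τ`. -/
theorem zτ_identity {z₁ z₂ : ℂ} (hz : ∀ i, D.x i * z₁ + D.y i * z₂ ∉ lat τ) (c₁ c₂ : ι → ℂ)
    (hc : ∀ k, D.x k * c₁ k + D.y k * c₂ k = 1)
    (u₁ u₂ : ℂ) (J : ℕ) :
    ∑ i, ∑ k, e i k * (coeff (J + 3) (κ (D.x k * z₁ + D.y k * z₂)) *
        ((D.x k * u₁ + D.y k * u₂) * (D.x i * c₁ k + D.y i * c₂ k) ^ 2 *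
          (∑ a ∈ Finset.HasAntidiagonal.antidiagonal J,
            (a.1 + 1 : ℂ) * ((p₁ * c₁ k + p₂ * c₂ k) ^ a.1 * D.ξ p₁ p₂ k i ^ a.2)) -
        (D.x i * u₁ + D.y i * u₂) * (J + 2) * (D.x i * c₁ k + D.y i * c₂ k) *
          ∑ a ∈ Finset.HasAntidiagonal.antidiagonal J,
            (p₁ * c₁ k + p₂ * c₂ k) ^ a.1 * D.ξ p₁ p₂ k i ^ a.2) +
      (D.x i * u₁ + D.y i * u₂) * ∑ a ∈ Finset.HasAntidiagonal.antidiagonal J,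
        coeff (a.1 + 1) (κ (D.x i * z₁ + D.y i * z₂)) *
          ((a.2 + 1 : ℂ) * coeff (a.2 + 2) (κ (D.x k * z₁ + D.y k * z₂))) *
          (D.ξ p₁ p₂ i k ^ a.1 * D.ξ p₁ p₂ k i ^ a.2)) = 0 := by
  set K : ι → ℕ → ℂ := fun i j => coeff j (κ (D.x i * z₁ + D.y i * z₂)) with hK
  have hK0 : ∀ i, K i 0 = 1 := fun i => by
    rw [hK]
    simp only [coeff_zero_eq_constantCoeff]
    exact h.const (hz i)
  set X : ι → ι → ℂ := D.ξ p₁ p₂ with hX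
  set T : ι → ℂ := fun k => p₁ * c₁ k + p₂ * c₂ k with hT
  set U : ι → ℂ := fun i => D.x i * u₁ + D.y i * u₂ with hU
  set al : ι → ι → ℂ := fun i k => D.x i * c₁ k + D.y i * c₂ k with hal
  have hder := kron_sum_deriv he h hp hz u₁ u₂ (J + 3)
  have hcls : ∑ k, ∑ i, (K k (J + 3) * ((al i k * U k - U i) * (J + 2) * T k ^ (J + 1) / X i k -
      U k * T k ^ (J + 2) / X i k ^ 2)) * e i k = 0 := by
    refine Finset.sum_eq_zero fun k _ => he.cls' k _ fun i i' _ hii => ?_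
    rw [hX, ξ_of_cls hii]
    obtain ⟨c, hx, hy⟩ := hii
    have : al i' k * U k - U i' = al i k * U k - U i := by
      simp only [hal, hU, hx, hy]
      linear_combination (c * (D.x k * u₁ + D.y k * u₂)) * hc k
    rw [this]
  rw [Finset.sum_comm] at hcls
  have hswap : ∑ i, ∑ k, e i k * (U k * K k (J + 3) * X k i ^ (J + 2) / X i k ^ 2) =
      -∑ i, ∑ k, e i k * (U i * K i (J + 3) * X i k ^ (J + 2) / X k i ^ 2) := by
    rw [Finset.sum_comm, ← Finset.sum_neg_distrib]
    refine Finset.sum_congr rfl fun i _ => ?_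
    rw [← Finset.sum_neg_distrib]
    refine Finset.sum_congr rfl fun k _ => ?_
    rw [he.anti]
    ring
  have hterm : ∀ i k, e i k * (K k (J + 3) *
        (U k * al i k ^ 2 * (∑ a ∈ Finset.HasAntidiagonal.antidiagonal J,
            (a.1 + 1 : ℂ) * (T k ^ a.1 * X k i ^ a.2)) -
        U i * (J + 2) * al i k * ∑ a ∈ Finset.HasAntidiagonal.antidiagonal J,
            T k ^ a.1 * X k i ^ a.2) +
      U i * ∑ a ∈ Finset.HasAntidiagonal.antidiagonal J,
        K i (a.1 + 1) * ((a.2 + 1 : ℂ) * K k (a.2 + 2)) * (X i k ^ a.1 * X k i ^ a.2)) =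
      e i k * (U i * ∑ a ∈ Finset.HasAntidiagonal.antidiagonal (J + 3),
        K i a.1 * K k a.2 *
        (X i k ^ (a.1 - 1 : ℤ) * ((a.2 - 1 : ℂ) * X k i ^ (a.2 - 1 - 1 : ℤ)))) +
      (K k (J + 3) * ((al i k * U k - U i) * (J + 2) * T k ^ (J + 1) / X i k -
        U k * T k ^ (J + 2) / X i k ^ 2)) * e i k +
      (e i k * (U k * K k (J + 3) * X k i ^ (J + 2) / X i k ^ 2) +
        e i k * (U i * K i (J + 3) * X i k ^ (J + 2) / X k i ^ 2)) := by
    intro i k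
    by_cases hd : D.det i k = 0
    · simp [he.zero hd]
    have hx : X i k ≠ 0 := hp.2 i k hd
    have hy : X k i ≠ 0 := hp.2 k i (by rwa [D.det_swap, neg_ne_zero])
    rw [Finset.Nat.sum_antidiagonal_succ (n := J + 2), Finset.Nat.sum_antidiagonal_succ' (n := J + 1),
      Finset.Nat.sum_antidiagonal_succ' (n := J)]
    simp only [hK0]
    have e1 : ∀ a : ℕ × ℕ, K i (a.1 + 1) * K k (a.2 + 1 + 1) *
        (X i k ^ (((a.1 + 1 : ℕ) : ℤ) - 1) * ((((a.2 + 1 + 1 : ℕ) : ℂ) - 1) *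
          X k i ^ (((a.2 + 1 + 1 : ℕ) : ℤ) - 1 - 1))) =
        K i (a.1 + 1) * ((a.2 + 1 : ℂ) * K k (a.2 + 2)) * (X i k ^ a.1 * X k i ^ a.2) := by
      intro a
      have e1 : ((a.1 + 1 : ℕ) : ℤ) - 1 = (a.1 : ℕ) := by push_cast; ring
      have e2 : ((a.2 + 1 + 1 : ℕ) : ℤ) - 1 - 1 = (a.2 : ℕ) := by push_cast; ring
      rw [e1, e2, zpow_natCast, zpow_natCast]
      push_cast
      ring
    simp only [e1]
    have hTX : al i k * X i k = T k - X k i := by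
      have := mul_ξ_add (p₁ := p₁) (p₂ := p₂) hd (c₁ k) (c₂ k)
      rw [hc, one_mul] at this
      rw [eq_sub_iff_add_eq, hT, hX, hal, this]
      ring
    have hgeo := sub_mul_sum_antidiagonal (T k) (X k i) J
    have hgeo2 := sub_sq_mul_sum_antidiagonal (T k) (X k i) J
    rw [← hTX] at hgeo hgeo2
    set S := ∑ a ∈ Finset.HasAntidiagonal.antidiagonal J, T k ^ a.1 * X k i ^ a.2
    set S₂ := ∑ a ∈ Finset.HasAntidiagonal.antidiagonal J,
      (a.1 + 1 : ℂ) * (T k ^ a.1 * X k i ^ a.2)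
    have hgeo' : al i k * S = (T k ^ (J + 1) - X k i ^ (J + 1)) / X i k := by
      rw [eq_div_iff hx, ← hgeo]
      ring
    have hgeo2' : al i k ^ 2 * S₂ = (J + 2) * T k ^ (J + 1) * al i k / X i k -
        (T k ^ (J + 2) - X k i ^ (J + 2)) / X i k ^ 2 := by
      field_simp
      linear_combination hgeo2
    have z1 : X i k ^ (((0 : ℕ) : ℤ) - 1) = (X i k)⁻¹ := by simp
    have z2 : X k i ^ (((0 : ℕ) : ℤ) - 1 - 1) = (X k i ^ 2)⁻¹ := by
      rw [← zpow_natCast, ← zpow_neg]; congr 1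
    have z3 : X k i ^ (((J + 3 : ℕ) : ℤ) - 1 - 1) = X k i ^ (J + 1) := by
      rw [← zpow_natCast]; congr 1; push_cast; ring
    have z4 : X i k ^ (((J + 2 + 1 : ℕ) : ℤ) - 1) = X i k ^ (J + 2) := by
      rw [← zpow_natCast]; congr 1; push_cast; ring
    rw [z1, z2, z3, z4]
    push_cast
    linear_combination (e i k * K k (J + 3) * U k) * hgeo2' -
      (e i k * K k (J + 3) * U i * (J + 2)) * hgeo'
  refine Eq.trans (Finset.sum_congr rfl fun i _ => Finset.sum_congr rfl fun k _ => hterm i k) ?_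
  simp only [Finset.sum_add_distrib]
  rw [hswap, neg_add_cancel, add_zero, hcls, add_zero]
  exact hder

end Weight

end Planar

end EllipticKZB

end

noncomputable section

namespace EllipticKZB

open MvPolynomial

theorem mvPolynomial_eq_zero_of_eval {σ : Type*} {Q R : MvPolynomial σ ℂ} (hR : R ≠ 0)
    (h : ∀ p : σ → ℂ, eval p R ≠ 0 → eval p Q = 0) : Q = 0 := by
  have : Q * R = 0 := by
    refine MvPolynomial.funext fun p => ?_
    rw [map_mul, map_zero]
    by_cases hp : eval p R = 0
    · rw [hp, mul_zero]
    · rw [h p hp, zero_mul]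
  exact (mul_eq_zero.1 this).resolve_right hR

section Brackets

variable {ι 𝔥 M : Type*} [Fintype ι] [AddCommGroup 𝔥] [Module ℂ 𝔥] [AddCommGroup M] [Module ℂ M]
variable {P : RootPairing ι ℂ M 𝔥} (b : P.Base)

/-- The linear map `X^p Y^q ↦ [(ad x_i)^p t_i, (ad x_k)^q t_k]`. -/
def brk (i k : ι) : MvPolynomial (Fin 2) ℂ →ₗ[ℂ] Ell b :=
  (basisMonomials (Fin 2) ℂ).constr ℂ fun s => ⁅Ell.tx b i (s 0), Ell.tx b k (s 1)⁆

variable {b}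

theorem brk_monomial (i k : ι) (s : Fin 2 →₀ ℕ) :
    brk b i k (monomial s 1) = ⁅Ell.tx b i (s 0), Ell.tx b k (s 1)⁆ := by
  have := (basisMonomials (Fin 2) ℂ).constr_basis ℂ
    (fun s => ⁅Ell.tx b i (s 0), Ell.tx b k (s 1)⁆) s
  rwa [coe_basisMonomials] at this

theorem X_pow_mul_X_pow (p q : ℕ) : (X 0 ^ p * X 1 ^ q : MvPolynomial (Fin 2) ℂ) =
    monomial (Finsupp.single 0 p + Finsupp.single 1 q) 1 := by
  rw [X_pow_eq_monomial, X_pow_eq_monomial, monomial_mul, one_mul]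

theorem brk_mul (i k : ι) (p q : ℕ) :
    brk b i k (X 0 ^ p * X 1 ^ q) = ⁅Ell.tx b i p, Ell.tx b k q⁆ := by
  rw [X_pow_mul_X_pow, brk_monomial]
  simp

theorem brk_C_mul (i k : ι) (c : ℂ) (f : MvPolynomial (Fin 2) ℂ) :
    brk b i k (C c * f) = c • brk b i k f := by
  rw [← smul_eq_C_mul, map_smul]

theorem brk_X_one_pow (i k : ι) (q : ℕ) :
    brk b i k (X 1 ^ q) = ⁅Ell.t b i, Ell.tx b k q⁆ := by
  have := brk_mul (b := b) i k 0 q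
  rwa [pow_zero, one_mul, Ell.tx_zero] at this

theorem brk_one (i k : ι) : brk b i k 1 = ⁅Ell.t b i, Ell.t b k⁆ := by
  have := brk_X_one_pow (b := b) i k 0
  rwa [pow_zero, Ell.tx_zero] at this

theorem lie_x_brk (w : 𝔥) (i k : ι) (f : MvPolynomial (Fin 2) ℂ) :
    ⁅Ell.x b w, brk b i k f⁆ = brk b i k ((C (P.root' i w) * X 0 + C (P.root' k w) * X 1) * f) := by
  have : (LieAlgebra.ad ℂ (Ell b) (Ell.x b w) : Ell b →ₗ[ℂ] Ell b).comp (brk b i k) =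
      (brk b i k).comp (LinearMap.mulLeft ℂ (C (P.root' i w) * X 0 + C (P.root' k w) * X 1)) := by
    refine (basisMonomials (Fin 2) ℂ).ext fun s => ?_
    have e0 : (X 0 : MvPolynomial (Fin 2) ℂ) * monomial s 1 =
        monomial (Finsupp.single 0 1 + s) 1 := by rw [X, monomial_mul, one_mul]
    have e1 : (X 1 : MvPolynomial (Fin 2) ℂ) * monomial s 1 =
        monomial (Finsupp.single 1 1 + s) 1 := by rw [X, monomial_mul, one_mul]
    simp only [coe_basisMonomials, LinearMap.comp_apply, LinearMap.mulLeft_apply, brk_monomial,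
      LieAlgebra.ad_apply, add_mul, mul_assoc, map_add, brk_C_mul, e0, e1]
    rw [leibniz_lie, Ell.lie_x_tx, Ell.lie_x_tx, smul_lie, lie_smul]
    simp [add_comm]
  exact congrArg (fun g => g f) this

theorem brk_swap (i k : ι) (f : MvPolynomial (Fin 2) ℂ) :
    brk b k i (rename (Equiv.swap 0 1) f) = -brk b i k f := by
  have : (brk b k i).comp (rename (R := ℂ) (Equiv.swap (0 : Fin 2) 1)).toLinearMap =
      -brk b i k := by
    refine (basisMonomials (Fin 2) ℂ).ext fun s => ?_
    simp only [coe_basisMonomials, LinearMap.comp_apply, AlgHom.toLinearMap_apply,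
      rename_monomial, LinearMap.neg_apply, brk_monomial]
    rw [← lie_skew]
    have h0 : Finsupp.mapDomain (Equiv.swap (0 : Fin 2) 1) s 0 = s 1 := by
      have := Finsupp.mapDomain_apply (Equiv.swap (0 : Fin 2) 1).injective s 1
      rwa [Equiv.swap_apply_right] at this
    have h1 : Finsupp.mapDomain (Equiv.swap (0 : Fin 2) 1) s 1 = s 0 := by
      have := Finsupp.mapDomain_apply (Equiv.swap (0 : Fin 2) 1).injective s 0
      rwa [Equiv.swap_apply_left] at this
    rw [h0, h1]
  exact congrArg (fun g => g f) this

/-! ### Operators attached to two commuting vectors -/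

variable (b)

/-- The linear map `X^p Y^q ↦ (ad x(w₁))^p (ad x(w₂))^q`. -/
def opr (w₁ w₂ : 𝔥) : MvPolynomial (Fin 2) ℂ →ₗ[ℂ] Module.End ℂ (Ell b) :=
  (basisMonomials (Fin 2) ℂ).constr ℂ fun s =>
    LieAlgebra.ad ℂ (Ell b) (Ell.x b w₁) ^ s 0 * LieAlgebra.ad ℂ (Ell b) (Ell.x b w₂) ^ s 1

variable {b}

theorem opr_monomial (w₁ w₂ : 𝔥) (s : Fin 2 →₀ ℕ) : opr b w₁ w₂ (monomial s 1) =
    LieAlgebra.ad ℂ (Ell b) (Ell.x b w₁) ^ s 0 * LieAlgebra.ad ℂ (Ell b) (Ell.x b w₂) ^ s 1 := by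
  have := (basisMonomials (Fin 2) ℂ).constr_basis ℂ
    (fun s => LieAlgebra.ad ℂ (Ell b) (Ell.x b w₁) ^ s 0 *
      LieAlgebra.ad ℂ (Ell b) (Ell.x b w₂) ^ s 1) s
  rwa [coe_basisMonomials] at this

theorem opr_one (w₁ w₂ : 𝔥) : opr b w₁ w₂ 1 = 1 := by
  have := opr_monomial (b := b) w₁ w₂ 0
  simpa using this

theorem commute_ad_x (w₁ w₂ : 𝔥) : Commute (LieAlgebra.ad ℂ (Ell b) (Ell.x b w₁))
    (LieAlgebra.ad ℂ (Ell b) (Ell.x b w₂)) := by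
  refine LinearMap.ext fun a => ?_
  simp only [Module.End.mul_apply, LieAlgebra.ad_apply]
  rw [leibniz_lie, Ell.lie_x_x, zero_lie, zero_add]

theorem opr_mul (w₁ w₂ : 𝔥) (a₁ a₂ : ℂ) (f : MvPolynomial (Fin 2) ℂ) :
    opr b w₁ w₂ ((C a₁ * X 0 + C a₂ * X 1) * f) =
      LieAlgebra.ad ℂ (Ell b) (Ell.x b (a₁ • w₁ + a₂ • w₂)) * opr b w₁ w₂ f := by
  have : (opr b w₁ w₂).comp (LinearMap.mulLeft ℂ (C a₁ * X 0 + C a₂ * X 1)) =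
      (LinearMap.mulLeft ℂ (LieAlgebra.ad ℂ (Ell b) (Ell.x b (a₁ • w₁ + a₂ • w₂)))).comp
        (opr b w₁ w₂) := by
    refine (basisMonomials (Fin 2) ℂ).ext fun s => ?_
    have e0 : (X 0 : MvPolynomial (Fin 2) ℂ) * monomial s 1 =
        monomial (Finsupp.single 0 1 + s) 1 := by rw [X, monomial_mul, one_mul]
    have e1 : (X 1 : MvPolynomial (Fin 2) ℂ) * monomial s 1 =
        monomial (Finsupp.single 1 1 + s) 1 := by rw [X, monomial_mul, one_mul]
    simp only [coe_basisMonomials, LinearMap.comp_apply, LinearMap.mulLeft_apply,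
      add_mul, map_add, ← smul_eq_C_mul, map_smul, e0, e1, opr_monomial, smul_mul_assoc]
    congr 2
    · simp [pow_add, mul_assoc]
    · simp only [Finsupp.coe_add, Pi.add_apply, Finsupp.single_eq_same, pow_add, pow_one,
        ← mul_assoc]
      rw [((commute_ad_x w₁ w₂).pow_left (s 0)).eq.symm]
      simp
  exact congrArg (fun g => g f) this

theorem brk_eq_opr {w₁ w₂ : 𝔥} {i k : ι} {a₁ a₂ c₁ c₂ : ℂ}
    (hii : P.root' i (a₁ • w₁ + a₂ • w₂) = 1) (hik : P.root' i (c₁ • w₁ + c₂ • w₂) = 0)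
    (hki : P.root' k (a₁ • w₁ + a₂ • w₂) = 0) (hkk : P.root' k (c₁ • w₁ + c₂ • w₂) = 1)
    (f : MvPolynomial (Fin 2) ℂ) :
    brk b i k f = opr b w₁ w₂ (aeval ![C a₁ * X 0 + C a₂ * X 1, C c₁ * X 0 + C c₂ * X 1] f)
      ⁅Ell.t b i, Ell.t b k⁆ := by
  induction f using MvPolynomial.induction_on with
  | C a =>
    have e1 : (C a : MvPolynomial (Fin 2) ℂ) = C a * 1 := (mul_one _).symm
    rw [e1, brk_C_mul, brk_one, map_mul, map_one, algHom_C, algebraMap_eq, ← smul_eq_C_mul,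
      map_smul, opr_one]
    rfl
  | add f g hf hg => rw [map_add, map_add, map_add, hf, hg, LinearMap.add_apply]
  | mul_X f n hf =>
    rw [mul_comm f, map_mul (aeval _), aeval_X]
    fin_cases n
    · have := lie_x_brk (b := b) (a₁ • w₁ + a₂ • w₂) i k f
      rw [hii, hki, map_one, one_mul, map_zero, zero_mul, add_zero, hf] at this
      refine this.symm.trans ?_
      exact (congrArg (fun g => g ⁅Ell.t b i, Ell.t b k⁆) (opr_mul w₁ w₂ a₁ a₂ _)).symm
    · have := lie_x_brk (b := b) (c₁ • w₁ + c₂ • w₂) i k f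
      rw [hik, hkk, map_one, one_mul, map_zero, zero_mul, zero_add, hf] at this
      refine this.symm.trans ?_
      exact (congrArg (fun g => g ⁅Ell.t b i, Ell.t b k⁆) (opr_mul w₁ w₂ c₁ c₂ _)).symm

theorem sum_opr_eq_zero {σ : Type*} (S : Finset σ) (w₁ w₂ : 𝔥) (Q : σ → MvPolynomial (Fin 2) ℂ)
    (v : σ → Ell b) (h : ∀ φ : Module.Dual ℂ (Ell b), ∑ s ∈ S, C (φ (v s)) * Q s = 0) :
    ∑ s ∈ S, opr b w₁ w₂ (Q s) (v s) = 0 := by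
  classical
  set U := S.biUnion fun s => (Q s).support with hU
  have h1 : ∀ s ∈ S, opr b w₁ w₂ (Q s) (v s) =
      ∑ m ∈ U, opr b w₁ w₂ (monomial m 1) (coeff m (Q s) • v s) := by
    intro s hs
    have e : Q s = ∑ m ∈ U, coeff m (Q s) • monomial m 1 := by
      nth_rewrite 1 [(Q s).as_sum]
      simp only [smul_monomial, smul_eq_mul, mul_one]
      refine Finset.sum_subset (Finset.subset_biUnion_of_mem (fun s => (Q s).support) hs) ?_
      intro m _ hm
      rw [notMem_support_iff.1 hm, map_zero]
    nth_rewrite 1 [e]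
    rw [map_sum, LinearMap.sum_apply]
    refine Finset.sum_congr rfl fun m _ => ?_
    rw [map_smul, LinearMap.smul_apply, map_smul]
  rw [Finset.sum_congr rfl h1, Finset.sum_comm]
  refine Finset.sum_eq_zero fun m _ => ?_
  rw [← map_sum]
  have : ∑ s ∈ S, coeff m (Q s) • v s = 0 := by
    rw [← Module.forall_dual_apply_eq_zero_iff ℂ]
    intro φ
    have := congrArg (coeff m) (h φ)
    rw [coeff_sum, coeff_zero] at this
    rw [map_sum, ← this]
    refine Finset.sum_congr rfl fun s _ => ?_
    rw [map_smul, coeff_C_mul, smul_eq_mul, mul_comm]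
  rw [this, map_zero]

/-! ### Planes spanned by two roots -/

/-- The roots in the plane spanned by two roots. -/
def PlaneIdx (P : RootPairing ι ℂ M 𝔥) (i₀ k₀ : ι) : Type _ :=
  {i : ι // P.root i ∈ Submodule.span ℂ {P.root i₀, P.root k₀}}

instance (i₀ k₀ : ι) : Fintype (PlaneIdx P i₀ k₀) := by
  classical exact inferInstanceAs (Fintype {i : ι // _})

section Plane

variable {i₀ k₀ : ι} (h : LinearIndependent ℂ ![P.root i₀, P.root k₀])

/-- Vectors dual to two independent roots. -/
def dualFst : 𝔥 := (exists_root'_pair i₀ k₀ h 1 0).choose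

/-- Vectors dual to two independent roots. -/
def dualSnd : 𝔥 := (exists_root'_pair i₀ k₀ h 0 1).choose

theorem root_eq_of_plane (i : PlaneIdx P i₀ k₀) : P.root i.1 =
    P.root' i.1 (dualFst h) • P.root i₀ + P.root' i.1 (dualSnd h) • P.root k₀ := by
  obtain ⟨x, y, e⟩ := Submodule.mem_span_pair.1 i.2
  obtain ⟨h1, h2⟩ := (exists_root'_pair i₀ k₀ h 1 0).choose_spec
  obtain ⟨h3, h4⟩ := (exists_root'_pair i₀ k₀ h 0 1).choose_spec
  have key : ∀ u, P.root' i.1 u = x * P.root' i₀ u + y * P.root' k₀ u := by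
    intro u
    rw [root'_eq, ← e]
    simp [root'_eq]
  rw [key, key, dualFst, dualSnd, h1, h2, h3, h4]
  simp [e]

theorem root'_eq_of_plane (i : PlaneIdx P i₀ k₀) (u : 𝔥) : P.root' i.1 u =
    P.root' i.1 (dualFst h) * P.root' i₀ u + P.root' i.1 (dualSnd h) * P.root' k₀ u := by
  have := congrArg (fun m => P.toLinearMap m u) (root_eq_of_plane h i)
  simpa [root'_eq] using this

variable [P.IsRootSystem] (b)

/-- The planar configuration of the roots in a plane. -/
def planeData : Planar (PlaneIdx P i₀ k₀) where
  x i := P.root' i.1 (dualFst h)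
  y i := P.root' i.1 (dualSnd h)
  l₁ := P.root' i₀ (heightVec b)
  l₂ := P.root' k₀ (heightVec b)
  n i := (root'_heightVec b i.1).choose
  n_ne i := (root'_heightVec b i.1).choose_spec.1
  n_eq i := by
    rw [← (root'_heightVec b i.1).choose_spec.2.1]
    exact root'_eq_of_plane h i _

variable {b}

theorem det_planeData [P.IsReduced] (i k : PlaneIdx P i₀ k₀) :
    (planeData b h).det i k ≠ 0 ↔ LinearIndependent ℂ ![P.root i.1, P.root k.1] := by
  constructor
  · intro hd
    by_contra hc
    apply hd
    rcases eq_or_eq_negIdx hc with e | e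
    · simp [Planar.det, planeData, e]
    · simp [Planar.det, planeData, e, mul_comm]
  · intro hind hd
    have h1 := root_eq_of_plane h i
    have h2 := root_eq_of_plane h k
    rw [LinearIndependent.pair_iff] at hind
    have hd' : P.root' i.1 (dualFst h) * P.root' k.1 (dualSnd h) -
      P.root' k.1 (dualFst h) * P.root' i.1 (dualSnd h) = 0 := hd
    have hy := hind (P.root' k.1 (dualSnd h)) (-P.root' i.1 (dualSnd h)) (by
      rw [h1, h2]
      linear_combination (norm := module) hd' • P.root i₀)
    have hx := hind (P.root' k.1 (dualFst h)) (-P.root' i.1 (dualFst h)) (by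
      rw [h1, h2]
      linear_combination (norm := module) -(hd' • P.root k₀))
    rw [hx.1, hy.1] at h2
    exact P.ne_zero k.1 (by simpa using h2)

theorem isWeight_planeData [P.IsReduced] (φ : Module.Dual ℂ (Ell b)) :
    (planeData b h).IsWeight fun i k => φ ⁅Ell.t b i.1, Ell.t b k.1⁆ where
  anti i k := by rw [← lie_skew, map_neg]
  zero {i k} hd := by
    rw [Ell.lie_t_t_of_dependent, map_zero]
    rw [← det_planeData h, not_not]
    exact hd
  cls i ψ hψ := by
    classical
    set S : Submodule ℂ M := Submodule.span ℂ {P.root i₀, P.root k₀} with hS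
    have := Ell.sum_apply_lie_t (b := b) i.1
      (fun k => if hk : P.root k ∈ S then ψ ⟨k, hk⟩ • φ else 0) (by
        intro k k' c hind e
        have hmem : P.root k' ∈ S ↔ P.root k ∈ S := by
          rw [e]
          exact Submodule.add_mem_iff_left _ (by
            rw [← Int.cast_smul_eq_zsmul ℂ]
            exact Submodule.smul_mem _ _ i.2)
        by_cases hk : P.root k ∈ S
        · rw [dif_pos hk, dif_pos (hmem.2 hk)]
          have hroot : ∀ u, P.root' k' u = P.root' k u + c * P.root' i.1 u := by
            intro u
            rw [root'_eq, e, map_add, map_zsmul, LinearMap.add_apply, LinearMap.smul_apply]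
            simp [root'_eq]
          rw [hψ ⟨k, hk⟩ ⟨k', hmem.2 hk⟩ ((det_planeData h i ⟨k, hk⟩).2 hind)
            ⟨c, hroot _, hroot _⟩]
        · rw [dif_neg hk, dif_neg (fun hk' => hk (hmem.1 hk'))])
    rw [← this]
    symm
    refine Eq.trans (Finset.sum_filter_of_ne (p := fun k => P.root k ∈ S) ?_).symm ?_
    · intro k _ hne
      by_contra hk
      rw [dif_neg hk] at hne
      exact hne rfl
    · rw [Finset.sum_subtype (p := fun k => P.root k ∈ S) _ (by simp)]
      refine Finset.sum_bij (fun k _ => (k : PlaneIdx P i₀ k₀)) (fun _ _ => Finset.mem_univ _)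
        (fun _ _ _ _ e => e) (fun k _ => ⟨k, Finset.mem_univ _, rfl⟩) ?_
      rintro ⟨k, hk⟩ _
      rw [dif_pos hk]
      rfl

end Plane

variable [P.IsRootSystem] [P.IsReduced]

theorem sum_brk_plane_eq_zero {i₀ k₀ : ι} (h : LinearIndependent ℂ ![P.root i₀, P.root k₀])
    (f : ι → ι → MvPolynomial (Fin 2) ℂ)
    (hf : ∀ e, (planeData b h).IsWeight e → ∀ p₁ p₂, (planeData b h).Gen p₁ p₂ →
        ∑ i, ∑ k, e i k * eval ![(planeData b h).ξ p₁ p₂ i k, (planeData b h).ξ p₁ p₂ k i]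
          (f i.1 k.1) = 0) :
    open Classical in
    ∑ q : ι × ι with LinearIndependent ℂ ![P.root q.1, P.root q.2] ∧
      Submodule.span ℂ {P.root q.1, P.root q.2} = Submodule.span ℂ {P.root i₀, P.root k₀},
      brk b q.1 q.2 (f q.1 q.2) = 0 := by
  classical
  set D := planeData b h with hD
  have hcoord : ∀ i k : PlaneIdx P i₀ k₀, D.det i k ≠ 0 →
      Submodule.span ℂ {P.root i.1, P.root k.1} = Submodule.span ℂ {P.root i₀, P.root k₀} := by
    intro i k hd
    have h1 := root_eq_of_plane h i
    have h2 := root_eq_of_plane h k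
    have hdd : D.det i k = P.root' i.1 (dualFst h) * P.root' k.1 (dualSnd h) -
      P.root' k.1 (dualFst h) * P.root' i.1 (dualSnd h) := rfl
    apply le_antisymm
    · rw [Submodule.span_le]
      rintro _ (rfl | rfl)
      · exact i.2
      · exact k.2
    · rw [Submodule.span_le]
      rintro _ (rfl | rfl)
      · refine Submodule.mem_span_pair.2 ⟨(D.det i k)⁻¹ * P.root' k.1 (dualSnd h),
          -((D.det i k)⁻¹ * P.root' i.1 (dualSnd h)), ?_⟩
        rw [h1, h2]
        have : (D.det i k)⁻¹ * D.det i k = 1 := inv_mul_cancel₀ hd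
        rw [hdd] at this ⊢
        linear_combination (norm := module) this • P.root i₀
      · refine Submodule.mem_span_pair.2 ⟨-((D.det i k)⁻¹ * P.root' k.1 (dualFst h)),
          (D.det i k)⁻¹ * P.root' i.1 (dualFst h), ?_⟩
        rw [h1, h2]
        have : (D.det i k)⁻¹ * D.det i k = 1 := inv_mul_cancel₀ hd
        rw [hdd] at this ⊢
        linear_combination (norm := module) this • P.root k₀
  set lx : PlaneIdx P i₀ k₀ → PlaneIdx P i₀ k₀ → MvPolynomial (Fin 2) ℂ := fun i k =>
    C (D.y k / D.det i k) * X 0 + C (-D.x k / D.det i k) * X 1 with hlx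
  set Q : PlaneIdx P i₀ k₀ × PlaneIdx P i₀ k₀ → MvPolynomial (Fin 2) ℂ := fun q =>
    if D.det q.1 q.2 = 0 then 0 else aeval ![lx q.1 q.2, lx q.2 q.1] (f q.1.1 q.2.1) with hQ
  have hop := sum_opr_eq_zero (b := b) Finset.univ (dualFst h) (dualSnd h) Q
    (fun q => ⁅Ell.t b q.1.1, Ell.t b q.2.1⁆) (by
      intro φ
      set R : MvPolynomial (Fin 2) ℂ := (C D.l₁ * X 0 + C D.l₂ * X 1) *
        ∏ i, ∏ k, (if D.det i k = 0 then 1 else C (D.y k) * X 0 - C (D.x k) * X 1) with hR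
      refine mvPolynomial_eq_zero_of_eval (R := R) ?_ ?_
      · have hlin : ∀ a c : ℂ, (a ≠ 0 ∨ c ≠ 0) →
            (C a * X 0 + C c * X 1 : MvPolynomial (Fin 2) ℂ) ≠ 0 := by
          intro a c hac e
          have h1 := congrArg (eval ![1, 0]) e
          have h2 := congrArg (eval ![0, 1]) e
          simp at h1 h2
          rcases hac with hac | hac
          · exact hac h1
          · exact hac h2
        refine mul_ne_zero (hlin _ _ ?_) (Finset.prod_ne_zero_iff.2 fun i _ =>
          Finset.prod_ne_zero_iff.2 fun k _ => ?_)
        · by_contra hc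
          push Not at hc
          have i₀' : PlaneIdx P i₀ k₀ := ⟨i₀, Submodule.subset_span (by simp)⟩
          have := D.n_eq i₀'
          rw [hc.1, hc.2, mul_zero, mul_zero, add_zero] at this
          exact D.n_ne i₀' (by exact_mod_cast this)
        · split_ifs with hd
          · exact one_ne_zero
          · have := hlin (D.y k) (-D.x k) (by
              by_contra hc
              push Not at hc
              apply hd
              rw [Planar.det, hc.1, neg_eq_zero.1 hc.2]
              ring)
            rw [map_neg] at this
            rwa [sub_eq_add_neg, ← neg_mul]
      · intro p hp
        rw [hR, map_mul, map_prod, mul_ne_zero_iff, Finset.prod_ne_zero_iff] at hp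
        have hgen : D.Gen (p 0) (p 1) := by
          refine ⟨by simpa using hp.1, fun i k hd => ?_⟩
          have h1 := hp.2 i (Finset.mem_univ _)
          rw [map_prod, Finset.prod_ne_zero_iff] at h1
          have h2 := h1 k (Finset.mem_univ _)
          rw [if_neg hd] at h2
          exact div_ne_zero (by simpa using h2) hd
        have hw := isWeight_planeData h φ
        have := hf _ hw (p 0) (p 1) hgen
        rw [← Finset.sum_product', Finset.univ_product_univ] at this
        rw [map_sum, ← this]
        refine Finset.sum_congr rfl fun q _ => ?_
        rw [map_mul, eval_C]
        by_cases hd : D.det q.1 q.2 = 0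
        · rw [hw.zero hd, zero_mul, zero_mul]
        · congr 1
          simp only [hQ, if_neg hd]
          rw [← coe_aeval_eq_eval, ← coe_aeval_eq_eval, RingHom.coe_coe, RingHom.coe_coe,
            ← AlgHom.comp_apply, comp_aeval]
          congr 1
          congr 1
          funext j
          fin_cases j
          · simp [hlx, Planar.ξ]
            ring
          · simp [hlx, Planar.ξ]
            ring)
  rw [← hop]
  have hb : ∀ q : PlaneIdx P i₀ k₀ × PlaneIdx P i₀ k₀, D.det q.1 q.2 ≠ 0 →
      brk b q.1.1 q.2.1 (f q.1.1 q.2.1) =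
        opr b (dualFst h) (dualSnd h) (Q q) ⁅Ell.t b q.1.1, Ell.t b q.2.1⁆ := by
    rintro ⟨i, k⟩ hd
    simp only [hQ, if_neg hd, hlx]
    have hd1 : P.root' i.1 (dualFst h) * P.root' k.1 (dualSnd h) -
        P.root' k.1 (dualFst h) * P.root' i.1 (dualSnd h) ≠ 0 := hd
    have hd2 : P.root' k.1 (dualFst h) * P.root' i.1 (dualSnd h) -
        P.root' i.1 (dualFst h) * P.root' k.1 (dualSnd h) ≠ 0 := by
      rw [← neg_ne_zero, neg_sub]
      exact hd1
    apply brk_eq_opr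
    all_goals
      simp only [map_add, map_smul, smul_eq_mul, hD, planeData, Planar.det]
      generalize P.root' i.1 (dualFst h) = xi at hd1 hd2 ⊢
      generalize P.root' i.1 (dualSnd h) = yi at hd1 hd2 ⊢
      generalize P.root' k.1 (dualFst h) = xk at hd1 hd2 ⊢
      generalize P.root' k.1 (dualSnd h) = yk at hd1 hd2 ⊢
      rw [div_mul_eq_mul_div, div_mul_eq_mul_div, ← add_div, div_eq_iff (by assumption)]
      ring
  refine Finset.sum_bij_ne_zero
    (fun q hq _ => ((⟨q.1, ?_⟩, ⟨q.2, ?_⟩) : PlaneIdx P i₀ k₀ × PlaneIdx P i₀ k₀)) ?_ ?_ ?_ ?_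
  · rw [← (Finset.mem_filter.1 hq).2.2]
    exact Submodule.subset_span (by simp)
  · rw [← (Finset.mem_filter.1 hq).2.2]
    exact Submodule.subset_span (by simp)
  · intros
    exact Finset.mem_univ _
  · rintro ⟨i, k⟩ _ _ ⟨i', k'⟩ _ _ e
    exact Prod.ext (congrArg (fun q => q.1.1) e) (congrArg (fun q => q.2.1) e)
  · rintro ⟨i, k⟩ _ hne
    have hd : D.det i k ≠ 0 := by
      intro hd
      simp [hQ, hd] at hne
    refine ⟨(i.1, k.1), ?_, ?_, rfl⟩
    · simp only [Finset.mem_filter, Finset.mem_univ, true_and]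
      exact ⟨(det_planeData h i k).1 hd, hcoord i k hd⟩
    · rwa [hb (i, k) hd]
  · rintro ⟨i, k⟩ hq _
    simp only [Finset.mem_filter, Finset.mem_univ, true_and] at hq
    have hi : P.root i ∈ Submodule.span ℂ {P.root i₀, P.root k₀} := by
      rw [← hq.2]
      exact Submodule.subset_span (by simp)
    have hk : P.root k ∈ Submodule.span ℂ {P.root i₀, P.root k₀} := by
      rw [← hq.2]
      exact Submodule.subset_span (by simp)
    exact hb (⟨i, hi⟩, ⟨k, hk⟩) ((det_planeData h ⟨i, hi⟩ ⟨k, hk⟩).2 hq.1)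

/-- A sum of brackets over pairs of independent roots vanishes if the corresponding scalar
identities hold in all planes. -/
theorem sum_brk_eq_zero (f : ι → ι → MvPolynomial (Fin 2) ℂ)
    (hf : ∀ i₀ k₀ (h : LinearIndependent ℂ ![P.root i₀, P.root k₀]) e,
      (planeData b h).IsWeight e → ∀ p₁ p₂, (planeData b h).Gen p₁ p₂ →
        ∑ i, ∑ k, e i k * eval ![(planeData b h).ξ p₁ p₂ i k, (planeData b h).ξ p₁ p₂ k i]
          (f i.1 k.1) = 0) :
    open Classical in
    ∑ i, ∑ k, (if LinearIndependent ℂ ![P.root i, P.root k] then brk b i k (f i k) else 0) = 0 := by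
  classical
  rw [← Finset.sum_product', Finset.univ_product_univ, ← Finset.sum_filter]
  refine (Finset.sum_fiberwise_of_maps_to (t := (Finset.univ : Finset (ι × ι)).image
      fun q => Submodule.span ℂ {P.root q.1, P.root q.2})
    (fun q _ => Finset.mem_image_of_mem _ (Finset.mem_univ q)) _).symm.trans
    (Finset.sum_eq_zero fun pl _ => ?_)
  by_cases hex : ∃ q : ι × ι, LinearIndependent ℂ ![P.root q.1, P.root q.2] ∧
      Submodule.span ℂ {P.root q.1, P.root q.2} = pl
  swap
  · refine Finset.sum_eq_zero fun q hq => ?_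
    simp only [Finset.mem_filter, Finset.mem_univ, true_and] at hq
    exact absurd ⟨q, hq⟩ hex
  obtain ⟨⟨i₀, k₀⟩, h, rfl⟩ := hex
  rw [Finset.filter_filter]
  exact sum_brk_plane_eq_zero h f (hf i₀ k₀ h)

end Brackets

end EllipticKZB

end

noncomputable section

namespace EllipticKZB

open Filter Topology PowerSeries
open scoped PowerSeries.WithPiTopology

/-! ### Parity and the degenerate Fay identity -/

theorem rescale_C (a w : ℂ) : rescale a (C w) = C w := by
  ext j
  rw [coeff_rescale, coeff_C]
  split_ifs with hj <;> simp [hj]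

theorem constantCoeff_rescale (a : ℂ) (f : ℂ⟦X⟧) :
    constantCoeff (rescale a f) = constantCoeff f := by
  rw [← coeff_zero_eq_constantCoeff_apply, coeff_rescale, pow_zero, one_mul,
    coeff_zero_eq_constantCoeff_apply]

theorem derivative_expS (c : ℂ) : derivative ℂ (expS c) = C c * expS c := by
  ext n
  rw [coeff_derivative, coeff_C_mul, expS, coeff_rescale, coeff_rescale, coeff_exp, coeff_exp]
  simp only [Nat.factorial_succ]
  push_cast
  have : (n : ℂ) + 1 ≠ 0 := by exact_mod_cast n.succ_ne_zero
  have h2 : (n.factorial : ℂ) ≠ 0 := by exact_mod_cast n.factorial_ne_zero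
  simp
  field_simp
  ring

namespace IsKron

variable {τ : ℂ} {Γ : ℂ⟦X⟧} {κ : ℂ → ℂ⟦X⟧} (h : IsKron τ Γ κ)
include h

theorem neg {z : ℂ} (hz : z ∉ lat τ) : κ (-z) = rescale (-1) (κ z) := by
  have hn : ∀ z ∉ lat τ, -z ∉ lat τ := fun z hz h => hz (by simpa using neg_mem h)
  refine sub_eq_zero.1 (eq_zero_of_quasiPeriodic (τ := τ) (μ := twoPiI)
    (f := fun z => κ (-z) - rescale (-1) (κ z)) ?_ h.im_pos twoPiI_ne_zero ?_ ?_ ?_ hz)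
  · intro z hz
    have h1 : κ (-(z + 1)) = κ (-z) := by
      rw [← h.per_int (hn z hz) (-1)]
      push_cast
      ring_nf
    rw [h1, h.per hz]
  · intro z hz
    have h1 : κ (-(z + τ)) = expS twoPiI * κ (-z) := by
      have := h.per_lat (hn z hz) 0 (-1)
      push_cast at this
      rw [mul_neg_one, neg_neg] at this
      rw [← this]
      ring_nf
    rw [h1, h.perτ hz, map_mul, rescale_expS, mul_neg_one, neg_neg]
    ring
  · intro z hz
    have h1 : CoeffDiffAt (fun z => κ (-z)) z := by
      have : -z = 0 + (-1) * z := by ring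
      have h2 := hn z hz
      rw [this] at h2
      have h3 := (h.hol h2).comp_affine
      simpa using h3
    exact h1.sub ((h.hol hz).rescale _)
  · have h1 : Tendsto (fun z : ℂ => -z) (𝓝[≠] 0) (𝓝[≠] 0) := by
      refine tendsto_nhdsWithin_iff.2 ⟨?_, ?_⟩
      · have : Tendsto (fun z : ℂ => -z) (𝓝 0) (𝓝 (-0)) := continuous_neg.tendsto 0
        rw [neg_zero] at this
        exact this.mono_left nhdsWithin_le_nhds
      · filter_upwards [self_mem_nhdsWithin] with s hs using neg_ne_zero.2 hs
    have h2 := (h.res.comp h1).neg.sub (tendsto_rescale (-1) h.res)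
    rw [rescale_X, map_neg, map_one, neg_one_mul, sub_self] at h2
    refine h2.congr fun z => ?_
    simp only [Function.comp_apply, map_neg, map_mul, rescale_C]
    ring

/-- The degenerate Fay identity. -/
theorem degenerate_fay {c : ℂ⟦X⟧} {c₀ : ℂ} (hΓ : Γ = -1 + X ^ 2 * (C c₀ - c)) {a b : ℂ}
    (hab : a + b ≠ 0) {z : ℂ} (hz : z ∉ lat τ) :
    C (a + b) * X * (C a * X * rescale a (κ z) * rescale b (X * derivative ℂ (κ z) - κ z) -
      C b * X * rescale b (κ z) * rescale a (X * derivative ℂ (κ z) - κ z)) =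
    rescale (a + b) (κ z) * (C (b ^ 2 - a ^ 2) * X ^ 2 +
      C (a ^ 2 * b ^ 2) * X ^ 4 * (rescale a c - rescale b c)) := by
  have hμ : -twoPiI * (a + b) ≠ 0 := mul_ne_zero (neg_ne_zero.2 twoPiI_ne_zero) hab
  refine sub_eq_zero.1 (eq_zero_of_quasiPeriodic (τ := τ)
    (f := fun z => C (a + b) * X *
      (C a * X * rescale a (κ z) * rescale b (X * derivative ℂ (κ z) - κ z) -
        C b * X * rescale b (κ z) * rescale a (X * derivative ℂ (κ z) - κ z)) -
      rescale (a + b) (κ z) * (C (b ^ 2 - a ^ 2) * X ^ 2 +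
        C (a ^ 2 * b ^ 2) * X ^ 4 * (rescale a c - rescale b c))) ?_ h.im_pos hμ ?_ ?_ ?_ hz)
  · intro z hz
    rw [h.per hz]
  · intro z hz
    have e : expS (-twoPiI * (a + b)) = expS (-twoPiI * a) * expS (-twoPiI * b) := by
      rw [← expS_add, mul_add]
    have d : derivative ℂ (expS (-twoPiI) * κ z) =
        expS (-twoPiI) * (derivative ℂ (κ z) + C (-twoPiI) * κ z) := by
      rw [Derivation.leibniz, derivative_expS, smul_eq_mul, smul_eq_mul]
      ring
    rw [h.perτ hz, d]
    simp only [map_mul, map_sub, map_add, rescale_expS, rescale_C, rescale_X, e]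
    ring
  · intro z hz
    have h1 := h.hol hz
    have h2 := ((CoeffDiffAt.const X).mul h1.derivative).sub h1
    exact ((CoeffDiffAt.const _).mul ((((CoeffDiffAt.const _).mul (h1.rescale a)).mul
      (h2.rescale b)).sub (((CoeffDiffAt.const _).mul (h1.rescale b)).mul (h2.rescale a)))).sub
      ((h1.rescale (a + b)).mul (CoeffDiffAt.const _))
  · have h1 := (((((tendsto_rescale a h.res).const_mul (C a * X)).mul (tendsto_rescale b h.fay)).sub
      (((tendsto_rescale b h.res).const_mul (C b * X)).mul (tendsto_rescale a h.fay))).const_mul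
        (C (a + b) * X)).sub ((tendsto_rescale (a + b) h.res).mul_const
          (C (b ^ 2 - a ^ 2) * X ^ 2 + C (a ^ 2 * b ^ 2) * X ^ 4 * (rescale a c - rescale b c)))
    convert h1 using 2 with z
    · simp only [map_mul, map_sub, map_add, map_pow, rescale_C, rescale_X]
      ring
    · rw [hΓ]
      simp only [map_mul, map_sub, map_add, map_neg, map_one, map_pow, rescale_C, rescale_X]
      ring

end IsKron

/-! ### The diagonal terms -/

/-- The coefficient polynomials of the diagonal terms. -/
def diagPoly (K c : ℕ → ℂ) (J : ℕ) : MvPolynomial (Fin 2) ℂ :=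
  ∑ p ∈ Finset.HasAntidiagonal.antidiagonal J,
      MvPolynomial.C (K (p.1 + 1) * ((p.2 + 1) * K (p.2 + 2))) *
        (MvPolynomial.X 0 ^ p.1 * MvPolynomial.X 1 ^ p.2) +
    ∑ p ∈ Finset.HasAntidiagonal.antidiagonal J, MvPolynomial.C (c p.2 * K (p.1 + 1)) *
      ((MvPolynomial.X 0 + MvPolynomial.X 1) ^ p.1 * MvPolynomial.X 1 ^ p.2) -
    MvPolynomial.C (c (J + 1) / 2) * ∑ p ∈ Finset.HasAntidiagonal.antidiagonal J,
      MvPolynomial.C ((-1) ^ p.2) * (MvPolynomial.X 0 ^ p.1 * MvPolynomial.X 1 ^ p.2) -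
    MvPolynomial.C (K (J + 3)) * ∑ p ∈ Finset.HasAntidiagonal.antidiagonal J,
      MvPolynomial.C (p.2 + 1 : ℂ) *
        ((MvPolynomial.X 0 + MvPolynomial.X 1) ^ p.1 * MvPolynomial.X 1 ^ p.2)

theorem sq_mul_sum_antidiagonal (a b : ℂ) (n : ℕ) :
    a ^ 2 * ∑ p ∈ Finset.HasAntidiagonal.antidiagonal n, (p.2 + 1 : ℂ) * ((a + b) ^ p.1 * b ^ p.2) =
      (a + b) ^ (n + 2) - (n + 2) * a * b ^ (n + 1) - b ^ (n + 2) := by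
  induction n with
  | zero => simp; ring
  | succ n ih =>
    rw [Finset.Nat.sum_antidiagonal_succ, mul_add]
    have : ∑ p ∈ Finset.HasAntidiagonal.antidiagonal n,
        (p.2 + 1 : ℂ) * ((a + b) ^ (p.1 + 1) * b ^ p.2) = (a + b) *
        ∑ p ∈ Finset.HasAntidiagonal.antidiagonal n, (p.2 + 1 : ℂ) * ((a + b) ^ p.1 * b ^ p.2) := by
      rw [Finset.mul_sum]
      exact Finset.sum_congr rfl fun p _ => by ring
    simp only at this ⊢
    rw [this]
    push_cast
    linear_combination (a + b) * ih

/-- The diagonal polynomials are symmetric. -/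
theorem IsKron.diagPoly_swap {τ : ℂ} {Γ : ℂ⟦X⟧} {κ : ℂ → ℂ⟦X⟧} (h : IsKron τ Γ κ) {c : ℂ⟦X⟧}
    {c₀ : ℂ} (hΓ : Γ = -1 + X ^ 2 * (C c₀ - c)) (hc : ∀ j, Odd j → coeff j c = 0)
    {z : ℂ} (hz : z ∉ lat τ) (J : ℕ) :
    MvPolynomial.rename (Equiv.swap (0 : Fin 2) 1)
      (diagPoly (fun j => coeff j (κ z)) (fun j => coeff j c) J) =
        diagPoly (fun j => coeff j (κ z)) (fun j => coeff j c) J := by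
  set K : ℕ → ℂ := fun j => coeff j (κ z) with hK
  set F : ℕ → MvPolynomial (Fin 2) ℂ := diagPoly K (fun j => coeff j c) with hF
  set k : ℂ⟦X⟧ := PowerSeries.mk fun n => K (n + 1) with hk
  have hκ : κ z = 1 + X * k := by
    ext n
    cases n with
    | zero => simp [h.const hz]
    | succ n => simp [coeff_succ_X_mul, hk, hK, coeff_one]
  set g := derivative ℂ k with hg
  have hE : X * derivative ℂ (κ z) - κ z = -1 + X ^ 2 * g := by
    rw [hκ, map_add, Derivation.leibniz, ← hg, derivative_X]
    simp only [smul_eq_mul, Derivation.map_one_eq_zero]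
    ring
  set V : ℂ → ℂ → ℂ⟦X⟧ := fun a b => PowerSeries.mk fun J => K (J + 3) *
    ∑ p ∈ Finset.HasAntidiagonal.antidiagonal J, (p.2 + 1 : ℂ) * ((a + b) ^ p.1 * b ^ p.2) with hV
  set U : ℂ → ℂ → ℂ⟦X⟧ := fun a b => PowerSeries.mk fun J => coeff (J + 1) c *
    ∑ p ∈ Finset.HasAntidiagonal.antidiagonal J, (-1) ^ p.2 * (a ^ p.1 * b ^ p.2) with hU
  have hVeq : ∀ a b, C (a ^ 2) * X ^ 2 * V a b =
      rescale (a + b) k - C a * X * rescale b g - rescale b k := by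
    intro a b
    ext n
    rcases n with _ | _ | n
    · simp [mul_assoc, constantCoeff_rescale]
    · rw [mul_assoc, coeff_C_mul, coeff_X_pow_mul', if_neg (by omega), mul_zero, mul_assoc, map_sub,
        map_sub, coeff_C_mul, coeff_succ_X_mul]
      simp [hk, hg, coeff_derivative]
      ring
    · rw [mul_assoc, coeff_C_mul, coeff_X_pow_mul', if_pos (by omega), mul_assoc, map_sub, map_sub,
        coeff_C_mul, coeff_succ_X_mul, hV, coeff_mk, mul_left_comm]
      rw [show n + 1 + 1 - 2 = n by omega, sq_mul_sum_antidiagonal]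
      simp only [coeff_rescale, hk, hg, coeff_derivative, coeff_mk]
      push_cast
      ring
  have hUeq : ∀ a b, C (a + b) * X * U a b = rescale a c - rescale b c := by
    intro a b
    ext n
    rcases n with _ | n
    · simp [mul_assoc, constantCoeff_rescale]
    · have h1 : ∑ p ∈ Finset.HasAntidiagonal.antidiagonal n, (-1) ^ p.2 * (a ^ p.1 * b ^ p.2) =
          ∑ p ∈ Finset.HasAntidiagonal.antidiagonal n, a ^ p.1 * (-b) ^ p.2 :=
        Finset.sum_congr rfl fun p _ => by rw [neg_pow b]; ring
      have h2 := sub_mul_sum_antidiagonal a (-b) n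
      rw [sub_neg_eq_add] at h2
      rw [mul_assoc, coeff_C_mul, coeff_succ_X_mul, hU, coeff_mk, mul_left_comm, h1, h2, map_sub,
        coeff_rescale, coeff_rescale]
      rcases Nat.even_or_odd (n + 1) with he | ho
      · rw [he.neg_pow]
        ring
      · rw [hc _ ho]
        ring
  set H : ℂ → ℂ → ℂ⟦X⟧ := fun a b => PowerSeries.mk fun J => MvPolynomial.eval ![a, b] (F J) with hH
  have hHeq : ∀ a b, H a b = rescale a k * rescale b g + rescale b c * rescale (a + b) k -
      C (1 / 2) * U a b - V a b := by
    intro a b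
    ext n
    rw [map_sub, map_sub, map_add, coeff_C_mul, coeff_mul, mul_comm (rescale b c), coeff_mul,
      hH, hU, hV, hF]
    simp only [coeff_mk, diagPoly, map_sub, map_add, map_mul, map_sum, MvPolynomial.eval_C, map_pow,
      MvPolynomial.eval_X, Matrix.cons_val_zero, Matrix.cons_val_one, coeff_rescale, hk, hg,
      coeff_derivative]
    congr 1
    congr 1
    · congr 1
      · exact Finset.sum_congr rfl fun p _ => by ring
      · exact Finset.sum_congr rfl fun p _ => by ring
    ring
  have hswap : ∀ a b, a + b ≠ 0 → a ≠ 0 → b ≠ 0 → H a b = H b a := by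
    intro a b hab ha hb
    have hf := h.degenerate_fay hΓ hab hz
    rw [hE, hκ] at hf
    simp only [map_add, map_mul, map_neg, map_one, map_pow, rescale_X, map_sub] at hf
    have hab' := hUeq a b
    have hba' := hUeq b a
    have hv := hVeq a b
    have hv' := hVeq b a
    rw [add_comm b a] at hba' hv'
    have hM : (C (a ^ 2 * b ^ 2 * (a + b)) * X ^ 5 : ℂ⟦X⟧) ≠ 0 :=
      mul_ne_zero (by
        rw [Ne, map_eq_zero_iff _ (C_injective (R := ℂ))]
        exact mul_ne_zero (mul_ne_zero (pow_ne_zero 2 ha) (pow_ne_zero 2 hb)) hab)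
        (pow_ne_zero _ X_ne_zero)
    refine mul_left_cancel₀ hM ?_
    rw [hHeq, hHeq, add_comm b a]
    simp only [map_add, map_mul, map_pow] at hab' hba' hv hv' ⊢
    have h2 : (C (1 / 2) : ℂ⟦X⟧) + C (1 / 2) = 1 := by
      rw [← map_add]
      norm_num
    linear_combination hf - C a ^ 2 * C b ^ 2 * X ^ 4 * C (1 / 2) * (hab' - hba') -
      (C a + C b) * X ^ 3 * C b ^ 2 * hv + (C a + C b) * X ^ 3 * C a ^ 2 * hv' -
      C a ^ 2 * C b ^ 2 * X ^ 4 * (rescale a c - rescale b c) * h2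
  have hR : (MvPolynomial.X 0 * MvPolynomial.X 1 * (MvPolynomial.X 0 + MvPolynomial.X 1) :
      MvPolynomial (Fin 2) ℂ) ≠ 0 := by
    intro e
    have := congrArg (MvPolynomial.eval ![1, 1]) e
    simp at this
  refine sub_eq_zero.1 (mvPolynomial_eq_zero_of_eval hR fun p hp => ?_)
  simp only [map_mul, map_add, MvPolynomial.eval_X] at hp
  have h1 := congrArg (coeff J) (hswap (p 0) (p 1) (right_ne_zero_of_mul hp)
    (left_ne_zero_of_mul (left_ne_zero_of_mul hp)) (right_ne_zero_of_mul (left_ne_zero_of_mul hp)))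
  rw [hH, coeff_mk, coeff_mk] at h1
  have e1 : p = ![p 0, p 1] := by
    funext i
    fin_cases i <;> rfl
  have e2 : p ∘ (Equiv.swap (0 : Fin 2) 1) = ![p 1, p 0] := by
    funext i
    fin_cases i <;> simp
  rw [map_sub, MvPolynomial.eval_rename, e2, sub_eq_zero]
  nth_rewrite 3 [e1]
  exact h1.symm

end EllipticKZB

end

noncomputable section

namespace EllipticKZB

open MvPolynomial

section LieIdentities

variable {ι 𝔥 M : Type*} [Fintype ι] [AddCommGroup 𝔥] [Module ℂ 𝔥] [AddCommGroup M] [Module ℂ M]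
variable {P : RootPairing ι ℂ M 𝔥} {b : P.Base}

/-! ### Brackets of `y(u)` and of `Δ̃₀` with `(ad x_α)^m t_α` -/

/-- The polynomial `∑_{p+q=m} (aX + Y)^p Y^q`. -/
def geomPoly (m : ℕ) (a : ℂ) : MvPolynomial (Fin 2) ℂ :=
  ∑ p ∈ Finset.HasAntidiagonal.antidiagonal m, (C a * X 0 + X 1) ^ p.1 * X 1 ^ p.2

/-- The polynomial `∑_{p+q=m} (p+1) (aX + Y)^p Y^q`. -/
def geomPoly' (m : ℕ) (a : ℂ) : MvPolynomial (Fin 2) ℂ :=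
  ∑ p ∈ Finset.HasAntidiagonal.antidiagonal m,
    C (p.1 + 1 : ℂ) * ((C a * X 0 + X 1) ^ p.1 * X 1 ^ p.2)

theorem geomPoly_zero (a : ℂ) : geomPoly 0 a = 1 := by simp [geomPoly]

theorem geomPoly'_zero (a : ℂ) : geomPoly' 0 a = 1 := by simp [geomPoly']

theorem geomPoly_succ (m : ℕ) (a : ℂ) :
    geomPoly (m + 1) a = X 1 ^ (m + 1) + (C a * X 0 + X 1) * geomPoly m a := by
  rw [geomPoly, Finset.Nat.sum_antidiagonal_succ, geomPoly, Finset.mul_sum, pow_zero, one_mul]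
  congr 1
  exact Finset.sum_congr rfl fun p _ => by ring

theorem geomPoly'_succ (m : ℕ) (a : ℂ) :
    geomPoly' (m + 1) a = geomPoly (m + 1) a + (C a * X 0 + X 1) * geomPoly' m a := by
  rw [geomPoly_succ, geomPoly', Finset.Nat.sum_antidiagonal_succ, geomPoly', geomPoly,
    Finset.mul_sum, Finset.mul_sum, add_assoc, ← Finset.sum_add_distrib]
  simp only [Nat.cast_zero, zero_add, map_one, one_mul, pow_zero]
  congr 1
  refine Finset.sum_congr rfl fun p _ => ?_
  push_cast
  rw [map_add (C) (p.1 + 1 : ℂ) 1, map_one]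
  ring

/-- The number `γ(β^∨)/2`. -/
def halfPair (P : RootPairing ι ℂ M 𝔥) (i k : ι) : ℂ := P.root' i (P.coroot k) / 2

theorem halfPair_self (i : ι) : halfPair P i i = 1 := by
  rw [halfPair, root'_coroot_self, div_self two_ne_zero]

theorem halfPair_negIdx (i k : ι) : halfPair P (negIdx P i) k = -halfPair P i k := by
  rw [halfPair, root'_negIdx, LinearMap.neg_apply, neg_div, halfPair]

theorem half_smul_lie_x_brk (i k : ι) (f : MvPolynomial (Fin 2) ℂ) :
    (1 / 2 : ℂ) • ⁅Ell.x b (P.coroot k), brk b i k f⁆ =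
      brk b i k ((C (halfPair P i k) * X 0 + X 1) * f) := by
  rw [lie_x_brk, ← brk_C_mul, root'_coroot_self, halfPair]
  congr 1
  have : (C (1 / 2) * C 2 : MvPolynomial (Fin 2) ℂ) = 1 := by
    rw [← map_mul]
    norm_num
  have e : (C (P.root' i (P.coroot k) / 2) : MvPolynomial (Fin 2) ℂ) =
      C (1 / 2) * C (P.root' i (P.coroot k)) := by
    rw [← map_mul, div_eq_inv_mul, one_div]
  rw [e]
  linear_combination X 1 * f * this

theorem Ell.lie_y_t_of_eq_zero {k : ι} {w : 𝔥} (hw : P.root' k w = 0) :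
    ⁅Ell.y b w, Ell.t b k⁆ = 0 := by
  rw [← lie_skew, Ell.lie_t_y_of_eq_zero k w hw, neg_zero]

variable [P.IsRootSystem]

theorem Ell.half_lie_lie_y_x_tx (u : 𝔥) (k : ι) (m : ℕ) :
    (1 / 2 : ℂ) • ⁅⁅Ell.y b u, Ell.x b (P.coroot k)⁆, Ell.tx b k m⁆ =
      (1 / 2 : ℂ) • ∑ i, (P.root' i u * halfPair P i k) • brk b i k (X 1 ^ m) := by
  rw [Ell.lie_y_x, smul_lie, sum_lie]
  simp only [smul_lie, brk_X_one_pow, Finset.smul_sum, smul_smul]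
  refine Finset.sum_congr rfl fun i _ => ?_
  rw [halfPair]
  congr 1
  ring

theorem Ell.lie_y_tx {k : ι} {w : 𝔥} (hw : P.root' k w = 0) (m : ℕ) :
    ⁅Ell.y b w, Ell.tx b k (m + 1)⁆ = (1 / 2 : ℂ) •
      ∑ i, (P.root' i w * halfPair P i k) • brk b i k (geomPoly m (halfPair P i k)) := by
  induction m with
  | zero =>
    rw [Ell.tx_succ, lie_smul, leibniz_lie, smul_add, Ell.half_lie_lie_y_x_tx, Ell.tx_zero,
      Ell.lie_y_t_of_eq_zero hw]
    simp [geomPoly_zero]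
  | succ m ih =>
    rw [Ell.tx_succ, lie_smul, leibniz_lie, smul_add, Ell.half_lie_lie_y_x_tx, ih, lie_smul,
      lie_sum, smul_comm, Finset.smul_sum (r := (1 / 2 : ℂ)) (f := fun i =>
        ⁅Ell.x b (P.coroot k), _⁆), ← smul_add, ← Finset.sum_add_distrib]
    congr 1
    refine Finset.sum_congr rfl fun i _ => ?_
    rw [lie_smul, smul_comm, half_smul_lie_x_brk, ← smul_add, ← map_add, geomPoly_succ]

/-- `α(u) Δ̃₀((ad x_α)^m t_α) - m [y(u), (ad x_α)^{m-1} t_α]` for `m ≥ 2`. -/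
theorem derΔ_tx_sub (k : ι) (u : 𝔥) (m : ℕ) :
    P.root' k u • derΔ b (Ell.tx b k (m + 1)) - (m + 1 : ℂ) • ⁅Ell.y b u, Ell.tx b k m⁆ =
      (1 / 2 : ℂ) • ∑ i, brk b i k (if m = 0 then 0 else
        C (P.root' k u * halfPair P i k ^ 2) * geomPoly' (m - 1) (halfPair P i k) -
        C (P.root' i u * (m + 1) * halfPair P i k) * geomPoly (m - 1) (halfPair P i k)) := by
  set W : 𝔥 := (P.root' k u / 2) • P.coroot k - u with hW
  have hkW : P.root' k W = 0 := by
    rw [hW, map_sub, map_smul, root'_coroot_self, smul_eq_mul]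
    ring
  have hiW : ∀ i, P.root' i W = P.root' k u * halfPair P i k - P.root' i u := by
    intro i
    rw [hW, map_sub, map_smul, smul_eq_mul, halfPair]
    ring
  have hyW : ∀ a : Ell b, ⁅Ell.y b W, a⁆ =
      P.root' k u • (1 / 2 : ℂ) • ⁅Ell.y b (P.coroot k), a⁆ - ⁅Ell.y b u, a⁆ := by
    intro a
    rw [hW, map_sub, map_smul, sub_lie, smul_lie]
    congr 1
    module
  have hd : ∀ m, derΔ b (Ell.tx b k (m + 1)) = (1 / 2 : ℂ) • ⁅Ell.y b (P.coroot k), Ell.tx b k m⁆ +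
      (1 / 2 : ℂ) • ⁅Ell.x b (P.coroot k), derΔ b (Ell.tx b k m)⁆ := by
    intro m
    rw [Ell.tx_succ, map_smul, LieDerivation.apply_lie_eq_add, derΔ_x, smul_add, add_comm]
  induction m with
  | zero =>
    have h1 := hyW (Ell.tx b k 0)
    rw [Ell.tx_zero, Ell.lie_y_t_of_eq_zero hkW] at h1
    rw [hd, Ell.tx_zero, derΔ_t, lie_zero, smul_zero, add_zero]
    rw [Nat.cast_zero, zero_add, one_smul, ← h1]
    simp
  | succ m ih =>
    have h1 := hyW (Ell.tx b k (m + 1))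
    rw [Ell.lie_y_tx hkW] at h1
    have h2 : ⁅Ell.y b u, Ell.tx b k (m + 1)⁆ = (1 / 2 : ℂ) •
        ∑ i, (P.root' i u * halfPair P i k) • brk b i k (X 1 ^ m) +
        (1 / 2 : ℂ) • ⁅Ell.x b (P.coroot k), ⁅Ell.y b u, Ell.tx b k m⁆⁆ := by
      rw [Ell.tx_succ, lie_smul, leibniz_lie, smul_add, Ell.half_lie_lie_y_x_tx]
    have h3 := congrArg (fun a => (1 / 2 : ℂ) • ⁅Ell.x b (P.coroot k), a⁆) ih
    simp only [lie_sub, lie_smul, lie_sum, smul_sub] at h3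
    rw [smul_comm (1 / 2 : ℂ) (1 / 2 : ℂ), Finset.smul_sum (r := (1 / 2 : ℂ)) (f := fun i =>
        ⁅Ell.x b (P.coroot k), _⁆)] at h3
    simp only [half_smul_lie_x_brk] at h3
    have h4 : P.root' k u • derΔ b (Ell.tx b k (m + 1 + 1)) -
        (((m + 1 : ℕ) : ℂ) + 1) • ⁅Ell.y b u, Ell.tx b k (m + 1)⁆ =
        (1 / 2 : ℂ) • ∑ i, (P.root' i W * halfPair P i k) •
          brk b i k (geomPoly m (halfPair P i k)) -
        (m + 1 : ℂ) • (1 / 2 : ℂ) • ∑ i, (P.root' i u * halfPair P i k) • brk b i k (X 1 ^ m) +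
        (1 / 2 : ℂ) • ∑ i, brk b i k ((C (halfPair P i k) * X 0 + X 1) * (if m = 0 then 0 else
        C (P.root' k u * halfPair P i k ^ 2) * geomPoly' (m - 1) (halfPair P i k) -
        C (P.root' i u * (m + 1) * halfPair P i k) * geomPoly (m - 1) (halfPair P i k))) := by
      rw [← h3, h1, hd]
      have h5 := congrArg (fun a => (m + 1 : ℂ) • a) h2
      simp only [smul_add] at h5
      push_cast
      rw [add_smul (m + 1 : ℂ) 1, one_smul]
      linear_combination (norm := module) -h5
    rw [h4, smul_comm (m + 1 : ℂ), ← smul_sub, ← smul_add, Finset.smul_sum, ← Finset.sum_sub_distrib,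
      ← Finset.sum_add_distrib]
    congr 1
    refine Finset.sum_congr rfl fun i _ => ?_
    rw [if_neg m.succ_ne_zero]
    rw [← brk_C_mul, smul_smul, ← brk_C_mul, ← map_sub, ← map_add, hiW, Nat.add_sub_cancel]
    congr 1
    rcases m with _ | m
    · simp [geomPoly_zero, geomPoly'_zero]
      ring
    · rw [if_neg m.succ_ne_zero, Nat.add_sub_cancel, geomPoly'_succ, geomPoly_succ]
      push_cast
      simp only [map_mul, map_sub, map_add, map_one, map_pow]
      ring

/-! ### The coefficients of the connection -/

variable (P) in
/-- The coefficients of the Kronecker function at `α_i(z)`. -/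
def kronCoeff (κ : ℂ → PowerSeries ℂ) (z : 𝔥) (i : ι) (j : ℕ) : ℂ :=
  PowerSeries.coeff j (κ (P.root' i z))

variable (b) in
/-- The component `½ ∑_α α(u) k_m(α) (ad x_α)^m t_α` of the connection. -/
def connCoeff (K : ι → ℕ → ℂ) (u : 𝔥) (m : ℕ) : Ell b :=
  (1 / 2 : ℂ) • ∑ i, (P.root' i u * K i (m + 1)) • Ell.tx b i m

variable (b) in
/-- The homogeneous components of the connection in the direction `u`. -/
def connShift (K : ι → ℕ → ℂ) (u : 𝔥) : ℕ → Ell b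
  | 0 => -Ell.y b u
  | m + 1 => connCoeff b K u m

variable (b) in
/-- The component `½ ∑_α g_m(α) (ad x_α)^m t_α`. -/
def gCoeff (K : ι → ℕ → ℂ) (m : ℕ) : Ell b :=
  (1 / 2 : ℂ) • ∑ i, ((m + 1) * K i (m + 2)) • Ell.tx b i m

variable (b) in
/-- The homogeneous components of `½ ∑_α g(α, ad x_α) t_α`. -/
def gShift (K : ι → ℕ → ℂ) : ℕ → Ell b
  | 0 => 0
  | 1 => 0
  | m + 2 => gCoeff b K m

theorem lie_y_connCoeff_sub (K : ι → ℕ → ℂ) (u v : 𝔥) (m : ℕ) :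
    ⁅Ell.y b u, connCoeff b K v m⁆ - ⁅Ell.y b v, connCoeff b K u m⁆ =
      (1 / 2 : ℂ) • ∑ k, K k (m + 1) •
        ⁅Ell.y b (P.root' k v • u - P.root' k u • v), Ell.tx b k m⁆ := by
  simp only [connCoeff, lie_smul, lie_sum, ← smul_sub, ← Finset.sum_sub_distrib, map_sub, map_smul,
    sub_lie, smul_lie]
  congr 1
  refine Finset.sum_congr rfl fun k _ => ?_
  module

theorem root'_smul_sub_smul (k : ι) (u v : 𝔥) :
    P.root' k (P.root' k v • u - P.root' k u • v) = 0 := by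
  rw [map_sub, map_smul, map_smul, smul_eq_mul, smul_eq_mul, mul_comm, sub_self]

theorem sum_sum_brk_antisymm (c : ι → ι → ℂ) (f : ι → ι → MvPolynomial (Fin 2) ℂ)
    (hf : ∀ i k, rename (Equiv.swap (0 : Fin 2) 1) (f k i) = f i k) :
    ∑ i, ∑ k, c i k • brk b i k (f i k) =
      (1 / 2 : ℂ) • ∑ i, ∑ k, (c i k - c k i) • brk b i k (f i k) := by
  have h : ∑ i, ∑ k, c i k • brk b i k (f i k) = -∑ i, ∑ k, c k i • brk b i k (f i k) := by
    rw [Finset.sum_comm, ← Finset.sum_neg_distrib]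
    refine Finset.sum_congr rfl fun i _ => ?_
    rw [← Finset.sum_neg_distrib]
    refine Finset.sum_congr rfl fun k _ => ?_
    rw [← hf i k, brk_swap, smul_neg, neg_neg]
  simp only [sub_smul, Finset.sum_sub_distrib]
  rw [sub_eq_add_neg, ← h]
  module

theorem lie_connCoeff_connCoeff (K : ι → ℕ → ℂ) (u v : 𝔥) (n : ℕ) :
    ∑ p ∈ Finset.HasAntidiagonal.antidiagonal n, ⁅connCoeff b K u p.1, connCoeff b K v p.2⁆ =
      (1 / 8 : ℂ) • ∑ i, ∑ k, (P.root' i u * P.root' k v - P.root' k u * P.root' i v) •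
        brk b i k (∑ p ∈ Finset.HasAntidiagonal.antidiagonal n,
          C (K i (p.1 + 1) * K k (p.2 + 1)) * (X 0 ^ p.1 * X 1 ^ p.2)) := by
  have h1 : ∑ p ∈ Finset.HasAntidiagonal.antidiagonal n,
      ⁅connCoeff b K u p.1, connCoeff b K v p.2⁆ =
      (1 / 4 : ℂ) • ∑ i, ∑ k, (P.root' i u * P.root' k v) •
        brk b i k (∑ p ∈ Finset.HasAntidiagonal.antidiagonal n,
          C (K i (p.1 + 1) * K k (p.2 + 1)) * (X 0 ^ p.1 * X 1 ^ p.2)) := by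
    simp only [map_sum, Finset.smul_sum, brk_C_mul, brk_mul, connCoeff, smul_lie, lie_smul,
      sum_lie, lie_sum, smul_smul]
    rw [Finset.sum_comm, Finset.sum_comm (s := (Finset.univ : Finset ι)) (t := Finset.univ)]
    refine Finset.sum_congr rfl fun k _ => ?_
    rw [Finset.sum_comm]
    refine Finset.sum_congr rfl fun i _ => Finset.sum_congr rfl fun p _ => ?_
    congr 1
    ring
  rw [h1, sum_sum_brk_antisymm, smul_smul]
  · norm_num
  · intro i k
    simp only [map_sum, map_mul, rename_C, map_pow, rename_X, Equiv.swap_apply_left,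
      Equiv.swap_apply_right]
    rw [← Finset.Nat.sum_antidiagonal_swap]
    refine Finset.sum_congr rfl fun p _ => ?_
    simp only [Prod.fst_swap, Prod.snd_swap]
    ring

variable [P.IsReduced]

theorem sum_brk_eq_zero' (f : ι → ι → MvPolynomial (Fin 2) ℂ)
    (hdep : ∀ i k, ¬ LinearIndependent ℂ ![P.root i, P.root k] → f i k = 0)
    (hf : ∀ i₀ k₀ (h : LinearIndependent ℂ ![P.root i₀, P.root k₀]) e,
      (planeData b h).IsWeight e → ∀ p₁ p₂, (planeData b h).Gen p₁ p₂ →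
        ∑ i, ∑ k, e i k * eval ![(planeData b h).ξ p₁ p₂ i k, (planeData b h).ξ p₁ p₂ k i]
          (f i.1 k.1) = 0) :
    ∑ i, ∑ k, brk b i k (f i k) = 0 := by
  classical
  rw [← sum_brk_eq_zero (b := b) f hf]
  refine Finset.sum_congr rfl fun i _ => Finset.sum_congr rfl fun k _ => ?_
  split_ifs with hik
  · rfl
  · rw [hdep i k hik, map_zero]

theorem planeData_root' {i₀ k₀ : ι} (h : LinearIndependent ℂ ![P.root i₀, P.root k₀])
    (i : PlaneIdx P i₀ k₀) (u : 𝔥) : P.root' i.1 u =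
      (planeData b h).x i * P.root' i₀ u + (planeData b h).y i * P.root' k₀ u :=
  root'_eq_of_plane h i u

theorem planeData_halfPair {i₀ k₀ : ι} (h : LinearIndependent ℂ ![P.root i₀, P.root k₀])
    (i k : PlaneIdx P i₀ k₀) : halfPair P i.1 k.1 =
      (planeData b h).x i * halfPair P i₀ k.1 + (planeData b h).y i * halfPair P k₀ k.1 := by
  rw [halfPair, root'_eq_of_plane h i, halfPair, halfPair]
  change _ = P.root' i.1 (dualFst h) * _ + P.root' i.1 (dualSnd h) * _
  ring

theorem eval_geom_base {i₀ k₀ : ι} (h : LinearIndependent ℂ ![P.root i₀, P.root k₀])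
    {i k : PlaneIdx P i₀ k₀} {p₁ p₂ : ℂ} (hd : (planeData b h).det i k ≠ 0) :
    halfPair P i.1 k.1 * (planeData b h).ξ p₁ p₂ i k + (planeData b h).ξ p₁ p₂ k i =
      p₁ * halfPair P i₀ k.1 + p₂ * halfPair P k₀ k.1 := by
  have h1 := Planar.mul_ξ_add (D := planeData b h) (p₁ := p₁) (p₂ := p₂) hd
    (halfPair P i₀ k.1) (halfPair P k₀ k.1)
  rw [← planeData_halfPair h, ← planeData_halfPair h, halfPair_self, one_mul] at h1
  rw [h1]
  ring

theorem omega_eq_zero {i k : ι} (h : ¬ LinearIndependent ℂ ![P.root i, P.root k]) (u v : 𝔥) :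
    P.root' i u * P.root' k v - P.root' k u * P.root' i v = 0 := by
  rcases eq_or_eq_negIdx h with e | e
  · rw [e, sub_self]
  · rw [e, root'_negIdx, LinearMap.neg_apply, LinearMap.neg_apply]
    ring

variable {τ : ℂ} {Γ : PowerSeries ℂ} {κ : ℂ → PowerSeries ℂ} (h : IsKron τ Γ κ) {z : 𝔥}
  (hz : ∀ i, P.root' i z ∉ lat τ)
include h hz

theorem sum_lie_connCoeff (u v : 𝔥) (n : ℕ) :
    ∑ p ∈ Finset.HasAntidiagonal.antidiagonal n, ⁅connCoeff b (kronCoeff P κ z) u p.1,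
      connCoeff b (kronCoeff P κ z) v p.2⁆ =
    ⁅Ell.y b u, connCoeff b (kronCoeff P κ z) v (n + 1)⁆ -
      ⁅Ell.y b v, connCoeff b (kronCoeff P κ z) u (n + 1)⁆ := by
  set K := kronCoeff P κ z with hK
  have key := sum_brk_eq_zero' (b := b) (fun i k =>
    C (P.root' i u * P.root' k v - P.root' k u * P.root' i v) *
      (∑ p ∈ Finset.HasAntidiagonal.antidiagonal n,
        C (K i (p.1 + 1) * K k (p.2 + 1)) * (X 0 ^ p.1 * X 1 ^ p.2) -
      C (2 * K k (n + 2) * halfPair P i k) * geomPoly n (halfPair P i k))) ?_ ?_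
  · rw [lie_connCoeff_connCoeff, lie_y_connCoeff_sub]
    simp only [Ell.lie_y_tx (root'_smul_sub_smul _ u v)]
    have h1 : (1 / 2 : ℂ) • ∑ k, K k (n + 1 + 1) • (1 / 2 : ℂ) • ∑ i,
        (P.root' i (P.root' k v • u - P.root' k u • v) * halfPair P i k) •
          brk b i k (geomPoly n (halfPair P i k)) =
        (1 / 8 : ℂ) • ∑ i, ∑ k, (P.root' i u * P.root' k v - P.root' k u * P.root' i v) •
          (2 * K k (n + 2) * halfPair P i k) • brk b i k (geomPoly n (halfPair P i k)) := by
      simp only [Finset.smul_sum, smul_smul]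
      rw [Finset.sum_comm]
      refine Finset.sum_congr rfl fun i _ => Finset.sum_congr rfl fun k _ => ?_
      congr 1
      rw [map_sub, map_smul, map_smul, smul_eq_mul, smul_eq_mul]
      ring
    rw [h1, ← sub_eq_zero, ← smul_sub, ← Finset.sum_sub_distrib]
    simp only [← Finset.sum_sub_distrib, ← smul_sub]
    rw [smul_eq_zero_of_right _ (Eq.trans _ key)]
    refine Finset.sum_congr rfl fun i _ => Finset.sum_congr rfl fun k _ => ?_
    rw [brk_C_mul, map_sub (brk b i k), brk_C_mul]
  · intro i k hik
    rw [omega_eq_zero hik, map_zero, zero_mul]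
  · intro i₀ k₀ hi e he p₁ p₂ hp
    set D := planeData b hi with hD
    have hr : ∀ (i : PlaneIdx P i₀ k₀) w, P.root' i.1 w = D.x i * P.root' i₀ w + D.y i * P.root' k₀ w :=
      planeData_root' hi
    have hh : ∀ i k : PlaneIdx P i₀ k₀, halfPair P i.1 k.1 =
        D.x i * halfPair P i₀ k.1 + D.y i * halfPair P k₀ k.1 := planeData_halfPair hi
    have hid := Planar.zz_identity he h hp (z₁ := P.root' i₀ z) (z₂ := P.root' k₀ z)
      (fun i => by rw [← hr]; exact hz _) (fun k => halfPair P i₀ k.1)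
      (fun k => halfPair P k₀ k.1) (fun k => by rw [← hh, halfPair_self]) n
    have := congrArg (fun w => (P.root' i₀ u * P.root' k₀ v - P.root' k₀ u * P.root' i₀ v) * w) hid
    simp only [mul_zero] at this
    rw [← this, Finset.mul_sum]
    refine Finset.sum_congr rfl fun i _ => ?_
    rw [Finset.mul_sum]
    refine Finset.sum_congr rfl fun k _ => ?_
    by_cases hd : D.det i k = 0
    · rw [he.zero hd]
      ring
    have hg := eval_geom_base (p₁ := p₁) (p₂ := p₂) hi hd
    rw [← hD] at hg
    have hω : P.root' i.1 u * P.root' k.1 v - P.root' k.1 u * P.root' i.1 v =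
        D.det i k * (P.root' i₀ u * P.root' k₀ v - P.root' k₀ u * P.root' i₀ v) := by
      rw [hr i u, hr i v, hr k u, hr k v, Planar.det]
      ring
    simp only [← hh, ← hr]
    rw [map_mul, eval_C, hω]
    simp only [geomPoly, map_mul, map_sub, map_sum, map_add, map_pow, eval_C, eval_X,
      Matrix.cons_val_zero, Matrix.cons_val_one, hg, hK, kronCoeff]
    ring

/-- The connection form has commuting components along `𝔥`. -/
theorem sum_lie_connShift (u v : 𝔥) (n : ℕ) :
    ∑ p ∈ Finset.HasAntidiagonal.antidiagonal n, ⁅connShift b (kronCoeff P κ z) u p.1,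
      connShift b (kronCoeff P κ z) v p.2⁆ = 0 := by
  rcases n with _ | _ | n
  · simp [connShift, Ell.lie_y_y]
  · have h1 := lie_y_connCoeff_sub (b := b) (kronCoeff P κ z) u v 0
    simp only [Ell.tx_zero, Ell.lie_y_t_of_eq_zero (root'_smul_sub_smul _ u v), smul_zero,
      Finset.sum_const_zero] at h1
    simp only [Finset.Nat.antidiagonal_succ, Finset.Nat.antidiagonal_zero, Finset.sum_cons,
      Finset.map_singleton, Finset.sum_singleton]
    simp only [Function.Embedding.prodMap, Function.Embedding.coeFn_mk, Prod.map, connShift,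
      neg_lie, lie_neg, Function.Embedding.refl_apply]
    rw [← lie_skew (connCoeff b _ u 0), neg_neg, neg_add_eq_zero, ← sub_eq_zero]
    exact h1
  · rw [Finset.Nat.sum_antidiagonal_succ, Finset.Nat.sum_antidiagonal_succ']
    simp only [connShift, neg_lie, lie_neg]
    rw [sum_lie_connCoeff h hz, ← lie_skew (connCoeff b _ u (n + 1))]
    abel

end LieIdentities

end EllipticKZB

end

noncomputable section

namespace EllipticKZB

open MvPolynomial

section HeatIdentity

variable {ι 𝔥 M : Type*} [Fintype ι] [AddCommGroup 𝔥] [Module ℂ 𝔥] [AddCommGroup M] [Module ℂ M]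
variable {P : RootPairing ι ℂ M 𝔥} {b : P.Base}

theorem sum_antidiagonal_add_three {V : Type*} [AddCommGroup V] (F : ℕ → ℕ → V)
    (h0 : ∀ i, F i 0 = 0) (h1 : ∀ i, F i 1 = 0) (n : ℕ) :
    ∑ p ∈ Finset.HasAntidiagonal.antidiagonal (n + 3), F p.1 p.2 =
      F 0 (n + 3) + ∑ p ∈ Finset.HasAntidiagonal.antidiagonal n, F (p.1 + 1) (p.2 + 2) := by
  rw [Finset.Nat.sum_antidiagonal_succ', h0, zero_add,
    Finset.Nat.sum_antidiagonal_succ' (f := fun p => F p.1 (p.2 + 1)), h1, zero_add,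
    Finset.Nat.sum_antidiagonal_succ (f := fun p => F p.1 (p.2 + 1 + 1))]

theorem brk_negIdx (i k : ι) (f : MvPolynomial (Fin 2) ℂ) :
    brk b (negIdx P i) k f = brk b i k (aeval ![-X 0, X 1] f) := by
  have : brk b (negIdx P i) k = (brk b i k).comp
      (aeval (R := ℂ) ![-X 0, (X 1 : MvPolynomial (Fin 2) ℂ)]).toLinearMap := by
    refine (basisMonomials (Fin 2) ℂ).ext fun s => ?_
    simp only [coe_basisMonomials, LinearMap.comp_apply, AlgHom.toLinearMap_apply, brk_monomial,
      aeval_monomial, map_one, one_mul, Ell.tx_negIdx, smul_lie]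
    rw [Finsupp.prod_fintype _ _ (fun _ => pow_zero _), Fin.prod_univ_two]
    simp only [Matrix.cons_val_zero, Matrix.cons_val_one]
    rw [neg_pow (X 0 : MvPolynomial (Fin 2) ℂ), ← brk_mul, ← brk_C_mul, mul_assoc, map_pow, map_neg,
      map_one]
  exact congrArg (fun g => g f) this

theorem brk_self_eq_zero (i : ι) {f : MvPolynomial (Fin 2) ℂ}
    (hf : rename (Equiv.swap (0 : Fin 2) 1) f = f) : brk b i i f = 0 := by
  have := brk_swap (b := b) i i f
  rw [hf] at this
  have h2 : (2 : ℂ) • brk b i i f = 0 := by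
    rw [two_smul]
    nth_rewrite 1 [this]
    exact neg_add_cancel _
  exact (smul_eq_zero.1 h2).resolve_left two_ne_zero

variable (b) in
/-- The value of `c_j δ̃_{j}` on the `i`-th component of the connection. -/
def deltaShift (c : ℕ → ℂ) (K : ι → ℕ → ℂ) (u : 𝔥) : ℕ → ℕ → Ell b
  | 0, j + 2 => -(c j • deltaY b (j / 2) u)
  | i + 1, j + 2 => c j • (1 / 2 : ℂ) • ∑ k, (P.root' k u * K k (i + 1)) •
      brk b k k ((X 0 + X 1) ^ i * X 1 ^ j)
  | _, 0 => 0
  | _, 1 => 0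

theorem deltaShift_zero (c : ℕ → ℂ) (K : ι → ℕ → ℂ) (u : 𝔥) (i : ℕ) :
    deltaShift b c K u i 0 = 0 := by
  cases i <;> rfl

theorem deltaShift_one (c : ℕ → ℂ) (K : ι → ℕ → ℂ) (u : 𝔥) (i : ℕ) :
    deltaShift b c K u i 1 = 0 := by
  cases i <;> rfl

theorem aeval_geomPoly (m : ℕ) :
    aeval ![-X 0, (X 1 : MvPolynomial (Fin 2) ℂ)] (geomPoly m (-1)) = geomPoly m 1 := by
  simp [geomPoly]

theorem aeval_geomPoly' (m : ℕ) :
    aeval ![-X 0, (X 1 : MvPolynomial (Fin 2) ℂ)] (geomPoly' m (-1)) = geomPoly' m 1 := by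
  simp [geomPoly']

/-- The coefficient polynomials of the pairs of roots in the identity `derΔ_connShift`. -/
def pairPoly (K : ι → ℕ → ℂ) (u : 𝔥) (J : ℕ) (i k : ι) : MvPolynomial (Fin 2) ℂ :=
  C (K k (J + 3)) *
    (C (P.root' k u * halfPair P i k ^ 2) * geomPoly' J (halfPair P i k) -
      C (P.root' i u * (J + 2) * halfPair P i k) * geomPoly J (halfPair P i k)) +
  C (P.root' i u) * ∑ p ∈ Finset.HasAntidiagonal.antidiagonal J,
    C (K i (p.1 + 1) * ((p.2 + 1) * K k (p.2 + 2))) * (X 0 ^ p.1 * X 1 ^ p.2)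

theorem pairPoly_self (K : ι → ℕ → ℂ) (c : ℕ → ℂ) (u : 𝔥) (J : ℕ) (k : ι) :
    pairPoly (P := P) K u J k k + C (P.root' k u) *
      (∑ p ∈ Finset.HasAntidiagonal.antidiagonal J, C (c p.2 * K k (p.1 + 1)) *
          ((X 0 + X 1) ^ p.1 * X 1 ^ p.2) -
        C (c (J + 1) / 2) * ∑ p ∈ Finset.HasAntidiagonal.antidiagonal J,
          C ((-1) ^ p.2) * (X 0 ^ p.1 * X 1 ^ p.2)) = C (P.root' k u) * diagPoly (K k) c J := by
  have hgeom : geomPoly' J 1 - C ((J : ℂ) + 2) * geomPoly J 1 =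
      -∑ p ∈ Finset.HasAntidiagonal.antidiagonal J, C (p.2 + 1 : ℂ) *
        ((X 0 + X 1) ^ p.1 * X 1 ^ p.2) := by
    rw [geomPoly, geomPoly', Finset.mul_sum, ← Finset.sum_sub_distrib, ← Finset.sum_neg_distrib]
    refine Finset.sum_congr rfl fun p hp => ?_
    rw [← Finset.HasAntidiagonal.mem_antidiagonal.1 hp]
    push_cast
    simp only [map_add, map_one, one_mul, map_ofNat]
    ring
  simp only [pairPoly, diagPoly, halfPair_self, map_mul, one_pow, mul_one]
  linear_combination (C (K k (J + 3)) * C (P.root' k u)) * hgeom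

variable [P.IsRootSystem]

theorem derΔ_connCoeff_sub (K : ι → ℕ → ℂ) (u : 𝔥) (m : ℕ) :
    derΔ b (connCoeff b K u (m + 1)) - ⁅Ell.y b u, gCoeff b K m⁆ =
      (1 / 4 : ℂ) • ∑ i, ∑ k, brk b i k (C (K k (m + 2)) * (if m = 0 then 0 else
        C (P.root' k u * halfPair P i k ^ 2) * geomPoly' (m - 1) (halfPair P i k) -
        C (P.root' i u * (m + 1) * halfPair P i k) * geomPoly (m - 1) (halfPair P i k))) := by
  have h1 : derΔ b (connCoeff b K u (m + 1)) - ⁅Ell.y b u, gCoeff b K m⁆ =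
      (1 / 2 : ℂ) • ∑ k, K k (m + 2) • (P.root' k u • derΔ b (Ell.tx b k (m + 1)) -
        (m + 1 : ℂ) • ⁅Ell.y b u, Ell.tx b k m⁆) := by
    rw [connCoeff, gCoeff, map_smul, map_sum, lie_smul, lie_sum, ← smul_sub,
      ← Finset.sum_sub_distrib]
    congr 1
    refine Finset.sum_congr rfl fun k _ => ?_
    rw [map_smul, lie_smul]
    module
  rw [h1]
  simp only [derΔ_tx_sub, Finset.smul_sum, smul_smul, brk_C_mul]
  rw [Finset.sum_comm]
  refine Finset.sum_congr rfl fun i _ => Finset.sum_congr rfl fun k _ => ?_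
  congr 1
  ring

theorem lie_connCoeff_gCoeff (K : ι → ℕ → ℂ) (u : 𝔥) (n : ℕ) :
    ∑ p ∈ Finset.HasAntidiagonal.antidiagonal n, ⁅connCoeff b K u p.1, gCoeff b K p.2⁆ =
      (1 / 4 : ℂ) • ∑ i, ∑ k, brk b i k (C (P.root' i u) *
        ∑ p ∈ Finset.HasAntidiagonal.antidiagonal n,
          C (K i (p.1 + 1) * ((p.2 + 1) * K k (p.2 + 2))) * (X 0 ^ p.1 * X 1 ^ p.2)) := by
  simp only [map_sum, Finset.smul_sum, brk_C_mul, brk_mul, connCoeff, gCoeff, smul_lie, lie_smul,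
    sum_lie, lie_sum, smul_smul]
  rw [Finset.sum_comm, Finset.sum_comm (s := (Finset.univ : Finset ι)) (t := Finset.univ)]
  refine Finset.sum_congr rfl fun k _ => ?_
  rw [Finset.sum_comm]
  refine Finset.sum_congr rfl fun i _ => Finset.sum_congr rfl fun p _ => ?_
  congr 1
  ring

theorem smul_deltaY (c : ℕ → ℂ) (hc : ∀ j, Odd j → c j = 0) (u : 𝔥) (n : ℕ) :
    c (n + 1) • deltaY b ((n + 1) / 2) u = (1 / 2 : ℂ) • ∑ k, P.root' k u • brk b k k
      (C (c (n + 1) / 2) * ∑ p ∈ Finset.HasAntidiagonal.antidiagonal n,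
        C ((-1) ^ p.2) * (X 0 ^ p.1 * X 1 ^ p.2)) := by
  rcases Nat.even_or_odd (n + 1) with he | ho
  · obtain ⟨m, hm⟩ := he
    have hm' : (n + 1) / 2 = m := by omega
    have hn : 2 * m - 1 = n := by omega
    rw [hm', deltaY_apply, sum_posRoots]
    · simp only [deltaYTerm_eq, hn, Finset.smul_sum, map_sum, brk_C_mul, brk_mul, smul_smul]
      refine Finset.sum_congr rfl fun k _ => Finset.sum_congr rfl fun p _ => ?_
      congr 1
      ring
    · intro i
      rw [deltaYTerm_negIdx (by omega), root'_negIdx, LinearMap.neg_apply, neg_smul_neg]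
  · rw [hc _ ho]
    simp

variable [P.IsReduced]

theorem sum_dependent {V : Type*} [AddCommGroup V] (k : ι) (f : ι → V) :
    open Classical in
    ∑ i, (if LinearIndependent ℂ ![P.root i, P.root k] then 0 else f i) =
      f k + f (negIdx P k) := by
  classical
  have hself : ¬ LinearIndependent ℂ ![P.root k, P.root k] := by
    rw [LinearIndependent.pair_iff]
    intro h
    simpa using h 1 (-1) (by simp)
  have hneg : ¬ LinearIndependent ℂ ![P.root (negIdx P k), P.root k] := by
    rw [LinearIndependent.pair_iff]
    intro h
    simpa using h 1 1 (by simp)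
  rw [Finset.sum_eq_add k (negIdx P k) (negIdx_ne k).symm]
  · rw [if_neg hself, if_neg hneg]
  · intro i _ hi
    rw [if_pos]
    by_contra hd
    rcases eq_or_eq_negIdx hd with e | e
    · exact hi.1 e.symm
    · exact hi.2 (by rw [e, negIdx_negIdx])
  · simp
  · simp

variable {τ : ℂ} {Γ : PowerSeries ℂ} {κ : ℂ → PowerSeries ℂ} (h : IsKron τ Γ κ) {z : 𝔥}
  (hz : ∀ i, P.root' i z ∉ lat τ)
include h hz

theorem kronCoeff_negIdx (i : ι) (j : ℕ) :
    kronCoeff P κ z (negIdx P i) j = (-1) ^ j * kronCoeff P κ z i j := by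
  rw [kronCoeff, root'_negIdx, LinearMap.neg_apply, h.neg (hz i), PowerSeries.coeff_rescale,
    kronCoeff]

theorem pairPoly_negIdx (u : 𝔥) (J : ℕ) (k : ι) :
    aeval ![-X 0, X 1] (pairPoly (P := P) (kronCoeff P κ z) u J (negIdx P k) k) =
      pairPoly (P := P) (kronCoeff P κ z) u J k k := by
  rw [pairPoly, halfPair_negIdx, halfPair_self, map_add, map_mul (aeval _), map_mul (aeval _), map_sub,
    map_mul (aeval _) _ (geomPoly' _ _), map_mul (aeval _) _ (geomPoly _ _), aeval_geomPoly,
    aeval_geomPoly', map_sum, pairPoly, halfPair_self, Finset.mul_sum, Finset.mul_sum]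
  have e1 : P.root' k u * (-1) ^ 2 = P.root' k u * 1 ^ 2 := by norm_num
  have e2 : P.root' (negIdx P k) u * (J + 2) * -1 = P.root' k u * (J + 2) * 1 := by
    rw [root'_negIdx, LinearMap.neg_apply]
    ring
  refine congrArg₂ (· + ·) ?_ ?_
  · rw [algHom_C, algHom_C, algHom_C, e1, e2]
    rfl
  · refine Finset.sum_congr rfl fun p _ => ?_
    simp only [map_mul, map_pow, algHom_C, algebraMap_eq, aeval_X, Matrix.cons_val_zero,
      Matrix.cons_val_one, kronCoeff_negIdx h hz, map_neg, map_one, root'_negIdx,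
      LinearMap.neg_apply]
    rw [neg_pow (X 0 : MvPolynomial (Fin 2) ℂ), pow_succ]
    have : ((-1) ^ p.1 * (-1) ^ p.1 : MvPolynomial (Fin 2) ℂ) = 1 := by
      rw [← mul_pow]
      simp
    linear_combination (C (P.root' k u) * C (kronCoeff P κ z k (p.1 + 1)) *
      (C ((p.2 : ℂ) + 1) * C (kronCoeff P κ z k (p.2 + 2))) * X 0 ^ p.1 * X 1 ^ p.2) * this

theorem sum_pairPoly_of_independent (u : 𝔥) (J : ℕ) :
    open Classical in
    ∑ i, ∑ k, (if LinearIndependent ℂ ![P.root i, P.root k] then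
      brk b i k (pairPoly (P := P) (kronCoeff P κ z) u J i k) else 0) = 0 := by
  refine sum_brk_eq_zero (b := b) (fun i k => pairPoly (P := P) (kronCoeff P κ z) u J i k) ?_
  intro i₀ k₀ hi e he p₁ p₂ hp
  set D := planeData b hi with hD
  have hr : ∀ (i : PlaneIdx P i₀ k₀) w, P.root' i.1 w =
    D.x i * P.root' i₀ w + D.y i * P.root' k₀ w := planeData_root' hi
  have hh : ∀ i k : PlaneIdx P i₀ k₀, halfPair P i.1 k.1 =
    D.x i * halfPair P i₀ k.1 + D.y i * halfPair P k₀ k.1 := planeData_halfPair hi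
  rw [← Planar.zτ_identity he h hp (z₁ := P.root' i₀ z) (z₂ := P.root' k₀ z)
    (fun i => by rw [← hr]; exact hz _) (fun k => halfPair P i₀ k.1)
    (fun k => halfPair P k₀ k.1) (fun k => by rw [← hh, halfPair_self]) (P.root' i₀ u)
    (P.root' k₀ u) J]
  refine Finset.sum_congr rfl fun i _ => Finset.sum_congr rfl fun k _ => ?_
  by_cases hd : D.det i k = 0
  · rw [he.zero hd, zero_mul, zero_mul]
  have hg := eval_geom_base (p₁ := p₁) (p₂ := p₂) hi hd
  rw [← hD] at hg
  simp only [← hh, ← hr]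
  simp only [pairPoly, geomPoly, geomPoly', map_mul, map_sub, map_sum, map_add, map_pow, eval_C,
    eval_X, Matrix.cons_val_zero, Matrix.cons_val_one, hg, kronCoeff, map_one, map_natCast]

theorem sum_pairPoly (u : 𝔥) (J : ℕ) :
    ∑ i, ∑ k, brk b i k (pairPoly (P := P) (kronCoeff P κ z) u J i k) =
      (2 : ℂ) • ∑ k, brk b k k (pairPoly (P := P) (kronCoeff P κ z) u J k k) := by
  classical
  have hsplit : ∑ i, ∑ k, brk b i k (pairPoly (P := P) (kronCoeff P κ z) u J i k) =
      ∑ i, ∑ k, (if LinearIndependent ℂ ![P.root i, P.root k] then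
        brk b i k (pairPoly (P := P) (kronCoeff P κ z) u J i k) else 0) +
      ∑ k, ∑ i, (if LinearIndependent ℂ ![P.root i, P.root k] then 0 else
        brk b i k (pairPoly (P := P) (kronCoeff P κ z) u J i k)) := by
    rw [Finset.sum_comm (f := fun k i => if LinearIndependent ℂ ![P.root i, P.root k] then 0 else
        brk b i k (pairPoly (P := P) (kronCoeff P κ z) u J i k)), ← Finset.sum_add_distrib]
    refine Finset.sum_congr rfl fun i _ => ?_
    rw [← Finset.sum_add_distrib]
    refine Finset.sum_congr rfl fun k _ => ?_
    split_ifs <;> simp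
  rw [hsplit, sum_pairPoly_of_independent h hz, zero_add, Finset.smul_sum]
  refine Finset.sum_congr rfl fun k _ => ?_
  rw [sum_dependent k fun i => brk b i k (pairPoly (P := P) (kronCoeff P κ z) u J i k), brk_negIdx,
    pairPoly_negIdx h hz, two_smul]

/-- The components of the identity `[Δ̃₀ + ∑ c_n δ̃_{2n} - G, A(u)] = 0`. -/
theorem derΔ_connShift {c : PowerSeries ℂ} {c₀ : ℂ}
    (hΓ : Γ = -1 + PowerSeries.X ^ 2 * (PowerSeries.C c₀ - c))
    (hc0 : PowerSeries.coeff 0 c = 0) (hc : ∀ j, Odd j → PowerSeries.coeff j c = 0)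
    (u : 𝔥) (n : ℕ) :
    derΔ b (connShift b (kronCoeff P κ z) u n) +
      ∑ p ∈ Finset.HasAntidiagonal.antidiagonal n,
        (deltaShift b (fun j => PowerSeries.coeff j c) (kronCoeff P κ z) u p.1 p.2 +
          ⁅connShift b (kronCoeff P κ z) u p.1, gShift b (kronCoeff P κ z) p.2⁆) = 0 := by
  classical
  set K := kronCoeff P κ z with hK
  set cc : ℕ → ℂ := fun j => PowerSeries.coeff j c with hcc
  rcases n with _ | _ | _ | J
  · simp [connShift, deltaShift, gShift]
  · simp [connShift, deltaShift, gShift, connCoeff, Finset.Nat.antidiagonal_succ, Ell.tx_zero]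
  · have h1 := derΔ_connCoeff_sub (b := b) K u 0
    simp only [if_true, mul_zero, map_zero, Finset.sum_const_zero, smul_zero] at h1
    rw [Finset.Nat.sum_antidiagonal_succ', Finset.Nat.sum_antidiagonal_succ']
    have hcc0 : cc 0 = 0 := hc0
    simp [connShift, deltaShift, gShift, hcc0]
    rw [← lie_skew, ← sub_eq_add_neg]
    exact h1
  rw [sum_antidiagonal_add_three (fun i j => deltaShift b cc K u i j +
    ⁅connShift b K u i, gShift b K j⁆) (fun i => by simp [deltaShift_zero, gShift])
    (fun i => by simp [deltaShift_one, gShift])]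
  simp only [connShift, deltaShift, gShift, Finset.sum_add_distrib]
  have e1 := derΔ_connCoeff_sub (b := b) K u (J + 1)
  have e0 : (((J + 1 : ℕ) : ℂ) + 1) = J + 2 := by
    push_cast
    ring
  simp only [if_neg J.succ_ne_zero, Nat.add_sub_cancel, e0] at e1
  rw [smul_deltaY cc hc, neg_lie]
  have hsum := sum_pairPoly (b := b) h hz u J
  have hpoly := fun k => pairPoly_self (P := P) K cc u J k
  have hdiag : ∑ k, brk b k k (C (P.root' k u) * diagPoly (K k) cc J) = 0 := by
    refine Finset.sum_eq_zero fun k _ => brk_self_eq_zero k ?_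
    rw [map_mul, rename_C]
    congr 1
    exact h.diagPoly_swap hΓ hc (hz k) J
  have e2 : ∑ p ∈ Finset.HasAntidiagonal.antidiagonal J, cc p.2 • (1 / 2 : ℂ) •
      ∑ k, (P.root' k u * K k (p.1 + 1)) • brk b k k ((X 0 + X 1) ^ p.1 * X 1 ^ p.2) =
      (1 / 2 : ℂ) • ∑ k, brk b k k (C (P.root' k u) *
        ∑ p ∈ Finset.HasAntidiagonal.antidiagonal J, C (cc p.2 * K k (p.1 + 1)) *
          ((X 0 + X 1) ^ p.1 * X 1 ^ p.2)) := by
    simp only [Finset.smul_sum, map_sum, brk_C_mul, smul_smul]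
    rw [Finset.sum_comm]
    refine Finset.sum_congr rfl fun k _ => Finset.sum_congr rfl fun p _ => ?_
    congr 1
    ring
  have e3 : ∑ k, brk b k k (pairPoly (P := P) K u J k k) + ∑ k, brk b k k (C (P.root' k u) *
        ∑ p ∈ Finset.HasAntidiagonal.antidiagonal J, C (cc p.2 * K k (p.1 + 1)) *
          ((X 0 + X 1) ^ p.1 * X 1 ^ p.2)) - ∑ k, P.root' k u • brk b k k
      (C (cc (J + 1) / 2) * ∑ p ∈ Finset.HasAntidiagonal.antidiagonal J,
        C ((-1) ^ p.2) * (X 0 ^ p.1 * X 1 ^ p.2)) = 0 := by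
    rw [← hdiag, ← Finset.sum_add_distrib, ← Finset.sum_sub_distrib]
    refine Finset.sum_congr rfl fun k _ => ?_
    rw [← hpoly, mul_sub, map_add, map_sub (brk b k k), brk_C_mul _ _ (P.root' k u)
      (C (cc (J + 1) / 2) * _), ← add_sub_assoc]
  rw [e2]
  have e4 : (1 / 4 : ℂ) • ∑ i, ∑ k, brk b i k (pairPoly (P := P) K u J i k) =
      derΔ b (connCoeff b K u (J + 1 + 1)) - ⁅Ell.y b u, gCoeff b K (J + 1)⁆ +
      ∑ p ∈ Finset.HasAntidiagonal.antidiagonal J, ⁅connCoeff b K u p.1, gCoeff b K p.2⁆ := by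
    rw [e1, lie_connCoeff_gCoeff, ← smul_add, ← Finset.sum_add_distrib]
    congr 1
    refine Finset.sum_congr rfl fun i _ => ?_
    rw [← Finset.sum_add_distrib]
    refine Finset.sum_congr rfl fun k _ => ?_
    rw [← map_add]
    rfl
  linear_combination (norm := module) (1 / 4 : ℂ) • hsum + (1 / 2 : ℂ) • e3 - e4

end HeatIdentity

end EllipticKZB

end

noncomputable section

namespace EllipticKZB

open Filter Topology
open scoped PowerSeries.WithPiTopology

section Flatness

variable {ι 𝔥 M : Type*} [Fintype ι] [AddCommGroup 𝔥] [Module ℂ 𝔥] [AddCommGroup M] [Module ℂ M]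
variable {P : RootPairing ι ℂ M 𝔥} {b : P.Base}

theorem sum_antidiagonal_comm {V : Type*} [AddCommMonoid V] (F : ℕ → ℕ → ℕ → V) (n : ℕ) :
    ∑ p ∈ Finset.HasAntidiagonal.antidiagonal n, ∑ q ∈ Finset.HasAntidiagonal.antidiagonal p.1,
      F q.1 q.2 p.2 = ∑ p ∈ Finset.HasAntidiagonal.antidiagonal n,
        ∑ q ∈ Finset.HasAntidiagonal.antidiagonal p.1, F q.1 p.2 q.2 := by
  rw [Finset.sum_sigma', Finset.sum_sigma']
  refine Finset.sum_nbij' (fun s => ⟨(s.2.1 + s.1.2, s.2.2), (s.2.1, s.1.2)⟩)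
    (fun s => ⟨(s.2.1 + s.1.2, s.2.2), (s.2.1, s.1.2)⟩) ?_ ?_ ?_ ?_ ?_
  · rintro ⟨⟨p1, p2⟩, ⟨q1, q2⟩⟩ h
    simp only [Finset.mem_sigma, Finset.HasAntidiagonal.mem_antidiagonal] at h ⊢
    exact ⟨by omega, trivial⟩
  · rintro ⟨⟨p1, p2⟩, ⟨q1, q2⟩⟩ h
    simp only [Finset.mem_sigma, Finset.HasAntidiagonal.mem_antidiagonal] at h ⊢
    exact ⟨by omega, trivial⟩
  · rintro ⟨⟨p1, p2⟩, ⟨q1, q2⟩⟩ h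
    simp only [Finset.mem_sigma, Finset.HasAntidiagonal.mem_antidiagonal] at h ⊢
    obtain ⟨rfl, rfl⟩ := h
    rfl
  · rintro ⟨⟨p1, p2⟩, ⟨q1, q2⟩⟩ h
    simp only [Finset.mem_sigma, Finset.HasAntidiagonal.mem_antidiagonal] at h ⊢
    obtain ⟨rfl, rfl⟩ := h
    rfl
  · rintro ⟨⟨p1, p2⟩, ⟨q1, q2⟩⟩ h
    rfl

/-- The Leibniz rule for sequences of derivations annihilating sequences of elements. -/
theorem sum_apply_lie_eq_zero {F L : Type*} [LieRing F] [LieAlgebra ℂ F] [LieRing L]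
    [LieAlgebra ℂ L] (m : F →ₗ⁅ℂ⁆ L) (T : ℕ → F →ₗ[ℂ] L)
    (hT : ∀ j r s, T j ⁅r, s⁆ = ⁅T j r, m s⁆ + ⁅m r, T j s⁆) (a c : ℕ → F)
    (ha : ∀ n, ∑ p ∈ Finset.HasAntidiagonal.antidiagonal n, T p.2 (a p.1) = 0)
    (hc : ∀ n, ∑ p ∈ Finset.HasAntidiagonal.antidiagonal n, T p.2 (c p.1) = 0) (n : ℕ) :
    ∑ p ∈ Finset.HasAntidiagonal.antidiagonal n,
      T p.2 (∑ q ∈ Finset.HasAntidiagonal.antidiagonal p.1, ⁅a q.1, c q.2⁆) = 0 := by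
  simp only [map_sum, hT, Finset.sum_add_distrib]
  rw [sum_antidiagonal_comm (fun i j k => ⁅T k (a i), m (c j)⁆)]
  have h1 : ∀ p : ℕ × ℕ, ∑ q ∈ Finset.HasAntidiagonal.antidiagonal p.1, ⁅m (a q.1), T p.2 (c q.2)⁆ =
      ∑ q ∈ Finset.HasAntidiagonal.antidiagonal p.1, ⁅m (a q.2), T p.2 (c q.1)⁆ := fun p =>
    (Finset.Nat.sum_antidiagonal_swap (f := fun q => ⁅m (a q.1), T p.2 (c q.2)⁆)).symm
  simp only [h1]
  rw [sum_antidiagonal_comm (fun i j k => ⁅m (a j), T k (c i)⁆)]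
  simp only [← sum_lie, ← lie_sum, ha, hc, zero_lie, lie_zero, Finset.sum_const_zero, add_zero]

variable (b) in
/-- The prescribed values of `δ̃_{2m}` on generators, extended to the free Lie algebra. -/
def preDelta (m : ℕ) : FreeLieAlgebra ℂ (Gen ι 𝔥) →ₗ[ℂ] Ell b :=
  preDer b (genData 0 (deltaY b m) (deltaT b m))

/-- The element `(ad x_α)^m t_α` of the free Lie algebra. -/
def freeTx (P : RootPairing ι ℂ M 𝔥) (i : ι) : ℕ → FreeLieAlgebra ℂ (Gen ι 𝔥)
  | 0 => ft 𝔥 i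
  | m + 1 => (1 / 2 : ℂ) • ⁅fx ι (P.coroot i), freeTx P i m⁆

theorem mk_freeTx (i : ι) (m : ℕ) : Ell.mk b (freeTx P i m) = Ell.tx b i m := by
  induction m with
  | zero => rw [Ell.tx_zero]; rfl
  | succ m ih =>
    rw [freeTx, map_smul, LieHom.map_lie, ih, Ell.tx_succ]
    rfl

theorem preDelta_freeTx (m : ℕ) (i : ι) (n : ℕ) : preDelta b m (freeTx P i n) =
    brk b i i ((MvPolynomial.X 0 + MvPolynomial.X 1) ^ n * MvPolynomial.X 1 ^ (2 * m)) := by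
  induction n with
  | zero =>
    rw [pow_zero, one_mul, brk_X_one_pow]
    exact preDer_ft _ _ _ i
  | succ n ih =>
    have h1 : preDelta b m (fx ι (P.coroot i)) = 0 := preDer_fx _ _ _ _
    rw [freeTx, map_smul, preDelta, preDer_lie]
    change (1 / 2 : ℂ) • (⁅preDelta b m _, _⁆ + ⁅Ell.x b (P.coroot i), preDelta b m _⁆) = _
    rw [h1, zero_lie, zero_add, ih, half_smul_lie_x_brk, halfPair_self, map_one, one_mul, pow_succ']
    congr 1
    ring

/-- The components of the connection in the free Lie algebra. -/
def freeConn (P : RootPairing ι ℂ M 𝔥) (K : ι → ℕ → ℂ) (u : 𝔥) :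
    ℕ → FreeLieAlgebra ℂ (Gen ι 𝔥)
  | 0 => -fy ι u
  | m + 1 => (1 / 2 : ℂ) • ∑ i, (P.root' i u * K i (m + 1)) • freeTx P i m

theorem mk_freeConn (K : ι → ℕ → ℂ) (u : 𝔥) (m : ℕ) :
    Ell.mk b (freeConn P K u m) = connShift b K u m := by
  cases m with
  | zero => exact map_neg (Ell.mk b) _
  | succ m => simp only [freeConn, map_smul, map_sum, mk_freeTx, connShift, connCoeff]

theorem smul_preDelta_freeConn {c : ℕ → ℂ} (hc : ∀ j, Odd j → c j = 0)
    (K : ι → ℕ → ℂ) (u : 𝔥) (i j : ℕ) :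
    c j • preDelta b (j / 2) (freeConn P K u i) = deltaShift b c K u i (j + 2) := by
  rcases Nat.even_or_odd j with he | ho
  · have hj : 2 * (j / 2) = j := Nat.two_mul_div_two_of_even he
    cases i with
    | zero =>
      rw [freeConn, map_neg, smul_neg, deltaShift]
      congr 2
      exact preDer_fy _ _ _ u
    | succ i => simp only [freeConn, map_smul, map_sum, preDelta_freeTx, hj, deltaShift]
  · cases i <;> simp [deltaShift, hc j ho]

variable (b) in
/-- The sequence of derivations `Δ̃₀ + ∑ c_n δ̃_{2n} - ad G`. -/
def heatDer (c : ℕ → ℂ) (K : ι → ℕ → ℂ) : ℕ → FreeLieAlgebra ℂ (Gen ι 𝔥) →ₗ[ℂ] Ell b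
  | 0 => (derΔ b : Ell b →ₗ[ℂ] Ell b).comp (Ell.mk b : _ →ₗ[ℂ] Ell b)
  | 1 => 0
  | j + 2 => c j • preDelta b (j / 2) -
      (LieAlgebra.ad ℂ (Ell b) (gCoeff b K j)).comp (Ell.mk b : _ →ₗ[ℂ] Ell b)

theorem heatDer_add_two (c : ℕ → ℂ) (K : ι → ℕ → ℂ) (j : ℕ) (r : FreeLieAlgebra ℂ (Gen ι 𝔥)) :
    heatDer b c K (j + 2) r = c j • preDelta b (j / 2) r + ⁅Ell.mk b r, gCoeff b K j⁆ := by
  rw [← lie_skew, ← sub_eq_add_neg]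
  rfl

theorem heatDer_lie (c : ℕ → ℂ) (K : ι → ℕ → ℂ) (j : ℕ) (r s : FreeLieAlgebra ℂ (Gen ι 𝔥)) :
    heatDer b c K j ⁅r, s⁆ = ⁅heatDer b c K j r, Ell.mk b s⁆ + ⁅Ell.mk b r, heatDer b c K j s⁆ := by
  rcases j with _ | _ | j
  · change derΔ b (Ell.mk b ⁅r, s⁆) = ⁅derΔ b (Ell.mk b r), _⁆ + ⁅_, derΔ b (Ell.mk b s)⁆
    rw [LieHom.map_lie, LieDerivation.apply_lie_eq_add, add_comm]
  · simp [heatDer]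
  · rw [heatDer_add_two, heatDer_add_two, heatDer_add_two, preDelta, preDer_lie, LieHom.map_lie,
      lie_lie, add_lie, lie_add, smul_lie, lie_smul]
    rw [← lie_skew (⁅Ell.mk b r, gCoeff b K j⁆)]
    module

variable [P.IsRootSystem] [P.IsReduced]

section

variable {τ : ℂ} {Γ : PowerSeries ℂ} {κ : ℂ → PowerSeries ℂ} (h : IsKron τ Γ κ) {z : 𝔥}
  (hz : ∀ i, P.root' i z ∉ lat τ)
include h hz

theorem sum_heatDer_freeConn {c : PowerSeries ℂ} {c₀ : ℂ}
    (hΓ : Γ = -1 + PowerSeries.X ^ 2 * (PowerSeries.C c₀ - c))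
    (hc0 : PowerSeries.coeff 0 c = 0) (hc : ∀ j, Odd j → PowerSeries.coeff j c = 0)
    (u : 𝔥) (n : ℕ) :
    ∑ p ∈ Finset.HasAntidiagonal.antidiagonal n,
      heatDer b (fun j => PowerSeries.coeff j c) (kronCoeff P κ z) p.2
        (freeConn P (kronCoeff P κ z) u p.1) = 0 := by
  have key := derΔ_connShift (b := b) h hz hΓ hc0 hc u n
  have h1 : ∀ p : ℕ × ℕ, heatDer b (fun j => PowerSeries.coeff j c) (kronCoeff P κ z) p.2
        (freeConn P (kronCoeff P κ z) u p.1) =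
      (if p.2 = 0 then derΔ b (connShift b (kronCoeff P κ z) u p.1) else 0) +
      (deltaShift b (fun j => PowerSeries.coeff j c) (kronCoeff P κ z) u p.1 p.2 +
        ⁅connShift b (kronCoeff P κ z) u p.1, gShift b (kronCoeff P κ z) p.2⁆) := by
    rintro ⟨i, j⟩
    rcases j with _ | _ | j
    · simp only [deltaShift_zero, gShift, lie_zero, add_zero, if_true]
      rw [← mk_freeConn]
      rfl
    · simp [deltaShift_one, gShift, heatDer]
    · rw [heatDer_add_two, mk_freeConn, smul_preDelta_freeConn hc]
      simp [gShift]
  have h2 : ∑ p ∈ Finset.HasAntidiagonal.antidiagonal n,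
      (if p.2 = 0 then derΔ b (connShift b (kronCoeff P κ z) u p.1) else 0) =
        derΔ b (connShift b (kronCoeff P κ z) u n) := by
    rw [Finset.sum_eq_single (n, 0)]
    · simp
    · rintro ⟨i, j⟩ hp hne
      rw [Finset.HasAntidiagonal.mem_antidiagonal] at hp
      rw [if_neg]
      rintro rfl
      apply hne
      simp only [add_zero] at hp
      rw [hp]
    · intro hn
      exact absurd (by simp) hn
  rw [Finset.sum_congr rfl fun p _ => h1 p, Finset.sum_add_distrib, h2]
  exact key

theorem sum_lie_freeConn_mem (u v : 𝔥) (n : ℕ) :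
    Ell.mk b (∑ p ∈ Finset.HasAntidiagonal.antidiagonal n, ⁅freeConn P (kronCoeff P κ z) u p.1,
      freeConn P (kronCoeff P κ z) v p.2⁆) = 0 := by
  simp only [map_sum, LieHom.map_lie, mk_freeConn]
  exact sum_lie_connShift h hz u v n

end

theorem mem_relIdeal_of_mk_eq_zero {r : FreeLieAlgebra ℂ (Gen ι 𝔥)} (h : Ell.mk b r = 0) :
    r ∈ relIdeal b :=
  (LieSubmodule.Quotient.mk_eq_zero (N := relIdeal b)).1 h

end Flatness

end EllipticKZB

end

noncomputable section

namespace EllipticKZB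

open Filter Topology
open scoped PowerSeries.WithPiTopology

section Action

variable {ι 𝔥 M : Type*} [Fintype ι] [AddCommGroup 𝔥] [Module ℂ 𝔥] [AddCommGroup M] [Module ℂ M]
variable {P : RootPairing ι ℂ M 𝔥} {b : P.Base} [P.IsRootSystem] [P.IsReduced]

theorem heatDer_eq_zero {c : PowerSeries ℂ} (hc0 : PowerSeries.coeff 0 c = 0)
    (hc : ∀ j, Odd j → PowerSeries.coeff j c = 0) {n : ℕ}
    (kill : ∀ m, 0 < m → m < n → ∀ r, Ell.mk b r = 0 → preDelta b m r = 0) (K : ι → ℕ → ℂ)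
    {r : FreeLieAlgebra ℂ (Gen ι 𝔥)} (hr : Ell.mk b r = 0) {j : ℕ} (hj : j ≠ 2 * n + 2)
    (hj' : j ≤ 2 * n + 3) : heatDer b (fun j => PowerSeries.coeff j c) K j r = 0 := by
  rcases j with _ | _ | j
  · change derΔ b (Ell.mk b r) = 0
    rw [hr, map_zero]
  · rfl
  · rw [heatDer_add_two, hr, zero_lie, add_zero]
    rcases Nat.even_or_odd j with he | ho
    · obtain ⟨m, rfl⟩ := he
      rcases Nat.eq_zero_or_pos m with rfl | hm
      · rw [add_zero, hc0, zero_smul]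
      · rw [kill _ _ _ _ hr, smul_zero]
        · omega
        · omega
    · rw [hc j ho, zero_smul]

section

variable {τ : ℂ} {Γ : PowerSeries ℂ} {κ : ℂ → PowerSeries ℂ} (h : IsKron τ Γ κ) {z : 𝔥}
  (hz : ∀ i, P.root' i z ∉ lat τ) {c : PowerSeries ℂ} {c₀ : ℂ}
  (hΓ : Γ = -1 + PowerSeries.X ^ 2 * (PowerSeries.C c₀ - c))
  (hc0 : PowerSeries.coeff 0 c = 0) (hc : ∀ j, Odd j → PowerSeries.coeff j c = 0) {n : ℕ}
  (hn : PowerSeries.coeff (2 * n) c ≠ 0)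
  (kill : ∀ m, 0 < m → m < n → ∀ r, Ell.mk b r = 0 → preDelta b m r = 0)
include h hz hΓ hc0 hc hn kill

theorem preDelta_lie_freeConn (u v : 𝔥) {k : ℕ} (hk : k ≤ 1) :
    preDelta b n (∑ p ∈ Finset.HasAntidiagonal.antidiagonal k,
      ⁅freeConn P (kronCoeff P κ z) u p.1, freeConn P (kronCoeff P κ z) v p.2⁆) = 0 := by
  have h1 := sum_apply_lie_eq_zero (Ell.mk b) _ (heatDer_lie (b := b)
    (fun j => PowerSeries.coeff j c) (kronCoeff P κ z)) _ _
      (sum_heatDer_freeConn h hz hΓ hc0 hc u) (sum_heatDer_freeConn h hz hΓ hc0 hc v)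
      (2 * n + 2 + k)
  rw [Finset.sum_eq_single (k, 2 * n + 2)] at h1
  · dsimp only at h1
    rw [heatDer_add_two, sum_lie_freeConn_mem h hz, zero_lie, add_zero,
      Nat.mul_div_cancel_left n two_pos] at h1
    exact (smul_eq_zero.1 h1).resolve_left hn
  · rintro ⟨i, j⟩ hp hne
    rw [Finset.HasAntidiagonal.mem_antidiagonal] at hp
    dsimp only at hp ⊢
    refine heatDer_eq_zero hc0 hc kill _ (sum_lie_freeConn_mem h hz u v i) ?_ (by omega)
    rintro rfl
    apply hne
    rw [Prod.mk.injEq]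
    exact ⟨by omega, rfl⟩
  · intro hp
    exact absurd (Finset.HasAntidiagonal.mem_antidiagonal.2 (by dsimp only; omega)) hp

theorem lie_deltaY_y (u v : 𝔥) :
    ⁅deltaY b n u, Ell.y b v⁆ + ⁅Ell.y b u, deltaY b n v⁆ = 0 := by
  have h1 := preDelta_lie_freeConn h hz hΓ hc0 hc hn kill u v (zero_le_one)
  rw [Finset.Nat.sum_antidiagonal_eq_sum_range_succ_mk, Finset.sum_range_one, Nat.sub_zero] at h1
  simp only [freeConn, neg_lie, lie_neg, neg_neg] at h1
  rw [preDelta, preDer_lie, preDer_fy, preDer_fy] at h1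
  exact h1

theorem sum_smul_lie_deltaT (u v : 𝔥) :
    ∑ i, kronCoeff P κ z i 1 •
      (P.root' i u • (⁅deltaT b n i, Ell.y b v⁆ + ⁅Ell.t b i, deltaY b n v⁆) -
        P.root' i v • (⁅deltaT b n i, Ell.y b u⁆ + ⁅Ell.t b i, deltaY b n u⁆)) = 0 := by
  have h1 := preDelta_lie_freeConn h hz hΓ hc0 hc hn kill u v le_rfl
  have h2 : ∀ w, preDelta b n (freeConn P (kronCoeff P κ z) w 0) = -deltaY b n w := fun w => by
    rw [freeConn, map_neg, preDelta, preDer_fy]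
  have h3 : ∀ w, preDelta b n (freeConn P (kronCoeff P κ z) w 1) =
      (1 / 2 : ℂ) • ∑ i, (P.root' i w * kronCoeff P κ z i 1) • deltaT b n i := fun w => by
    simp only [freeConn, map_smul, map_sum, freeTx, preDelta, preDer_ft]
  have h4 : ∀ w, Ell.mk b (freeConn P (kronCoeff P κ z) w 0) = -Ell.y b w := fun w => by
    rw [mk_freeConn]; rfl
  have h5 : ∀ w, Ell.mk b (freeConn P (kronCoeff P κ z) w 1) =
      (1 / 2 : ℂ) • ∑ i, (P.root' i w * kronCoeff P κ z i 1) • Ell.t b i := fun w => by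
    rw [mk_freeConn, connShift, connCoeff]
    simp only [Ell.tx_zero]
  rw [Finset.Nat.sum_antidiagonal_eq_sum_range_succ_mk, Finset.sum_range_succ,
    Finset.sum_range_one, map_add] at h1
  simp only [Nat.sub_zero, Nat.sub_self] at h1
  rw [preDelta, preDer_lie, preDer_lie, ← preDelta, h2, h2, h3, h3, h4, h4, h5, h5] at h1
  simp only [smul_lie, lie_smul, sum_lie, lie_sum, neg_lie, lie_neg] at h1
  have h6 := congrArg (fun a => (2 : ℂ) • a) h1
  simp only [smul_add, smul_neg, smul_smul, smul_zero] at h6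
  norm_num at h6
  rw [← neg_eq_zero, ← h6]
  simp only [← Finset.sum_neg_distrib, ← Finset.sum_add_distrib]
  refine Finset.sum_congr rfl fun i _ => ?_
  rw [← lie_skew (deltaY b n u), ← lie_skew (Ell.y b u)]
  module

end

/-- Points at which a given root vanishes to first order and the others are generic. -/
theorem exists_line (i₀ : ι) {τ : ℂ} {Γ : PowerSeries ℂ} {κ : ℂ → PowerSeries ℂ}
    (h : IsKron τ Γ κ) : ∃ w : 𝔥, P.root' i₀ w = 0 ∧
      ∀ i, i ≠ i₀ → i ≠ negIdx P i₀ → P.root' i w ∉ lat τ := by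
  obtain ⟨w, hw, hw'⟩ := Module.Dual.exists_forall_mem_ne_zero_of_forall_exists
    (LinearMap.ker (P.root' i₀)) (fun i : {i // i ≠ i₀ ∧ i ≠ negIdx P i₀} => P.root' i.1) (by
      rintro ⟨i, hi, hi'⟩
      have hl : LinearIndependent ℂ ![P.root i₀, P.root i] := by
        by_contra hl
        rcases eq_or_eq_negIdx hl with e | e
        · exact hi e
        · exact hi' e
      obtain ⟨w, h0, h1⟩ := exists_root'_pair i₀ i hl 0 1
      exact ⟨w, h0, by dsimp only; rw [h1]; exact one_ne_zero⟩)
  have h1 : ∀ᶠ s : ℂ in 𝓝[≠] 0, ∀ i : {i // i ≠ i₀ ∧ i ≠ negIdx P i₀},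
      0 + P.root' i.1 w * s ∉ lat τ := by
    rw [eventually_all]
    exact fun i => h.eventually_affine (hw' i) 0
  obtain ⟨s, hs⟩ := h1.exists
  refine ⟨s • w, ?_, fun i hi hi' => ?_⟩
  · rw [map_smul, LinearMap.mem_ker.1 hw, smul_zero]
  · have := hs ⟨i, hi, hi'⟩
    rwa [zero_add, mul_comm, ← smul_eq_mul, ← map_smul] at this

theorem exists_regular {τ : ℂ} {Γ : PowerSeries ℂ} {κ : ℂ → PowerSeries ℂ}
    (h : IsKron τ Γ κ) : ∃ z : 𝔥, ∀ i, P.root' i z ∉ lat τ := by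
  obtain ⟨w, hw⟩ := Module.Dual.exists_forall_ne_zero_of_forall_exists
    (fun i : ι => P.root' i) (fun i => ⟨P.coroot i, by
      rw [root'_coroot_self]
      exact two_ne_zero⟩)
  have h1 : ∀ᶠ s : ℂ in 𝓝[≠] 0, ∀ i, 0 + P.root' i w * s ∉ lat τ := by
    rw [eventually_all]
    exact fun i => h.eventually_affine (hw i) 0
  obtain ⟨s, hs⟩ := h1.exists
  refine ⟨s • w, fun i => ?_⟩
  have := hs i
  rwa [zero_add, mul_comm, ← smul_eq_mul, ← map_smul] at this

/-- Residues of the first coefficients of the Kronecker functions separate the roots. -/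
theorem eq_zero_of_sum_kronCoeff_smul {τ : ℂ} {Γ : PowerSeries ℂ} {κ : ℂ → PowerSeries ℂ}
    (h : IsKron τ Γ κ) {V : Type*} [AddCommGroup V] [Module ℂ V] (A : ι → V)
    (hA : ∀ i, A (negIdx P i) = -A i)
    (hs : ∀ z : 𝔥, (∀ i, P.root' i z ∉ lat τ) → ∑ i, kronCoeff P κ z i 1 • A i = 0) (i₀ : ι) :
    A i₀ = 0 := by
  classical
  obtain ⟨w, hw, hw'⟩ := exists_line (P := P) i₀ h
  rw [← Module.forall_dual_apply_eq_zero_iff ℂ]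
  intro f
  set a : ι → ℂ := fun i => (1 / 2 : ℂ) * P.root' i (P.coroot i₀) with ha
  have hval : ∀ (s : ℂ) i, P.root' i (w + s • (1 / 2 : ℂ) • P.coroot i₀) =
      P.root' i w + a i * s := fun s i => by
    rw [map_add, map_smul, map_smul, ha, smul_eq_mul, smul_eq_mul, mul_comm]
  have h0 : a i₀ = 1 := by rw [ha]; dsimp only; rw [root'_coroot_self]; norm_num
  have h0' : a (negIdx P i₀) = -1 := by
    rw [ha]; dsimp only; rw [root'_negIdx, LinearMap.neg_apply, root'_coroot_self]; norm_num
  have hwn : P.root' (negIdx P i₀) w = 0 := by rw [root'_negIdx, LinearMap.neg_apply, hw, neg_zero]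
  have hlim : ∀ i, i ≠ i₀ → i ≠ negIdx P i₀ →
      Tendsto (fun s : ℂ => P.root' i w + a i * s) (𝓝[≠] 0) (𝓝 (P.root' i w)) := fun i _ _ => by
    have : Tendsto (fun s : ℂ => P.root' i w + a i * s) (𝓝 0) (𝓝 (P.root' i w + a i * 0)) :=
      (by fun_prop : Continuous fun s : ℂ => P.root' i w + a i * s).tendsto 0
    rw [mul_zero, add_zero] at this
    exact this.mono_left nhdsWithin_le_nhds
  have hreg : ∀ᶠ s : ℂ in 𝓝[≠] 0, ∀ i, P.root' i (w + s • (1 / 2 : ℂ) • P.coroot i₀) ∉ lat τ := by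
    rw [eventually_all]
    intro i
    simp only [hval]
    by_cases hi : i = i₀
    · exact h.eventually_affine (by rw [hi, h0]; exact one_ne_zero) 0
    by_cases hi' : i = negIdx P i₀
    · exact h.eventually_affine (by rw [hi', h0']; exact neg_ne_zero.2 one_ne_zero) 0
    exact (hlim i hi hi').eventually ((isOpen_compl_lat h.im_pos).mem_nhds (hw' i hi hi'))
  have key : Tendsto (fun s : ℂ => ∑ i, s * (PowerSeries.coeff 1 (κ (P.root' i w + a i * s)) *
      f (A i))) (𝓝[≠] 0) (𝓝 (∑ i, if i = i₀ ∨ i = negIdx P i₀ then f (A i₀) else 0)) := by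
    refine tendsto_finsetSum _ fun i _ => ?_
    have hres : ∀ e : ℂ, e ≠ 0 → Tendsto (fun s : ℂ => s * PowerSeries.coeff 1 (κ (0 + e * s)))
        (𝓝[≠] 0) (𝓝 e⁻¹) := fun e he => by
      have := tendsto_coeff (h.tendsto_mul (a := 0) (c := 0) he 0 0 (by simp)) 1
      simp only [sub_zero, PowerSeries.coeff_C_mul, Int.cast_zero, mul_zero, expS_zero, one_mul,
        PowerSeries.coeff_one_X, mul_one] at this
      exact this
    by_cases hi : i = i₀
    · subst hi
      rw [if_pos (Or.inl rfl), hw, h0]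
      have := (hres 1 one_ne_zero).mul_const (f (A i))
      rw [inv_one, one_mul] at this
      simpa only [mul_assoc] using this
    by_cases hi' : i = negIdx P i₀
    · rw [if_pos (Or.inr hi'), hi', hwn, h0', hA, map_neg]
      have := (hres (-1) (neg_ne_zero.2 one_ne_zero)).mul_const (-f (A i₀))
      rw [inv_neg, inv_one, neg_one_mul, neg_neg] at this
      simpa only [mul_assoc] using this
    · rw [if_neg (by tauto)]
      have h1 := ((h.hol (hw' i hi hi')) 1).continuousAt.tendsto.comp (hlim i hi hi')
      have h2 : Tendsto (fun s : ℂ => s) (𝓝[≠] 0) (𝓝 0) := nhdsWithin_le_nhds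
      have := h2.mul (h1.mul_const (f (A i)))
      rw [zero_mul] at this
      exact this
  have hz : (fun s : ℂ => ∑ i, s * (PowerSeries.coeff 1 (κ (P.root' i w + a i * s)) *
      f (A i))) =ᶠ[𝓝[≠] 0] fun _ => 0 := by
    filter_upwards [hreg] with s hs'
    have := congrArg f (hs _ hs')
    rw [map_sum, map_zero] at this
    simp only [map_smul, smul_eq_mul, kronCoeff, hval] at this
    rw [← Finset.mul_sum, this, mul_zero]
  have h2 := tendsto_nhds_unique (key.congr' hz) tendsto_const_nhds
  rw [← Finset.sum_filter, Finset.sum_const, nsmul_eq_mul] at h2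
  refine (mul_eq_zero.1 h2).resolve_left ?_
  rw [← ne_eq, Nat.cast_ne_zero, ← Nat.pos_iff_ne_zero, Finset.card_pos]
  exact ⟨i₀, by simp⟩

theorem lie_deltaT_y {τ : ℂ} {Γ : PowerSeries ℂ} {κ : ℂ → PowerSeries ℂ} (h : IsKron τ Γ κ)
    {c : PowerSeries ℂ} {c₀ : ℂ} (hΓ : Γ = -1 + PowerSeries.X ^ 2 * (PowerSeries.C c₀ - c))
    (hc0 : PowerSeries.coeff 0 c = 0) (hc : ∀ j, Odd j → PowerSeries.coeff j c = 0) {n : ℕ}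
    (hn : PowerSeries.coeff (2 * n) c ≠ 0)
    (kill : ∀ m, 0 < m → m < n → ∀ r, Ell.mk b r = 0 → preDelta b m r = 0)
    (i : ι) (u : 𝔥) (hu : P.root' i u = 0) :
    ⁅deltaT b n i, Ell.y b u⁆ + ⁅Ell.t b i, deltaY b n u⁆ = 0 := by
  have h1 := eq_zero_of_sum_kronCoeff_smul h (fun k =>
      P.root' k u • (⁅deltaT b n k, Ell.y b (P.coroot i)⁆ + ⁅Ell.t b k, deltaY b n (P.coroot i)⁆) -
        P.root' k (P.coroot i) • (⁅deltaT b n k, Ell.y b u⁆ + ⁅Ell.t b k, deltaY b n u⁆))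
    (fun k => by
      simp only [deltaT_negIdx, Ell.t_negIdx, root'_negIdx, LinearMap.neg_apply]
      module)
    (fun z hz => sum_smul_lie_deltaT h hz hΓ hc0 hc hn kill u (P.coroot i)) i
  rw [hu, zero_smul, zero_sub, root'_coroot_self, neg_eq_zero] at h1
  exact (smul_eq_zero.1 h1).resolve_left two_ne_zero

/-- `𝔡` acts on `𝔱_{ell,Φ}` by derivations, provided that Kronecker functions exist. -/
theorem exists_isAction_of_isKron (H : ∀ n : ℕ, 0 < n → ∃ (τ : ℂ) (Γ : PowerSeries ℂ)
    (κ : ℂ → PowerSeries ℂ) (c : PowerSeries ℂ) (c₀ : ℂ), IsKron τ Γ κ ∧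
      Γ = -1 + PowerSeries.X ^ 2 * (PowerSeries.C c₀ - c) ∧ PowerSeries.coeff 0 c = 0 ∧
        (∀ j, Odd j → PowerSeries.coeff j c = 0) ∧ PowerSeries.coeff (2 * n) c ≠ 0) :
    ∃ ρ : Der →ₗ⁅ℂ⁆ LieDerivation ℂ (Ell b) (Ell b), IsAction b ρ := by
  have key : ∀ m : ℕ, 0 < m →
      (∀ u v, ⁅deltaY b m u, Ell.y b v⁆ + ⁅Ell.y b u, deltaY b m v⁆ = 0) ∧
      (∀ i u, P.root' i u = 0 →
        ⁅deltaT b m i, Ell.y b u⁆ + ⁅Ell.t b i, deltaY b m u⁆ = 0) := by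
    intro n
    induction n using Nat.strong_induction_on with
    | _ n ih =>
      intro hn
      obtain ⟨τ, Γ, κ, c, c₀, h, hΓ, hc0, hc, hcn⟩ := H n hn
      have kill : ∀ m, 0 < m → m < n → ∀ r, Ell.mk b r = 0 → preDelta b m r = 0 := by
        intro m hm hmn r hr
        have := ih m hmn hm
        exact preDer_relIdeal _ (preDer_delta_relator hm this.1 this.2)
          (mem_relIdeal_of_mk_eq_zero hr)
      obtain ⟨z, hz⟩ := exists_regular (P := P) h
      exact ⟨lie_deltaY_y h hz hΓ hc0 hc hcn kill, lie_deltaT_y h hΓ hc0 hc hcn kill⟩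
  exact exists_isAction (fun m hm => (key m hm).1) fun m hm => (key m hm).2

end Action

end EllipticKZB

end

noncomputable section

namespace EllipticKZB

open Filter Topology

/-! ### The theta function for fixed `τ` -/

/-- The infinite product `∏_{s>0} (1 - q^s w)`. -/
def qProd (q w : ℂ) : ℂ := ∏' s : ℕ, (1 - q ^ (s + 1) * w)

section QProd

variable {q : ℂ} (hq : ‖q‖ < 1)
include hq

theorem summable_norm_qProd (w : ℂ) : Summable fun s : ℕ => ‖-(q ^ (s + 1) * w)‖ := by
  simp only [norm_neg, norm_mul, norm_pow]
  exact ((summable_nat_add_iff 1).2 (summable_geometric_of_lt_one (norm_nonneg _) hq)).mul_right _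

theorem multipliable_qProd (w : ℂ) : Multipliable fun s : ℕ => 1 - q ^ (s + 1) * w := by
  simp only [sub_eq_add_neg]
  exact multipliable_one_add_of_summable (summable_norm_qProd hq w)

theorem qProd_eq_mul (w : ℂ) : qProd q w = (1 - q * w) * qProd q (q * w) := by
  have h : (fun s : ℕ => 1 - q ^ (s + 1) * (q * w)) = fun s : ℕ => 1 - q ^ (s + 1 + 1) * w := by
    ext s
    ring
  rw [qProd, tprod_eq_zero_mul', qProd, h]
  · simp
  · rw [← h]
    exact multipliable_qProd hq _

theorem tprod_eq_one_sub_mul_qProd (w : ℂ) : ∏' s : ℕ, (1 - q ^ s * w) = (1 - w) * qProd q w := by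
  have h := tprod_eq_zero_mul' (f := fun s : ℕ => 1 - q ^ s * w) (multipliable_qProd hq w)
  rwa [pow_zero, one_mul, ← qProd] at h

theorem qProd_ne_zero {w : ℂ} (hw : ∀ s : ℕ, q ^ (s + 1) * w ≠ 1) : qProd q w ≠ 0 := by
  simp only [qProd, sub_eq_add_neg]
  refine tprod_one_add_ne_zero_of_summable (fun s => ?_) (summable_norm_qProd hq w)
  rw [← sub_eq_add_neg, sub_ne_zero]
  exact (hw s).symm

theorem qProd_one_ne_zero : qProd q 1 ≠ 0 := by
  refine qProd_ne_zero hq fun s h => ?_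
  rw [mul_one] at h
  have := congrArg norm h
  rw [norm_pow, norm_one] at this
  exact (pow_lt_one₀ (norm_nonneg _) hq (Nat.succ_ne_zero s)).ne this

theorem differentiable_qProd : Differentiable ℂ (qProd q) := by
  rw [← differentiableOn_univ]
  have h : HasProdLocallyUniformlyOn (fun (s : ℕ) w => 1 + -(q ^ (s + 1) * w))
      (fun w => ∏' s : ℕ, (1 + -(q ^ (s + 1) * w))) Set.univ := by
    refine hasProdLocallyUniformlyOn_of_forall_compact isOpen_univ fun K _ hK => ?_
    obtain ⟨R, hR⟩ := hK.isBounded.exists_norm_le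
    refine (((summable_nat_add_iff 1).2 (summable_geometric_of_lt_one (norm_nonneg _)
      hq)).mul_right R).hasProdUniformlyOn_nat_one_add hK (.of_forall fun n w hw => ?_)
      (fun _ => by fun_prop)
    rw [norm_neg, norm_mul, norm_pow]
    exact mul_le_mul_of_nonneg_left (hR w hw) (by positivity)
  have h2 := h.differentiableOn (.of_forall fun _ => by
    simpa [Finset.prod_fn] using DifferentiableOn.finsetProd (fun _ _ => by fun_prop)) isOpen_univ
  exact h2.congr fun w _ => by simp only [qProd, sub_eq_add_neg]

end QProd

theorem exp_twoPiI_add_one (z : ℂ) : Complex.exp (twoPiI * (z + 1)) = Complex.exp (twoPiI * z) := by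
  rw [mul_add, mul_one, twoPiI, Complex.exp_add, Complex.exp_two_pi_mul_I, mul_one]

theorem exp_twoPiI_div_two : Complex.exp (twoPiI / 2) = -1 := by
  rw [twoPiI, show (2 * Real.pi * Complex.I / 2 : ℂ) = Real.pi * Complex.I by ring,
    Complex.exp_pi_mul_I]

theorem exp_twoPiI_eq_one_iff {z : ℂ} : Complex.exp (twoPiI * z) = 1 ↔ ∃ n : ℤ, z = n := by
  rw [Complex.exp_eq_one_iff]
  refine exists_congr fun n => ?_
  rw [← twoPiI, mul_comm, mul_left_inj' twoPiI_ne_zero]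

theorem add_lat_of_doubly_periodic {τ : ℂ} {r : ℂ → ℂ} (h₁ : ∀ z, r (z + 1) = r z)
    (h₂ : ∀ z, r (z + τ) = r z) (m n : ℤ) (z : ℂ) : r (z + (m + n * τ)) = r z := by
  have e1 : Function.Periodic r 1 := h₁
  have e2 : Function.Periodic r τ := h₂
  rw [← add_assoc, e2.int_mul n, ← mul_one (m : ℂ), e1.int_mul m]

section Theta

variable {τ : ℂ} (hτ : 0 < τ.im)

theorem norm_exp_twoPiI_lt_one (hτ : 0 < τ.im) : ‖Complex.exp (twoPiI * τ)‖ < 1 :=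
  UpperHalfPlane.norm_exp_two_pi_I_lt_one ⟨τ, hτ⟩

include hτ

theorem theta_eq (z : ℂ) : theta z τ =
    (Complex.exp (twoPiI * z / 2) - Complex.exp (-(twoPiI * z) / 2)) *
      qProd (Complex.exp (twoPiI * τ)) (Complex.exp (twoPiI * z)) *
      qProd (Complex.exp (twoPiI * τ)) (Complex.exp (-(twoPiI * z))) *
      (twoPiI⁻¹ * (qProd (Complex.exp (twoPiI * τ)) 1 ^ 2)⁻¹) := by
  have h1 : (∏' s : ℕ, (1 - Complex.exp (twoPiI * τ) ^ (s + 1))) =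
      qProd (Complex.exp (twoPiI * τ)) 1 := by simp only [qProd, mul_one]
  have h2 : Complex.exp (-(twoPiI * z) / 2) =
      Complex.exp (twoPiI * z / 2) * Complex.exp (-(twoPiI * z)) := by
    rw [← Complex.exp_add]
    congr 1
    ring
  rw [theta, h1, tprod_eq_one_sub_mul_qProd (norm_exp_twoPiI_lt_one hτ), h2, ← qProd]
  ring

theorem differentiable_theta : Differentiable ℂ fun z => theta z τ := by
  simp only [theta_eq hτ]
  have h := differentiable_qProd (norm_exp_twoPiI_lt_one hτ)
  have h1 : Differentiable ℂ fun z => qProd (Complex.exp (twoPiI * τ)) (Complex.exp (twoPiI * z)) :=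
    h.comp (by fun_prop)
  have h2 : Differentiable ℂ fun z =>
      qProd (Complex.exp (twoPiI * τ)) (Complex.exp (-(twoPiI * z))) := h.comp (by fun_prop)
  fun_prop

theorem theta_zero : theta 0 τ = 0 := by simp [theta_eq hτ]

theorem deriv_theta_zero : deriv (fun z => theta z τ) 0 = 1 := by
  simp only [theta_eq hτ]
  have h := differentiable_qProd (norm_exp_twoPiI_lt_one hτ)
  set A := qProd (Complex.exp (twoPiI * τ)) with hA
  have h1 : HasDerivAt (fun z => Complex.exp (twoPiI * z / 2) - Complex.exp (-(twoPiI * z) / 2))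
      twoPiI 0 := by
    have e1 : HasDerivAt (fun z : ℂ => twoPiI * z / 2) (twoPiI / 2) 0 := by
      simpa using ((hasDerivAt_id (0 : ℂ)).const_mul twoPiI).div_const 2
    have e2 : HasDerivAt (fun z : ℂ => -(twoPiI * z) / 2) (-twoPiI / 2) 0 := by
      simpa using ((hasDerivAt_id (0 : ℂ)).const_mul twoPiI).neg.div_const 2
    convert! e1.cexp.sub e2.cexp using 1
    simp
    ring
  have h2 : DifferentiableAt ℂ (fun z => A (Complex.exp (twoPiI * z)) *
      A (Complex.exp (-(twoPiI * z))) * (twoPiI⁻¹ * (A 1 ^ 2)⁻¹)) 0 := by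
    have e1 : Differentiable ℂ fun z => A (Complex.exp (twoPiI * z)) := h.comp (by fun_prop)
    have e2 : Differentiable ℂ fun z => A (Complex.exp (-(twoPiI * z))) := h.comp (by fun_prop)
    exact ((e1.mul e2).mul_const _) 0
  have h3 := (h1.mul h2.hasDerivAt).deriv
  have h4 : A 1 ≠ 0 := qProd_one_ne_zero (norm_exp_twoPiI_lt_one hτ)
  simp only [mul_zero, neg_zero, zero_div, sub_self, zero_mul, add_zero, Complex.exp_zero] at h3
  refine Eq.trans ?_ (h3.trans ?_)
  · congr 1
    ext z
    simp only [Pi.mul_apply]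
    ring
  · field_simp [twoPiI_ne_zero]

theorem theta_add_one (z : ℂ) : theta (z + 1) τ = -theta z τ := by
  rw [theta_eq hτ, theta_eq hτ, exp_twoPiI_add_one, Complex.exp_neg, exp_twoPiI_add_one,
    ← Complex.exp_neg]
  have h1 : Complex.exp (twoPiI * (z + 1) / 2) = -Complex.exp (twoPiI * z / 2) := by
    rw [show twoPiI * (z + 1) / 2 = twoPiI * z / 2 + twoPiI / 2 by ring, Complex.exp_add,
      exp_twoPiI_div_two, mul_neg_one]
  have h2 : Complex.exp (-(twoPiI * (z + 1)) / 2) = -Complex.exp (-(twoPiI * z) / 2) := by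
    rw [show -(twoPiI * (z + 1)) / 2 = -(twoPiI * z) / 2 + -(twoPiI / 2) by ring, Complex.exp_add,
      Complex.exp_neg (twoPiI / 2), exp_twoPiI_div_two]
    norm_num
  rw [h1, h2]
  ring

theorem theta_add_tau (z : ℂ) :
    theta (z + τ) τ = -Complex.exp (-(twoPiI * τ / 2) - twoPiI * z) * theta z τ := by
  rw [theta_eq hτ, theta_eq hτ]
  have hq := norm_exp_twoPiI_lt_one hτ
  set q := Complex.exp (twoPiI * τ) with hq'
  set u := Complex.exp (twoPiI * z) with hu
  set c := Complex.exp (-(twoPiI * τ / 2) - twoPiI * z) with hc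
  set e := Complex.exp (twoPiI * z / 2) with he
  have h1 : Complex.exp (twoPiI * (z + τ)) = q * u := by
    rw [hq', hu, ← Complex.exp_add]; congr 1; ring
  have h2 : Complex.exp (-(twoPiI * z)) = q * Complex.exp (-(twoPiI * (z + τ))) := by
    rw [hq', ← Complex.exp_add]; congr 1; ring
  have h3 : Complex.exp (twoPiI * (z + τ) / 2) = c * u * q * e := by
    rw [hq', hu, hc, he, ← Complex.exp_add, ← Complex.exp_add, ← Complex.exp_add]; congr 1; ring
  have h4 : Complex.exp (-(twoPiI * (z + τ)) / 2) = c * e := by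
    rw [hc, he, ← Complex.exp_add]; congr 1; ring
  have h5 : Complex.exp (-(twoPiI * z) / 2) = e * Complex.exp (-(twoPiI * z)) := by
    rw [he, ← Complex.exp_add]; congr 1; ring
  have h6 := qProd_eq_mul hq u
  have h7 := qProd_eq_mul hq (Complex.exp (-(twoPiI * (z + τ))))
  rw [← h2] at h7
  rw [h1, h3, h4, h5, h6, h7]
  ring

theorem theta_ne_zero {z : ℂ} (hz : z ∉ lat τ) : theta z τ ≠ 0 := by
  have hq := norm_exp_twoPiI_lt_one hτ
  have key : ∀ w : ℂ, w ∉ lat τ → qProd (Complex.exp (twoPiI * τ)) (Complex.exp (twoPiI * w)) ≠ 0 := by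
    intro w hw
    refine qProd_ne_zero hq fun s hs => hw ?_
    rw [← Complex.exp_nat_mul, ← Complex.exp_add,
      show ((s + 1 : ℕ) : ℂ) * (twoPiI * τ) + twoPiI * w = twoPiI * ((s + 1 : ℕ) * τ + w) by ring,
      exp_twoPiI_eq_one_iff] at hs
    obtain ⟨n, hn⟩ := hs
    refine ⟨n, -((s + 1 : ℕ) : ℤ), ?_⟩
    rw [← hn]
    push_cast
    ring
  rw [theta_eq hτ]
  refine mul_ne_zero (mul_ne_zero (mul_ne_zero ?_ (key z hz)) ?_) (mul_ne_zero
    (inv_ne_zero twoPiI_ne_zero) (inv_ne_zero (pow_ne_zero _ (qProd_one_ne_zero hq))))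
  · intro h
    have h1 : Complex.exp (twoPiI * z) = 1 := by
      rw [show twoPiI * z = twoPiI * z / 2 + twoPiI * z / 2 by ring, Complex.exp_add]
      nth_rw 1 [sub_eq_zero.1 h]
      rw [← Complex.exp_add, show -(twoPiI * z) / 2 + twoPiI * z / 2 = 0 by ring, Complex.exp_zero]
    obtain ⟨n, hn⟩ := exp_twoPiI_eq_one_iff.1 h1
    exact hz ⟨n, 0, by rw [hn]; simp⟩
  · rw [← mul_neg]
    exact key (-z) fun h => hz (by simpa using neg_mem h)

/-- An elliptic function with at most removable singularities on the lattice is constant. -/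
theorem exists_eq_const_of_doubly_periodic {r : ℂ → ℂ} (h₁ : ∀ z, r (z + 1) = r z)
    (h₂ : ∀ z, r (z + τ) = r z) (hd : ∀ z ∉ lat τ, DifferentiableAt ℂ r z)
    (h₀ : Tendsto (fun z => z * r z) (𝓝[≠] 0) (𝓝 0)) : ∃ C, ∀ z ∉ lat τ, r z = C := by
  obtain ⟨g, hg, hgr, hgc⟩ := exists_entire_of_removable (f := r)
    (fun c => (eventually_notMem_lat hτ c).mono hd) (fun c => by
      by_cases hc : c ∈ lat τ
      · obtain ⟨m, n, e⟩ := mem_lat.1 hc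
        have h3 : Tendsto (fun s : ℂ => s - c) (𝓝[≠] c) (𝓝[≠] 0) := by
          refine tendsto_nhdsWithin_iff.2 ⟨?_, ?_⟩
          · have : Tendsto (fun s : ℂ => s - c) (𝓝 c) (𝓝 (c - c)) :=
              (continuous_id.sub continuous_const).tendsto c
            rw [sub_self] at this
            exact this.mono_left nhdsWithin_le_nhds
          · filter_upwards [self_mem_nhdsWithin] with s hs
            exact sub_ne_zero.2 hs
        refine (h₀.comp h3).congr fun s => ?_
        have := add_lat_of_doubly_periodic h₁ h₂ m n (s - c)
        rw [← e, sub_add_cancel] at this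
        simp only [Function.comp_apply, this]
      · have h4 : Tendsto (fun s => (s - c) * r s) (𝓝 c) (𝓝 ((c - c) * r c)) :=
          ((continuous_id.sub continuous_const).tendsto c).mul (hd c hc).continuousAt.tendsto
        rw [sub_self, zero_mul] at h4
        exact h4.mono_left nhdsWithin_le_nhds)
  have hp : ∀ w, (∀ s, r (s + w) = r s) → ∀ s, g (s + w) = g s := fun w hw s => by
    refine eq_of_eventuallyEq_punctured (f := fun s => g (s + w))
      (hg.continuous.comp (continuous_id.add continuous_const)).continuousAt
      hg.continuous.continuousAt ?_
    filter_upwards [eventually_punctured_add (p := fun s => g s = r s) hgr s w, hgr s] with t ht ht'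
    rw [ht, ht', hw]
  refine ⟨g 0, fun z hz => ?_⟩
  rw [← hgc z (hd z hz).continuousAt]
  exact apply_eq_of_doubly_periodic hτ hg (hp 1 h₁) (hp τ h₂) z 0

theorem tendsto_theta_div : Tendsto (fun z => theta z τ / z) (𝓝[≠] 0) (𝓝 1) := by
  have h := (differentiable_theta hτ 0).hasDerivAt
  rw [deriv_theta_zero hτ, hasDerivAt_iff_tendsto_slope] at h
  refine h.congr fun z => ?_
  rw [slope_def_field, theta_zero hτ, sub_zero, sub_zero]

/-- The theta function is characterised by its quasi-periodicity. -/
theorem eq_deriv_mul_theta {H : ℂ → ℂ} (hH : Differentiable ℂ H) (h₁ : ∀ z, H (z + 1) = -H z)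
    (h₂ : ∀ z, H (z + τ) = -Complex.exp (-(twoPiI * τ / 2) - twoPiI * z) * H z) (h₀ : H 0 = 0)
    (z : ℂ) : H z = deriv H 0 * theta z τ := by
  have hlim : Tendsto (fun z => H z / theta z τ) (𝓝[≠] 0) (𝓝 (deriv H 0)) := by
    have h := (hH 0).hasDerivAt
    rw [hasDerivAt_iff_tendsto_slope] at h
    have h3 := h.div (tendsto_theta_div hτ) one_ne_zero
    rw [div_one] at h3
    refine h3.congr' ?_
    filter_upwards [self_mem_nhdsWithin] with s hs
    have hs' : s ≠ 0 := hs
    rw [Pi.div_apply, slope_def_field, h₀, sub_zero, sub_zero, div_div_div_cancel_right₀ hs']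
  obtain ⟨C, hC⟩ := exists_eq_const_of_doubly_periodic hτ (r := fun z => H z / theta z τ)
    (fun z => by rw [h₁, theta_add_one hτ, neg_div_neg_eq])
    (fun z => by
      rw [h₂, theta_add_tau hτ, mul_div_mul_left]
      exact neg_ne_zero.2 (Complex.exp_ne_zero _))
    (fun z hz => (hH z).div (differentiable_theta hτ z) (theta_ne_zero hτ hz))
    (by
      have h3 : Tendsto (fun z : ℂ => z) (𝓝[≠] 0) (𝓝 0) := nhdsWithin_le_nhds
      have := h3.mul hlim
      rwa [zero_mul] at this)
  have hC' : deriv H 0 = C := by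
    refine tendsto_nhds_unique (hlim.congr' ?_) tendsto_const_nhds
    filter_upwards [eventually_notMem_lat hτ 0] with s hs using hC s hs
  refine eq_of_eventuallyEq_punctured (g := fun z => deriv H 0 * theta z τ)
    hH.continuous.continuousAt ((differentiable_theta hτ).continuous.const_mul _).continuousAt ?_
  filter_upwards [eventually_notMem_lat hτ z] with s hs
  rw [hC', ← hC s hs, div_mul_cancel₀ _ (theta_ne_zero hτ hs)]

end Theta

end EllipticKZB

end

noncomputable section

namespace EllipticKZB

open Filter Topology PowerSeries
open scoped PowerSeries.WithPiTopology ContDiff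

/-! ### Taylor series -/

/-- The Taylor series of a function. -/
def tay (f : ℂ → ℂ) (z : ℂ) : ℂ⟦X⟧ := PowerSeries.mk fun n => iteratedDeriv n f z / (n.factorial : ℂ)

theorem coeff_tay (f : ℂ → ℂ) (z : ℂ) (n : ℕ) :
    coeff n (tay f z) = iteratedDeriv n f z / (n.factorial : ℂ) := coeff_mk _ _

theorem constantCoeff_tay (f : ℂ → ℂ) (z : ℂ) : constantCoeff (tay f z) = f z := by
  rw [← coeff_zero_eq_constantCoeff_apply, coeff_tay]
  simp

theorem factorial_cast_ne_zero (n : ℕ) : (n.factorial : ℂ) ≠ 0 :=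
  Nat.cast_ne_zero.2 n.factorial_ne_zero

theorem tay_congr {f g : ℂ → ℂ} {z : ℂ} (h : f =ᶠ[𝓝 z] g) : tay f z = tay g z := by
  ext n
  rw [coeff_tay, coeff_tay, h.iteratedDeriv_eq]

theorem tay_mul {f g : ℂ → ℂ} {z : ℂ} (hf : AnalyticAt ℂ f z) (hg : AnalyticAt ℂ g z) :
    tay (fun w => f w * g w) z = tay f z * tay g z := by
  ext n
  rw [coeff_tay, coeff_mul, iteratedDeriv_fun_mul hf.contDiffAt hg.contDiffAt,
    Finset.Nat.sum_antidiagonal_eq_sum_range_succ_mk, Finset.sum_div]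
  refine Finset.sum_congr rfl fun i hi => ?_
  have hi' : i ≤ n := Nat.lt_succ_iff.1 (Finset.mem_range.1 hi)
  dsimp only
  have h1 := factorial_cast_ne_zero n
  have h2 := factorial_cast_ne_zero i
  have h3 := factorial_cast_ne_zero (n - i)
  rw [coeff_tay, coeff_tay, Nat.cast_choose ℂ hi']
  field_simp

theorem tay_add {f g : ℂ → ℂ} {z : ℂ} (hf : AnalyticAt ℂ f z) (hg : AnalyticAt ℂ g z) :
    tay (fun w => f w + g w) z = tay f z + tay g z := by
  ext n
  rw [coeff_tay, map_add, iteratedDeriv_fun_add hf.contDiffAt hg.contDiffAt, add_div, coeff_tay,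
    coeff_tay]

theorem tay_const_mul (c : ℂ) (f : ℂ → ℂ) (z : ℂ) : tay (fun w => c * f w) z = C c * tay f z := by
  ext n
  rw [coeff_tay, coeff_C_mul, iteratedDeriv_const_mul_field, coeff_tay, mul_div_assoc]

theorem tay_deriv (f : ℂ → ℂ) (z : ℂ) : tay (deriv f) z = derivative ℂ (tay f z) := by
  ext n
  rw [coeff_tay, coeff_derivative, coeff_tay, ← iteratedDeriv_succ', Nat.factorial_succ]
  push_cast
  field_simp [factorial_cast_ne_zero]

theorem tay_comp_add (f : ℂ → ℂ) (s z : ℂ) : tay (fun w => f (w + s)) z = tay f (z + s) := by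
  ext n
  rw [coeff_tay, coeff_tay, iteratedDeriv_comp_add_const]

theorem tay_exp (c z : ℂ) :
    tay (fun w => Complex.exp (c * w)) z = C (Complex.exp (c * z)) * expS c := by
  ext n
  rw [coeff_tay, coeff_C_mul, expS, coeff_rescale, coeff_exp, iteratedDeriv_cexp_const_mul]
  simp
  ring

theorem tay_id_zero : tay (fun w => w) 0 = X := by
  ext n
  rw [coeff_tay, iteratedDeriv_fun_id_zero, coeff_X]
  split_ifs with h
  · simp [h]
  · simp

theorem hasDerivAt_coeff_tay {f : ℂ → ℂ} (hf : ContDiff ℂ ∞ f) (n : ℕ) (z : ℂ) :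
    HasDerivAt (fun w => coeff n (tay f w)) (coeff n (derivative ℂ (tay f z))) z := by
  rw [← tay_deriv]
  simp only [coeff_tay]
  refine HasDerivAt.div_const ?_ _
  rw [← iteratedDeriv_succ', iteratedDeriv_succ]
  have : Differentiable ℂ (iteratedDeriv n f) := hf.differentiable_iteratedDeriv n (by
    exact_mod_cast WithTop.coe_lt_top n)
  exact (this z).hasDerivAt

theorem coeff_X_mul_derivative (f : ℂ⟦X⟧) (n : ℕ) :
    coeff n (X * derivative ℂ f) = n * coeff n f := by
  cases n with
  | zero => simp
  | succ n =>
    rw [coeff_succ_X_mul, coeff_derivative]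
    push_cast
    ring

section Theta

variable {τ : ℂ} (hτ : 0 < τ.im)

theorem thetaTaylor_eq (z τ : ℂ) : thetaTaylor z τ = tay (fun w => theta w τ) z := rfl

include hτ

theorem contDiff_theta : ContDiff ℂ ∞ fun z => theta z τ := (differentiable_theta hτ).contDiff

theorem analyticAt_theta (z : ℂ) : AnalyticAt ℂ (fun z => theta z τ) z :=
  (differentiable_theta hτ).analyticAt z

theorem constantCoeff_thetaDivX : constantCoeff (thetaDivX τ) = 1 := by
  rw [← coeff_zero_eq_constantCoeff_apply, thetaDivX, coeff_mk, thetaTaylor_eq, coeff_tay]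
  simp [deriv_theta_zero hτ]

theorem thetaTaylor_zero : thetaTaylor 0 τ = X * thetaDivX τ := by
  ext n
  cases n with
  | zero =>
    rw [coeff_zero_X_mul, coeff_zero_eq_constantCoeff_apply, thetaTaylor_eq, constantCoeff_tay,
      theta_zero hτ]
  | succ n => rw [coeff_succ_X_mul, thetaDivX, coeff_mk]

theorem thetaDivX_mul_inv : thetaDivX τ * (thetaDivX τ)⁻¹ = 1 :=
  PowerSeries.mul_inv_cancel _ (by rw [constantCoeff_thetaDivX hτ]; exact one_ne_zero)

omit hτ in
/-- The Kronecker function `x θ(z+x) / (θ(z) θ(x))` as a power series in `x`. -/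
def kron (τ z : ℂ) : ℂ⟦X⟧ := C (theta z τ)⁻¹ * thetaTaylor z τ * (thetaDivX τ)⁻¹

theorem constantCoeff_kron {z : ℂ} (hz : z ∉ lat τ) : constantCoeff (kron τ z) = 1 := by
  rw [kron, map_mul, map_mul, constantCoeff_inv, constantCoeff_thetaDivX hτ, thetaTaylor_eq,
    constantCoeff_tay, inv_one, mul_one]
  exact inv_mul_cancel₀ (theta_ne_zero hτ hz)

theorem kron_eq {z : ℂ} (hz : z ∉ lat τ) : kron τ z = 1 + X * kSeries z τ := by
  ext n
  cases n with
  | zero => simp [constantCoeff_kron hτ hz]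
  | succ n =>
    rw [map_add, coeff_succ_X_mul, kSeries, coeff_mk, coeff_one, if_neg (Nat.succ_ne_zero n),
      zero_add, kron]

theorem coeffDiffAt_thetaTaylor (z : ℂ) : CoeffDiffAt (fun z => thetaTaylor z τ) z := fun n =>
  (hasDerivAt_coeff_tay (contDiff_theta hτ) n z).differentiableAt

theorem thetaTaylor_add_one (z : ℂ) : thetaTaylor (z + 1) τ = -thetaTaylor z τ := by
  rw [thetaTaylor_eq, ← tay_comp_add]
  simp only [theta_add_one hτ]
  ext n
  simp [coeff_tay, thetaTaylor_eq, iteratedDeriv_fun_neg, neg_div]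

theorem thetaTaylor_add_tau (z : ℂ) : thetaTaylor (z + τ) τ =
    -(C (Complex.exp (-(twoPiI * τ / 2) - twoPiI * z)) * expS (-twoPiI) * thetaTaylor z τ) := by
  have h : ∀ w, theta (w + τ) τ = -Complex.exp (-(twoPiI * τ / 2)) *
      (Complex.exp (-twoPiI * w) * theta w τ) := fun w => by
    rw [theta_add_tau hτ, sub_eq_add_neg, Complex.exp_add]
    ring_nf
  rw [thetaTaylor_eq, ← tay_comp_add]
  simp only [h]
  rw [tay_const_mul, tay_mul (by fun_prop) (analyticAt_theta hτ z), tay_exp, ← thetaTaylor_eq,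
    sub_eq_add_neg, Complex.exp_add, map_neg, map_mul, neg_mul twoPiI z]
  ring

omit hτ in
/-- The value at `z = 0` of `x² ∂_x F(z, x)`. -/
def kronGamma (τ : ℂ) : ℂ⟦X⟧ :=
  -1 + X ^ 2 * derivative ℂ (derivative ℂ (thetaDivX τ) * (thetaDivX τ)⁻¹)

theorem hasDerivAt_coeff_thetaTaylor_mul (E : ℂ⟦X⟧) (n : ℕ) (z : ℂ) :
    HasDerivAt (fun z => coeff n (thetaTaylor z τ * E))
      (coeff n (derivative ℂ (thetaTaylor z τ) * E)) z := by
  simp only [coeff_mul]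
  exact HasDerivAt.fun_sum fun p _ =>
    (hasDerivAt_coeff_tay (contDiff_theta hτ) p.1 z).mul_const _

theorem tendsto_div_theta : Tendsto (fun z => z / theta z τ) (𝓝[≠] 0) (𝓝 1) := by
  have h := (tendsto_theta_div hτ).inv₀ one_ne_zero
  rw [inv_one] at h
  exact h.congr fun z => inv_div _ _

theorem kron_add_one (z : ℂ) : kron τ (z + 1) = kron τ z := by
  rw [kron, theta_add_one hτ, thetaTaylor_add_one hτ, kron, inv_neg, map_neg]
  ring

theorem kron_add_tau (z : ℂ) : kron τ (z + τ) = expS (-twoPiI) * kron τ z := by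
  rw [kron, theta_add_tau hτ, thetaTaylor_add_tau hτ, kron]
  set e := Complex.exp (-(twoPiI * τ / 2) - twoPiI * z) with he
  have h : C (-e * theta z τ)⁻¹ * -(C e * expS (-twoPiI) * thetaTaylor z τ) =
      C (e⁻¹ * e) * (C (theta z τ)⁻¹ * (expS (-twoPiI) * thetaTaylor z τ)) := by
    rw [mul_inv, inv_neg, map_mul, map_mul, map_neg]
    ring
  rw [h, inv_mul_cancel₀ (Complex.exp_ne_zero _), map_one]
  ring

theorem isKron_kron : IsKron τ (kronGamma τ) (kron τ) where
  im_pos := hτ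
  hol {z} hz := by
    refine CoeffDiffAt.mul (CoeffDiffAt.mul ?_ (coeffDiffAt_thetaTaylor hτ z)) (CoeffDiffAt.const _)
    intro n
    simp only [coeff_C]
    split_ifs
    · exact (differentiable_theta hτ z).inv (theta_ne_zero hτ hz)
    · exact differentiableAt_const _
  const := constantCoeff_kron hτ
  per _ := kron_add_one hτ _
  perτ _ := kron_add_tau hτ _
  res := by
    have h1 : Tendsto (fun z => thetaTaylor z τ) (𝓝[≠] 0) (𝓝 (X * thetaDivX τ)) := by
      rw [← thetaTaylor_zero hτ]
      exact (coeffDiffAt_thetaTaylor hτ 0).tendsto.mono_left nhdsWithin_le_nhds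
    have h2 : Tendsto (fun z => C (z / theta z τ)) (𝓝[≠] 0) (𝓝 (C (1 : ℂ))) := by
      refine tendsto_of_coeff fun n => ?_
      simp only [coeff_C]
      split_ifs
      · exact tendsto_div_theta hτ
      · exact tendsto_const_nhds
    have h3 := (h2.mul h1).mul_const (thetaDivX τ)⁻¹
    rw [map_one, one_mul, mul_assoc, thetaDivX_mul_inv hτ, mul_one] at h3
    refine h3.congr fun z => ?_
    rw [kron, div_eq_mul_inv, map_mul]
    ring
  fay := by
    have hD := thetaDivX_mul_inv hτ
    set W := derivative ℂ (thetaDivX τ) * (thetaDivX τ)⁻¹ with hW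
    have hQ : derivative ℂ (thetaTaylor 0 τ) * (thetaDivX τ)⁻¹ = 1 + X * W := by
      rw [thetaTaylor_zero hτ, Derivation.leibniz, derivative_X, smul_eq_mul, smul_eq_mul, mul_one,
        hW]
      linear_combination hD
    refine tendsto_of_coeff fun n => ?_
    have h1 := hasDerivAt_coeff_thetaTaylor_mul hτ (thetaDivX τ)⁻¹ n 0
    rw [hQ, hasDerivAt_iff_tendsto_slope] at h1
    have h2 := (h1.const_mul ((n : ℂ) - 1)).mul (tendsto_div_theta hτ)
    have e : coeff n (kronGamma τ) = ((n : ℂ) - 1) * coeff n (1 + X * W) * 1 := by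
      have : kronGamma τ = X * derivative ℂ (1 + X * W) - (1 + X * W) := by
        rw [kronGamma, ← hW, map_add, Derivation.map_one_eq_zero, Derivation.leibniz _ X W, derivative_X,
          smul_eq_mul, smul_eq_mul]
        ring
      rw [this, map_sub, coeff_X_mul_derivative]
      ring
    rw [e]
    refine h2.congr' ?_
    filter_upwards [self_mem_nhdsWithin] with z hz
    have hz' : z ≠ 0 := hz
    have h0 : ((n : ℂ) - 1) * coeff n (thetaTaylor 0 τ * (thetaDivX τ)⁻¹) = 0 := by
      rw [thetaTaylor_zero hτ, mul_assoc, hD, mul_one, coeff_X]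
      split_ifs with h
      · simp [h]
      · simp
    have h1 : kron τ z = C (theta z τ)⁻¹ * (thetaTaylor z τ * (thetaDivX τ)⁻¹) := by
      rw [kron, mul_assoc]
    rw [slope_def_field, map_sub, coeff_X_mul_derivative, h1, coeff_C_mul, sub_zero, mul_assoc,
      div_mul_div_cancel₀ hz']
    linear_combination (-(theta z τ)⁻¹) * h0

end Theta

end EllipticKZB

end

noncomputable section

namespace EllipticKZB

open Filter Topology PowerSeries
open scoped PowerSeries.WithPiTopology ContDiff

/-! ### Expansion of the logarithmic derivative of theta -/

/-- The period lattice `ℤ + ℤτ`. -/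
def periodPair {τ : ℂ} (hτ : 0 < τ.im) : PeriodPair where
  ω₁ := 1
  ω₂ := τ
  indep := by
    rw [LinearIndependent.pair_iff]
    intro s t h
    have h1 := congrArg Complex.im h
    simp at h1
    rcases h1 with h1 | h1
    · subst h1
      simp at h
      exact ⟨h, rfl⟩
    · exact absurd h1 hτ.ne'

theorem mem_periodPair_lattice {τ : ℂ} (hτ : 0 < τ.im) {z : ℂ} :
    z ∈ (periodPair hτ).lattice ↔ z ∈ lat τ := by
  rw [PeriodPair.mem_lattice, mem_lat]
  refine exists_congr fun m => exists_congr fun n => ?_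
  simp only [periodPair, mul_one]
  exact eq_comm

/-- The Wronskian-type expression `f f'' - f'²`. -/
def logWron (f : ℂ → ℂ) (z : ℂ) : ℂ := f z * deriv (deriv f) z - deriv f z ^ 2

theorem differentiable_deriv {f : ℂ → ℂ} (hf : Differentiable ℂ f) : Differentiable ℂ (deriv f) :=
  fun _ => ((hf.differentiableOn (s := Set.univ)).deriv isOpen_univ).differentiableAt univ_mem

theorem differentiable_logWron {f : ℂ → ℂ} (hf : Differentiable ℂ f) :
    Differentiable ℂ (logWron f) := by
  have h1 := differentiable_deriv hf
  have h2 := differentiable_deriv h1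
  exact (hf.mul h2).sub (h1.pow 2)

theorem logWron_mul {f g : ℂ → ℂ} (hf : Differentiable ℂ f) (hg : Differentiable ℂ g) (z : ℂ) :
    logWron (fun w => f w * g w) z = f z ^ 2 * logWron g z + g z ^ 2 * logWron f z := by
  have hf1 := differentiable_deriv hf
  have hg1 := differentiable_deriv hg
  have h1 : deriv (fun w => f w * g w) = fun w => deriv f w * g w + f w * deriv g w := by
    ext w
    exact deriv_fun_mul (hf w) (hg w)
  rw [logWron, h1, deriv_fun_add ((hf1 z).fun_mul (hg z)) ((hf z).fun_mul (hg1 z)),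
    deriv_fun_mul (hf1 z) (hg z), deriv_fun_mul (hf z) (hg1 z), logWron, logWron]
  ring

theorem logWron_comp_add (f : ℂ → ℂ) (s z : ℂ) :
    logWron (fun w => f (w + s)) z = logWron f (z + s) := by
  have h1 : deriv (fun w => f (w + s)) = fun w => deriv f (w + s) := by
    ext w
    exact deriv_comp_add_const f s w
  rw [logWron, h1, deriv_comp_add_const, logWron]

theorem logWron_exp (a c z : ℂ) : logWron (fun w => a * Complex.exp (c * w)) z = 0 := by
  have h1 : deriv (fun w => a * Complex.exp (c * w)) = fun w => a * c * Complex.exp (c * w) := by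
    ext w
    have : HasDerivAt (fun w => Complex.exp (c * w)) (Complex.exp (c * w) * (c * 1)) w :=
      ((hasDerivAt_id w).const_mul c).cexp
    rw [(this.const_mul a).deriv]
    ring
  have h2 : deriv (fun w => a * c * Complex.exp (c * w)) = fun w => a * c * c * Complex.exp (c * w) := by
    ext w
    have : HasDerivAt (fun w => Complex.exp (c * w)) (Complex.exp (c * w) * (c * 1)) w :=
      ((hasDerivAt_id w).const_mul c).cexp
    rw [(this.const_mul (a * c)).deriv]
    ring
  rw [logWron, h1, h2]
  ring

theorem logWron_id (z : ℂ) : logWron (fun w => w) z = -1 := by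
  have h1 : deriv (fun w : ℂ => w) = fun _ => 1 := by
    ext w
    exact deriv_id w
  rw [logWron, h1, deriv_const]
  ring

section Theta

variable {τ : ℂ} (hτ : 0 < τ.im)

/-- The entire function `θ(z|τ)/z`. -/
def thetaQuot (τ : ℂ) : ℂ → ℂ := dslope (fun z => theta z τ) 0

include hτ

theorem theta_eq_mul (z : ℂ) : theta z τ = z * thetaQuot τ z := by
  have h := sub_smul_dslope (fun z => theta z τ) 0 z
  rw [sub_zero, theta_zero hτ, sub_zero] at h
  exact h.symm

theorem differentiable_thetaQuot : Differentiable ℂ (thetaQuot τ) := by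
  rw [← differentiableOn_univ]
  exact (Complex.differentiableOn_dslope univ_mem).2 (differentiable_theta hτ).differentiableOn

theorem thetaQuot_zero : thetaQuot τ 0 = 1 := by
  rw [thetaQuot, dslope_same, deriv_theta_zero hτ]

theorem tay_thetaQuot : tay (thetaQuot τ) 0 = thetaDivX τ := by
  have h1 : thetaTaylor 0 τ = X * tay (thetaQuot τ) 0 := by
    rw [thetaTaylor_eq]
    simp only [theta_eq_mul hτ]
    rw [tay_mul (f := fun w => w) analyticAt_id ((differentiable_thetaQuot hτ).analyticAt 0), tay_id_zero]
  rw [thetaTaylor_zero hτ] at h1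
  exact (mul_left_cancel₀ X_ne_zero h1).symm

theorem logWron_theta (z : ℂ) : logWron (fun w => theta w τ) z =
    z ^ 2 * logWron (thetaQuot τ) z - thetaQuot τ z ^ 2 := by
  simp only [theta_eq_mul hτ]
  rw [logWron_mul (f := fun w => w) differentiable_id (differentiable_thetaQuot hτ), logWron_id]
  ring

theorem logWron_theta_add_one (z : ℂ) :
    logWron (fun w => theta w τ) (z + 1) = logWron (fun w => theta w τ) z := by
  rw [← logWron_comp_add]
  simp only [theta_add_one hτ]
  have h := logWron_mul (f := fun w => (-1) * Complex.exp (0 * w)) (by fun_prop)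
    (differentiable_theta hτ) z
  rw [logWron_exp] at h
  simpa using h

theorem logWron_theta_add_tau (z : ℂ) : logWron (fun w => theta w τ) (z + τ) =
    Complex.exp (-(twoPiI * τ / 2) - twoPiI * z) ^ 2 * logWron (fun w => theta w τ) z := by
  rw [← logWron_comp_add]
  have h1 : ∀ w, theta (w + τ) τ = (-Complex.exp (-(twoPiI * τ / 2)) *
      Complex.exp (-twoPiI * w)) * theta w τ := fun w => by
    rw [theta_add_tau hτ, sub_eq_add_neg, Complex.exp_add]
    ring_nf
  simp only [h1]
  rw [logWron_mul (by fun_prop) (differentiable_theta hτ), logWron_exp, sub_eq_add_neg,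
    Complex.exp_add]
  ring_nf

/-- The second logarithmic derivative of theta is `-℘` up to a constant. -/
theorem exists_logWron_thetaQuot : ∃ C : ℂ, ∀ᶠ z in 𝓝 0, logWron (thetaQuot τ) z =
    (C - (periodPair hτ).weierstrassPExcept 0 z) * thetaQuot τ z ^ 2 := by
  set L := periodPair hτ with hL
  have h1L : (1 : ℂ) ∈ L.lattice := (mem_periodPair_lattice hτ).2 (one_mem_lat τ)
  have hτL : τ ∈ L.lattice := (mem_periodPair_lattice hτ).2 (self_mem_lat τ)
  have h0L : (0 : ℂ) ∈ L.lattice := zero_mem _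
  have hP0 : ContinuousAt (L.weierstrassPExcept 0) 0 :=
    (L.analyticAt_weierstrassPExcept 0).continuousAt
  have hd := differentiable_thetaQuot hτ
  have hd0 : ∀ᶠ z in 𝓝 0, thetaQuot τ z ≠ 0 :=
    hd.continuous.continuousAt.eventually_ne (by rw [thetaQuot_zero hτ]; exact one_ne_zero)
  set r : ℂ → ℂ := fun z => logWron (fun w => theta w τ) z / theta z τ ^ 2 + L.weierstrassP z with hr
  have hloc : ∀ z, z ≠ 0 → thetaQuot τ z ≠ 0 → r z =
      logWron (thetaQuot τ) z / thetaQuot τ z ^ 2 + L.weierstrassPExcept 0 z := by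
    intro z hz hz'
    have h2 := L.weierstrassPExcept_add ⟨0, h0L⟩ z
    dsimp only at h2
    rw [hr]
    dsimp only
    rw [← h2, logWron_theta hτ, theta_eq_mul hτ]
    simp only [sub_zero]
    field_simp
    ring
  have hcont : ContinuousAt (fun z => logWron (thetaQuot τ) z / thetaQuot τ z ^ 2 +
      L.weierstrassPExcept 0 z) 0 := by
    refine ContinuousAt.add (ContinuousAt.div (differentiable_logWron hd).continuous.continuousAt
      (hd.continuous.pow 2).continuousAt ?_) hP0
    rw [thetaQuot_zero hτ]
    norm_num
  have hev : ∀ᶠ z in 𝓝[≠] 0, r z =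
      logWron (thetaQuot τ) z / thetaQuot τ z ^ 2 + L.weierstrassPExcept 0 z := by
    filter_upwards [self_mem_nhdsWithin, nhdsWithin_le_nhds hd0] with z hz hz' using hloc z hz hz'
  obtain ⟨C, hC⟩ := exists_eq_const_of_doubly_periodic hτ (r := r)
    (fun z => by
      rw [hr]
      dsimp only
      rw [logWron_theta_add_one hτ, theta_add_one hτ, neg_sq]
      congr 1
      exact L.weierstrassP_add_coe z ⟨1, h1L⟩)
    (fun z => by
      rw [hr]
      dsimp only
      rw [logWron_theta_add_tau hτ, theta_add_tau hτ, mul_pow, neg_sq,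
        mul_div_mul_left _ _ (pow_ne_zero 2 (Complex.exp_ne_zero _))]
      congr 1
      exact L.weierstrassP_add_coe z ⟨τ, hτL⟩)
    (fun z hz => by
      refine DifferentiableAt.add (((differentiable_logWron (differentiable_theta hτ)) z).div
        ((differentiable_theta hτ z).pow 2) (pow_ne_zero 2 (theta_ne_zero hτ hz))) ?_
      refine L.differentiableOn_weierstrassP.differentiableAt ?_
      refine (isOpen_compl_iff.2 L.isClosed_lattice).mem_nhds ?_
      rw [Set.mem_compl_iff, SetLike.mem_coe, mem_periodPair_lattice]
      exact hz)
    (by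
      have h3 : Tendsto (fun z : ℂ => z) (𝓝[≠] 0) (𝓝 0) := nhdsWithin_le_nhds
      have h4 := h3.mul (hcont.tendsto.mono_left nhdsWithin_le_nhds)
      rw [zero_mul] at h4
      refine h4.congr' ?_
      filter_upwards [hev] with z hz
      rw [hz])
  refine ⟨C, ?_⟩
  have hp : ∀ᶠ z in 𝓝[≠] 0, logWron (thetaQuot τ) z =
      (C - L.weierstrassPExcept 0 z) * thetaQuot τ z ^ 2 := by
    filter_upwards [hev, eventually_notMem_lat hτ 0, nhdsWithin_le_nhds hd0] with z h1 h2 h3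
    rw [hC z h2] at h1
    rw [h1]
    field_simp
    ring
  have h0 : logWron (thetaQuot τ) 0 = (C - L.weierstrassPExcept 0 0) * thetaQuot τ 0 ^ 2 :=
    eq_of_eventuallyEq_punctured
      (g := fun z => (C - L.weierstrassPExcept 0 z) * thetaQuot τ z ^ 2)
      (differentiable_logWron hd).continuous.continuousAt
      ((continuousAt_const.sub hP0).mul (hd.continuous.pow 2).continuousAt) hp
  rw [eventually_nhdsWithin_iff] at hp
  filter_upwards [hp] with z hz
  rcases eq_or_ne z 0 with rfl | hz0
  · exact h0
  · exact hz hz0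

theorem exists_kronGamma_eq : ∃ C₀ : ℂ, kronGamma τ =
    -1 + X ^ 2 * (C C₀ - tay ((periodPair hτ).weierstrassPExcept 0) 0) := by
  obtain ⟨C₀, hC⟩ := exists_logWron_thetaQuot hτ
  refine ⟨C₀, ?_⟩
  have hd := differentiable_thetaQuot hτ
  have ad := hd.analyticAt 0
  have ad1 := (differentiable_deriv hd).analyticAt 0
  have ad2 := (differentiable_deriv (differentiable_deriv hd)).analyticAt 0
  have ap := (periodPair hτ).analyticAt_weierstrassPExcept 0
  have h1 : tay (fun w => thetaQuot τ w * deriv (deriv (thetaQuot τ)) w) 0 =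
      tay (fun w => deriv (thetaQuot τ) w * deriv (thetaQuot τ) w +
        (C₀ * (thetaQuot τ w * thetaQuot τ w) + (-1) * ((periodPair hτ).weierstrassPExcept 0 w *
          (thetaQuot τ w * thetaQuot τ w)))) 0 := by
    refine tay_congr ?_
    filter_upwards [hC] with w hw
    rw [logWron] at hw
    linear_combination hw
  rw [tay_mul ad ad2, tay_add (ad1.fun_mul ad1) ((analyticAt_const.fun_mul (ad.fun_mul ad)).fun_add
    (analyticAt_const.fun_mul (ap.fun_mul (ad.fun_mul ad)))), tay_mul ad1 ad1,
    tay_add (analyticAt_const.fun_mul (ad.fun_mul ad))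
      (analyticAt_const.fun_mul (ap.fun_mul (ad.fun_mul ad))), tay_const_mul, tay_const_mul,
    tay_mul ap (ad.fun_mul ad), tay_mul ad ad, tay_deriv, tay_deriv, tay_thetaQuot hτ] at h1
  rw [kronGamma, Derivation.leibniz, derivative_inv', smul_eq_mul, smul_eq_mul]
  have hD := thetaDivX_mul_inv hτ
  set D := thetaDivX τ
  set E := D⁻¹
  set p := tay ((periodPair hτ).weierstrassPExcept 0) 0
  rw [map_neg, map_one] at h1
  congr 2
  linear_combination (norm := ring_nf) E ^ 2 * h1 +
    (-derivative ℂ (derivative ℂ D) * E + (C C₀ - p) * (D * E + 1)) * hD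

theorem coeff_tay_weierstrass (n : ℕ) : coeff n (tay ((periodPair hτ).weierstrassPExcept 0) 0) =
    if n = 0 then 0 else (n + 1) * (periodPair hτ).G (n + 2) := by
  rw [coeff_tay, PeriodPair.iteratedDeriv_weierstrassPExcept_self]
  split_ifs with h
  · simp
  · rw [PeriodPair.sumInvPow_zero, Nat.factorial_succ]
    have := factorial_cast_ne_zero n
    push_cast
    field_simp

theorem periodPair_G {k : ℕ} (hk : 3 ≤ k) : (periodPair hτ).G k =
    2 * riemannZeta k * ModularForm.E hk (UpperHalfPlane.ofComplex τ) := by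
  have h1 : (UpperHalfPlane.ofComplex τ : ℂ) = τ := UpperHalfPlane.ofComplex_apply_of_im_pos hτ ▸ rfl
  have h2 : ModularForm.E hk (UpperHalfPlane.ofComplex τ) =
      (1 / 2 : ℂ) • EisensteinSeries.eisensteinSeriesSIF (N := 1) 0 k (UpperHalfPlane.ofComplex τ) := rfl
  rw [h2, EisensteinSeries.eisensteinSeriesSIF_apply]
  have h3 := tsum_eisSummand_eq_riemannZeta_mul_eisensteinSeries hk
    (UpperHalfPlane.ofComplex τ)
  rw [smul_eq_mul, show ∀ a b : ℂ, 2 * a * (1 / 2 * b) = a * b from fun a b => by ring, ← h3]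
  rw [PeriodPair.G, ← ((finTwoArrowEquiv ℤ).trans ((Equiv.prodComm ℤ ℤ).trans
    (periodPair hτ).latticeEquivProd.symm.toEquiv)).tsum_eq]
  refine tsum_congr fun v => ?_
  have h4 := (periodPair hτ).latticeEquiv_symm_apply (v 1, v 0)
  have h5 : ((finTwoArrowEquiv ℤ).trans ((Equiv.prodComm ℤ ℤ).trans
    (periodPair hτ).latticeEquivProd.symm.toEquiv)) v =
      (periodPair hτ).latticeEquivProd.symm (v 1, v 0) := rfl
  rw [h5, h4, EisensteinSeries.eisSummand, h1, zpow_neg, zpow_natCast, add_comm]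
  simp only [periodPair, mul_one]

end Theta

theorem aCoeff_eq (n : ℕ+) : aCoeff n = 2 * (2 * (n : ℂ) + 1) * riemannZeta (2 * (n : ℕ) + 2 : ℕ) := by
  have h := riemannZeta_two_mul_nat (k := (n : ℕ) + 1) (Nat.succ_ne_zero _)
  have e : ((2 * (n : ℕ) + 2 : ℕ) : ℂ) = 2 * (((n : ℕ) + 1 : ℕ) : ℂ) := by push_cast; ring
  rw [e, h, aCoeff, show 2 * ((n : ℕ) + 1) = 2 * (n : ℕ) + 2 by ring,
    show 2 * (n : ℕ) + 2 - 1 = 2 * (n : ℕ) + 1 by omega, twoPiI, mul_pow, mul_pow]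
  have hI : Complex.I ^ (2 * (n : ℕ) + 2) = (-1) ^ ((n : ℕ) + 1) := by
    rw [show 2 * (n : ℕ) + 2 = 2 * ((n : ℕ) + 1) by ring, pow_mul, Complex.I_sq]
  rw [hI]
  ring

theorem aCoeff_ne_zero (n : ℕ+) : aCoeff n ≠ 0 := by
  rw [aCoeff_eq]
  refine mul_ne_zero (mul_ne_zero two_ne_zero ?_) (riemannZeta_ne_zero_of_one_lt_re ?_)
  · have h : (2 * (n : ℂ) + 1) = ((2 * (n : ℕ) + 1 : ℕ) : ℂ) := by push_cast; rfl
    rw [h]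
    exact Nat.cast_ne_zero.2 (Nat.succ_ne_zero _)
  · rw [Complex.natCast_re]
    exact_mod_cast (by omega : 1 < 2 * (n : ℕ) + 2)

/-- The power series `∑_{n ≥ 1} a_{2n} E_{2n+2}(τ) x^{2n}`. -/
def eisSeries (τ : ℂ) : ℂ⟦X⟧ := PowerSeries.mk fun j =>
  if h : 0 < j / 2 ∧ Even j then aCoeff ⟨j / 2, h.1⟩ * eisenstein ⟨j / 2, h.1⟩ τ else 0

theorem coeff_zero_eisSeries (τ : ℂ) : coeff 0 (eisSeries τ) = 0 := by simp [eisSeries]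

theorem coeff_odd_eisSeries (τ : ℂ) {j : ℕ} (hj : Odd j) : coeff j (eisSeries τ) = 0 := by
  rw [eisSeries, coeff_mk, dif_neg fun h => Nat.not_even_iff_odd.2 hj h.2]

theorem coeff_even_eisSeries (τ : ℂ) (n : ℕ+) :
    coeff (2 * (n : ℕ)) (eisSeries τ) = aCoeff n * eisenstein n τ := by
  have h : 0 < 2 * (n : ℕ) / 2 ∧ Even (2 * (n : ℕ)) := by
    rw [Nat.mul_div_cancel_left _ two_pos]
    exact ⟨n.pos, even_two_mul _⟩
  have e : (⟨2 * (n : ℕ) / 2, h.1⟩ : ℕ+) = n := by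
    ext
    exact Nat.mul_div_cancel_left _ two_pos
  rw [eisSeries, coeff_mk, dif_pos h, e]

theorem tay_weierstrass_eq {τ : ℂ} (hτ : 0 < τ.im) :
    tay ((periodPair hτ).weierstrassPExcept 0) 0 = eisSeries τ := by
  ext j
  rw [coeff_tay_weierstrass hτ]
  rcases Nat.even_or_odd j with he | ho
  · obtain ⟨n, rfl⟩ := even_iff_two_dvd.1 he
    rcases Nat.eq_zero_or_pos n with rfl | hn
    · simp [coeff_zero_eisSeries]
    · lift n to ℕ+ using hn
      rw [coeff_even_eisSeries τ n, if_neg (by have := n.pos; omega),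
        periodPair_G hτ (by have := n.pos; omega), aCoeff_eq, eisenstein]
      push_cast
      ring
  · rw [coeff_odd_eisSeries τ ho, (periodPair hτ).G_eq_zero_of_odd _ (ho.add_even even_two)]
    simp

theorem exists_kronGamma_eq_eisSeries {τ : ℂ} (hτ : 0 < τ.im) : ∃ C₀ : ℂ,
    kronGamma τ = -1 + X ^ 2 * (C C₀ - eisSeries τ) := by
  rw [← tay_weierstrass_eq hτ]
  exact exists_kronGamma_eq hτ

theorem exists_eisenstein_ne_zero (n : ℕ+) : ∃ τ : ℂ, 0 < τ.im ∧ eisenstein n τ ≠ 0 := by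
  have h3 : 3 ≤ 2 * (n : ℕ) + 2 := by have := n.pos; omega
  have h := EisensteinSeries.E_ne_zero h3 ⟨(n : ℕ) + 1, by ring⟩
  obtain ⟨z, hz⟩ : ∃ z, ModularForm.E h3 z ≠ 0 := by
    by_contra hc
    push Not at hc
    exact h (DFunLike.ext _ _ hc)
  refine ⟨z, z.im_pos, ?_⟩
  rw [eisenstein, UpperHalfPlane.ofComplex_apply]
  exact hz

/-- `𝔡` acts on `𝔱_{ell,Φ}` by derivations. -/
theorem exists_isAction_ell {ι 𝔥 M : Type*} [Fintype ι] [AddCommGroup 𝔥] [Module ℂ 𝔥]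
    [AddCommGroup M] [Module ℂ M] {P : RootPairing ι ℂ M 𝔥} [P.IsRootSystem] [P.IsReduced]
    (b : P.Base) : ∃ ρ : Der →ₗ⁅ℂ⁆ LieDerivation ℂ (Ell b) (Ell b), IsAction b ρ := by
  refine exists_isAction_of_isKron fun n hn => ?_
  obtain ⟨τ, hτ, hE⟩ := exists_eisenstein_ne_zero ⟨n, hn⟩
  obtain ⟨C₀, hC⟩ := exists_kronGamma_eq_eisSeries hτ
  refine ⟨τ, kronGamma τ, kron τ, eisSeries τ, C₀, isKron_kron hτ, hC, coeff_zero_eisSeries τ,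
    fun j => coeff_odd_eisSeries τ, ?_⟩
  have := coeff_even_eisSeries τ ⟨n, hn⟩
  rw [PNat.mk_coe] at this
  rw [this]
  exact mul_ne_zero (aCoeff_ne_zero _) hE

end EllipticKZB

end

noncomputable section

namespace EllipticKZB

open Filter Topology PowerSeries
open scoped PowerSeries.WithPiTopology ContDiff

/-! ### Joint smoothness of theta -/

/-- The upper half plane times `ℂ`. -/
def halfSpace : Set (ℂ × ℂ) := {p | 0 < p.2.im}

theorem isOpen_halfSpace : IsOpen halfSpace :=
  isOpen_lt continuous_const (Complex.continuous_im.comp continuous_snd)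

/-- The `k`-th `z`-derivative of the Jacobi theta series. -/
def thetaSum (k : ℕ) (p : ℂ × ℂ) : ℂ :=
  ∑' n : ℤ, (twoPiI * n) ^ k * jacobiTheta₂_term n p.1 p.2

theorem norm_twoPiI_mul (n : ℤ) : ‖twoPiI * n‖ = 2 * Real.pi * (|n| : ℤ) := by
  rw [twoPiI, norm_mul, norm_mul, norm_mul, Complex.norm_I, Complex.norm_two, Complex.norm_real,
    Complex.norm_intCast, Real.norm_of_nonneg Real.pi_pos.le, mul_one, Int.cast_abs]

theorem summable_thetaSum (k : ℕ) {p : ℂ × ℂ} (hp : p ∈ halfSpace) :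
    Summable fun n : ℤ => (twoPiI * n) ^ k * jacobiTheta₂_term n p.1 p.2 := by
  have hp' : 0 < p.2.im := hp
  refine ((summable_pow_mul_jacobiTheta₂_term_bound |p.1.im| hp' k).mul_left
    ((2 * Real.pi) ^ k)).of_norm_bounded fun n => ?_
  rw [norm_mul, norm_pow, norm_twoPiI_mul, mul_pow, mul_assoc]
  gcongr
  exact norm_jacobiTheta₂_term_le hp' le_rfl le_rfl n

theorem hasFDerivAt_thetaSum (k : ℕ) {p : ℂ × ℂ} (hp : p ∈ halfSpace) :
    HasFDerivAt (thetaSum k) (thetaSum (k + 1) p • ContinuousLinearMap.fst ℂ ℂ ℂ +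
      ((2 * twoPiI)⁻¹ * thetaSum (k + 2) p) • ContinuousLinearMap.snd ℂ ℂ ℂ) p := by
  obtain ⟨T, hT, hτ'⟩ := exists_between (show 0 < p.2.im from hp)
  obtain ⟨S, hz⟩ := exists_gt |p.1.im|
  let V : Set (ℂ × ℂ) := {u | |u.im| < S} ×ˢ {v | T < v.im}
  have hVo : IsOpen V := by
    refine ((continuous_abs.comp Complex.continuous_im).isOpen_preimage _ isOpen_Iio).prod ?_
    exact Complex.continuous_im.isOpen_preimage _ isOpen_Ioi
  have hVmem : p ∈ V := ⟨hz, hτ'⟩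
  have hVp : IsPreconnected V := by
    refine (Convex.isPreconnected ?_).prod (convex_halfSpace_im_gt T).isPreconnected
    simpa only [abs_lt] using! (convex_halfSpace_im_gt _).inter (convex_halfSpace_im_lt _)
  let f' : ℤ → ℂ × ℂ → ℂ × ℂ →L[ℂ] ℂ := fun n q =>
    (twoPiI * n) ^ k • jacobiTheta₂_term_fderiv n q.1 q.2
  have hf (n : ℤ) : ∀ q ∈ V, HasFDerivAt
      (fun q : ℂ × ℂ => (twoPiI * n) ^ k * jacobiTheta₂_term n q.1 q.2) (f' n q) q :=
    fun q _ => (hasFDerivAt_jacobiTheta₂_term n q.1 q.2).const_mul _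
  have hu : ∀ (n : ℤ), ∀ q ∈ V, ‖f' n q‖ ≤ (2 * Real.pi) ^ k * (3 * Real.pi) *
      (((|n| : ℤ) : ℝ) ^ (k + 2) * Real.exp (-Real.pi * (T * n ^ 2 - 2 * S * |n|))) := by
    intro n q hq
    have h1 : ‖f' n q‖ = ‖(twoPiI * n) ^ k‖ * ‖jacobiTheta₂_term_fderiv n q.1 q.2‖ := norm_smul _ _
    have h2 := norm_jacobiTheta₂_term_le hT (le_of_lt hq.1) (le_of_lt hq.2) n
    have h3 := norm_jacobiTheta₂_term_fderiv_le n q.1 q.2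
    rw [h1, norm_pow, norm_twoPiI_mul, mul_pow]
    calc _ ≤ (2 * Real.pi) ^ k * ((|n| : ℤ) : ℝ) ^ k * (3 * Real.pi * |n| ^ 2 *
            Real.exp (-Real.pi * (T * n ^ 2 - 2 * S * |n|))) := by
          gcongr
          exact h3.trans (by gcongr)
      _ = _ := by ring
  have h := hasFDerivAt_tsum_of_isPreconnected
    ((summable_pow_mul_jacobiTheta₂_term_bound S hT (k + 2)).mul_left
      ((2 * Real.pi) ^ k * (3 * Real.pi))) hVo hVp hf hu hVmem (summable_thetaSum k hp) hVmem
  have e : (∑' n : ℤ, f' n p) = thetaSum (k + 1) p • ContinuousLinearMap.fst ℂ ℂ ℂ +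
      ((2 * twoPiI)⁻¹ * thetaSum (k + 2) p) • ContinuousLinearMap.snd ℂ ℂ ℂ := by
    refine HasSum.tsum_eq ?_
    have h1 := (summable_thetaSum (k + 1) hp).hasSum.smul_const (ContinuousLinearMap.fst ℂ ℂ ℂ)
    have h2 := ((summable_thetaSum (k + 2) hp).hasSum.mul_left (2 * twoPiI)⁻¹).smul_const
      (ContinuousLinearMap.snd ℂ ℂ ℂ)
    refine (h1.add h2).congr_fun fun n => ?_
    have e1 : (Real.pi * Complex.I * n ^ 2 : ℂ) = (2 * twoPiI)⁻¹ * (twoPiI * n) ^ 2 := by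
      have := twoPiI_ne_zero
      field_simp
      rw [twoPiI]
      ring
    simp only [f', jacobiTheta₂_term_fderiv]
    rw [show Complex.exp (2 * Real.pi * Complex.I * n * p.1 + Real.pi * Complex.I * n ^ 2 * p.2) =
      jacobiTheta₂_term n p.1 p.2 from rfl, e1, show (2 * Real.pi * Complex.I : ℂ) = twoPiI from rfl]
    module
  rw [← e]
  exact h

theorem contDiffOn_thetaSum (k : ℕ) : ContDiffOn ℂ ∞ (thetaSum k) halfSpace := by
  rw [contDiffOn_infty]
  intro n
  induction n generalizing k with
  | zero =>
    rw [Nat.cast_zero, contDiffOn_zero]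
    exact fun p hp => (hasFDerivAt_thetaSum k hp).continuousAt.continuousWithinAt
  | succ n ih =>
    rw [Nat.cast_succ, contDiffOn_succ_iff_fderiv_of_isOpen isOpen_halfSpace]
    refine ⟨fun p hp => (hasFDerivAt_thetaSum k hp).differentiableAt.differentiableWithinAt,
      by simp, ?_⟩
    refine ContDiffOn.congr (((ih (k + 1)).smul contDiffOn_const).add
      ((contDiffOn_const.mul (ih (k + 2))).smul contDiffOn_const))
      fun p hp => (hasFDerivAt_thetaSum k hp).fderiv

/-- The odd theta series, with the same quasi-periods as `theta`. -/
def oddTheta (p : ℂ × ℂ) : ℂ :=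
  Complex.exp (twoPiI * p.1 / 2) * thetaSum 0 (p.1 + 1 / 2 + p.2 / 2, p.2)

theorem thetaSum_zero (p : ℂ × ℂ) : thetaSum 0 p = jacobiTheta₂ p.1 p.2 := by
  simp [thetaSum, jacobiTheta₂]

theorem contDiffOn_oddTheta : ContDiffOn ℂ ∞ oddTheta halfSpace := by
  have h1 : ContDiff ℂ ∞ fun p : ℂ × ℂ => (p.1 + 1 / 2 + p.2 / 2, p.2) := by fun_prop
  have h2 : ContDiff ℂ ∞ fun p : ℂ × ℂ => Complex.exp (twoPiI * p.1 / 2) := by fun_prop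
  exact h2.contDiffOn.mul ((contDiffOn_thetaSum 0).comp h1.contDiffOn fun p hp => hp)

theorem oddTheta_add_one (z τ : ℂ) : oddTheta (z + 1, τ) = -oddTheta (z, τ) := by
  simp only [oddTheta, thetaSum_zero]
  rw [show z + 1 + 1 / 2 + τ / 2 = z + 1 / 2 + τ / 2 + 1 by ring, jacobiTheta₂_add_left,
    mul_add, add_div, Complex.exp_add, mul_one, exp_twoPiI_div_two]
  ring

theorem oddTheta_add_tau (z τ : ℂ) : oddTheta (z + τ, τ) =
    -Complex.exp (-(twoPiI * τ / 2) - twoPiI * z) * oddTheta (z, τ) := by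
  simp only [oddTheta, thetaSum_zero]
  rw [show z + τ + 1 / 2 + τ / 2 = z + 1 / 2 + τ / 2 + τ by ring, jacobiTheta₂_add_left',
    ← mul_assoc, ← mul_assoc]
  congr 1
  have h : ∀ w, -Complex.exp w = Complex.exp (w - twoPiI / 2) := fun w => by
    rw [Complex.exp_sub, exp_twoPiI_div_two, div_neg, div_one]
  rw [h, ← Complex.exp_add, ← Complex.exp_add]
  congr 1
  rw [twoPiI]
  ring

theorem oddTheta_zero (τ : ℂ) : oddTheta (0, τ) = 0 := by
  have h1 := jacobiTheta₂_add_left' (-(1 / 2) - τ / 2) τ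
  have h2 := jacobiTheta₂_add_left (-(1 / 2) + τ / 2) τ
  have h3 := jacobiTheta₂_neg_left (1 / 2 + τ / 2) τ
  rw [show -(1 / 2) - τ / 2 + τ = -(1 / 2) + τ / 2 by ring,
    show (-Real.pi * Complex.I * (τ + 2 * (-(1 / 2) - τ / 2)) : ℂ) = Real.pi * Complex.I by ring,
    Complex.exp_pi_mul_I] at h1
  rw [show -(1 / 2) + τ / 2 + 1 = 1 / 2 + τ / 2 by ring] at h2
  rw [show -(1 / 2 + τ / 2) = -(1 / 2) - τ / 2 by ring] at h3
  have h4 : jacobiTheta₂ (1 / 2 + τ / 2) τ = 0 := by linear_combination (h2 + h1 - h3) / 2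
  simp only [oddTheta, thetaSum_zero, zero_add]
  rw [h4, mul_zero]

/-- The partial derivative in the first variable. -/
def pderivFst (F : ℂ × ℂ → ℂ) (p : ℂ × ℂ) : ℂ := deriv (fun w => F (w, p.2)) p.1

/-- The partial derivative in the second variable. -/
def pderivSnd (F : ℂ × ℂ → ℂ) (p : ℂ × ℂ) : ℂ := deriv (fun s => F (p.1, s)) p.2

theorem hasDerivAt_fst {F : ℂ × ℂ → ℂ} {p : ℂ × ℂ} (h : DifferentiableAt ℂ F p) :
    HasDerivAt (fun w => F (w, p.2)) (fderiv ℂ F p (1, 0)) p.1 := by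
  have h1 : HasDerivAt (fun w : ℂ => (w, p.2)) (1, 0) p.1 :=
    (hasDerivAt_id _).prodMk (hasDerivAt_const _ _)
  exact HasFDerivAt.comp_hasDerivAt (x := p.1) (f := fun w : ℂ => (w, p.2)) h.hasFDerivAt h1

theorem hasDerivAt_snd {F : ℂ × ℂ → ℂ} {p : ℂ × ℂ} (h : DifferentiableAt ℂ F p) :
    HasDerivAt (fun s => F (p.1, s)) (fderiv ℂ F p (0, 1)) p.2 := by
  have h1 : HasDerivAt (fun s : ℂ => (p.1, s)) (0, 1) p.2 :=
    (hasDerivAt_const _ _).prodMk (hasDerivAt_id _)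
  exact HasFDerivAt.comp_hasDerivAt (x := p.2) (f := fun s : ℂ => (p.1, s)) h.hasFDerivAt h1

theorem pderivFst_eq {F : ℂ × ℂ → ℂ} {p : ℂ × ℂ} (h : DifferentiableAt ℂ F p) :
    pderivFst F p = fderiv ℂ F p (1, 0) := (hasDerivAt_fst h).deriv

theorem pderivSnd_eq {F : ℂ × ℂ → ℂ} {p : ℂ × ℂ} (h : DifferentiableAt ℂ F p) :
    pderivSnd F p = fderiv ℂ F p (0, 1) := (hasDerivAt_snd h).deriv

theorem contDiffOn_fderiv_apply {F : ℂ × ℂ → ℂ} {U : Set (ℂ × ℂ)} (hU : IsOpen U)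
    (h : ContDiffOn ℂ ∞ F U) (v : ℂ × ℂ) : ContDiffOn ℂ ∞ (fun p => fderiv ℂ F p v) U :=
  (h.fderiv_of_isOpen hU (by simp)).clm_apply contDiffOn_const

theorem ContDiffOn.differentiableAt' {F : ℂ × ℂ → ℂ} {U : Set (ℂ × ℂ)} (hU : IsOpen U)
    (h : ContDiffOn ℂ ∞ F U) {p : ℂ × ℂ} (hp : p ∈ U) : DifferentiableAt ℂ F p :=
  (h.contDiffAt (hU.mem_nhds hp)).differentiableAt (by simp)

theorem contDiffOn_pderivFst {F : ℂ × ℂ → ℂ} {U : Set (ℂ × ℂ)} (hU : IsOpen U)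
    (h : ContDiffOn ℂ ∞ F U) : ContDiffOn ℂ ∞ (pderivFst F) U :=
  (contDiffOn_fderiv_apply hU h (1, 0)).congr fun _ hp =>
    pderivFst_eq (ContDiffOn.differentiableAt' hU h hp)

theorem contDiffOn_pderivSnd {F : ℂ × ℂ → ℂ} {U : Set (ℂ × ℂ)} (hU : IsOpen U)
    (h : ContDiffOn ℂ ∞ F U) : ContDiffOn ℂ ∞ (pderivSnd F) U :=
  (contDiffOn_fderiv_apply hU h (0, 1)).congr fun _ hp =>
    pderivSnd_eq (ContDiffOn.differentiableAt' hU h hp)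

/-- Mixed partial derivatives agree. -/
theorem pderivFst_pderivSnd {F : ℂ × ℂ → ℂ} {U : Set (ℂ × ℂ)} (hU : IsOpen U)
    (h : ContDiffOn ℂ ∞ F U) {p : ℂ × ℂ} (hp : p ∈ U) :
    pderivFst (pderivSnd F) p = pderivSnd (pderivFst F) p := by
  have hd := ContDiffOn.differentiableAt' hU (contDiffOn_pderivSnd hU h) hp
  have hd' := ContDiffOn.differentiableAt' hU (contDiffOn_pderivFst hU h) hp
  have hF : DifferentiableAt ℂ (fderiv ℂ F) p :=
    ((h.fderiv_of_isOpen hU (m := ∞) (by simp)).contDiffAt (hU.mem_nhds hp)).differentiableAt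
      (by simp)
  have e1 : pderivSnd F =ᶠ[𝓝 p] fun q => fderiv ℂ F q (0, 1) := by
    filter_upwards [hU.mem_nhds hp] with q hq
    exact pderivSnd_eq (ContDiffOn.differentiableAt' hU h hq)
  have e2 : pderivFst F =ᶠ[𝓝 p] fun q => fderiv ℂ F q (1, 0) := by
    filter_upwards [hU.mem_nhds hp] with q hq
    exact pderivFst_eq (ContDiffOn.differentiableAt' hU h hq)
  have e3 : ∀ v : ℂ × ℂ, fderiv ℂ (fun q => fderiv ℂ F q v) p =
      (fderiv ℂ (fderiv ℂ F) p).flip v := fun v => by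
    have := (hF.hasFDerivAt.clm_apply (hasFDerivAt_const v p)).fderiv
    rw [this]
    ext <;> simp
  rw [pderivFst_eq hd, pderivSnd_eq hd', e1.fderiv_eq, e2.fderiv_eq, e3, e3]
  exact ((h.contDiffAt (hU.mem_nhds hp)).isSymmSndFDerivAt (by
    simp only [minSmoothness_of_isRCLikeNormedField]; exact WithTop.coe_le_coe.2 le_top)) (1, 0) (0, 1)

theorem iteratedDeriv_fst (F : ℂ × ℂ → ℂ) (n : ℕ) (p : ℂ × ℂ) :
    iteratedDeriv n (fun w => F (w, p.2)) p.1 = pderivFst^[n] F p := by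
  induction n generalizing p with
  | zero => simp
  | succ n ih =>
    rw [iteratedDeriv_succ, Function.iterate_succ_apply', pderivFst]
    congr 1
    funext w
    exact ih (w, p.2)

theorem contDiffOn_iterate_pderivFst {F : ℂ × ℂ → ℂ} {U : Set (ℂ × ℂ)} (hU : IsOpen U)
    (h : ContDiffOn ℂ ∞ F U) (n : ℕ) : ContDiffOn ℂ ∞ (pderivFst^[n] F) U := by
  induction n with
  | zero => exact h
  | succ n ih =>
    rw [Function.iterate_succ_apply']
    exact contDiffOn_pderivFst hU ih

theorem exists_jacobiTheta₂_ne_zero {τ : ℂ} (hτ : 0 < τ.im) : ∃ z, jacobiTheta₂ z τ ≠ 0 := by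
  by_contra! h0
  have h := intervalIntegral.hasSum_integral_of_dominated_convergence (μ := MeasureTheory.volume)
    (a := 0) (b := 1)
    (F := fun (n : ℤ) (t : ℝ) => jacobiTheta₂_term n (t : ℂ) τ)
    (f := fun t : ℝ => jacobiTheta₂ t τ)
    (fun n _ => Real.exp (-Real.pi * (τ.im * n ^ 2 - 2 * 0 * |n|)))
    (fun n => by
      refine Continuous.aestronglyMeasurable ?_
      unfold jacobiTheta₂_term
      fun_prop)
    (fun n => Filter.Eventually.of_forall fun t _ =>
      norm_jacobiTheta₂_term_le hτ (by simp) le_rfl n)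
    (Filter.Eventually.of_forall fun t _ => by
      simpa using summable_pow_mul_jacobiTheta₂_term_bound 0 hτ 0)
    (by simp)
    (Filter.Eventually.of_forall fun t _ => hasSum_jacobiTheta₂_term _ hτ)
  have h2 : ∀ n : ℤ, ∫ t in (0:ℝ)..1, jacobiTheta₂_term n (t : ℂ) τ = if n = 0 then 1 else 0 := by
    intro n
    rcases eq_or_ne n 0 with rfl | hn
    · simp [jacobiTheta₂_term]
    · rw [if_neg hn]
      have hne : (2 * Real.pi * Complex.I * n : ℂ) ≠ 0 :=
        mul_ne_zero twoPiI_ne_zero (Int.cast_ne_zero.2 hn)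
      simp_rw [jacobiTheta₂_term, Complex.exp_add]
      rw [intervalIntegral.integral_mul_const, integral_exp_mul_complex hne]
      rw [Complex.ofReal_one, Complex.ofReal_zero, mul_zero, Complex.exp_zero, mul_one,
        mul_comm _ (n : ℂ), Complex.exp_int_mul_two_pi_mul_I]
      simp
  simp_rw [h0, h2] at h
  have h3 := h.unique (hasSum_ite_eq (0 : ℤ) (1 : ℂ))
  simp at h3

theorem pderivFst_oddTheta_ne_zero {τ : ℂ} (hτ : 0 < τ.im) : pderivFst oddTheta (0, τ) ≠ 0 ∧
    ∀ z, oddTheta (z, τ) = pderivFst oddTheta (0, τ) * theta z τ := by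
  have h := eq_deriv_mul_theta hτ (H := fun z => oddTheta (z, τ)) (fun z =>
    (hasDerivAt_fst (p := (z, τ)) (ContDiffOn.differentiableAt' isOpen_halfSpace
      contDiffOn_oddTheta hτ)).differentiableAt) (fun z => oddTheta_add_one z τ)
      (fun z => oddTheta_add_tau z τ) (oddTheta_zero τ)
  refine ⟨fun h0 => ?_, h⟩
  obtain ⟨w, hw⟩ := exists_jacobiTheta₂_ne_zero hτ
  have h1 := h (w - 1 / 2 - τ / 2)
  rw [show deriv (fun z => oddTheta (z, τ)) 0 = pderivFst oddTheta (0, τ) from rfl, h0, zero_mul]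
    at h1
  simp only [oddTheta, thetaSum_zero] at h1
  rw [show w - 1 / 2 - τ / 2 + 1 / 2 + τ / 2 = w by ring] at h1
  exact (mul_ne_zero (Complex.exp_ne_zero _) hw) h1

theorem contDiffOn_theta : ContDiffOn ℂ ∞ (fun p : ℂ × ℂ => theta p.1 p.2) halfSpace := by
  have h1 : ContDiff ℂ ∞ fun p : ℂ × ℂ => ((0 : ℂ), p.2) := by fun_prop
  have h2 : ContDiffOn ℂ ∞ (fun p : ℂ × ℂ => pderivFst oddTheta (0, p.2)) halfSpace :=
    (contDiffOn_pderivFst isOpen_halfSpace contDiffOn_oddTheta).comp h1.contDiffOn fun p hp => hp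
  refine ((h2.inv fun p hp => (pderivFst_oddTheta_ne_zero hp).1).mul contDiffOn_oddTheta).congr
    fun p hp => ?_
  obtain ⟨h3, h4⟩ := pderivFst_oddTheta_ne_zero (show 0 < p.2.im from hp)
  rw [show oddTheta p = _ from h4 p.1, Pi.inv_apply, inv_mul_cancel_left₀ h3]

end EllipticKZB

end

noncomputable section

namespace EllipticKZB

open Filter Topology PowerSeries
open scoped PowerSeries.WithPiTopology ContDiff

/-! ### Power series depending smoothly on parameters -/

/-- All coefficients of the power series `K p` are smooth functions of `p ∈ U`. -/
def CoeffSmoothOn (K : ℂ × ℂ → ℂ⟦X⟧) (U : Set (ℂ × ℂ)) : Prop :=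
  ∀ n, ContDiffOn ℂ ∞ (fun p => coeff n (K p)) U

namespace CoeffSmoothOn

variable {K L : ℂ × ℂ → ℂ⟦X⟧} {U : Set (ℂ × ℂ)}

theorem mul (hK : CoeffSmoothOn K U) (hL : CoeffSmoothOn L U) :
    CoeffSmoothOn (fun p => K p * L p) U := fun n => by
  simp only [coeff_mul]
  exact ContDiffOn.sum fun p _ => (hK p.1).mul (hL p.2)

theorem inv (hK : CoeffSmoothOn K U) (h : ∀ p ∈ U, constantCoeff (K p) ≠ 0) :
    CoeffSmoothOn (fun p => (K p)⁻¹) U := fun n => by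
  have h0 : ContDiffOn ℂ ∞ (fun p => (constantCoeff (K p))⁻¹) U := by
    have := (hK 0).inv (by simpa using h)
    simp only [coeff_zero_eq_constantCoeff_apply] at this
    exact this
  induction n using Nat.strong_induction_on with
  | _ n ih =>
    rcases eq_or_ne n 0 with rfl | hn
    · simpa using h0
    · refine ContDiffOn.congr ?_ fun p _ => by rw [PowerSeries.coeff_inv, if_neg hn]
      refine h0.neg.mul (ContDiffOn.sum fun p _ => ?_)
      by_cases hp : p.2 < n
      · simp only [if_pos hp]
        exact (hK p.1).mul (ih _ hp)
      · simp only [if_neg hp]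
        exact contDiffOn_const

end CoeffSmoothOn

theorem coeffSmoothOn_thetaTaylor :
    CoeffSmoothOn (fun p => thetaTaylor p.1 p.2) halfSpace := fun n => by
  have h := (contDiffOn_iterate_pderivFst isOpen_halfSpace contDiffOn_theta n).div_const
    (n.factorial : ℂ)
  refine h.congr fun p _ => ?_
  dsimp only
  rw [thetaTaylor_eq, coeff_tay, ← iteratedDeriv_fst]

theorem coeffSmoothOn_thetaDivX : CoeffSmoothOn (fun p => thetaDivX p.2) halfSpace := fun n => by
  have h1 : ContDiff ℂ ∞ fun p : ℂ × ℂ => ((0 : ℂ), p.2) := by fun_prop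
  refine ((coeffSmoothOn_thetaTaylor (n + 1)).comp h1.contDiffOn fun p hp => hp).congr
    fun p _ => ?_
  exact coeff_mk _ _

/-- The coefficients of `x θ(z+x|τ)/θ(x|τ)`. -/
def kronNum (n : ℕ) (p : ℂ × ℂ) : ℂ := coeff n (thetaTaylor p.1 p.2 * (thetaDivX p.2)⁻¹)

theorem contDiffOn_kronNum (n : ℕ) : ContDiffOn ℂ ∞ (kronNum n) halfSpace :=
  (coeffSmoothOn_thetaTaylor.mul (coeffSmoothOn_thetaDivX.inv fun p hp => by
    rw [constantCoeff_thetaDivX (τ := p.2) hp]; exact one_ne_zero)) n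

theorem kronNum_zero {τ : ℂ} (hτ : 0 < τ.im) (n : ℕ) :
    kronNum n (0, τ) = if n = 1 then 1 else 0 := by
  rw [kronNum, thetaTaylor_zero hτ, mul_assoc, thetaDivX_mul_inv hτ, mul_one, coeff_X]

/-- The coefficients of `kron` as functions of two variables. -/
def kronJ (n : ℕ) (p : ℂ × ℂ) : ℂ := coeff n (kron p.2 p.1)

theorem kronJ_eq (n : ℕ) (p : ℂ × ℂ) : kronJ n p = kronNum n p / theta p.1 p.2 := by
  rw [kronJ, kron, mul_assoc, coeff_C_mul, kronNum, div_eq_inv_mul]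

/-- The complement of the zeros of theta. -/
def thetaSupport : Set (ℂ × ℂ) := halfSpace ∩ {p | theta p.1 p.2 ≠ 0}

theorem isOpen_thetaSupport : IsOpen thetaSupport :=
  contDiffOn_theta.continuousOn.isOpen_inter_preimage isOpen_halfSpace isOpen_ne

theorem mem_thetaSupport {z τ : ℂ} (hτ : 0 < τ.im) (hz : z ∉ lat τ) : (z, τ) ∈ thetaSupport :=
  ⟨hτ, theta_ne_zero hτ hz⟩

theorem contDiffOn_kronJ (n : ℕ) : ContDiffOn ℂ ∞ (kronJ n) thetaSupport :=
  (((contDiffOn_kronNum n).mono Set.inter_subset_left).div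
    (contDiffOn_theta.mono Set.inter_subset_left) fun _ hp => hp.2).congr fun p _ => kronJ_eq n p

theorem differentiableAt_kronJ (n : ℕ) {p : ℂ × ℂ} (hp : p ∈ thetaSupport) :
    DifferentiableAt ℂ (kronJ n) p :=
  ContDiffOn.differentiableAt' isOpen_thetaSupport (contDiffOn_kronJ n) hp

theorem differentiableAt_kronNum (n : ℕ) {p : ℂ × ℂ} (hp : p ∈ halfSpace) :
    DifferentiableAt ℂ (kronNum n) p :=
  ContDiffOn.differentiableAt' isOpen_halfSpace (contDiffOn_kronNum n) hp

/-! ### The heat equation -/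

section Heat

variable {τ : ℂ} (hτ : 0 < τ.im)

/-- The `z`-derivative of `kron`, coefficientwise. -/
def kronZ (τ z : ℂ) : ℂ⟦X⟧ := PowerSeries.mk fun n => pderivFst (kronJ n) (z, τ)

/-- The `τ`-derivative of `kron`, coefficientwise. -/
def kronT (τ z : ℂ) : ℂ⟦X⟧ := PowerSeries.mk fun n => pderivSnd (kronJ n) (z, τ)

include hτ

theorem kronZ_add_one (z : ℂ) : kronZ τ (z + 1) = kronZ τ z := by
  ext n
  rw [kronZ, kronZ, coeff_mk, coeff_mk, pderivFst, pderivFst]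
  dsimp only
  rw [← deriv_comp_add_const]
  simp only [kronJ, kron_add_one hτ]

theorem kronT_add_one (z : ℂ) : kronT τ (z + 1) = kronT τ z := by
  ext n
  rw [kronT, kronT, coeff_mk, coeff_mk, pderivSnd, pderivSnd]
  refine Filter.EventuallyEq.deriv_eq ?_
  filter_upwards [(isOpen_lt continuous_const Complex.continuous_im).mem_nhds hτ] with s hs
  simp only [kronJ]
  rw [kron_add_one (τ := s) hs]

theorem hasDerivAt_kronJ_fst {z : ℂ} (hz : z ∉ lat τ) (n : ℕ) :
    HasDerivAt (fun w => coeff n (kron τ w)) (coeff n (kronZ τ z)) z := by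
  have h := differentiableAt_kronJ n (mem_thetaSupport hτ hz)
  have h1 := hasDerivAt_fst h
  rw [← pderivFst_eq h] at h1
  rw [kronZ, coeff_mk]
  exact h1

theorem hasDerivAt_kronJ_snd {z : ℂ} (hz : z ∉ lat τ) (n : ℕ) :
    HasDerivAt (fun s => coeff n (kron s z)) (coeff n (kronT τ z)) τ := by
  have h := differentiableAt_kronJ n (mem_thetaSupport hτ hz)
  have h1 := hasDerivAt_snd h
  rw [← pderivSnd_eq h] at h1
  rw [kronT, coeff_mk]
  exact h1

theorem kronZ_add_tau {z : ℂ} (hz : z ∉ lat τ) :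
    kronZ τ (z + τ) = expS (-twoPiI) * kronZ τ z := by
  ext n
  rw [kronZ, coeff_mk, pderivFst]
  dsimp only
  rw [← deriv_comp_add_const]
  simp only [kronJ, kron_add_tau hτ, coeff_mul]
  exact (HasDerivAt.fun_sum fun p _ => (hasDerivAt_kronJ_fst hτ hz p.2).const_mul _).deriv

theorem kronT_add_tau {z : ℂ} (hz : z ∉ lat τ) :
    kronT τ (z + τ) = expS (-twoPiI) * (kronT τ z - kronZ τ z) := by
  have hz' : z + τ ∉ lat τ := by rwa [add_mem_lat_iff (self_mem_lat τ)]
  rw [mul_sub, eq_sub_iff_add_eq, ← kronZ_add_tau hτ hz]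
  ext n
  have h := differentiableAt_kronJ n (mem_thetaSupport hτ hz')
  have h1 : HasDerivAt (fun s : ℂ => (z + s, s)) (1, 1) τ :=
    ((hasDerivAt_id _).const_add z).prodMk (hasDerivAt_id _)
  have h2 := HasFDerivAt.comp_hasDerivAt (x := τ) (f := fun s : ℂ => (z + s, s)) h.hasFDerivAt h1
  rw [show ((1, 1) : ℂ × ℂ) = (0, 1) + (1, 0) by simp, map_add, ← pderivFst_eq h,
    ← pderivSnd_eq h] at h2
  rw [map_add, kronT, kronZ, coeff_mk, coeff_mk, ← h2.deriv]
  have h3 : HasDerivAt (fun s => coeff n (expS (-twoPiI) * kron s z))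
      (coeff n (expS (-twoPiI) * kronT τ z)) τ := by
    simp only [coeff_mul]
    exact HasDerivAt.fun_sum fun p _ => (hasDerivAt_kronJ_snd hτ hz p.2).const_mul _
  rw [← h3.deriv]
  refine Filter.EventuallyEq.deriv_eq ?_
  filter_upwards [(isOpen_lt continuous_const Complex.continuous_im).mem_nhds hτ] with s hs
  simp only [Function.comp_apply, kronJ]
  rw [kron_add_tau (τ := s) hs]

theorem tendsto_mul_div_theta_sq {N : ℂ → ℂ} (h0 : N 0 = 0) (h1 : HasDerivAt N 0 0) :
    Tendsto (fun z => z * (N z / theta z τ ^ 2)) (𝓝[≠] 0) (𝓝 0) := by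
  rw [hasDerivAt_iff_tendsto_slope] at h1
  have h2 := h1.mul ((tendsto_div_theta hτ).pow 2)
  rw [zero_mul] at h2
  refine h2.congr' ?_
  filter_upwards [self_mem_nhdsWithin] with z hz
  have hz' : z ≠ 0 := hz
  rw [slope_def_field, h0, sub_zero, sub_zero, div_pow]
  field_simp

theorem contDiffAt_theta_joint (z : ℂ) : DifferentiableAt ℂ (fun p : ℂ × ℂ => theta p.1 p.2) (z, τ) :=
  ContDiffOn.differentiableAt' isOpen_halfSpace contDiffOn_theta hτ

omit hτ in
theorem pderivFst_kronJ (n : ℕ) {p : ℂ × ℂ} (hp : p ∈ thetaSupport) : pderivFst (kronJ n) p =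
    (pderivFst (kronNum n) p * theta p.1 p.2 -
      kronNum n p * pderivFst (fun p => theta p.1 p.2) p) / theta p.1 p.2 ^ 2 := by
  have h1 := hasDerivAt_fst (differentiableAt_kronNum n hp.1)
  have h2 := hasDerivAt_fst (contDiffAt_theta_joint (τ := p.2) hp.1 p.1)
  rw [pderivFst_eq (differentiableAt_kronNum n hp.1),
    pderivFst_eq (contDiffAt_theta_joint (τ := p.2) hp.1 p.1)]
  rw [pderivFst]
  simp only [kronJ_eq]
  exact (h1.fun_div h2 hp.2).deriv

omit hτ in
theorem pderivSnd_kronJ (n : ℕ) {p : ℂ × ℂ} (hp : p ∈ thetaSupport) : pderivSnd (kronJ n) p =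
    (pderivSnd (kronNum n) p * theta p.1 p.2 -
      kronNum n p * pderivSnd (fun p => theta p.1 p.2) p) / theta p.1 p.2 ^ 2 := by
  have h1 := hasDerivAt_snd (differentiableAt_kronNum n hp.1)
  have h2 := hasDerivAt_snd (contDiffAt_theta_joint (τ := p.2) hp.1 p.1)
  rw [pderivSnd_eq (differentiableAt_kronNum n hp.1),
    pderivSnd_eq (contDiffAt_theta_joint (τ := p.2) hp.1 p.1)]
  rw [pderivSnd]
  simp only [kronJ_eq]
  exact (h1.fun_div h2 hp.2).deriv

theorem hasDerivAt_section {F : ℂ × ℂ → ℂ} (hF : ContDiffOn ℂ ∞ F halfSpace) (z : ℂ) :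
    HasDerivAt (fun w => F (w, τ)) (pderivFst F (z, τ)) z := by
  have h := ContDiffOn.differentiableAt' isOpen_halfSpace hF (p := (z, τ)) hτ
  rw [pderivFst_eq h]
  exact hasDerivAt_fst h

theorem pderivFst_theta_zero : pderivFst (fun p => theta p.1 p.2) (0, τ) = 1 :=
  deriv_theta_zero hτ

theorem eventually_im_pos : ∀ᶠ s : ℂ in 𝓝 τ, 0 < s.im :=
  (isOpen_lt continuous_const Complex.continuous_im).mem_nhds hτ

theorem pderivSnd_eq_zero {F : ℂ × ℂ → ℂ} {c z : ℂ} (h : ∀ s : ℂ, 0 < s.im → F (z, s) = c) :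
    pderivSnd F (z, τ) = 0 := by
  have : (fun s => F (z, s)) =ᶠ[𝓝 τ] fun _ => c := by
    filter_upwards [eventually_im_pos hτ] with s hs using h s hs
  rw [pderivSnd]
  simp only [this.deriv_eq, deriv_const]

theorem eventually_mem_thetaSupport : ∀ᶠ z in 𝓝[≠] (0 : ℂ), (z, τ) ∈ thetaSupport := by
  filter_upwards [eventually_notMem_lat hτ 0] with z hz using mem_thetaSupport hτ hz

theorem tendsto_mul_pderivFst_kronJ {n : ℕ} (hn : n ≠ 1) :
    Tendsto (fun z => z * pderivFst (kronJ n) (z, τ)) (𝓝[≠] 0) (𝓝 0) := by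
  have hs0 : kronNum n (0, τ) = 0 := by rw [kronNum_zero hτ, if_neg hn]
  have h := tendsto_mul_div_theta_sq hτ (N := fun z => pderivFst (kronNum n) (z, τ) * theta z τ -
    kronNum n (z, τ) * pderivFst (fun p => theta p.1 p.2) (z, τ))
    (by rw [hs0, theta_zero hτ]; ring) ?_
  · refine h.congr' ?_
    filter_upwards [eventually_mem_thetaSupport hτ] with z hz
    rw [pderivFst_kronJ n hz]
  · have h1 := ((hasDerivAt_section hτ (contDiffOn_pderivFst isOpen_halfSpace
      (contDiffOn_kronNum n)) 0).fun_mul (hasDerivAt_section hτ contDiffOn_theta 0)).fun_sub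
      ((hasDerivAt_section hτ (contDiffOn_kronNum n) 0).fun_mul (hasDerivAt_section hτ
        (contDiffOn_pderivFst isOpen_halfSpace contDiffOn_theta) 0))
    dsimp only at h1
    rw [hs0, theta_zero hτ, pderivFst_theta_zero hτ] at h1
    simpa using h1

theorem tendsto_mul_pderivSnd_kronJ (n : ℕ) :
    Tendsto (fun z => z * pderivSnd (kronJ n) (z, τ)) (𝓝[≠] 0) (𝓝 0) := by
  have hA : pderivSnd (kronNum n) (0, τ) = 0 := pderivSnd_eq_zero hτ fun s hs => kronNum_zero hs n
  have hB : pderivSnd (fun p => theta p.1 p.2) (0, τ) = 0 :=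
    pderivSnd_eq_zero hτ (c := 0) fun s hs => theta_zero hs
  have hB' : pderivFst (pderivSnd (fun p => theta p.1 p.2)) (0, τ) = 0 := by
    rw [pderivFst_pderivSnd isOpen_halfSpace contDiffOn_theta hτ]
    exact pderivSnd_eq_zero hτ (c := 1) fun s hs => pderivFst_theta_zero hs
  have h := tendsto_mul_div_theta_sq hτ (N := fun z => pderivSnd (kronNum n) (z, τ) * theta z τ -
    kronNum n (z, τ) * pderivSnd (fun p => theta p.1 p.2) (z, τ))
    (by rw [hA, hB]; ring) ?_
  · refine h.congr' ?_
    filter_upwards [eventually_mem_thetaSupport hτ] with z hz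
    rw [pderivSnd_kronJ n hz]
  · have h1 := ((hasDerivAt_section hτ (contDiffOn_pderivSnd isOpen_halfSpace
      (contDiffOn_kronNum n)) 0).fun_mul (hasDerivAt_section hτ contDiffOn_theta 0)).fun_sub
      ((hasDerivAt_section hτ (contDiffOn_kronNum n) 0).fun_mul (hasDerivAt_section hτ
        (contDiffOn_pderivSnd isOpen_halfSpace contDiffOn_theta) 0))
    dsimp only at h1
    rw [hA, hB, hB', theta_zero hτ] at h1
    simpa using h1

theorem coeffDiffAt_kronZ {z : ℂ} (hz : z ∉ lat τ) : CoeffDiffAt (kronZ τ) z := fun n => by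
  have h := (hasDerivAt_fst (ContDiffOn.differentiableAt' isOpen_thetaSupport
    (contDiffOn_pderivFst isOpen_thetaSupport (contDiffOn_kronJ n))
    (mem_thetaSupport hτ hz))).differentiableAt
  simpa only [kronZ, coeff_mk] using h

theorem coeffDiffAt_kronT {z : ℂ} (hz : z ∉ lat τ) : CoeffDiffAt (kronT τ) z := fun n => by
  have h := (hasDerivAt_fst (ContDiffOn.differentiableAt' isOpen_thetaSupport
    (contDiffOn_pderivSnd isOpen_thetaSupport (contDiffOn_kronJ n))
    (mem_thetaSupport hτ hz))).differentiableAt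
  simpa only [kronT, coeff_mk] using h

theorem kron_heat {z : ℂ} (hz : z ∉ lat τ) :
    C twoPiI * X * kronT τ z - (X * derivative ℂ (kronZ τ z) - kronZ τ z) = 0 := by
  refine eq_zero_of_quasiPeriodic (τ := τ) (μ := -twoPiI)
    (f := fun z => C twoPiI * X * kronT τ z - (X * derivative ℂ (kronZ τ z) - kronZ τ z))
    (fun z _ => ?_) hτ (neg_ne_zero.2 twoPiI_ne_zero) (fun z hz => ?_) (fun z hz => ?_) ?_ hz
  · rw [kronT_add_one hτ, kronZ_add_one hτ]
  · rw [kronT_add_tau hτ hz, kronZ_add_tau hτ hz, Derivation.leibniz, derivative_expS,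
      smul_eq_mul, smul_eq_mul, map_neg]
    ring
  · exact ((CoeffDiffAt.const _).mul (coeffDiffAt_kronT hτ hz)).sub
      (((CoeffDiffAt.const _).mul (coeffDiffAt_kronZ hτ hz).derivative).sub
        (coeffDiffAt_kronZ hτ hz))
  · refine tendsto_of_coeff fun n => ?_
    have e : ∀ z, coeff n (C z * (C twoPiI * X * kronT τ z -
        (X * derivative ℂ (kronZ τ z) - kronZ τ z))) =
        twoPiI * (z * coeff n (X * kronT τ z)) -
          ((n : ℂ) - 1) * (z * pderivFst (kronJ n) (z, τ)) := fun z => by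
      rw [coeff_C_mul, map_sub, map_sub, coeff_X_mul_derivative, mul_assoc, coeff_C_mul, kronZ,
        coeff_mk]
      ring
    simp only [e, map_zero]
    have h1 : Tendsto (fun z => z * coeff n (X * kronT τ z)) (𝓝[≠] 0) (𝓝 0) := by
      cases n with
      | zero => simp
      | succ n =>
        simp only [coeff_succ_X_mul, kronT, coeff_mk]
        exact tendsto_mul_pderivSnd_kronJ hτ n
    have h2 : Tendsto (fun z => ((n : ℂ) - 1) * (z * pderivFst (kronJ n) (z, τ))) (𝓝[≠] 0)
        (𝓝 0) := by
      rcases eq_or_ne n 1 with rfl | hn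
      · simp
      · simpa using (tendsto_mul_pderivFst_kronJ hτ hn).const_mul ((n : ℂ) - 1)
    simpa using (h1.const_mul twoPiI).sub h2

/-- The heat equation `2πi ∂_τ k = ∂_z g`. -/
theorem kronT_coeff_succ {z : ℂ} (hz : z ∉ lat τ) (n : ℕ) :
    twoPiI * coeff (n + 1) (kronT τ z) = ((n : ℂ) + 1) * coeff (n + 2) (kronZ τ z) := by
  have h := congrArg (coeff (n + 2)) (kron_heat hτ hz)
  rw [map_sub, map_sub, coeff_X_mul_derivative, mul_assoc, coeff_C_mul, coeff_succ_X_mul,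
    map_zero] at h
  push_cast at h
  linear_combination h

end Heat

end EllipticKZB

end

noncomputable section

namespace EllipticKZB

open Filter Topology PowerSeries
open scoped PowerSeries.WithPiTopology ContDiff

/-! ### Modularity of the Kronecker function -/

section Modular

variable {τ : ℂ} (hτ : 0 < τ.im)

/-- The Kronecker function is determined by its quasi-periods and its residue. -/
theorem eq_kron_of_quasiPeriodic (hτ : 0 < τ.im) {f : ℂ → ℂ⟦X⟧} (hol : ∀ z ∉ lat τ, CoeffDiffAt f z)
    (per : ∀ z ∉ lat τ, f (z + 1) = f z) (perτ : ∀ z ∉ lat τ, f (z + τ) = expS (-twoPiI) * f z)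
    (res : Tendsto (fun z => C z * f z) (𝓝[≠] 0) (𝓝 X)) {z : ℂ} (hz : z ∉ lat τ) :
    f z = kron τ z := by
  have hk := isKron_kron hτ
  refine sub_eq_zero.1 (eq_zero_of_quasiPeriodic (τ := τ) (μ := -twoPiI)
    (f := fun z => f z - kron τ z) (fun z hz => ?_) hτ (neg_ne_zero.2 twoPiI_ne_zero)
    (fun z hz => ?_) (fun z hz => (hol z hz).sub (hk.hol hz)) ?_ hz)
  · rw [per z hz, kron_add_one hτ]
  · rw [perτ z hz, kron_add_tau hτ, mul_sub]
  · have h := res.sub hk.res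
    rw [sub_self] at h
    exact h.congr fun z => (mul_sub _ _ _).symm

theorem lat_add_one (τ : ℂ) : lat (τ + 1) = lat τ := by
  ext z
  rw [mem_lat, mem_lat]
  constructor
  · rintro ⟨m, n, rfl⟩
    exact ⟨m + n, n, by push_cast; ring⟩
  · rintro ⟨m, n, rfl⟩
    exact ⟨m - n, n, by push_cast; ring⟩

theorem mem_lat_neg_inv {τ z : ℂ} (h0 : τ ≠ 0) : z * τ⁻¹ ∈ lat (-τ⁻¹) ↔ z ∈ lat τ := by
  rw [mem_lat, mem_lat]
  constructor
  · rintro ⟨m, n, h⟩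
    refine ⟨-n, m, ?_⟩
    rw [← div_eq_mul_inv, div_eq_iff h0] at h
    rw [h]
    field_simp
    push_cast
    ring
  · rintro ⟨m, n, rfl⟩
    refine ⟨n, -m, ?_⟩
    field_simp
    push_cast
    ring

include hτ

theorem ne_zero_of_im_pos : τ ≠ 0 := by
  rintro rfl
  simp at hτ

theorem im_neg_inv_pos : 0 < (-τ⁻¹).im := by
  rw [Complex.neg_im, Complex.inv_im, neg_div, neg_neg]
  exact div_pos hτ (Complex.normSq_pos.2 (ne_zero_of_im_pos hτ))

theorem kron_tau_add_one {z : ℂ} (hz : z ∉ lat τ) : kron (τ + 1) z = kron τ z := by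
  have hτ' : 0 < (τ + 1).im := by simpa using hτ
  have hk := isKron_kron hτ'
  refine eq_kron_of_quasiPeriodic hτ (fun z hz => hk.hol (by rwa [lat_add_one]))
    (fun z _ => kron_add_one hτ' z) (fun z _ => ?_) hk.res hz
  rw [← kron_add_one hτ', add_assoc, kron_add_tau hτ']

omit hτ in
theorem coeffDiffAt_expS (c z : ℂ) : CoeffDiffAt (fun z => expS (c * z)) z := fun n => by
  simp only [expS, coeff_rescale]
  fun_prop

theorem kron_neg_inv {z : ℂ} (hz : z ∉ lat τ) :
    kron (-τ⁻¹) (z * τ⁻¹) = expS (twoPiI * z) * rescale τ (kron τ z) := by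
  have h0 := ne_zero_of_im_pos hτ
  have hτ' := im_neg_inv_pos hτ
  have hk := isKron_kron hτ'
  have key := eq_kron_of_quasiPeriodic hτ
    (f := fun z => expS (-twoPiI * τ⁻¹ * z) * rescale τ⁻¹ (kron (-τ⁻¹) (z * τ⁻¹)))
    (fun z hz => ?_) (fun z hz => ?_) (fun z hz => ?_) ?_ hz
  · rw [← key, map_mul, rescale_rescale, inv_mul_cancel₀ h0, rescale_one, RingHom.id_apply,
      rescale_expS, ← mul_assoc, ← expS_add]
    rw [show twoPiI * z + -twoPiI * τ⁻¹ * z * τ = 0 by field_simp; ring, expS_zero, one_mul]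
  · refine (coeffDiffAt_expS _ _).mul (CoeffDiffAt.rescale _ fun n => ?_)
    have h1 := hk.hol (z := z * τ⁻¹) (by rwa [mem_lat_neg_inv h0]) n
    exact DifferentiableAt.comp (g := fun w => coeff n (kron (-τ⁻¹) w)) z h1 (by fun_prop)
  · have h1 := kron_add_tau hτ' (z * τ⁻¹ + τ⁻¹)
    rw [add_neg_cancel_right] at h1
    rw [add_mul, one_mul, h1, map_mul, rescale_expS, mul_add, expS_add, mul_one, mul_assoc]
  · rw [add_mul, mul_inv_cancel₀ h0, kron_add_one hτ', mul_add, inv_mul_cancel_right₀ h0, expS_add]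
    ring
  · have h1 : Tendsto (fun z : ℂ => z * τ⁻¹) (𝓝[≠] 0) (𝓝[≠] 0) := by
      refine tendsto_nhdsWithin_iff.2 ⟨?_, ?_⟩
      · have : Continuous fun z : ℂ => z * τ⁻¹ := by fun_prop
        simpa using (this.tendsto 0).mono_left nhdsWithin_le_nhds
      · filter_upwards [self_mem_nhdsWithin] with z hz using mul_ne_zero hz (inv_ne_zero h0)
    have h2 := tendsto_rescale τ⁻¹ (hk.res.comp h1)
    have h3 : Tendsto (fun z => C τ * expS (-twoPiI * τ⁻¹ * z)) (𝓝[≠] 0) (𝓝 (C τ * 1)) := by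
      have := ((CoeffDiffAt.const (C τ)).mul (coeffDiffAt_expS (-twoPiI * τ⁻¹) 0)).tendsto.mono_left
        (nhdsWithin_le_nhds (s := {0}ᶜ))
      rwa [mul_zero, expS_zero] at this
    have h4 := h3.mul h2
    rw [rescale_X, mul_one, ← mul_assoc, ← map_mul, mul_inv_cancel₀ h0, map_one, one_mul] at h4
    refine h4.congr fun z => ?_
    simp only [Function.comp_apply, map_mul, rescale_C]
    have : (C τ : ℂ⟦X⟧) * C τ⁻¹ = 1 := by rw [← map_mul, mul_inv_cancel₀ h0, map_one]
    linear_combination (expS (-twoPiI * τ⁻¹ * z) * C z * rescale τ⁻¹ (kron (-τ⁻¹) (z * τ⁻¹))) * this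

theorem kron_add_int (z : ℂ) (m : ℤ) : kron τ (z + m) = kron τ z := by
  induction m using Int.induction_on with
  | zero => simp
  | succ m ih =>
    rw [← ih, ← kron_add_one hτ (z + (m : ℤ)), add_assoc]
    push_cast
    rfl
  | pred m ih => rw [← ih, ← kron_add_one hτ]; push_cast; ring_nf

theorem kron_add_int_mul (z : ℂ) (m : ℤ) : kron τ (z + m * τ) = expS (-twoPiI * m) * kron τ z := by
  induction m using Int.induction_on with
  | zero => simp [expS_zero]
  | succ m ih =>
    have h := kron_add_tau hτ (z + m * τ)
    rw [show z + ((m + 1 : ℤ) : ℂ) * τ = z + m * τ + τ by push_cast; ring, h]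
    push_cast at ih ⊢
    rw [ih, ← mul_assoc, ← expS_add]
    ring_nf
  | pred m ih =>
    have h := kron_add_tau hτ (z + ((-m - 1 : ℤ) : ℂ) * τ)
    rw [show z + ((-m - 1 : ℤ) : ℂ) * τ + τ = z + ((-m : ℤ) : ℂ) * τ by push_cast; ring, ih] at h
    have h2 := congrArg (expS twoPiI * ·) h
    rw [← mul_assoc, ← mul_assoc, ← expS_add, ← expS_add, add_neg_cancel, expS_zero, one_mul] at h2
    rw [← h2]
    push_cast
    ring_nf

end Modular

/-! ### Modularity of the Eisenstein series -/

section Eisenstein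

variable {τ : ℂ} (hτ : 0 < τ.im) (n : ℕ+)
include hτ

theorem differentiableAt_eisenstein : DifferentiableAt ℂ (eisenstein n) τ :=
  (UpperHalfPlane.mdifferentiable_iff.1 (ModularForm.E (k := 2 * (n : ℕ) + 2)
    (by have := n.pos; omega)).holo' τ hτ).differentiableAt
    (UpperHalfPlane.isOpen_upperHalfPlaneSet.mem_nhds hτ)

theorem eisenstein_smul (γ : Matrix.SpecialLinearGroup (Fin 2) ℤ) :
    ModularForm.E (k := 2 * (n : ℕ) + 2) (by have := n.pos; omega) (γ • (⟨τ, hτ⟩ : UpperHalfPlane)) =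
      UpperHalfPlane.denom γ (⟨τ, hτ⟩ : UpperHalfPlane) ^ (2 * (n : ℕ) + 2) * eisenstein n τ := by
  have h := SlashInvariantForm.slash_action_eqn'' (ModularForm.E (k := 2 * (n : ℕ) + 2)
    (by have := n.pos; omega)) (γ := (γ : Matrix.GeneralLinearGroup (Fin 2) ℝ))
    (MonoidHom.mem_range.2 ⟨γ, rfl⟩) ⟨τ, hτ⟩
  rw [eisenstein, UpperHalfPlane.ofComplex_apply_of_im_pos hτ, ← zpow_natCast]
  exact h

theorem eisenstein_add_one : eisenstein n (τ + 1) = eisenstein n τ := by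
  have hτ' : 0 < (τ + 1).im := by simpa using hτ
  have h := eisenstein_smul hτ n ModularGroup.T
  rw [UpperHalfPlane.modular_T_smul] at h
  rw [eisenstein, UpperHalfPlane.ofComplex_apply_of_im_pos hτ']
  convert h using 1
  · congr 1
    ext
    simp [add_comm]
  · rw [ModularGroup.denom_apply]
    simp [ModularGroup.T]

theorem eisenstein_neg_inv : eisenstein n (-τ⁻¹) = τ ^ (2 * (n : ℕ) + 2) * eisenstein n τ := by
  have h := eisenstein_smul hτ n ModularGroup.S
  rw [UpperHalfPlane.modular_S_smul, ModularGroup.denom_S] at h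
  rw [eisenstein, UpperHalfPlane.ofComplex_apply_of_im_pos (im_neg_inv_pos hτ)]
  convert h using 1
  congr 1
  ext
  simp [inv_neg]

end Eisenstein

end EllipticKZB

end

noncomputable section

namespace EllipticKZB

open LieAlgebra (SemiDirectSum)
open LieAlgebra.SemiDirectSum (inl inr)

/-! ### Brackets in the semidirect product -/

theorem Der.gen_rel {r : FreeLieAlgebra ℂ DGen} (h : DRelator r) : quotHom dRelIdeal r = 0 :=
  quotHom_eq_zero (LieSubmodule.subset_lieSpan h)

theorem Der.lie_d_X : ⁅Der.gen .d, Der.gen .X⁆ = (2 : ℂ) • Der.gen .X := by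
  have h := Der.gen_rel DRelator.d_X
  rw [map_sub, map_smul, LieHom.map_lie, sub_eq_zero] at h
  exact h

theorem Der.lie_d_Δ₀ : ⁅Der.gen .d, Der.gen .Δ₀⁆ = -((2 : ℂ) • Der.gen .Δ₀) := by
  have h := Der.gen_rel DRelator.d_Δ₀
  rw [map_add, map_smul, LieHom.map_lie, add_eq_zero_iff_eq_neg] at h
  exact h

theorem Der.lie_X_Δ₀ : ⁅Der.gen .X, Der.gen .Δ₀⁆ = Der.gen .d := by
  have h := Der.gen_rel DRelator.X_Δ₀
  rw [map_sub, LieHom.map_lie, sub_eq_zero] at h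
  exact h

theorem Der.lie_δ_X (m : ℕ+) : ⁅Der.gen (.δ m), Der.gen .X⁆ = 0 := by
  have h := Der.gen_rel (DRelator.δ_X m)
  rw [LieHom.map_lie] at h
  exact h

theorem Der.lie_d_δ (m : ℕ+) :
    ⁅Der.gen .d, Der.gen (.δ m)⁆ = (2 * m : ℂ) • Der.gen (.δ m) := by
  have h := Der.gen_rel (DRelator.d_δ m)
  rw [map_sub, map_smul, LieHom.map_lie, sub_eq_zero] at h
  exact h

section Brackets

variable {ι 𝔥 M : Type*} [Fintype ι] [AddCommGroup 𝔥] [Module ℂ 𝔥] [AddCommGroup M] [Module ℂ M]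
variable {P : RootPairing ι ℂ M 𝔥} {b : P.Base}
variable (ρ : Der →ₗ⁅ℂ⁆ LieDerivation ℂ (Ell b) (Ell b))

/-- The element `(ad x(α^∨)/2)^p (t_α)` of the semidirect product. -/
def Semi.tx (i : ι) (p : ℕ) : Semi ρ := inl ρ (Ell.tx b i p)

theorem Semi.lie_gen_inl (g : DGen) (a : Ell b) :
    ⁅Semi.gen ρ g, (inl ρ a : Semi ρ)⁆ = inl ρ (ρ (Der.gen g) a) := by
  refine SemiDirectSum.ext ?_ ?_
  · change ⁅(0 : Ell b), a⁆ + ρ (Der.gen g) a - ρ 0 0 = ρ (Der.gen g) a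
    rw [zero_lie, zero_add, map_zero, sub_zero]
  · change ⁅Der.gen g, (0 : Der)⁆ = 0
    rw [lie_zero]

theorem Semi.ad_pow_t (i : ι) (p : ℕ) :
    ((LieAlgebra.ad ℂ (Semi ρ) (Semi.x ρ ((1 / 2 : ℂ) • P.coroot i))) ^ p) (Semi.t ρ i) =
      Semi.tx ρ i p := by
  induction p with
  | zero =>
    rw [Semi.tx, Ell.tx_zero]
    rfl
  | succ p ih =>
    rw [pow_succ', Module.End.mul_apply, ih, LieAlgebra.ad_apply, Semi.x, Semi.tx, Semi.tx,
      ← LieHom.map_lie, Ell.tx_succ, map_smul, smul_lie]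

theorem Semi.lie_x_tx (u : 𝔥) (i : ι) (p : ℕ) :
    ⁅Semi.x ρ u, Semi.tx ρ i p⁆ = P.root' i u • Semi.tx ρ i (p + 1) := by
  rw [Semi.x, Semi.tx, Semi.tx, ← LieHom.map_lie, Ell.lie_x_tx, map_smul]

theorem Semi.lie_x_x (u v : 𝔥) : ⁅Semi.x ρ u, Semi.x ρ v⁆ = 0 := by
  rw [Semi.x, Semi.x, ← LieHom.map_lie, Ell.lie_x_x, map_zero]

theorem Semi.lie_x_y (u v : 𝔥) : ⁅Semi.x ρ u, Semi.y ρ v⁆ =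
    -∑ i ∈ posRoots b, (P.root' i u * P.root' i v) • Semi.tx ρ i 0 := by
  rw [Semi.x, Semi.y, ← LieHom.map_lie, ← lie_skew, Ell.lie_y_x_pos, map_neg, map_sum]
  refine congrArg _ (Finset.sum_congr rfl fun i _ => ?_)
  rw [map_smul, Semi.tx, Ell.tx_zero]

variable {ρ} (hρ : IsAction b ρ)
include hρ

theorem IsAction.d_eq : ρ (Der.gen .d) = derD b :=
  Ell.der_ext (fun u => by rw [hρ.d_x, derD_x]) (fun u => by rw [hρ.d_y, derD_y])
    fun i => by rw [hρ.d_t, derD_t]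

theorem IsAction.X_eq : ρ (Der.gen .X) = derX b :=
  Ell.der_ext (fun u => by rw [hρ.X_x, derX_x]) (fun u => by rw [hρ.X_y, derX_y])
    fun i => by rw [hρ.X_t, derX_t]

theorem IsAction.Δ₀_eq : ρ (Der.gen .Δ₀) = derΔ b :=
  Ell.der_ext (fun u => by rw [hρ.Δ₀_x, derΔ_x]) (fun u => by rw [hρ.Δ₀_y, derΔ_y])
    fun i => by rw [hρ.Δ₀_t, derΔ_t]

theorem Semi.lie_X_tx (i : ι) (p : ℕ) : ⁅Semi.gen ρ .X, Semi.tx ρ i p⁆ = 0 := by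
  rw [Semi.tx, Semi.lie_gen_inl, hρ.X_eq, derX_tx, map_zero]

theorem Semi.lie_X_x (u : 𝔥) : ⁅Semi.gen ρ .X, Semi.x ρ u⁆ = 0 := by
  rw [Semi.x, Semi.lie_gen_inl, hρ.X_x, map_zero]

theorem Semi.lie_X_y (u : 𝔥) : ⁅Semi.gen ρ .X, Semi.y ρ u⁆ = Semi.x ρ u := by
  rw [Semi.y, Semi.lie_gen_inl, hρ.X_y, Semi.x]

theorem Semi.lie_x_Δ₀ (u : 𝔥) : ⁅Semi.x ρ u, Semi.gen ρ .Δ₀⁆ = -Semi.y ρ u := by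
  rw [← lie_skew, Semi.x, Semi.lie_gen_inl, hρ.Δ₀_x, Semi.y]

theorem Semi.lie_x_d (u : 𝔥) : ⁅Semi.x ρ u, Semi.gen ρ .d⁆ = -Semi.x ρ u := by
  rw [← lie_skew, Semi.x, Semi.lie_gen_inl, hρ.d_x]

theorem Semi.lie_x_δ (u : 𝔥) (m : ℕ+) : ⁅Semi.x ρ u, Semi.gen ρ (.δ m)⁆ = 0 := by
  rw [← lie_skew, Semi.x, Semi.lie_gen_inl, hρ.δ_x, map_zero, neg_zero]

theorem Semi.lie_d_tx (i : ι) (p : ℕ) :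
    ⁅Semi.gen ρ .d, Semi.tx ρ i p⁆ = (p : ℂ) • Semi.tx ρ i p := by
  rw [Semi.tx, Semi.lie_gen_inl, hρ.d_eq, derD_tx, map_smul]

theorem Semi.lie_d_y (u : 𝔥) : ⁅Semi.gen ρ .d, Semi.y ρ u⁆ = -Semi.y ρ u := by
  rw [Semi.y, Semi.lie_gen_inl, hρ.d_y, map_neg]

omit hρ

theorem Semi.lie_X_Δ₀ : ⁅Semi.gen ρ .X, Semi.gen ρ .Δ₀⁆ = Semi.gen ρ .d := by
  rw [Semi.gen, Semi.gen, ← LieHom.map_lie, Der.lie_X_Δ₀, Semi.gen]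

theorem Semi.lie_X_d : ⁅Semi.gen ρ .X, Semi.gen ρ .d⁆ = -((2 : ℂ) • Semi.gen ρ .X) := by
  rw [← lie_skew, Semi.gen, Semi.gen, ← LieHom.map_lie, Der.lie_d_X, map_smul]

theorem Semi.lie_X_δ (m : ℕ+) : ⁅Semi.gen ρ .X, Semi.gen ρ (.δ m)⁆ = 0 := by
  rw [← lie_skew, Semi.gen, Semi.gen, ← LieHom.map_lie, Der.lie_δ_X, map_zero, neg_zero]

theorem Semi.lie_d_Δ₀ : ⁅Semi.gen ρ .d, Semi.gen ρ .Δ₀⁆ = -((2 : ℂ) • Semi.gen ρ .Δ₀) := by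
  rw [Semi.gen, Semi.gen, ← LieHom.map_lie, Der.lie_d_Δ₀, map_neg, map_smul]

theorem Semi.lie_d_δ (m : ℕ+) :
    ⁅Semi.gen ρ .d, Semi.gen ρ (.δ m)⁆ = (2 * m : ℂ) • Semi.gen ρ (.δ m) := by
  rw [Semi.gen, Semi.gen, ← LieHom.map_lie, Der.lie_d_δ, map_smul]

end Brackets

/-! ### The completion -/

section Completion

variable {ι 𝔥 M : Type*} [Fintype ι] [AddCommGroup 𝔥] [Module ℂ 𝔥] [AddCommGroup M] [Module ℂ M]
variable {P : RootPairing ι ℂ M 𝔥} {b : P.Base}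
variable (ρ : Der →ₗ⁅ℂ⁆ LieDerivation ℂ (Ell b) (Ell b))

theorem Compl.proj_of (N : ℕ) (a : Semi ρ) : Compl.proj ρ N (Compl.of ρ a) = trunc ρ N a := rfl

theorem Compl.of_lie (a c : Semi ρ) : Compl.of ρ ⁅a, c⁆ = ⁅Compl.of ρ a, Compl.of ρ c⁆ := by
  ext N
  rw [Compl.proj_lie]
  exact LieHom.map_lie (trunc ρ N) a c

theorem Compl.proj_series (s : ℕ → Semi ρ) (hs : ∀ j, s j ∈ filt ρ j) {N R : ℕ} (h : N ≤ R) :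
    Compl.proj ρ N (Compl.series ρ s hs) = trunc ρ N (∑ j ∈ Finset.range R, s j) := by
  change trunc ρ N (∑ j ∈ Finset.range N, s j) = _
  rw [← sub_eq_zero, ← map_sub]
  apply trunc_eq_zero
  rw [← neg_mem_iff, neg_sub, ← Finset.sum_Ico_eq_sub _ h]
  exact sum_mem fun j hj => filt_anti ρ (Finset.mem_Ico.1 hj).1 (hs j)

theorem proj_psAd (ψ : PowerSeries ℂ) (i : ι) {N R : ℕ} (h : N ≤ R) :
    Compl.proj ρ N (psAd ρ ψ i) =
      trunc ρ N (∑ j ∈ Finset.range R, PowerSeries.coeff j ψ • Semi.tx ρ i j) := by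
  rw [psAd, Compl.proj_series ρ _ _ h]
  simp only [Semi.ad_pow_t]

theorem proj_deltaSeries (c : ℕ+ → ℂ) {N R : ℕ} (h : N ≤ R) :
    Compl.proj ρ N (deltaSeries ρ c) =
      trunc ρ N (∑ j ∈ Finset.range R, c j.succPNat • Semi.gen ρ (.δ j.succPNat)) := by
  rw [deltaSeries, Compl.proj_series ρ _ _ h]

/-- The map `ψ ↦ ψ(ad x(α^∨)/2)(t_α)` as a linear map. -/
def psAdL (i : ι) : PowerSeries ℂ →ₗ[ℂ] Compl ρ where
  toFun ψ := psAd ρ ψ i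
  map_add' ψ φ := by
    ext N
    rw [map_add, proj_psAd ρ _ i le_rfl, proj_psAd ρ _ i le_rfl, proj_psAd ρ _ i le_rfl, ← map_add,
      ← Finset.sum_add_distrib]
    simp only [map_add, add_smul]
  map_smul' r ψ := by
    ext N
    rw [map_smul, proj_psAd ρ _ i le_rfl, proj_psAd ρ _ i le_rfl, ← map_smul, Finset.smul_sum]
    simp only [map_smul, smul_eq_mul, mul_smul, RingHom.id_apply]

theorem psAdL_apply (i : ι) (ψ : PowerSeries ℂ) : psAdL ρ i ψ = psAd ρ ψ i := rfl

theorem proj_psAd_congr {ψ φ : PowerSeries ℂ} (i : ι) {N : ℕ}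
    (h : ∀ j < N, PowerSeries.coeff j ψ = PowerSeries.coeff j φ) :
    Compl.proj ρ N (psAd ρ ψ i) = Compl.proj ρ N (psAd ρ φ i) := by
  rw [proj_psAd ρ _ i le_rfl, proj_psAd ρ _ i le_rfl]
  exact congrArg _ (Finset.sum_congr rfl fun j hj => by rw [h j (Finset.mem_range.1 hj)])

theorem of_tx_zero (i : ι) : Compl.of ρ (Semi.tx ρ i 0) = psAdL ρ i 1 := by
  ext N
  rw [psAdL_apply, proj_psAd ρ _ i N.le_succ, Finset.sum_range_succ', Finset.sum_eq_zero, zero_add,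
    PowerSeries.coeff_zero_one, one_smul, Compl.proj_of]
  intro j _
  rw [PowerSeries.coeff_one, if_neg j.succ_ne_zero, zero_smul]

theorem lie_psAdL {w : Semi ρ} {i : ι} {μ : ℂ}
    (h : ∀ j, ⁅w, Semi.tx ρ i j⁆ = μ • Semi.tx ρ i (j + 1)) (ψ : PowerSeries ℂ) :
    ⁅Compl.of ρ w, psAdL ρ i ψ⁆ = psAdL ρ i (PowerSeries.C μ * PowerSeries.X * ψ) := by
  ext N
  rw [Compl.proj_lie, Compl.proj_of, psAdL_apply, psAdL_apply, proj_psAd ρ _ i le_rfl,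
    proj_psAd ρ _ i N.le_succ, ← LieHom.map_lie, lie_sum, Finset.sum_range_succ']
  congr 1
  simp only [lie_smul, h, mul_assoc, PowerSeries.coeff_C_mul, PowerSeries.coeff_succ_X_mul,
    PowerSeries.coeff_zero_X_mul, smul_smul, mul_comm μ, zero_mul]
  rw [zero_smul, add_zero]

theorem lie_deltaSeries {w : Semi ρ} (h : ∀ m, ⁅w, Semi.gen ρ (.δ m)⁆ = 0) (c : ℕ+ → ℂ) :
    ⁅Compl.of ρ w, deltaSeries ρ c⁆ = 0 := by
  ext N
  rw [Compl.proj_lie, Compl.proj_of, proj_deltaSeries ρ _ le_rfl, ← LieHom.map_lie, lie_sum]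
  simp only [lie_smul, h, smul_zero, Finset.sum_const_zero, map_zero]

end Completion

end EllipticKZB

end

noncomputable section

namespace EllipticKZB

open LieAlgebra (SemiDirectSum)
open LieAlgebra.SemiDirectSum (inl inr)

/-! ### Tails of the exponential series -/

/-- The series `∑ xⁿ / (n + k)!`. -/
def expTail (k : ℕ) : PowerSeries ℂ := PowerSeries.mk fun n => (((n + k).factorial : ℕ) : ℂ)⁻¹

theorem coeff_expTail (k n : ℕ) :
    PowerSeries.coeff n (expTail k) = (((n + k).factorial : ℕ) : ℂ)⁻¹ := PowerSeries.coeff_mk _ _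

theorem rescale_expTail_zero (c : ℂ) : PowerSeries.rescale c (expTail 0) = expS c := by
  rw [expS]
  congr 1
  ext n
  simp [coeff_expTail, PowerSeries.coeff_exp]

theorem rescale_expTail_succ (c : ℂ) (k : ℕ) :
    PowerSeries.C c * PowerSeries.X * PowerSeries.rescale c (expTail (k + 1)) =
      PowerSeries.rescale c (expTail k) - PowerSeries.C ((k.factorial : ℂ)⁻¹) := by
  ext n
  rw [mul_assoc, PowerSeries.coeff_C_mul]
  cases n with
  | zero =>
    rw [PowerSeries.coeff_zero_X_mul, mul_zero, map_sub, PowerSeries.coeff_rescale, coeff_expTail,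
      PowerSeries.coeff_zero_C, pow_zero, zero_add, one_mul, sub_self]
  | succ n =>
    rw [PowerSeries.coeff_succ_X_mul, map_sub, PowerSeries.coeff_rescale,
      PowerSeries.coeff_rescale, coeff_expTail, coeff_expTail, PowerSeries.coeff_C,
      if_neg n.succ_ne_zero, sub_zero, add_assoc, add_comm 1, add_comm k, pow_succ]
    ring_nf

section Completion

variable {ι 𝔥 M : Type*} [Fintype ι] [AddCommGroup 𝔥] [Module ℂ 𝔥] [AddCommGroup M] [Module ℂ M]
variable {P : RootPairing ι ℂ M 𝔥} {b : P.Base}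
variable (ρ : Der →ₗ⁅ℂ⁆ LieDerivation ℂ (Ell b) (Ell b))

/-! ### Power series in `ad w` -/

/-- `c = φ(ad w)(a)` in the completion, a finite sum in each truncation. -/
def IsPhiAd (φ : PowerSeries ℂ) (w a c : Compl ρ) : Prop :=
  ∀ N, ∃ n₀ : ℕ, (∀ n ≥ n₀, Compl.proj ρ N (((LieAlgebra.ad ℂ (Compl ρ) w) ^ n) a) = 0) ∧
    Compl.proj ρ N c = ∑ n ∈ Finset.range n₀,
      PowerSeries.coeff n φ • Compl.proj ρ N (((LieAlgebra.ad ℂ (Compl ρ) w) ^ n) a)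

variable {ρ} {φ : PowerSeries ℂ} {w a a' c c' : Compl ρ}

theorem sum_range_eq_of_le {V : Type*} [AddCommMonoid V] {f : ℕ → V} {m n : ℕ} (h : m ≤ n)
    (hf : ∀ k ≥ m, f k = 0) : ∑ k ∈ Finset.range n, f k = ∑ k ∈ Finset.range m, f k :=
  (Finset.sum_subset (Finset.range_subset_range.2 h) fun k _ hk =>
    hf k (not_lt.1 fun hlt => hk (Finset.mem_range.2 hlt))).symm

theorem IsPhiAd.add (h : IsPhiAd ρ φ w a c) (h' : IsPhiAd ρ φ w a' c') :
    IsPhiAd ρ φ w (a + a') (c + c') := by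
  intro N
  obtain ⟨n, hn, e⟩ := h N
  obtain ⟨n', hn', e'⟩ := h' N
  refine ⟨max n n', fun m hm => ?_, ?_⟩
  · rw [map_add, map_add, hn m (le_trans (le_max_left _ _) hm),
      hn' m (le_trans (le_max_right _ _) hm), add_zero]
  · simp only [map_add, smul_add, Finset.sum_add_distrib]
    rw [e, e', sum_range_eq_of_le (le_max_left n n') fun k hk => by rw [hn k hk, smul_zero],
      sum_range_eq_of_le (le_max_right n n') fun k hk => by rw [hn' k hk, smul_zero]]

theorem IsPhiAd.smul (h : IsPhiAd ρ φ w a c) (r : ℂ) : IsPhiAd ρ φ w (r • a) (r • c) := by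
  intro N
  obtain ⟨n, hn, e⟩ := h N
  refine ⟨n, fun m hm => ?_, ?_⟩
  · rw [map_smul, map_smul, hn m hm, smul_zero]
  · simp only [map_smul, e, Finset.smul_sum, smul_comm r]

theorem IsPhiAd.neg (h : IsPhiAd ρ φ w a c) : IsPhiAd ρ φ w (-a) (-c) := by
  simpa only [neg_smul, one_smul] using h.smul (-1)

theorem IsPhiAd.sub (h : IsPhiAd ρ φ w a c) (h' : IsPhiAd ρ φ w a' c') :
    IsPhiAd ρ φ w (a - a') (c - c') := by
  rw [sub_eq_add_neg, sub_eq_add_neg]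
  exact h.add h'.neg

theorem IsPhiAd.of_lie_eq_zero (h : ⁅w, a⁆ = 0) :
    IsPhiAd ρ φ w a (PowerSeries.coeff 0 φ • a) := by
  intro N
  refine ⟨1, fun n hn => ?_, by simp⟩
  obtain ⟨m, rfl⟩ := Nat.exists_eq_add_of_le' hn
  rw [pow_succ, Module.End.mul_apply, LieAlgebra.ad_apply, h, map_zero, map_zero]

theorem IsPhiAd.zero : IsPhiAd ρ φ w 0 0 := by
  simpa using IsPhiAd.of_lie_eq_zero (φ := φ) (lie_zero w)

theorem IsPhiAd.sum {κ : Type*} (s : Finset κ) {f g : κ → Compl ρ}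
    (h : ∀ i ∈ s, IsPhiAd ρ φ w (f i) (g i)) : IsPhiAd ρ φ w (∑ i ∈ s, f i) (∑ i ∈ s, g i) := by
  classical
  induction s using Finset.induction_on with
  | empty => simpa using IsPhiAd.zero
  | insert i s hi ih =>
    rw [Finset.sum_insert hi, Finset.sum_insert hi]
    exact (h i (Finset.mem_insert_self _ _)).add (ih fun j hj => h j (Finset.mem_insert_of_mem hj))

theorem IsPhiAd.step {φ' : PowerSeries ℂ}
    (hφ : ∀ n, PowerSeries.coeff n φ' = PowerSeries.coeff (n + 1) φ)
    (h : IsPhiAd ρ φ' w ⁅w, a⁆ c) : IsPhiAd ρ φ w a (PowerSeries.coeff 0 φ • a + c) := by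
  intro N
  obtain ⟨n, hn, e⟩ := h N
  refine ⟨n + 1, fun m hm => ?_, ?_⟩
  · obtain ⟨k, rfl⟩ := Nat.exists_eq_add_of_le' (le_trans (Nat.le_add_left 1 n) hm)
    rw [pow_succ, Module.End.mul_apply, LieAlgebra.ad_apply]
    exact hn k (by omega)
  · rw [map_add, map_smul, e, Finset.sum_range_succ', add_comm]
    simp only [hφ, pow_succ _ (_ : ℕ), Module.End.mul_apply, LieAlgebra.ad_apply, pow_zero,
      Module.End.one_apply]

theorem IsPhiAd.step_expTail {k : ℕ} (h : IsPhiAd ρ (expTail (k + 1)) w ⁅w, a⁆ c) :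
    IsPhiAd ρ (expTail k) w a ((k.factorial : ℂ)⁻¹ • a + c) := by
  have := h.step (φ := expTail k) fun n => by
    rw [coeff_expTail, coeff_expTail, add_assoc, add_comm 1]
  rwa [coeff_expTail, zero_add] at this

theorem IsPhiAd.psAdL {w : Semi ρ} {i : ι} {μ : ℂ}
    (h : ∀ j, ⁅w, Semi.tx ρ i j⁆ = μ • Semi.tx ρ i (j + 1)) (φ ψ : PowerSeries ℂ) :
    IsPhiAd ρ φ (Compl.of ρ w) (psAdL ρ i ψ) (psAdL ρ i (PowerSeries.rescale μ φ * ψ)) := by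
  have hp : ∀ n, ((LieAlgebra.ad ℂ (Compl ρ) (Compl.of ρ w)) ^ n) (EllipticKZB.psAdL ρ i ψ) =
      EllipticKZB.psAdL ρ i (PowerSeries.C (μ ^ n) * (PowerSeries.X ^ n * ψ)) := by
    intro n
    induction n with
    | zero => simp
    | succ n ih =>
      rw [pow_succ', Module.End.mul_apply, ih, LieAlgebra.ad_apply, lie_psAdL ρ h, pow_succ' μ,
        map_mul (PowerSeries.C (R := ℂ))]
      congr 1
      ring
  intro N
  refine ⟨N, fun n hn => ?_, ?_⟩
  · rw [hp, psAdL_apply, proj_psAd_congr ρ i (φ := 0), ← psAdL_apply, map_zero, map_zero]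
    intro j hj
    rw [PowerSeries.coeff_C_mul, PowerSeries.coeff_X_pow_mul', if_neg (by omega), mul_zero, map_zero]
  · simp only [hp, ← map_smul]
    rw [← map_sum, ← map_sum, psAdL_apply, psAdL_apply]
    refine proj_psAd_congr ρ i fun j hj => ?_
    rw [PowerSeries.coeff_mul, Finset.Nat.sum_antidiagonal_eq_sum_range_succ_mk, map_sum]
    rw [sum_range_eq_of_le (m := j + 1) (n := N) (by omega)]
    · refine Finset.sum_congr rfl fun n hn => ?_
      have : n ≤ j := Nat.lt_succ_iff.1 (Finset.mem_range.1 hn)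
      simp only [map_smul, smul_eq_mul, PowerSeries.coeff_C_mul, PowerSeries.coeff_X_pow_mul',
        if_pos this, PowerSeries.coeff_rescale]
      ring
    · intro n hn
      simp only [map_smul, smul_eq_mul, PowerSeries.coeff_C_mul, PowerSeries.coeff_X_pow_mul',
        if_neg (show ¬ n ≤ j by omega), mul_zero]

/-! ### The gauge transformations -/

variable (ρ) in
/-- The element `c x(l) + e X`. -/
def gaugeVec (l : 𝔥) (c e : ℂ) : Semi ρ := c • Semi.x ρ l + e • Semi.gen ρ .X

section Gauge

variable (hρ : IsAction b ρ) (l : 𝔥) (c e : ℂ)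
include hρ

theorem lie_gaugeVec_tx (i : ι) (j : ℕ) : ⁅gaugeVec ρ l c e, Semi.tx ρ i j⁆ =
    (c * P.root' i l) • Semi.tx ρ i (j + 1) := by
  rw [gaugeVec, add_lie, smul_lie, smul_lie, Semi.lie_x_tx, Semi.lie_X_tx hρ, smul_zero, add_zero,
    smul_smul]

theorem lie_gaugeVec_x (v : 𝔥) : ⁅gaugeVec ρ l c e, Semi.x ρ v⁆ = 0 := by
  rw [gaugeVec, add_lie, smul_lie, smul_lie, Semi.lie_x_x, Semi.lie_X_x hρ, smul_zero, smul_zero,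
    add_zero]

theorem lie_gaugeVec_y (v : 𝔥) : ⁅gaugeVec ρ l c e, Semi.y ρ v⁆ = e • Semi.x ρ v -
    ∑ i ∈ posRoots b, (c * P.root' i l * P.root' i v) • Semi.tx ρ i 0 := by
  rw [gaugeVec, add_lie, smul_lie, smul_lie, Semi.lie_x_y, Semi.lie_X_y hρ, smul_neg,
    Finset.smul_sum, neg_add_eq_sub]
  simp only [smul_smul, mul_assoc]

theorem lie_gaugeVec_Δ₀ : ⁅gaugeVec ρ l c e, Semi.gen ρ .Δ₀⁆ =
    e • Semi.gen ρ .d - c • Semi.y ρ l := by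
  rw [gaugeVec, add_lie, smul_lie, smul_lie, Semi.lie_x_Δ₀ hρ, Semi.lie_X_Δ₀, smul_neg,
    neg_add_eq_sub]

theorem lie_gaugeVec_d : ⁅gaugeVec ρ l c e, Semi.gen ρ .d⁆ =
    -(c • Semi.x ρ l) - (2 * e) • Semi.gen ρ .X := by
  rw [gaugeVec, add_lie, smul_lie, smul_lie, Semi.lie_x_d hρ, Semi.lie_X_d]
  module

theorem lie_gaugeVec_δ (m : ℕ+) : ⁅gaugeVec ρ l c e, Semi.gen ρ (.δ m)⁆ = 0 := by
  rw [gaugeVec, add_lie, smul_lie, smul_lie, Semi.lie_x_δ hρ, Semi.lie_X_δ, smul_zero, smul_zero,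
    add_zero]

theorem isPhiAd_gauge_psAdL (φ ψ : PowerSeries ℂ) (i : ι) :
    IsPhiAd ρ φ (Compl.of ρ (gaugeVec ρ l c e)) (psAdL ρ i ψ)
      (psAdL ρ i (PowerSeries.rescale (c * P.root' i l) φ * ψ)) :=
  IsPhiAd.psAdL (lie_gaugeVec_tx hρ l c e i) φ ψ

theorem isPhiAd_gauge_y (k : ℕ) (v : 𝔥) :
    IsPhiAd ρ (expTail k) (Compl.of ρ (gaugeVec ρ l c e)) (Compl.of ρ (Semi.y ρ v))
      ((k.factorial : ℂ)⁻¹ • Compl.of ρ (Semi.y ρ v) +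
        (((k + 1).factorial : ℂ)⁻¹ • e • Compl.of ρ (Semi.x ρ v) -
        ∑ i ∈ posRoots b, (c * P.root' i l * P.root' i v) •
          psAdL ρ i (PowerSeries.rescale (c * P.root' i l) (expTail (k + 1))))) := by
  refine IsPhiAd.step_expTail ?_
  rw [← Compl.of_lie, lie_gaugeVec_y hρ, map_sub, map_smul, map_sum]
  simp only [map_smul, of_tx_zero]
  refine IsPhiAd.sub ?_ (IsPhiAd.sum _ fun i _ => ?_)
  · have h := IsPhiAd.of_lie_eq_zero (φ := expTail (k + 1))
      (w := Compl.of ρ (gaugeVec ρ l c e)) (a := e • Compl.of ρ (Semi.x ρ v))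
      (by rw [lie_smul, ← Compl.of_lie, lie_gaugeVec_x hρ, map_zero, smul_zero])
    rwa [coeff_expTail, zero_add] at h
  · have h := (isPhiAd_gauge_psAdL hρ l c e (expTail (k + 1)) 1 i).smul
      (c * P.root' i l * P.root' i v)
    rwa [mul_one] at h

theorem isPhiAd_gauge_d (k : ℕ) :
    IsPhiAd ρ (expTail k) (Compl.of ρ (gaugeVec ρ l c e)) (Compl.of ρ (Semi.gen ρ .d))
      ((k.factorial : ℂ)⁻¹ • Compl.of ρ (Semi.gen ρ .d) + ((k + 1).factorial : ℂ)⁻¹ •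
        Compl.of ρ (-(c • Semi.x ρ l) - (2 * e) • Semi.gen ρ .X)) := by
  refine IsPhiAd.step_expTail ?_
  rw [← Compl.of_lie, lie_gaugeVec_d hρ]
  have h := IsPhiAd.of_lie_eq_zero (φ := expTail (k + 1)) (w := Compl.of ρ (gaugeVec ρ l c e))
    (a := Compl.of ρ (-(c • Semi.x ρ l) - (2 * e) • Semi.gen ρ .X))
    (by
      rw [← Compl.of_lie, lie_sub, lie_neg, lie_smul, lie_smul, lie_gaugeVec_x hρ, gaugeVec, add_lie,
        smul_lie, smul_lie, lie_self, ← lie_skew, Semi.lie_X_x hρ]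
      simp only [smul_zero, neg_zero, add_zero, sub_zero, map_zero])
  rwa [coeff_expTail, zero_add] at h

theorem isPhiAd_gauge_Δ₀ :
    IsPhiAd ρ (expTail 0) (Compl.of ρ (gaugeVec ρ l c e)) (Compl.of ρ (Semi.gen ρ .Δ₀))
      (Compl.of ρ (Semi.gen ρ .Δ₀ + e • Semi.gen ρ .d - c • Semi.y ρ l - e • gaugeVec ρ l c e) +
        ∑ i ∈ posRoots b, psAdL ρ i (PowerSeries.C ((c * P.root' i l) ^ 2) *
          PowerSeries.rescale (c * P.root' i l) (expTail 2))) := by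
  have h := ((isPhiAd_gauge_d hρ l c e 1).smul e).sub ((isPhiAd_gauge_y hρ l c e 1 l).smul c)
  rw [← map_smul, ← map_smul, ← map_sub, ← lie_gaugeVec_Δ₀ hρ, Compl.of_lie] at h
  convert h.step_expTail using 1
  have e1 : ∀ i, psAdL ρ i (PowerSeries.C ((c * P.root' i l) ^ 2) *
      PowerSeries.rescale (c * P.root' i l) (expTail 2)) = (c * (c * P.root' i l * P.root' i l)) •
        psAdL ρ i (PowerSeries.rescale (c * P.root' i l) (expTail (1 + 1))) := fun i => by
    rw [← map_smul, PowerSeries.smul_eq_C_mul]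
    congr 3
    ring
  simp only [e1, smul_add, smul_sub, Finset.smul_sum, mul_smul c]
  simp only [gaugeVec, map_sub, map_add, map_smul, map_neg, Nat.factorial]
  module

end Gauge

end Completion

section Normed

variable {ι 𝔥 M : Type*} [Fintype ι] [NormedAddCommGroup 𝔥] [NormedSpace ℂ 𝔥]
  [AddCommGroup M] [Module ℂ M]
variable {P : RootPairing ι ℂ M 𝔥} {b : P.Base}
variable {ρ : Der →ₗ⁅ℂ⁆ LieDerivation ℂ (Ell b) (Ell b)}

theorem IsPhiAd.isExpAd {w a c : Compl ρ} (h : IsPhiAd ρ (expTail 0) w a c) :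
    IsExpAd ρ w a c := by
  intro N
  obtain ⟨n, hn, e⟩ := h N
  exact ⟨n, hn, e.trans (Finset.sum_congr rfl fun m _ => by rw [coeff_expTail, add_zero])⟩

end Normed

end EllipticKZB

end

noncomputable section

namespace EllipticKZB

open LieAlgebra (SemiDirectSum)

/-! ### Gauge transformations of the coefficient functions -/

theorem eq_of_X_mul_eq {f g : PowerSeries ℂ} (h : PowerSeries.X * f = PowerSeries.X * g) : f = g :=
  mul_left_cancel₀ PowerSeries.X_ne_zero h

/-- The transform of `k` by the gauge `exp(μ x)`. -/
def gaugeK (μ : ℂ) (k : PowerSeries ℂ) : PowerSeries ℂ :=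
  expS μ * k + PowerSeries.C μ * PowerSeries.rescale μ (expTail 1)

/-- The transform of `g` by the gauge `exp(μ x)`. -/
def gaugeG (μ : ℂ) (g : PowerSeries ℂ) : PowerSeries ℂ :=
  expS μ * g - PowerSeries.C (μ ^ 2) * PowerSeries.rescale μ (expTail 2)

theorem one_add_X_mul_gaugeK (μ : ℂ) (k : PowerSeries ℂ) :
    1 + PowerSeries.X * gaugeK μ k = expS μ * (1 + PowerSeries.X * k) := by
  have h := rescale_expTail_succ μ 0
  rw [rescale_expTail_zero, Nat.factorial_zero, Nat.cast_one, inv_one, map_one] at h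
  rw [gaugeK]
  linear_combination h

theorem gaugeG_derivative (μ : ℂ) (k : PowerSeries ℂ) :
    gaugeG μ (PowerSeries.derivative ℂ k) =
      PowerSeries.derivative ℂ (gaugeK μ k) - PowerSeries.C μ * gaugeK μ k := by
  have h1 := rescale_expTail_succ μ 0
  have h2 := rescale_expTail_succ μ 1
  rw [rescale_expTail_zero, Nat.factorial_zero, Nat.cast_one, inv_one, map_one] at h1
  rw [Nat.factorial_one, Nat.cast_one, inv_one, map_one] at h2
  set A := PowerSeries.rescale μ (expTail 1) with hA
  have h3 := congrArg (PowerSeries.derivative ℂ) h1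
  rw [mul_assoc, Derivation.leibniz, Derivation.leibniz, map_sub, derivative_expS,
    PowerSeries.derivative_C, PowerSeries.derivative_X, Derivation.map_one_eq_zero] at h3
  simp only [smul_eq_mul, mul_zero, add_zero, mul_one, sub_zero] at h3
  apply eq_of_X_mul_eq
  rw [gaugeG, gaugeK, map_add, Derivation.leibniz, Derivation.leibniz, derivative_expS,
    PowerSeries.derivative_C, map_pow]
  simp only [smul_eq_mul, mul_zero, add_zero]
  linear_combination (-PowerSeries.C μ) * h2 - h3 + PowerSeries.C μ * h1

theorem derivative_rescale (c : ℂ) (f : PowerSeries ℂ) :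
    PowerSeries.derivative ℂ (PowerSeries.rescale c f) =
      PowerSeries.C c * PowerSeries.rescale c (PowerSeries.derivative ℂ f) := by
  ext n
  rw [PowerSeries.coeff_derivative, PowerSeries.coeff_C_mul, PowerSeries.coeff_rescale,
    PowerSeries.coeff_rescale, PowerSeries.coeff_derivative, pow_succ]
  ring

section KzbSeries

variable {τ z : ℂ} (hτ : 0 < τ.im) (hz : z ∉ lat τ)
include hτ hz

theorem kSeries_add_int (m : ℤ) : kSeries (z + m) τ = kSeries z τ := by
  have hz' : z + m ∉ lat τ := by rwa [add_mem_lat_iff ⟨m, 0, by simp⟩]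
  have h := kron_add_int hτ z m
  rw [kron_eq hτ hz, kron_eq hτ hz'] at h
  exact eq_of_X_mul_eq (add_left_cancel h)

theorem kSeries_add_int_mul (m : ℤ) :
    kSeries (z + m * τ) τ = gaugeK (-twoPiI * m) (kSeries z τ) := by
  have hz' : z + m * τ ∉ lat τ := by rwa [add_mem_lat_iff ⟨0, m, by simp⟩]
  have h := kron_add_int_mul hτ z m
  rw [kron_eq hτ hz, kron_eq hτ hz', ← one_add_X_mul_gaugeK] at h
  exact eq_of_X_mul_eq (add_left_cancel h)

theorem kSeries_tau_add_one : kSeries z (τ + 1) = kSeries z τ := by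
  have h := kron_tau_add_one hτ hz
  rw [kron_eq hτ hz, kron_eq (by simpa using hτ) (by rwa [lat_add_one])] at h
  exact eq_of_X_mul_eq (add_left_cancel h)

theorem kSeries_neg_inv : kSeries (z * τ⁻¹) (-τ⁻¹) =
    PowerSeries.C τ * PowerSeries.rescale τ (gaugeK (twoPiI / τ * z) (kSeries z τ)) := by
  have h0 := ne_zero_of_im_pos hτ
  have h := kron_neg_inv hτ hz
  rw [kron_eq hτ hz, kron_eq (im_neg_inv_pos hτ) (by rwa [mem_lat_neg_inv h0])] at h
  have h1 := congrArg (PowerSeries.rescale τ) (one_add_X_mul_gaugeK (twoPiI / τ * z) (kSeries z τ))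
  rw [map_mul (PowerSeries.rescale τ) (expS _), rescale_expS, show twoPiI / τ * z * τ = twoPiI * z by
    field_simp, ← h, map_add, map_one, map_mul, PowerSeries.rescale_X] at h1
  refine eq_of_X_mul_eq (add_left_cancel (h1.symm.trans ?_))
  ring

end KzbSeries

/-! ### The torus -/

section Torus

variable {ι 𝔥 M : Type*} [Fintype ι] [NormedAddCommGroup 𝔥] [NormedSpace ℂ 𝔥]
  [AddCommGroup M] [Module ℂ M]
variable {P : RootPairing ι ℂ M 𝔥} {b : P.Base}
variable {ρ : Der →ₗ⁅ℂ⁆ LieDerivation ℂ (Ell b) (Ell b)}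

variable (ρ) in
/-- `Ad(r^d)` in one truncation. -/
def IsTorusAdAt (r : ℂ) (N : ℕ) (a c : Semi ρ ⧸ filt ρ N) : Prop :=
  ∃ f : ℤ →₀ (Semi ρ ⧸ filt ρ N), (∀ j, ⁅trunc ρ N (Semi.gen ρ .d), f j⁆ = (j : ℂ) • f j) ∧
    a = (f.sum fun _ e => e) ∧ c = (f.sum fun j e => r ^ j • e)

theorem isTorusAd_iff {r : ℂ} {a c : Compl ρ} :
    IsTorusAd ρ r a c ↔ ∀ N, IsTorusAdAt ρ r N (Compl.proj ρ N a) (Compl.proj ρ N c) := Iff.rfl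

variable {r : ℂ} {N : ℕ}

theorem IsTorusAdAt.zero : IsTorusAdAt ρ r N 0 0 :=
  ⟨0, fun j => by rw [Finsupp.zero_apply, lie_zero, smul_zero], by simp, by simp⟩

theorem IsTorusAdAt.add {a c a' c' : Semi ρ ⧸ filt ρ N} (h : IsTorusAdAt ρ r N a c)
    (h' : IsTorusAdAt ρ r N a' c') : IsTorusAdAt ρ r N (a + a') (c + c') := by
  obtain ⟨f, hf, rfl, rfl⟩ := h
  obtain ⟨g, hg, rfl, rfl⟩ := h'
  refine ⟨f + g, fun j => ?_, ?_, ?_⟩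
  · rw [Finsupp.add_apply, lie_add, hf, hg, smul_add]
  · rw [Finsupp.sum_add_index' (fun _ => rfl) (fun _ _ _ => rfl)]
  · rw [Finsupp.sum_add_index' (fun _ => smul_zero _) (fun _ _ _ => smul_add _ _ _)]

theorem IsTorusAdAt.smul {a c : Semi ρ ⧸ filt ρ N} (h : IsTorusAdAt ρ r N a c) (t : ℂ) :
    IsTorusAdAt ρ r N (t • a) (t • c) := by
  obtain ⟨f, hf, rfl, rfl⟩ := h
  refine ⟨t • f, fun j => ?_, ?_, ?_⟩
  · rw [Finsupp.smul_apply, lie_smul, hf, smul_comm]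
  · rw [Finsupp.sum_smul_index' (fun _ => rfl), Finsupp.smul_sum]
  · rw [Finsupp.sum_smul_index' (fun _ => smul_zero _), Finsupp.smul_sum]
    simp only [smul_comm t]

theorem IsTorusAdAt.sum {κ : Type*} (s : Finset κ) {f g : κ → Semi ρ ⧸ filt ρ N}
    (h : ∀ i ∈ s, IsTorusAdAt ρ r N (f i) (g i)) :
    IsTorusAdAt ρ r N (∑ i ∈ s, f i) (∑ i ∈ s, g i) := by
  classical
  induction s using Finset.induction_on with
  | empty => simpa using IsTorusAdAt.zero
  | insert i s hi ih =>
    rw [Finset.sum_insert hi, Finset.sum_insert hi]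
    exact (h i (Finset.mem_insert_self _ _)).add (ih fun j hj => h j (Finset.mem_insert_of_mem hj))

theorem IsTorusAdAt.of_lie_eq {a : Semi ρ} (j : ℤ) (h : ⁅Semi.gen ρ .d, a⁆ = (j : ℂ) • a) :
    IsTorusAdAt ρ r N (trunc ρ N a) (r ^ j • trunc ρ N a) := by
  refine ⟨Finsupp.single j (trunc ρ N a), fun i => ?_, ?_, ?_⟩
  · rcases eq_or_ne j i with rfl | hne
    · rw [Finsupp.single_eq_same, ← LieHom.map_lie, h, map_smul]
    · rw [Finsupp.single_eq_of_ne hne.symm, lie_zero, smul_zero]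
  · rw [Finsupp.sum_single_index rfl]
  · exact (Finsupp.sum_single_index (h := fun (j : ℤ) e => r ^ j • e) (smul_zero _)).symm

variable {a c a' c' : Compl ρ}

theorem IsTorusAd.add (h : IsTorusAd ρ r a c) (h' : IsTorusAd ρ r a' c') :
    IsTorusAd ρ r (a + a') (c + c') := fun N => by
  rw [map_add, map_add]
  exact IsTorusAdAt.add (h N) (h' N)

theorem IsTorusAd.smul (h : IsTorusAd ρ r a c) (t : ℂ) : IsTorusAd ρ r (t • a) (t • c) :=
  fun N => by
    rw [map_smul, map_smul]
    exact IsTorusAdAt.smul (h N) t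

theorem IsTorusAd.neg (h : IsTorusAd ρ r a c) : IsTorusAd ρ r (-a) (-c) := by
  simpa only [neg_smul, one_smul] using h.smul (-1)

theorem IsTorusAd.sub (h : IsTorusAd ρ r a c) (h' : IsTorusAd ρ r a' c') :
    IsTorusAd ρ r (a - a') (c - c') := by
  rw [sub_eq_add_neg, sub_eq_add_neg]
  exact h.add h'.neg

theorem IsTorusAd.sum {κ : Type*} (s : Finset κ) {f g : κ → Compl ρ}
    (h : ∀ i ∈ s, IsTorusAd ρ r (f i) (g i)) : IsTorusAd ρ r (∑ i ∈ s, f i) (∑ i ∈ s, g i) :=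
  fun N => by
    rw [map_sum, map_sum]
    exact IsTorusAdAt.sum s fun i hi => h i hi N

theorem IsTorusAd.of_lie_eq {a : Semi ρ} (j : ℤ) (h : ⁅Semi.gen ρ .d, a⁆ = (j : ℂ) • a) :
    IsTorusAd ρ r (Compl.of ρ a) (r ^ j • Compl.of ρ a) := fun _ => IsTorusAdAt.of_lie_eq j h

variable (hρ : IsAction b ρ)
include hρ

theorem isTorusAd_psAdL (i : ι) (ψ : PowerSeries ℂ) :
    IsTorusAd ρ r (psAdL ρ i ψ) (psAdL ρ i (PowerSeries.rescale r ψ)) := by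
  rw [isTorusAd_iff]
  intro N
  rw [psAdL_apply, psAdL_apply, proj_psAd ρ _ i le_rfl, proj_psAd ρ _ i le_rfl, map_sum, map_sum]
  refine IsTorusAdAt.sum _ fun j _ => ?_
  have h := (IsTorusAdAt.of_lie_eq (r := r) (N := N) j (by
    rw [Semi.lie_d_tx hρ i j, Int.cast_natCast])).smul (PowerSeries.coeff j ψ)
  rw [map_smul, map_smul, PowerSeries.coeff_rescale, mul_comm, mul_smul]
  rwa [zpow_natCast] at h

omit hρ in
theorem isTorusAd_deltaSeries (f : ℕ+ → ℂ) :
    IsTorusAd ρ r (deltaSeries ρ f) (deltaSeries ρ fun n => r ^ (2 * (n : ℕ)) * f n) := by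
  rw [isTorusAd_iff]
  intro N
  rw [proj_deltaSeries ρ _ le_rfl, proj_deltaSeries ρ _ le_rfl, map_sum, map_sum]
  refine IsTorusAdAt.sum _ fun j _ => ?_
  have h0 : ⁅Semi.gen ρ .d, Semi.gen ρ (.δ j.succPNat)⁆ =
      (((2 * (j.succPNat : ℕ) : ℕ) : ℤ) : ℂ) • Semi.gen ρ (.δ j.succPNat) := by
    rw [Semi.lie_d_δ]
    push_cast
    rfl
  have h := (IsTorusAdAt.of_lie_eq (r := r) (N := N) _ h0).smul (f j.succPNat)
  rw [map_smul, map_smul, mul_comm, mul_smul]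
  rwa [zpow_natCast] at h

end Torus

end EllipticKZB

end

noncomputable section

namespace EllipticKZB

section Equivariance

variable {ι 𝔥 M : Type*} [Fintype ι] [NormedAddCommGroup 𝔥] [NormedSpace ℂ 𝔥]
  [AddCommGroup M] [Module ℂ M]
variable {P : RootPairing ι ℂ M 𝔥} {b : P.Base}
variable (ρ : Der →ₗ⁅ℂ⁆ LieDerivation ℂ (Ell b) (Ell b))

/-! ### Equivariance of the connection -/

theorem mem_regularSet {z : 𝔥} {τ : ℂ} :
    (z, τ) ∈ regularSet P ↔ 0 < τ.im ∧ ∀ i, P.root' i z ∉ lat τ := by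
  refine and_congr Iff.rfl (forall_congr' fun i => ?_)
  rw [mem_lat]
  push Not
  rfl

/-- The part of `Δ` in the completion of `𝔡`. -/
def deltaPart (e : ℕ+ → ℂ) : Compl ρ :=
  -(twoPiI⁻¹ • Compl.of ρ (Semi.gen ρ .Δ₀)) - twoPiI⁻¹ • deltaSeries ρ e

/-- The value of the connection form with prescribed coefficient functions. -/
def kzbVal (k g : ι → PowerSeries ℂ) (D : Compl ρ) (v : 𝔥) (s : ℂ) : Compl ρ :=
  s • (D + twoPiI⁻¹ • ∑ i ∈ posRoots b, psAdL ρ i (g i)) +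
    ∑ i ∈ posRoots b, P.root' i v • psAdL ρ i (k i) - Compl.of ρ (Semi.y ρ v)

theorem kzbForm_apply (z : 𝔥) (τ : ℂ) (v : 𝔥) (s : ℂ) : kzbForm ρ (z, τ) (v, s) =
    kzbVal ρ (fun i => kSeries (P.root' i z) τ)
      (fun i => PowerSeries.derivative ℂ (kSeries (P.root' i z) τ))
      (deltaPart ρ fun n => aCoeff n * eisenstein n τ) v s := by
  simp only [kzbForm, LinearMap.sub_apply, LinearMap.add_apply, LinearMap.smulRight_apply,
    LinearMap.snd_apply, LinearMap.sum_apply, LinearMap.comp_apply, LinearMap.fst_apply, kzbVal,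
    bigDelta, deltaPart, psAdL_apply, gSeries]
  rfl

variable {ρ}

theorem Semi.y_add (u v : 𝔥) : Semi.y ρ (u + v) = Semi.y ρ u + Semi.y ρ v := by
  rw [Semi.y, map_add, map_add, Semi.y, Semi.y]

theorem Semi.y_smul (t : ℂ) (v : 𝔥) : Semi.y ρ (t • v) = t • Semi.y ρ v := by
  rw [Semi.y, map_smul, map_smul, Semi.y]

theorem deltaSeries_smul (t : ℂ) (e : ℕ+ → ℂ) :
    deltaSeries ρ (fun n => t * e n) = t • deltaSeries ρ e := by
  ext N
  rw [map_smul, proj_deltaSeries ρ _ le_rfl, proj_deltaSeries ρ _ le_rfl, ← map_smul,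
    Finset.smul_sum]
  simp only [mul_smul]

variable (hρ : IsAction b ρ)
include hρ

theorem isExpAd_kzbVal (l : 𝔥) (c e : ℂ) (k g : ι → PowerSeries ℂ) (d : ℕ+ → ℂ) (v : 𝔥) (s : ℂ) :
    IsExpAd ρ (Compl.of ρ (gaugeVec ρ l c e)) (kzbVal ρ k g (deltaPart ρ d) v s)
      (kzbVal ρ (fun i => gaugeK (c * P.root' i l) (k i)) (fun i => gaugeG (c * P.root' i l) (g i))
        (deltaPart ρ d - twoPiI⁻¹ • Compl.of ρ
          (e • Semi.gen ρ .d - c • Semi.y ρ l - e • gaugeVec ρ l c e)) v s -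
        e • Compl.of ρ (Semi.x ρ v)) := by
  apply IsPhiAd.isExpAd
  have hδ : IsPhiAd ρ (expTail 0) (Compl.of ρ (gaugeVec ρ l c e)) (deltaSeries ρ d)
      (deltaSeries ρ d) := by
    have := IsPhiAd.of_lie_eq_zero (φ := expTail 0)
      (lie_deltaSeries ρ (w := gaugeVec ρ l c e) (lie_gaugeVec_δ hρ l c e) d)
    simpa [coeff_expTail] using this
  have hps := isPhiAd_gauge_psAdL hρ l c e (expTail 0)
  have key := ((((((isPhiAd_gauge_Δ₀ hρ l c e).smul twoPiI⁻¹).neg.sub (hδ.smul twoPiI⁻¹)).add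
    ((IsPhiAd.sum (posRoots b) fun i _ => hps (g i) i).smul twoPiI⁻¹)).smul s).add
    (IsPhiAd.sum (posRoots b) fun i _ => (hps (k i) i).smul (P.root' i v))).sub
    (isPhiAd_gauge_y hρ l c e 0 v)
  have hK : ∑ i ∈ posRoots b, P.root' i v • psAdL ρ i (gaugeK (c * P.root' i l) (k i)) =
      ∑ i ∈ posRoots b, P.root' i v • psAdL ρ i (expS (c * P.root' i l) * k i) +
      ∑ i ∈ posRoots b, (c * P.root' i l * P.root' i v) •
          psAdL ρ i (PowerSeries.rescale (c * P.root' i l) (expTail (0 + 1))) := by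
    rw [← Finset.sum_add_distrib]
    refine Finset.sum_congr rfl fun i _ => ?_
    rw [gaugeK, map_add, ← PowerSeries.smul_eq_C_mul, map_smul]
    module
  have hG : ∑ i ∈ posRoots b, psAdL ρ i (gaugeG (c * P.root' i l) (g i)) =
      ∑ i ∈ posRoots b, psAdL ρ i (expS (c * P.root' i l) * g i) -
      ∑ i ∈ posRoots b, psAdL ρ i (PowerSeries.C ((c * P.root' i l) ^ 2) *
          PowerSeries.rescale (c * P.root' i l) (expTail 2)) := by
    rw [← Finset.sum_sub_distrib]
    exact Finset.sum_congr rfl fun i _ => by rw [gaugeG, map_sub]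
  simp only [rescale_expTail_zero] at key
  convert key using 1
  swap
  · rw [kzbVal, hK, hG, deltaPart]
    simp only [map_sub, map_add, map_smul, Nat.factorial]
    module
  · rw [kzbVal, deltaPart]

omit hρ in
theorem kzbVal_add_smul (k g : ι → PowerSeries ℂ) (D : Compl ρ) (v l : 𝔥) (s t μ : ℂ)
    (ht : s * twoPiI⁻¹ * μ = -t) :
    kzbVal ρ k (fun i => g i - PowerSeries.C (μ * P.root' i l) * k i) D v s =
      kzbVal ρ k g D (v + t • l) s + Compl.of ρ (t • Semi.y ρ l) := by
  have h1 : ∑ i ∈ posRoots b, psAdL ρ i (g i - PowerSeries.C (μ * P.root' i l) * k i) =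
      ∑ i ∈ posRoots b, psAdL ρ i (g i) - μ • ∑ i ∈ posRoots b, P.root' i l • psAdL ρ i (k i) := by
    rw [Finset.smul_sum, ← Finset.sum_sub_distrib]
    refine Finset.sum_congr rfl fun i _ => ?_
    rw [map_sub, ← PowerSeries.smul_eq_C_mul, map_smul, mul_smul]
  have h2 : ∑ i ∈ posRoots b, P.root' i (v + t • l) • psAdL ρ i (k i) =
      ∑ i ∈ posRoots b, P.root' i v • psAdL ρ i (k i) +
        t • ∑ i ∈ posRoots b, P.root' i l • psAdL ρ i (k i) := by
    rw [Finset.smul_sum, ← Finset.sum_add_distrib]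
    refine Finset.sum_congr rfl fun i _ => ?_
    rw [map_add, map_smul, smul_eq_mul]
    module
  rw [kzbVal, kzbVal, h1, h2, Semi.y_add, Semi.y_smul, map_add, map_smul, smul_add, smul_sub,
    smul_sub, smul_add, smul_smul twoPiI⁻¹ μ, smul_smul s (twoPiI⁻¹ * μ), ← mul_assoc, ht]
  module

theorem isTorusAd_kzbVal (r : ℂ) (k g : ι → PowerSeries ℂ) (d : ℕ+ → ℂ) (l v : 𝔥) (s e c : ℂ) :
    IsTorusAd ρ r
      (kzbVal ρ k g (deltaPart ρ d - twoPiI⁻¹ • Compl.of ρ (e • Semi.gen ρ .d - c • Semi.y ρ l)) v s)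
      (kzbVal ρ (fun i => PowerSeries.rescale r (k i)) (fun i => PowerSeries.rescale r (g i))
        (-((r⁻¹ ^ 2 * twoPiI⁻¹) • Compl.of ρ (Semi.gen ρ .Δ₀)) -
          twoPiI⁻¹ • deltaSeries ρ (fun n => r ^ (2 * (n : ℕ)) * d n) -
          twoPiI⁻¹ • Compl.of ρ (e • Semi.gen ρ .d - (r⁻¹ * c) • Semi.y ρ l)) 0 s +
        ∑ i ∈ posRoots b, P.root' i v • psAdL ρ i (PowerSeries.rescale r (k i)) -
        r⁻¹ • Compl.of ρ (Semi.y ρ v)) := by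
  have hΔ := IsTorusAd.of_lie_eq (ρ := ρ) (r := r) (a := Semi.gen ρ .Δ₀) (-2)
    (by rw [Semi.lie_d_Δ₀]; push_cast; module)
  have hd := IsTorusAd.of_lie_eq (ρ := ρ) (r := r) (a := Semi.gen ρ .d) 0
    (by rw [lie_self]; simp)
  have hy := fun u : 𝔥 => IsTorusAd.of_lie_eq (ρ := ρ) (r := r) (a := Semi.y ρ u) (-1)
    (by rw [Semi.lie_d_y hρ]; push_cast; module)
  have hps := isTorusAd_psAdL (r := r) hρ
  have hδ := isTorusAd_deltaSeries (ρ := ρ) (r := r) d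
  have key := (((((hΔ.smul twoPiI⁻¹).neg.sub (hδ.smul twoPiI⁻¹)).sub
    (((hd.smul e).sub ((hy l).smul c)).smul twoPiI⁻¹)).add
    ((IsTorusAd.sum (posRoots b) fun i _ => hps i (g i)).smul twoPiI⁻¹)).smul s).add
    (IsTorusAd.sum (posRoots b) fun i _ => (hps i (k i)).smul (P.root' i v)) |>.sub (hy v)
  have h2 : r ^ (-2 : ℤ) = r⁻¹ ^ 2 := by
    rw [zpow_neg, ← inv_zpow]
    rfl
  rw [zpow_zero, zpow_neg_one, h2] at key
  have hy0 : Semi.y ρ (0 : 𝔥) = 0 := by rw [Semi.y, map_zero, map_zero]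
  convert key using 1
  · rw [kzbVal, deltaPart]
    simp only [map_sub, map_smul]
  · rw [kzbVal, hy0]
    simp only [map_sub, map_smul, map_zero, zero_smul, Finset.sum_const_zero]
    module

theorem kzbForm_transl_tau (l : 𝔥) (hl : IsCoweight P l) {z : 𝔥} {τ : ℂ}
    (h : (z, τ) ∈ regularSet P) (v : 𝔥) (s : ℂ) :
    IsExpAd ρ (Compl.of ρ (-twoPiI • Semi.x ρ l)) (kzbForm ρ (z, τ) (v, s))
      (kzbForm ρ (z + τ • l, τ) (v + s • l, s)) := by
  obtain ⟨hτ, hz⟩ := mem_regularSet.1 h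
  have hk : ∀ i, kSeries (P.root' i (z + τ • l)) τ =
      gaugeK (-twoPiI * P.root' i l) (kSeries (P.root' i z) τ) := fun i => by
    obtain ⟨m, hm⟩ := hl i
    rw [map_add, map_smul, smul_eq_mul, hm, mul_comm τ, kSeries_add_int_mul hτ (hz i)]
  have key := isExpAd_kzbVal hρ l (-twoPiI) 0 (fun i => kSeries (P.root' i z) τ)
    (fun i => PowerSeries.derivative ℂ (kSeries (P.root' i z) τ))
    (fun n => aCoeff n * eisenstein n τ) v s
  rw [← kzbForm_apply, gaugeVec, zero_smul, add_zero] at key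
  simp only [gaugeG_derivative, zero_smul, sub_zero, zero_sub, ← hk] at key
  rw [kzbVal_add_smul _ _ _ v l s s (-twoPiI) (by
    have := twoPiI_ne_zero
    field_simp)] at key
  rw [kzbForm_apply ρ (z + τ • l)]
  convert key using 1
  have h1 : -(twoPiI⁻¹ • Compl.of ρ (-(-twoPiI • Semi.y ρ l))) = -Compl.of ρ (Semi.y ρ l) := by
    rw [neg_smul, neg_neg, map_smul, inv_smul_smul₀ twoPiI_ne_zero]
  rw [kzbVal, kzbVal, sub_eq_add_neg (deltaPart ρ _), h1, map_smul]
  module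

theorem kzbForm_inversion {z : 𝔥} {τ : ℂ} (h : (z, τ) ∈ regularSet P) (v : 𝔥) (s : ℂ) :
    ∃ B : Compl ρ,
      IsExpAd ρ (Compl.of ρ ((twoPiI / τ) • (Semi.x ρ z + Semi.gen ρ .X)))
        (kzbForm ρ (z, τ) (v, s)) B ∧
      IsTorusAd ρ τ
        (B + Compl.of ρ ((twoPiI / τ) • Semi.x ρ v -
          (twoPiI * s / τ ^ 2) • (Semi.x ρ z + Semi.gen ρ .X)))
        (kzbForm ρ (τ⁻¹ • z, -τ⁻¹) (τ⁻¹ • v - (s / τ ^ 2) • z, s / τ ^ 2) -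
          Compl.of ρ ((s / τ) • Semi.gen ρ .d)) := by
  obtain ⟨hτ, hz⟩ := mem_regularSet.1 h
  have h0 := ne_zero_of_im_pos hτ
  have h2π := twoPiI_ne_zero
  set c := twoPiI / τ with hc
  set K : ι → PowerSeries ℂ := fun i => gaugeK (c * P.root' i z) (kSeries (P.root' i z) τ) with hK
  set k' : ι → PowerSeries ℂ := fun i => kSeries (P.root' i (τ⁻¹ • z)) (-τ⁻¹) with hk'
  have hk : ∀ i, k' i = PowerSeries.C τ * PowerSeries.rescale τ (K i) := fun i => by
    rw [hk', hK]
    dsimp only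
    rw [map_smul, smul_eq_mul, mul_comm, kSeries_neg_inv hτ (hz i)]
  have hK' : ∀ i, PowerSeries.rescale τ (K i) = τ⁻¹ • k' i := fun i => by
    rw [hk, ← PowerSeries.smul_eq_C_mul, inv_smul_smul₀ h0]
  have hg : ∀ i, PowerSeries.rescale τ (gaugeG (c * P.root' i z)
      (PowerSeries.derivative ℂ (kSeries (P.root' i z) τ))) =
      τ⁻¹ ^ 2 • PowerSeries.derivative ℂ (k' i) - (τ⁻¹ * (c * P.root' i z)) • k' i := fun i => by
    have e : PowerSeries.derivative ℂ (k' i) =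
        (τ * τ) • PowerSeries.rescale τ (PowerSeries.derivative ℂ (K i)) := by
      rw [hk, ← PowerSeries.smul_eq_C_mul, Derivation.map_smul, derivative_rescale,
        ← PowerSeries.smul_eq_C_mul, smul_smul]
    rw [e, smul_smul, show τ⁻¹ ^ 2 * (τ * τ) = 1 by field_simp, one_smul, gaugeG_derivative, map_sub,
      map_mul (PowerSeries.rescale τ), rescale_C]
    change _ - PowerSeries.C _ * PowerSeries.rescale τ (K i) = _
    rw [hK', ← PowerSeries.smul_eq_C_mul, smul_smul, mul_comm τ⁻¹]
  have key := isExpAd_kzbVal hρ z c c (fun i => kSeries (P.root' i z) τ)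
    (fun i => PowerSeries.derivative ℂ (kSeries (P.root' i z) τ))
    (fun n => aCoeff n * eisenstein n τ) v s
  rw [← kzbForm_apply, gaugeVec, ← smul_add] at key
  refine ⟨_, key, ?_⟩
  have key2 := isTorusAd_kzbVal hρ τ K (fun i => gaugeG (c * P.root' i z)
    (PowerSeries.derivative ℂ (kSeries (P.root' i z) τ))) (fun n => aCoeff n * eisenstein n τ)
    z v s c c
  have hE : deltaSeries ρ (fun n => aCoeff n * eisenstein n (-τ⁻¹)) =
      τ ^ 2 • deltaSeries ρ (fun n => τ ^ (2 * (n : ℕ)) * (aCoeff n * eisenstein n τ)) := by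
    rw [← deltaSeries_smul]
    congr 1
    funext n
    rw [eisenstein_neg_inv hτ]
    ring
  convert key2 using 1
  · rw [kzbVal, kzbVal]
    have e1 : s * (twoPiI⁻¹ * (c * c)) = twoPiI * s / τ ^ 2 := by
      rw [hc]
      field_simp
    rw [← e1]
    simp only [map_sub, map_add, map_smul]
    module
  · rw [show kzbForm ρ (τ⁻¹ • z, -τ⁻¹) _ = kzbVal ρ k' (fun i => PowerSeries.derivative ℂ (k' i))
      (deltaPart ρ fun n => aCoeff n * eisenstein n (-τ⁻¹)) _ _ from kzbForm_apply ρ _ _ _ _]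
    have hS1 : ∑ i ∈ posRoots b, psAdL ρ i (PowerSeries.rescale τ (gaugeG (c * P.root' i z)
        (PowerSeries.derivative ℂ (kSeries (P.root' i z) τ)))) =
        τ⁻¹ ^ 2 • ∑ i ∈ posRoots b, psAdL ρ i (PowerSeries.derivative ℂ (k' i)) -
        (τ⁻¹ * c) • ∑ i ∈ posRoots b, P.root' i z • psAdL ρ i (k' i) := by
      rw [Finset.smul_sum, Finset.smul_sum, ← Finset.sum_sub_distrib]
      refine Finset.sum_congr rfl fun i _ => ?_
      rw [hg, map_sub, map_smul, map_smul, smul_smul, mul_assoc]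
    have hS2 : ∑ i ∈ posRoots b, P.root' i v • psAdL ρ i (PowerSeries.rescale τ (K i)) =
        τ⁻¹ • ∑ i ∈ posRoots b, P.root' i v • psAdL ρ i (k' i) := by
      rw [Finset.smul_sum]
      refine Finset.sum_congr rfl fun i _ => ?_
      rw [hK', map_smul, smul_comm]
    have hS3 : ∑ i ∈ posRoots b, P.root' i (τ⁻¹ • v - (s / τ ^ 2) • z) • psAdL ρ i (k' i) =
        τ⁻¹ • ∑ i ∈ posRoots b, P.root' i v • psAdL ρ i (k' i) -
        (s / τ ^ 2) • ∑ i ∈ posRoots b, P.root' i z • psAdL ρ i (k' i) := by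
      rw [Finset.smul_sum, Finset.smul_sum, ← Finset.sum_sub_distrib]
      refine Finset.sum_congr rfl fun i _ => ?_
      rw [map_sub, map_smul, map_smul, smul_eq_mul, smul_eq_mul]
      module
    have hy0 : Semi.y ρ (0 : 𝔥) = 0 := by rw [Semi.y, map_zero, map_zero]
    have hyy : Semi.y ρ (τ⁻¹ • v - (s / τ ^ 2) • z) =
        τ⁻¹ • Semi.y ρ v - (s / τ ^ 2) • Semi.y ρ z := by
      rw [sub_eq_add_neg, ← neg_smul, Semi.y_add, Semi.y_smul, Semi.y_smul]
      module
    rw [kzbVal, kzbVal, hS1, hS2, hS3, hyy, hy0, deltaPart, hE]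
    simp only [map_zero, zero_smul, Finset.sum_const_zero, map_sub, map_smul, hc]
    match_scalars <;> field_simp

theorem isModuliConnection_kzbForm : IsModuliConnection ρ (kzbForm ρ) where
  transl l hl z τ h v s := by
    obtain ⟨hτ, hz⟩ := mem_regularSet.1 h
    have hk : ∀ i, kSeries (P.root' i (z + l)) τ = kSeries (P.root' i z) τ := fun i => by
      obtain ⟨m, hm⟩ := hl i
      rw [map_add, hm, kSeries_add_int hτ (hz i)]
    rw [kzbForm_apply, kzbForm_apply]
    simp only [hk]
  transl_tau l hl z τ h v s := kzbForm_transl_tau hρ l hl h v s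
  tau_add_one z τ h v s := by
    obtain ⟨hτ, hz⟩ := mem_regularSet.1 h
    rw [kzbForm_apply, kzbForm_apply]
    simp only [kSeries_tau_add_one hτ (hz _), eisenstein_add_one hτ]
  inversion z τ h v s := kzbForm_inversion hρ h v s

end Equivariance

end EllipticKZB

end

noncomputable section

namespace EllipticKZB

open LieAlgebra (SemiDirectSum)
open LieAlgebra.SemiDirectSum (inl inr)

section Graded

variable {ι 𝔥 M : Type*} [Fintype ι] [AddCommGroup 𝔥] [Module ℂ 𝔥] [AddCommGroup M] [Module ℂ M]
variable {P : RootPairing ι ℂ M 𝔥} {b : P.Base}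
variable (ρ : Der →ₗ⁅ℂ⁆ LieDerivation ℂ (Ell b) (Ell b))

/-! ### Brackets of series -/

/-- The span of the homogeneous components of total degree `≥ N`. -/
def gradedGE (N : ℕ) : Submodule ℂ (Semi ρ) :=
  Submodule.span ℂ {a | ∃ p : ℤ × ℤ, (N : ℤ) ≤ p.1 + p.2 ∧ HasDegree ρ p a}

variable {ρ}

theorem HasDegree.mem_gradedGE {p : ℤ × ℤ} {a : Semi ρ} (h : HasDegree ρ p a) {N : ℕ}
    (hN : (N : ℤ) ≤ p.1 + p.2) : a ∈ gradedGE ρ N :=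
  Submodule.subset_span ⟨p, hN, h⟩

theorem gradedGE_anti {m n : ℕ} (h : m ≤ n) : gradedGE ρ n ≤ gradedGE ρ m :=
  Submodule.span_mono fun _ ⟨p, hp, ha⟩ => ⟨p, le_trans (by exact_mod_cast h) hp, ha⟩

theorem lie_mem_filt {i j : ℕ} {a c : Semi ρ} (ha : a ∈ gradedGE ρ i) (hc : c ∈ gradedGE ρ j) :
    ⁅a, c⁆ ∈ filt ρ (i + j) := by
  induction ha, hc using Submodule.span_induction₂ with
  | mem_mem a c ha hc =>
    obtain ⟨p, hp, ha⟩ := ha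
    obtain ⟨q, hq, hc⟩ := hc
    refine LieSubmodule.subset_lieSpan ⟨p + q, ?_, ha.lie hc⟩
    rw [Prod.fst_add, Prod.snd_add]
    push_cast
    linarith
  | zero_left => rw [zero_lie]; exact zero_mem _
  | zero_right => rw [lie_zero]; exact zero_mem _
  | add_left x y z _ _ _ h1 h2 => rw [add_lie]; exact add_mem h1 h2
  | add_right x y z _ _ _ h1 h2 => rw [lie_add]; exact add_mem h1 h2
  | smul_left r x y _ _ h => rw [smul_lie]; exact SMulMemClass.smul_mem r h
  | smul_right r x y _ _ h => rw [lie_smul]; exact SMulMemClass.smul_mem r h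

theorem trunc_lie_sum {s a : ℕ → Semi ρ} (hs : ∀ j, s j ∈ gradedGE ρ j)
    (ha : ∀ j, a j ∈ gradedGE ρ j)
    (h : ∀ n, ∑ p ∈ Finset.HasAntidiagonal.antidiagonal n, ⁅s p.2, a p.1⁆ = 0) {N R : ℕ}
    (hR : N ≤ R) :
    trunc ρ N ⁅∑ j ∈ Finset.range R, s j, ∑ j ∈ Finset.range R, a j⁆ = 0 := by
  rw [sum_lie]
  simp only [lie_sum]
  rw [Finset.sum_comm, ← Finset.sum_product' (f := fun i j => ⁅s j, a i⁆), map_sum,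
    ← Finset.sum_fiberwise_of_maps_to (g := fun p : ℕ × ℕ => p.1 + p.2)
      (t := Finset.range (R + R)) (fun p hp => by
        simp only [Finset.mem_product, Finset.mem_range] at hp ⊢
        omega)]
  refine Finset.sum_eq_zero fun n _ => ?_
  rcases lt_or_ge n R with hn | hn
  · rw [← map_sum, ← map_zero (trunc ρ N), ← h n]
    refine congrArg _ (Finset.sum_congr ?_ fun _ _ => rfl)
    ext p
    simp only [Finset.mem_filter, Finset.mem_product, Finset.mem_range,
      Finset.HasAntidiagonal.mem_antidiagonal]
    omega
  · refine Finset.sum_eq_zero fun p hp => trunc_eq_zero ρ (filt_anti ρ ?_ (lie_mem_filt (hs _) (ha _)))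
    have := (Finset.mem_filter.1 hp).2
    omega

theorem Semi.tx_mem_gradedGE (i : ι) (j : ℕ) : Semi.tx ρ i j ∈ gradedGE ρ (j + 2) := by
  rw [← Semi.ad_pow_t]
  refine (hasDegree_adPow ρ _ i j).mem_gradedGE ?_
  push_cast
  linarith

theorem inl_connShift_mem_gradedGE (K : ι → ℕ → ℂ) (u : 𝔥) (j : ℕ) :
    (inl ρ (connShift b K u j) : Semi ρ) ∈ gradedGE ρ j := by
  cases j with
  | zero =>
    rw [connShift, map_neg]
    exact neg_mem ((HasDegree.y u).mem_gradedGE (by norm_num))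
  | succ m =>
    rw [connShift, connCoeff, map_smul, map_sum]
    refine Submodule.smul_mem _ _ (sum_mem fun i _ => ?_)
    rw [map_smul]
    exact Submodule.smul_mem _ _ (gradedGE_anti (Nat.le_succ _) (Semi.tx_mem_gradedGE i m))

theorem inl_gCoeff_mem_gradedGE (K : ι → ℕ → ℂ) (j : ℕ) :
    (inl ρ (gCoeff b K j) : Semi ρ) ∈ gradedGE ρ (j + 2) := by
  rw [gCoeff, map_smul, map_sum]
  refine Submodule.smul_mem _ _ (sum_mem fun i _ => ?_)
  rw [map_smul]
  exact Submodule.smul_mem _ _ (Semi.tx_mem_gradedGE i j)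

/-! ### The components of the connection form -/

theorem Ell.der_mk_eq_preDer (δ : LieDerivation ℂ (Ell b) (Ell b)) {D : Gen ι 𝔥 → Ell b}
    (h : ∀ g, δ (Ell.mk b (FreeLieAlgebra.of ℂ g)) = D g) (r : FreeLieAlgebra ℂ (Gen ι 𝔥)) :
    δ (Ell.mk b r) = preDer b D r := by
  let G : FreeLieAlgebra ℂ (Gen ι 𝔥) →ₗ⁅ℂ⁆ Tang (Ell b) :=
    { toFun := fun r => Tang.mk (Ell.mk b r) (δ (Ell.mk b r))
      map_add' := fun r s => by rw [map_add, map_add]; rfl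
      map_smul' := fun c r => by rw [map_smul, map_smul]; rfl
      map_lie' := fun {r s} => by
        rw [LieHom.map_lie, LieDerivation.apply_lie_eq_add, add_comm]
        rfl }
  have hG : G = tangLift b D := FreeLieAlgebra.hom_ext fun g => by
    rw [tangLift, FreeLieAlgebra.lift_of_apply, ← h]
    rfl
  exact congrArg Prod.snd (LieHom.congr_fun hG r)

theorem IsAction.δ_mk (hρ : IsAction b ρ) (m : ℕ+) (r : FreeLieAlgebra ℂ (Gen ι 𝔥)) :
    ρ (Der.gen (.δ m)) (Ell.mk b r) = preDelta b m r := by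
  refine Ell.der_mk_eq_preDer _ (fun g => ?_) r
  cases g with
  | x u => exact hρ.δ_x m u
  | y u => exact (hρ.δ_y m u).trans (deltaY_apply _ u).symm
  | t i => exact hρ.δ_t m i

variable (ρ) in
/-- `δ_{2m}`, where `δ_0 = 0`. -/
def Semi.δ (m : ℕ) : Semi ρ := if h : 0 < m then Semi.gen ρ (.δ (m.toPNat h)) else 0

variable (ρ) in
/-- The homogeneous components of `-2πi Δ`. -/
def bigDeltaCoeff (c : ℕ → ℂ) (K : ι → ℕ → ℂ) : ℕ → Semi ρ
  | 0 => Semi.gen ρ .Δ₀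
  | 1 => 0
  | j + 2 => c j • Semi.δ ρ (j / 2) - inl ρ (gCoeff b K j)

theorem bigDeltaCoeff_mem_gradedGE {c : ℕ → ℂ} (hc : ∀ j, Odd j → c j = 0) (K : ι → ℕ → ℂ)
    (j : ℕ) : bigDeltaCoeff ρ c K j ∈ gradedGE ρ j := by
  rcases j with _ | _ | j
  · exact HasDegree.Δ₀.mem_gradedGE (by norm_num)
  · exact zero_mem _
  · refine sub_mem ?_ (inl_gCoeff_mem_gradedGE K j)
    rcases Nat.even_or_odd j with he | ho
    · refine Submodule.smul_mem _ _ ?_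
      rw [Semi.δ]
      split_ifs with h
      · refine (HasDegree.δ ((j / 2).toPNat h)).mem_gradedGE ?_
        have := Nat.even_iff.1 he
        rw [Nat.toPNat, PNat.mk_coe]
        push_cast
        omega
      · exact zero_mem _
    · rw [hc j ho, zero_smul]
      exact zero_mem _

theorem lie_bigDeltaCoeff (hρ : IsAction b ρ) {c : ℕ → ℂ} (hc : c 0 = 0)
    (hc' : ∀ j, Odd j → c j = 0) (K : ι → ℕ → ℂ) (j : ℕ) (r : FreeLieAlgebra ℂ (Gen ι 𝔥)) :
    ⁅bigDeltaCoeff ρ c K j, (inl ρ (Ell.mk b r) : Semi ρ)⁆ = inl ρ (heatDer b c K j r) := by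
  rcases j with _ | _ | j
  · rw [bigDeltaCoeff, Semi.lie_gen_inl, hρ.Δ₀_eq]
    rfl
  · rw [bigDeltaCoeff, zero_lie]
    exact (map_zero (inl ρ)).symm
  · rw [bigDeltaCoeff, heatDer_add_two, sub_lie, smul_lie, ← LieHom.map_lie, map_add, map_smul,
      ← lie_skew (Ell.mk b r), map_neg, ← sub_eq_add_neg, Semi.δ]
    congr 1
    split_ifs with h
    · rw [Semi.lie_gen_inl, hρ.δ_mk]
      rfl
    · have : c j = 0 := by
        rcases Nat.even_or_odd j with he | ho
        · have := Nat.even_iff.1 he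
          rw [show j = 0 by omega, hc]
        · exact hc' j ho
      rw [this, zero_smul, zero_smul]

theorem sum_smul_δ {c : ℕ → ℂ} (hc : ∀ j, Odd j → c j = 0) (N : ℕ) :
    ∑ j ∈ Finset.range (2 * (N + 1)), c j • Semi.δ ρ (j / 2) =
      ∑ n ∈ Finset.range N, c (2 * (n.succPNat : ℕ)) • Semi.gen ρ (.δ n.succPNat) := by
  induction N with
  | zero =>
    rw [Finset.range_zero, Finset.sum_empty, Finset.sum_range_succ, Finset.sum_range_one,
      hc 1 odd_one, zero_smul, add_zero, Semi.δ, dif_neg (by norm_num), smul_zero]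
  | succ N ih =>
    rw [Finset.sum_range_succ, ← ih, mul_add 2 (N + 1), mul_one, Finset.sum_range_succ,
      Finset.sum_range_succ, hc (2 * (N + 1) + 1) (odd_two_mul_add_one _), zero_smul, add_zero,
      Semi.δ, dif_pos (by omega)]
    have : (2 * (N + 1) / 2).toPNat (by omega) = N.succPNat :=
      PNat.eq (Nat.mul_div_cancel_left _ two_pos)
    rw [this]
    rfl

end Graded

end EllipticKZB

end

noncomputable section

namespace EllipticKZB

open LieAlgebra (SemiDirectSum)
open LieAlgebra.SemiDirectSum (inl inr)

section Commutation

variable {ι 𝔥 M : Type*} [Fintype ι] [NormedAddCommGroup 𝔥] [NormedSpace ℂ 𝔥]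
  [AddCommGroup M] [Module ℂ M]
variable {P : RootPairing ι ℂ M 𝔥} [P.IsRootSystem] [P.IsReduced] {b : P.Base}
variable (ρ : Der →ₗ⁅ℂ⁆ LieDerivation ℂ (Ell b) (Ell b))

/-! ### The components of the connection form commute -/

/-- The component of the connection form along `𝔥`. -/
def horForm (z : 𝔥) (τ : ℂ) (u : 𝔥) : Compl ρ :=
  ∑ i ∈ posRoots b, P.root' i u • psAdL ρ i (kSeries (P.root' i z) τ) - Compl.of ρ (Semi.y ρ u)

theorem kzbForm_eq_horForm (z : 𝔥) (τ : ℂ) (u : 𝔥) (s : ℂ) :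
    kzbForm ρ (z, τ) (u, s) = s • bigDelta ρ (z, τ) + horForm ρ z τ u := by
  rw [horForm, ← add_sub_assoc]
  simp only [kzbForm, LinearMap.sub_apply, LinearMap.add_apply, LinearMap.smulRight_apply,
    LinearMap.snd_apply, LinearMap.sum_apply, LinearMap.comp_apply, LinearMap.fst_apply,
    psAdL_apply]
  rfl

variable {z : 𝔥} {τ : ℂ} (hτ : 0 < τ.im) (hz : ∀ i, P.root' i z ∉ lat τ)
include hτ hz

theorem kronCoeff_kron_succ (i : ι) (m : ℕ) : kronCoeff P (kron τ) z i (m + 1) =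
    PowerSeries.coeff m (kSeries (P.root' i z) τ) := by
  rw [kronCoeff, kron_eq hτ (hz i), map_add, PowerSeries.coeff_one, if_neg m.succ_ne_zero, zero_add,
    PowerSeries.coeff_succ_X_mul]

theorem proj_horForm (u : 𝔥) {N R : ℕ} (h : N ≤ R) : Compl.proj ρ N (horForm ρ z τ u) =
    trunc ρ N (∑ j ∈ Finset.range (R + 1), inl ρ (connShift b (kronCoeff P (kron τ) z) u j)) := by
  have h1 : ∀ m, connShift b (kronCoeff P (kron τ) z) u (m + 1) = ∑ i ∈ posRoots b,
      P.root' i u • PowerSeries.coeff m (kSeries (P.root' i z) τ) • Ell.tx b i m := fun m => by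
    rw [connShift, connCoeff, ← sum_posRoots b]
    · simp only [kronCoeff_kron_succ hτ hz, mul_smul]
    · intro i
      rw [kronCoeff_negIdx (isKron_kron hτ) hz, Ell.tx_negIdx, root'_negIdx, LinearMap.neg_apply,
        smul_smul]
      congr 1
      have : ((-1 : ℂ) ^ m) ^ 2 = 1 := by rw [← pow_mul, mul_comm, pow_mul]; norm_num
      linear_combination P.root' i u * kronCoeff P (kron τ) z i (m + 1) * this
  rw [Finset.sum_range_succ', connShift, map_neg, ← sub_eq_add_neg, map_sub, horForm, map_sub,
    Compl.proj_of, map_sum]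
  congr 1
  simp only [h1, map_sum, map_smul, psAdL_apply, proj_psAd ρ _ _ h, Finset.smul_sum]
  rw [Finset.sum_comm]
  rfl

theorem proj_bigDelta (N : ℕ) : Compl.proj ρ N (twoPiI • bigDelta ρ (z, τ)) =
    -trunc ρ N (∑ j ∈ Finset.range (2 * (N + 1) + 2), bigDeltaCoeff ρ
      (fun j => PowerSeries.coeff j (eisSeries τ)) (kronCoeff P (kron τ) z) j) := by
  have h1 : ∀ m, gCoeff b (kronCoeff P (kron τ) z) m = ∑ i ∈ posRoots b,
      PowerSeries.coeff m (gSeries (P.root' i z) τ) • Ell.tx b i m := fun m => by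
    rw [gCoeff, ← sum_posRoots b]
    · refine Finset.sum_congr rfl fun i _ => ?_
      rw [kronCoeff_kron_succ hτ hz, gSeries, PowerSeries.coeff_derivative, mul_comm]
    · intro i
      rw [kronCoeff_negIdx (isKron_kron hτ) hz, Ell.tx_negIdx, smul_smul]
      congr 1
      have : ((-1 : ℂ) ^ m) ^ 2 = 1 := by rw [← pow_mul, mul_comm, pow_mul]; norm_num
      linear_combination (m + 1) * kronCoeff P (kron τ) z i (m + 2) * this
  have h2 : twoPiI • bigDelta ρ (z, τ) = -(Compl.of ρ (Semi.gen ρ .Δ₀) +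
      (deltaSeries ρ (fun n => aCoeff n * eisenstein n τ) -
        ∑ i ∈ posRoots b, psAd ρ (gSeries (P.root' i z) τ) i)) := by
    rw [bigDelta]
    simp only [smul_add, smul_sub, smul_neg, smul_smul, mul_inv_cancel₀ twoPiI_ne_zero, one_smul]
    abel
  rw [h2, map_neg, Finset.sum_range_succ', Finset.sum_range_succ']
  simp only [bigDeltaCoeff]
  rw [add_zero, add_comm _ (Semi.gen ρ .Δ₀), Finset.sum_sub_distrib,
    sum_smul_δ fun j => coeff_odd_eisSeries τ, map_add, map_add, map_sub, map_sub, map_sum,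
    Compl.proj_of, proj_deltaSeries ρ _ le_rfl]
  simp only [coeff_even_eisSeries, h1, map_sum, map_smul,
    proj_psAd ρ _ _ (show N ≤ 2 * (N + 1) by omega)]
  rw [Finset.sum_comm]
  rfl

theorem lie_horForm (u v : 𝔥) : ⁅horForm ρ z τ u, horForm ρ z τ v⁆ = 0 := by
  ext N
  rw [Compl.proj_lie, proj_horForm ρ hτ hz u le_rfl, proj_horForm ρ hτ hz v le_rfl,
    ← LieHom.map_lie, map_zero]
  refine trunc_lie_sum (inl_connShift_mem_gradedGE _ u) (inl_connShift_mem_gradedGE _ v)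
    (fun n => ?_) N.le_succ
  rw [← Finset.Nat.sum_antidiagonal_swap]
  simp only [Prod.fst_swap, Prod.snd_swap, ← LieHom.map_lie, ← map_sum,
    sum_lie_connShift (isKron_kron hτ) hz, map_zero]

theorem lie_bigDelta_horForm (hρ : IsAction b ρ) (u : 𝔥) :
    ⁅bigDelta ρ (z, τ), horForm ρ z τ u⁆ = 0 := by
  obtain ⟨C₀, hC⟩ := exists_kronGamma_eq_eisSeries hτ
  have hc0 := coeff_zero_eisSeries τ
  have hc : ∀ j, Odd j → PowerSeries.coeff j (eisSeries τ) = 0 := fun j => coeff_odd_eisSeries τ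
  suffices h : ⁅twoPiI • bigDelta ρ (z, τ), horForm ρ z τ u⁆ = 0 by
    rw [smul_lie] at h
    exact (smul_eq_zero.1 h).resolve_left twoPiI_ne_zero
  ext N
  rw [Compl.proj_lie, proj_bigDelta ρ hτ hz, proj_horForm ρ hτ hz u
    (show N ≤ 2 * (N + 1) + 1 by omega), neg_lie, ← LieHom.map_lie, map_zero, neg_eq_zero]
  refine trunc_lie_sum (bigDeltaCoeff_mem_gradedGE hc _) (inl_connShift_mem_gradedGE _ u)
    (fun n => ?_) (by omega)
  simp only [← mk_freeConn, lie_bigDeltaCoeff hρ hc0 hc, ← map_sum]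
  rw [sum_heatDer_freeConn (isKron_kron hτ) hz hC hc0 hc, map_zero]

theorem lie_kzbForm (hρ : IsAction b ρ) (u v : 𝔥 × ℂ) :
    ⁅kzbForm ρ (z, τ) u, kzbForm ρ (z, τ) v⁆ = 0 := by
  obtain ⟨u, s⟩ := u
  obtain ⟨v, r⟩ := v
  rw [kzbForm_eq_horForm, kzbForm_eq_horForm, add_lie, lie_add, lie_add, smul_lie, lie_smul,
    smul_lie, lie_smul, lie_self, lie_horForm ρ hτ hz, lie_bigDelta_horForm ρ hτ hz hρ,
    ← lie_skew, lie_bigDelta_horForm ρ hτ hz hρ]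
  simp only [smul_zero, neg_zero, add_zero]

end Commutation

end EllipticKZB

end

noncomputable section

namespace EllipticKZB

section Flat

variable {ι 𝔥 M : Type*} [Fintype ι] [NormedAddCommGroup 𝔥] [NormedSpace ℂ 𝔥]
  [AddCommGroup M] [Module ℂ M]
variable {P : RootPairing ι ℂ M 𝔥} {b : P.Base}
variable {ρ : Der →ₗ⁅ℂ⁆ LieDerivation ℂ (Ell b) (Ell b)}

/-! ### Derivatives of functions with values in the completion -/

section Derivative

variable {F G : 𝔥 × ℂ → Compl ρ} {F' G' : 𝔥 × ℂ →ₗ[ℂ] Compl ρ} {p : 𝔥 × ℂ}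

theorem hasDerivative_const (c : Compl ρ) : HasDerivative ρ (fun _ => c) 0 p := fun N f =>
  ⟨0, fun v => by simp, hasFDerivAt_const _ _⟩

theorem HasDerivative.congr (hF : HasDerivative ρ F F' p) (h : ∀ q, G q = F q) :
    HasDerivative ρ G F' p := by
  rwa [funext h]

theorem HasDerivative.add (hF : HasDerivative ρ F F' p) (hG : HasDerivative ρ G G' p) :
    HasDerivative ρ (fun q => F q + G q) (F' + G') p := fun N f => by
  obtain ⟨L, hL, hF⟩ := hF N f
  obtain ⟨K, hK, hG⟩ := hG N f
  refine ⟨L + K, fun v => ?_, ?_⟩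
  · rw [add_apply, hL, hK, LinearMap.add_apply, map_add, map_add]
  · simp only [map_add]
    exact hF.add hG

theorem HasDerivative.const_smul (c : ℂ) (hF : HasDerivative ρ F F' p) :
    HasDerivative ρ (fun q => c • F q) (c • F') p := fun N f => by
  obtain ⟨L, hL, hF⟩ := hF N f
  refine ⟨c • L, fun v => ?_, ?_⟩
  · rw [smul_apply, hL, LinearMap.smul_apply, map_smul, map_smul]
  · simp only [map_smul]
    exact hF.const_smul c

theorem HasDerivative.sum {κ : Type*} (S : Finset κ) {F : κ → 𝔥 × ℂ → Compl ρ}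
    {F' : κ → 𝔥 × ℂ →ₗ[ℂ] Compl ρ} (h : ∀ i ∈ S, HasDerivative ρ (F i) (F' i) p) :
    HasDerivative ρ (fun q => ∑ i ∈ S, F i q) (∑ i ∈ S, F' i) p := by
  classical
  induction S using Finset.induction_on with
  | empty => exact hasDerivative_const 0
  | insert i S hi ih =>
    simp only [Finset.sum_insert hi]
    exact (h i (Finset.mem_insert_self i S)).add (ih fun j hj => h j (Finset.mem_insert_of_mem hj))

theorem HasDerivative.psAdL (i : ι) {ψ : 𝔥 × ℂ → PowerSeries ℂ} {ψ' : 𝔥 × ℂ →ₗ[ℂ] PowerSeries ℂ}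
    (h : ∀ j, ∃ L : 𝔥 × ℂ →L[ℂ] ℂ, (∀ v, L v = PowerSeries.coeff j (ψ' v)) ∧
      HasFDerivAt (fun q => PowerSeries.coeff j (ψ q)) L p) :
    HasDerivative ρ (fun q => EllipticKZB.psAdL ρ i (ψ q)) ((EllipticKZB.psAdL ρ i).comp ψ') p := by
  choose L hL hψ using h
  intro N f
  refine ⟨∑ j ∈ Finset.range N, f (trunc ρ N (Semi.tx ρ i j)) • L j, fun v => ?_, ?_⟩
  · rw [LinearMap.comp_apply, psAdL_apply, proj_psAd ρ _ i le_rfl]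
    simp only [map_sum, map_smul, sum_apply, smul_apply, hL,
      smul_eq_mul, mul_comm]
  · simp only [psAdL_apply, proj_psAd ρ _ i le_rfl, map_sum, map_smul, smul_eq_mul,
      mul_comm _ (f _)]
    exact HasFDerivAt.fun_sum fun j _ => (hψ j).const_mul _

theorem hasDerivative_deltaSeries {e : ℕ+ → ℂ → ℂ} {e' : ℕ+ → ℂ}
    (h : ∀ n, HasDerivAt (e n) (e' n) p.2) :
    HasDerivative ρ (fun q => deltaSeries ρ fun n => e n q.2)
      ((LinearMap.snd ℂ 𝔥 ℂ).smulRight (deltaSeries ρ e')) p := by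
  intro N f
  refine ⟨∑ j ∈ Finset.range N, f (trunc ρ N (Semi.gen ρ (.δ j.succPNat))) •
    e' j.succPNat • ContinuousLinearMap.snd ℂ 𝔥 ℂ, fun v => ?_, ?_⟩
  · rw [LinearMap.smulRight_apply, map_smul, proj_deltaSeries ρ _ le_rfl]
    simp only [map_sum, map_smul, sum_apply, smul_apply,
      smul_eq_mul, ContinuousLinearMap.coe_snd', LinearMap.snd_apply, Finset.mul_sum]
    exact Finset.sum_congr rfl fun j _ => by ring
  · simp only [proj_deltaSeries ρ _ le_rfl, map_sum, map_smul, smul_eq_mul, mul_comm _ (f _)]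
    exact HasFDerivAt.fun_sum fun j _ =>
      ((h j.succPNat).comp_hasFDerivAt p hasFDerivAt_snd).const_mul _

end Derivative

/-! ### The differential of the connection form -/

/-- The `z`-derivative of `kSeries`. -/
def kSeriesZ (z τ : ℂ) : PowerSeries ℂ :=
  PowerSeries.mk fun n => PowerSeries.coeff (n + 1) (kronZ τ z)

/-- The `τ`-derivative of `kSeries`. -/
def kSeriesT (z τ : ℂ) : PowerSeries ℂ :=
  PowerSeries.mk fun n => PowerSeries.coeff (n + 1) (kronT τ z)

theorem kSeriesT_eq {z τ : ℂ} (hτ : 0 < τ.im) (hz : z ∉ lat τ) :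
    kSeriesT z τ = twoPiI⁻¹ • PowerSeries.derivative ℂ (kSeriesZ z τ) := by
  ext n
  rw [map_smul, PowerSeries.coeff_derivative, kSeriesT, kSeriesZ, PowerSeries.coeff_mk,
    PowerSeries.coeff_mk, smul_eq_mul, eq_inv_mul_iff_mul_eq₀ twoPiI_ne_zero,
    kronT_coeff_succ hτ hz, mul_comm]

/-- The differential of `k(α(z), x | τ)`. -/
def kSeriesD (P : RootPairing ι ℂ M 𝔥) (z : 𝔥) (τ : ℂ) (i : ι) : 𝔥 × ℂ →ₗ[ℂ] PowerSeries ℂ :=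
  ((P.root' i).comp (LinearMap.fst ℂ 𝔥 ℂ)).smulRight (kSeriesZ (P.root' i z) τ) +
    (LinearMap.snd ℂ 𝔥 ℂ).smulRight (kSeriesT (P.root' i z) τ)

theorem kSeriesD_apply (z : 𝔥) (τ : ℂ) (i : ι) (u : 𝔥) (s : ℂ) : kSeriesD P z τ i (u, s) =
    P.root' i u • kSeriesZ (P.root' i z) τ + s • kSeriesT (P.root' i z) τ := rfl

theorem finite_of_isRootSystem (P : RootPairing ι ℂ M 𝔥) [P.IsRootSystem] : Module.Finite ℂ 𝔥 :=
  ⟨Submodule.fg_def.2 ⟨_, Set.finite_range P.coroot, RootPairing.IsRootSystem.span_coroot_eq_top⟩⟩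

variable [P.IsRootSystem] {z : 𝔥} {τ : ℂ} (hτ : 0 < τ.im) (hz : ∀ i, P.root' i z ∉ lat τ)
include hτ hz

theorem hasFDerivAt_coeff_kSeries (i : ι) (j : ℕ) : ∃ L : 𝔥 × ℂ →L[ℂ] ℂ,
    (∀ v, L v = PowerSeries.coeff j (kSeriesD P z τ i v)) ∧
      HasFDerivAt (fun q : 𝔥 × ℂ => PowerSeries.coeff j (kSeries (P.root' i q.1) q.2)) L (z, τ) := by
  have := finite_of_isRootSystem P
  let R : 𝔥 × ℂ →L[ℂ] ℂ × ℂ := ((LinearMap.toContinuousLinearMap (P.root' i)).comp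
    (ContinuousLinearMap.fst ℂ 𝔥 ℂ)).prod (ContinuousLinearMap.snd ℂ 𝔥 ℂ)
  have hd := differentiableAt_kronJ (j + 1) (mem_thetaSupport hτ (hz i))
  refine ⟨(fderiv ℂ (kronJ (j + 1)) (P.root' i z, τ)).comp R, fun ⟨u, s⟩ => ?_, ?_⟩
  · have h1 : R (u, s) = P.root' i u • ((1, 0) : ℂ × ℂ) + s • ((0, 1) : ℂ × ℂ) := by
      ext <;> simp [R]
    rw [ContinuousLinearMap.comp_apply, h1, map_add, map_smul, map_smul, kSeriesD_apply, map_add,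
      map_smul, map_smul, kSeriesZ, kSeriesT, PowerSeries.coeff_mk, PowerSeries.coeff_mk, kronZ,
      kronT, PowerSeries.coeff_mk, PowerSeries.coeff_mk, pderivFst_eq hd, pderivSnd_eq hd]
  · have h2 : (fun q : 𝔥 × ℂ => PowerSeries.coeff j (kSeries (P.root' i q.1) q.2)) =
        kronJ (j + 1) ∘ R := by
      funext q
      rw [kSeries, PowerSeries.coeff_mk]
      rfl
    rw [h2]
    exact HasFDerivAt.comp (z, τ) hd.hasFDerivAt R.hasFDerivAt

theorem hasFDerivAt_coeff_gSeries (i : ι) (j : ℕ) : ∃ L : 𝔥 × ℂ →L[ℂ] ℂ,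
    (∀ v, L v = PowerSeries.coeff j
      (((PowerSeries.derivative ℂ : _ →ₗ[ℂ] PowerSeries ℂ).comp (kSeriesD P z τ i)) v)) ∧
      HasFDerivAt (fun q : 𝔥 × ℂ => PowerSeries.coeff j (gSeries (P.root' i q.1) q.2)) L
        (z, τ) := by
  obtain ⟨L, hL, h⟩ := hasFDerivAt_coeff_kSeries hτ hz i (j + 1)
  refine ⟨((j : ℂ) + 1) • L, fun v => ?_, ?_⟩
  · rw [smul_apply, hL, smul_eq_mul, mul_comm]
    exact (PowerSeries.coeff_derivative _ _).symm
  · simp only [gSeries, PowerSeries.coeff_derivative, mul_comm _ ((j : ℂ) + 1)]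
    exact h.const_mul _

omit [P.IsRootSystem] hτ hz in
theorem kzbForm_apply_eq_sum (z : 𝔥) (τ : ℂ) (v : 𝔥) (s : ℂ) : kzbForm ρ (z, τ) (v, s) =
    (-(s * twoPiI⁻¹)) • deltaSeries ρ (fun n => aCoeff n * eisenstein n τ) +
      ∑ i ∈ posRoots b, ((s * twoPiI⁻¹) • psAdL ρ i (gSeries (P.root' i z) τ) +
        P.root' i v • psAdL ρ i (kSeries (P.root' i z) τ)) +
      (-(s * twoPiI⁻¹) • Compl.of ρ (Semi.gen ρ .Δ₀) - Compl.of ρ (Semi.y ρ v)) := by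
  rw [kzbForm_apply, kzbVal, deltaPart, Finset.sum_add_distrib, ← Finset.smul_sum]
  simp only [gSeries]
  module

variable (ρ z τ) in
/-- The derivative at `(z,τ)` of the value of the connection form on a tangent vector. -/
def kzbDeriv (v : 𝔥 × ℂ) : 𝔥 × ℂ →ₗ[ℂ] Compl ρ :=
  (-(v.2 * twoPiI⁻¹)) • (LinearMap.snd ℂ 𝔥 ℂ).smulRight
      (deltaSeries ρ fun n => aCoeff n * deriv (eisenstein n) τ) +
    ∑ i ∈ posRoots b, ((v.2 * twoPiI⁻¹) • (psAdL ρ i).comp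
        ((PowerSeries.derivative ℂ : _ →ₗ[ℂ] PowerSeries ℂ).comp (kSeriesD P z τ i)) +
      P.root' i v.1 • (psAdL ρ i).comp (kSeriesD P z τ i)) + 0

theorem hasDerivative_kzbForm (v : 𝔥 × ℂ) :
    HasDerivative ρ (fun q => kzbForm ρ q v) (kzbDeriv ρ z τ v) (z, τ) := by
  have h1 := (hasDerivative_deltaSeries (ρ := ρ) (p := (z, τ)) fun n =>
    (differentiableAt_eisenstein hτ n).hasDerivAt.const_mul (aCoeff n)).const_smul
      (-(v.2 * twoPiI⁻¹))
  have h2 := fun i => (HasDerivative.psAdL (ρ := ρ) i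
    (hasFDerivAt_coeff_gSeries hτ hz i)).const_smul (v.2 * twoPiI⁻¹)
  have h3 := fun i => (HasDerivative.psAdL (ρ := ρ) i
    (hasFDerivAt_coeff_kSeries hτ hz i)).const_smul (P.root' i v.1)
  exact ((h1.add (HasDerivative.sum (posRoots b) fun i _ => (h2 i).add (h3 i))).add
    (hasDerivative_const (-(v.2 * twoPiI⁻¹) • Compl.of ρ (Semi.gen ρ .Δ₀) -
      Compl.of ρ (Semi.y ρ v.1)))).congr fun q => kzbForm_apply_eq_sum q.1 q.2 v.1 v.2

theorem kzbDeriv_comm (u v : 𝔥 × ℂ) : kzbDeriv ρ z τ v u = kzbDeriv ρ z τ u v := by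
  obtain ⟨u, s⟩ := u
  obtain ⟨v, r⟩ := v
  simp only [kzbDeriv, LinearMap.add_apply, LinearMap.smul_apply, LinearMap.sum_apply,
    LinearMap.comp_apply, LinearMap.smulRight_apply, LinearMap.snd_apply, LinearMap.zero_apply,
    kSeriesD_apply, kSeriesT_eq hτ (hz _)]
  congr 2
  · module
  · refine Finset.sum_congr rfl fun i _ => ?_
    simp only [map_add, map_smul, Derivation.coeFn_coe]
    module

omit hτ hz in
/-- The connection is flat. -/
theorem isFlatOn_kzbForm [P.IsReduced] (hρ : IsAction b ρ) :
    IsFlatOn ρ (kzbForm ρ) (regularSet P) := by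
  rintro ⟨z, τ⟩ hp
  obtain ⟨hτ, hz⟩ := mem_regularSet.1 hp
  refine ⟨kzbDeriv ρ z τ, hasDerivative_kzbForm hτ hz, fun u v => ?_⟩
  rw [kzbDeriv_comm hτ hz, sub_self, lie_kzbForm ρ hτ hz hρ, sub_zero]

end Flat

end EllipticKZB

end

theorem mainTheorem4 {ι 𝔥 M : Type*} [Fintype ι] [NormedAddCommGroup 𝔥] [NormedSpace ℂ 𝔥]
    [AddCommGroup M] [Module ℂ M] (P : RootPairing ι ℂ M 𝔥) [P.IsRootSystem]
    [P.IsCrystallographic] [P.IsReduced] (b : P.Base) :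
    ∃ ρ : EllipticKZB.Der →ₗ⁅ℂ⁆ LieDerivation ℂ (EllipticKZB.Ell b) (EllipticKZB.Ell b),
      EllipticKZB.IsAction b ρ ∧
      EllipticKZB.IsModuliConnection ρ (EllipticKZB.kzbForm ρ) ∧
      EllipticKZB.IsFlatOn ρ (EllipticKZB.kzbForm ρ) (EllipticKZB.regularSet P) := by
  obtain ⟨ρ, hρ⟩ := EllipticKZB.exists_isAction_ell b
  exact ⟨ρ, hρ, EllipticKZB.isModuliConnection_kzbForm hρ, EllipticKZB.isFlatOn_kzbForm hρ⟩
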